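/- Let $G$ be a locally compact (Hausdorff) group and let $\sigma=(\mathbb T\overset{\iota}{\hookrightarrow} G_\sigma\overset{q}{\twoheadrightarrow} G)$ be a twist for $G$, that is, a central extension of $G$ by $\mathbb T$ in the category of locally compact groups; we write $sz$ for $s\,\iota(z)$. Let $(B,\beta,\phi)$ be a weak $G\rtimes G$-algebra: $B$ is a $C^*$-algebra, $\beta$ a strongly continuous action of $G$ on $B$, and $\phi:C_0(G)\to\mathcal M(B)$ a nondegenerate $*$-homomorphism that is equivariant for $\beta$ and the right translation action $(\mathrm{rt}_g f)(t)=f(tg)$. *Crossed products.* Let $\alpha$ be an action of $G$ on a $C^*$-algebra $A$, regarded as an action of $G_\sigma$. The twisted crossed product $A\rtimes_{(\alpha,\iota^\sigma)}G$ is the universal $C^*$-algebra for the nondegenerate covariant representations $(\pi,U)$ of $(A,G_\sigma,\alpha)$ with $U_{z}=z1$ for $z\in\mathbb T$, i.e. the completion of $\{f\in C_c(G_\sigma,A): f(zs)=\bar z f(s)\}$ with respect to the supremum of the norms of all integrated forms $\pi\rtimes U(f)=\int_{G_\sigma}\pi(f(s))U_s\,ds$. The (full) crossed product $A\rtimes_\alpha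 G$ is the same with $U_z=1$. The dual coaction of $A\rtimes G$ (with or without twist) is the $*$-homomorphism $A\rtimes G\to\mathcal M((A\rtimes G)\otimes C^*(G))$ (spatial tensor product, $C^*(G)$ the full group $C^*$-algebra) which is the integrated form of $(i_A\otimes 1,\ s\mapsto i_{G_\sigma}(s)\otimes u_{q(s)})$, where $(i_A,i_{G_\sigma})$ and $u$ are the universal representations. Dual coactions are denoted by a hat. *The deformed algebra.* Let $C_0(G_\sigma,\bar\iota)=\{f\in C_0(G_\sigma): f(sz)=\bar z f(s)\}$, a $C_0(G)$-$C_0(G)$ equivalence bimodule with pointwise multiplication, inner products $\langle f,g\rangle_{C_0(G)}=\bar f g$ and ${}_{C_0(G)}\langle f,g\rangle=f\bar g$, and with the action $\mathrm{rt}^\sigma$ of $G_\sigma$ by right translation. Put $$\mathcal E_\sigma(B)=C_0(G_\sigma,\bar\iota)\otimes_{C_0(G)}B,\qquad \gamma=\mathrm{rt}^\sigma\otimes\beta,\qquad B^\sigma=\mathcal K(\mathcal E_\sigma(B)),\qquad \beta^\sigma=\mathrm{Ad}\,\gamma,$$ and let $\phi^\sigma:C_0(G)\to\mathcal M(B^\sigma)=\mathcal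 L_B(\mathcal E_\sigma(B))$ be given by $\phi^\sigma(c)(f\otimes b)=cf\otimes b$. Since $\gamma_z$ is multiplication by $\bar z$ for $z\in\mathbb T$, $\beta^\sigma$ is an action of $G$, and $(\mathcal E_\sigma(B),\gamma)$ is an equivalence bimodule between $(B^\sigma,\beta^\sigma)$ and the twisted system $(B,\beta,\iota^\sigma)$, with crossed product the $B^\sigma\rtimes_{\beta^\sigma}G$-$B\rtimes_{(\beta,\iota^\sigma)}G$ equivalence bimodule $\mathcal E_\sigma(B)\rtimes_\gamma G$ (the off-diagonal corner of the crossed product of the linking algebra). Similarly, $C_0(G_\sigma,\bar\iota)\rtimes_{\mathrm{rt}^\sigma}G$ is a $C_0(G)\rtimes_{\mathrm{rt}}G$-$C_0(G)\rtimes_{(\mathrm{rt},\iota^\sigma)}G$ equivalence bimodule. The map $\psi:C_0(G_\sigma,\bar\iota)\to\mathcal M(\mathcal E_\sigma(B))=\mathcal L_B(B,\mathcal E_\sigma(B))$, $\psi(f)b=f\otimes b$, together with $\phi^\sigma$ and $\phi$, is an equivariant nondegenerate imprimitivity bimodule map and descends to $\psi\rtimes G:\mathcal M(C_0(G_\sigma,\bar\iota)\rtimes_{\mathrm{rt}^\sigma}G)\to\mathcal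 M(\mathcal E_\sigma(B)\rtimes_\gamma G)$; likewise $\phi$ and $\phi^\sigma$ descend to $\phi\rtimes G:C_0(G)\rtimes_{(\mathrm{rt},\iota^\sigma)}G\to\mathcal M(B\rtimes_{(\beta,\iota^\sigma)}G)$ and $\phi^\sigma\rtimes G:C_0(G)\rtimes_{\mathrm{rt}}G\to\mathcal M(B^\sigma\rtimes_{\beta^\sigma}G)$. *The multipliers.* Let $\varphi:G_\sigma\to\mathbb T$ be a Borel function with $\varphi(sz)=\bar z\varphi(s)$ for all $s\in G_\sigma$, $z\in\mathbb T$. Let $L^2(G_\sigma,\iota)=\{\xi\in L^2(G_\sigma):\xi(sz)=z\xi(s)\}$, identify $L^2(G)$ with the $\mathbb T$-invariant functions in $L^2(G_\sigma)$, and let $L_\varphi:L^2(G_\sigma,\iota)\to L^2(G)$, $L_\varphi\xi=\varphi\xi$. The functions $f\in C_0(G_\sigma,\bar\iota)$ act as multiplication operators $L^2(G_\sigma,\iota)\to L^2(G)$; together with multiplication by functions in $C_0(G)$ and the right regular representations $(\rho_s\xi)(t)=\Delta(s)^{1/2}\xi(ts)$ of $G_\sigma$ on both spaces, this gives a regular representation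 of $\mathcal M(C_0(G_\sigma,\bar\iota)\rtimes_{\mathrm{rt}^\sigma}G)$ by operators from $L^2(G_\sigma,\iota)$ to $L^2(G)$. **Proposition.** There is a unique $S_\varphi\in\mathcal M(C_0(G_\sigma,\bar\iota)\rtimes_{\mathrm{rt}^\sigma}G)$ that is mapped to $L_\varphi$ by the regular representation. It satisfies $S_\varphi^*S_\varphi=1$ and $S_\varphi S_\varphi^*=1$, so that $\mathrm{Ad}\,S_\varphi: x\mapsto S_\varphi xS_\varphi^*$ is a $*$-isomorphism $C_0(G)\rtimes_{(\mathrm{rt},\iota^\sigma)}G\to C_0(G)\rtimes_{\mathrm{rt}}G$. The element $R_\varphi=(\psi\rtimes G)(S_\varphi)$ belongs to $\mathcal M(\mathcal E_\sigma(B)\rtimes_\gamma G)$ and satisfies $R_\varphi^*R_\varphi=1$ and $R_\varphi R_\varphi^*=1$, and $x\mapsto R_\varphi xR_\varphi^*$ is a $*$-isomorphism $$\mathrm{Ad}\,R_\varphi: B\rtimes_{(\beta,\iota^\sigma)}G\to B^\sigma\rtimes_{\beta^\sigma}G$$ (extending to the multiplier algebras by the same formula) with the following properties. 1. It is equivariant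 for the dual coactions: $$(\mathrm{Ad}\,R_\varphi\otimes\mathrm{id}_{C^*(G)})\circ\widehat{(\beta,\iota^\sigma)}=\widehat{\beta^\sigma}\circ\mathrm{Ad}\,R_\varphi,$$ where $\mathrm{Ad}\,R_\varphi\otimes\mathrm{id}$ is extended to multiplier algebras. 2. For all $x\in C_0(G)\rtimes_{(\mathrm{rt},\iota^\sigma)}G$, $$\mathrm{Ad}\,R_\varphi\big((\phi\rtimes G)(x)\big)=(\phi^\sigma\rtimes G)\big(\mathrm{Ad}\,S_\varphi(x)\big)\quad\text{in }\mathcal M(B^\sigma\rtimes_{\beta^\sigma}G).$$ -/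

import Mathlib

open MeasureTheory Filter Topology
open scoped ZeroAtInfty MultiplierAlgebra ENNReal TensorProduct ComplexConjugate

noncomputable section

set_option linter.unusedSectionVars false

namespace TwistDeform

universe u v w

/-- A twist for `G`: a central extension `𝕋 → Γ → G` of topological groups (`Γ` is `G_σ`). -/
structure Twist (G Γ : Type u) [Group G] [TopologicalSpace G] [Group Γ] [TopologicalSpace Γ] where
  ι : Circle →* Γ
  q : Γ →* G
  ι_cont : Continuous ι
  ι_inj : Function.Injective ι
  q_cont : Continuous q
  q_open : IsOpenMap q
  q_surj : Function.Surjective q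
  ker_q : q.ker = ι.range
  central : ∀ z s, ι z * s = s * ι z

lemma Twist.q_ι {G Γ : Type u} [Group G] [TopologicalSpace G] [Group Γ] [TopologicalSpace Γ]
    (σ : Twist G Γ) (z : Circle) : σ.q (σ.ι z) = 1 := by
  rw [← MonoidHom.mem_ker, σ.ker_q]; exact ⟨z, rfl⟩

/-! ### Bounded families of operators -/

section Families

variable {I J : Type*} (H : I → Type*) [∀ i, NormedAddCommGroup (H i)]
  [∀ i, InnerProductSpace ℂ (H i)] [∀ i, CompleteSpace (H i)]

/-- The `C⋆`-algebra `∏ᵢ B(Hᵢ)` of bounded families of operators on Hilbert spaces `Hᵢ`. -/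
def BFam : Type _ := ↥(lp (fun i => H i →L[ℂ] H i) ∞)

instance : NonUnitalCStarAlgebra (BFam H) :=
  inferInstanceAs (NonUnitalCStarAlgebra ↥(lp (fun i => H i →L[ℂ] H i) ∞))

variable {H}

/-- The `i`-th component. -/
def BFam.ap (x : BFam H) (i : I) : H i →L[ℂ] H i := x.1 i

/-- Pulling back bounded families along a map of index sets. -/
def BFam.reindex (r : J → I) (x : BFam H) : BFam (fun j => H (r j)) :=
  ⟨fun j => x.ap (r j), memℓp_infty ⟨‖(show ↥(lp (fun i => H i →L[ℂ] H i) ∞) from x)‖, by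
    rintro _ ⟨j, rfl⟩
    exact lp.norm_apply_le_norm (E := fun i => H i →L[ℂ] H i) ENNReal.top_ne_zero x (r j)⟩⟩

end Families

/-- The closed `*`-subalgebra generated by a set. -/
def closedGen {P : Type*} [NonUnitalCStarAlgebra P] (S : Set P) : NonUnitalStarSubalgebra ℂ P :=
  (NonUnitalStarAlgebra.adjoin ℂ S).topologicalClosure

/-! ### Representations and crossed products -/

section Reps

variable {G Γ : Type u} [Group G] [TopologicalSpace G] [Group Γ] [TopologicalSpace Γ]
  {A : Type v} [NonUnitalCStarAlgebra A]

/-- Strongly continuous unitary representations of a group on a Hilbert space. -/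
structure URep (G : Type u) [Group G] [TopologicalSpace G] (H : Type w) [NormedAddCommGroup H]
    [InnerProductSpace ℂ H] [CompleteSpace H] where
  U : G →* unitary (H →L[ℂ] H)
  cont : ∀ ξ : H, Continuous fun s => (U s : H →L[ℂ] H) ξ

/-- Nondegenerate covariant representations `(π, U)` on `H` of the Green twisted action of
`(Γ, 𝕋)` on `A` given by the action `α` and the scalar-valued twist `z ↦ χ z • 1`.
For `χ = 1` these are the covariant representations of an action of `G = Γ / 𝕋` (inflated to `Γ`),
for `χ = id` those of the twisted action `(α, ι^σ)`. -/
structure CovRep (σ : Twist G Γ) (α : Γ → A → A) (χ : Circle →* Circle) (H : Type w)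
    [NormedAddCommGroup H] [InnerProductSpace ℂ H] [CompleteSpace H] extends URep Γ H where
  π : A →⋆ₙₐ[ℂ] (H →L[ℂ] H)
  nondeg : Dense (Submodule.span ℂ {η | ∃ a ξ, η = π a ξ} : Set H)
  covariant : ∀ s a ξ, (U s : H →L[ℂ] H) (π a ξ) = π (α s a) ((U s : H →L[ℂ] H) ξ)
  twist : ∀ z ξ, (U (σ.ι z) : H →L[ℂ] H) ξ = (χ z : ℂ) • ξ

/-- The covariant representations on all Hilbert spaces (in the universe of the groups). -/
structure CovFam (σ : Twist G Γ) (α : Γ → A → A) (χ : Circle →* Circle) where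
  H : Type u
  [nacg : NormedAddCommGroup H]
  [ips : InnerProductSpace ℂ H]
  [complete : CompleteSpace H]
  rep : CovRep σ α χ H

attribute [instance] CovFam.nacg CovFam.ips CovFam.complete

/-- The bounded families `(T_i)`, `T_i ∈ B(H_i)`, indexed by all covariant representations. -/
abbrev CovFam.Prod (σ : Twist G Γ) (α : Γ → A → A) (χ : Circle →* Circle) :=
  BFam (fun i : CovFam σ α χ => i.H)

/-- `C_c(Γ, X, τ)` for the scalar twist `χ`: continuous compactly supported `f : Γ → X` with
`f (z s) = conj (χ z) f s`. -/
def IsCcTwisted {X : Type*} [NormedAddCommGroup X] [NormedSpace ℂ X] (σ : Twist G Γ)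
    (χ : Circle →* Circle) (f : Γ → X) : Prop :=
  Continuous f ∧ HasCompactSupport f ∧ ∀ z s, f (σ.ι z * s) = conj (χ z : ℂ) • f s

/-- The (full) Green twisted crossed product `A ⋊_{(α, χ)} G`: the completion of `C_c(Γ, A, χ)`
in the supremum of the seminorms given by the integrated forms
`(π ⋊ U)(f) = ∫ π(f(s)) U_s ds` of all covariant representations. -/
def crossedProduct [MeasurableSpace Γ] (μ : Measure Γ) (σ : Twist G Γ) (α : Γ → A → A)
    (χ : Circle →* Circle) : NonUnitalStarSubalgebra ℂ (CovFam.Prod σ α χ) :=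
  closedGen {T : CovFam.Prod σ α χ | ∃ f : Γ → A, IsCcTwisted σ χ f ∧
    ∀ (i : CovFam σ α χ) (ξ : i.H),
      T.ap i ξ = ∫ s, i.rep.π (f s) ((i.rep.U s : i.H →L[ℂ] i.H) ξ) ∂μ}

/-- The multiplier algebra of a `C⋆`-subalgebra `D` of `P` that acts nondegenerately (in our case,
on each of the Hilbert spaces `H_i`), as the idealizer of `D`. -/
def multiplierAlgebra {P : Type*} [NonUnitalCStarAlgebra P] (D : NonUnitalStarSubalgebra ℂ P) :
    NonUnitalStarSubalgebra ℂ P where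
  carrier := {m | ∀ d ∈ D, m * d ∈ D ∧ d * m ∈ D}
  add_mem' ha hb d hd := by
    simpa only [add_mul, mul_add] using
      ⟨add_mem (ha d hd).1 (hb d hd).1, add_mem (ha d hd).2 (hb d hd).2⟩
  zero_mem' d hd := by simp [zero_mem]
  mul_mem' ha hb d hd := by
    refine ⟨?_, ?_⟩
    · rw [mul_assoc]; exact (ha _ (hb d hd).1).1
    · rw [← mul_assoc]; exact (hb _ (ha d hd).2).2
  smul_mem' c a ha d hd := by
    simpa only [smul_mul_assoc, mul_smul_comm] using
      ⟨SMulMemClass.smul_mem c (ha d hd).1, SMulMemClass.smul_mem c (ha d hd).2⟩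
  star_mem' {a} ha d hd := by
    refine ⟨?_, ?_⟩
    · simpa using star_mem (ha (star d) (star_mem hd)).2
    · simpa using star_mem (ha (star d) (star_mem hd)).1

end Reps

/-! ### The group `C⋆`-algebra, tensor products and dual coactions -/

section Hat

variable {H K L : Type*} [NormedAddCommGroup H] [InnerProductSpace ℂ H]
  [NormedAddCommGroup K] [InnerProductSpace ℂ K]

/-- The Hilbert space tensor product. -/
def HTensor (H K : Type*) [NormedAddCommGroup H] [InnerProductSpace ℂ H]
    [NormedAddCommGroup K] [InnerProductSpace ℂ K] := UniformSpace.Completion (H ⊗[ℂ] K)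

instance : NormedAddCommGroup (HTensor H K) :=
  inferInstanceAs (NormedAddCommGroup (UniformSpace.Completion (H ⊗[ℂ] K)))

instance : InnerProductSpace ℂ (HTensor H K) :=
  inferInstanceAs (InnerProductSpace ℂ (UniformSpace.Completion (H ⊗[ℂ] K)))

instance : CompleteSpace (HTensor H K) :=
  inferInstanceAs (CompleteSpace (UniformSpace.Completion (H ⊗[ℂ] K)))

/-- The inclusion of the algebraic tensor product. -/
def htoL : (H ⊗[ℂ] K) →L[ℂ] HTensor H K := UniformSpace.Completion.toComplL

lemma htoL_dense : DenseRange (htoL : (H ⊗[ℂ] K) →L[ℂ] HTensor H K) :=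
  UniformSpace.Completion.denseRange_coe

lemma htoL_inner (x y : H ⊗[ℂ] K) : inner ℂ (htoL x) (htoL y) = inner ℂ x y :=
  UniformSpace.Completion.inner_coe x y

/-- Elementary tensors. -/
def htmul (ξ : H) (η : K) : HTensor H K := htoL (ξ ⊗ₜ[ℂ] η)

/-- The operator `S ⊗ T` on the Hilbert space tensor product. -/
def hmap (S : H →L[ℂ] H) (T : K →L[ℂ] K) : HTensor H K →L[ℂ] HTensor H K :=
  (htoL.comp (TensorProduct.mapL S T)).extend htoL

lemma hmap_coe (S : H →L[ℂ] H) (T : K →L[ℂ] K) (x : H ⊗[ℂ] K) :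
    hmap S T (htoL x) = htoL (TensorProduct.mapL S T x) :=
  ContinuousLinearMap.extend_eq _ htoL_dense
    (UniformSpace.Completion.isUniformInducing_coe _) x

@[simp] lemma hmap_htmul (S : H →L[ℂ] H) (T : K →L[ℂ] K) (ξ : H) (η : K) :
    hmap S T (htmul ξ η) = htmul (S ξ) (T η) := hmap_coe _ _ _

lemma dense_htmul : Dense (Submodule.span ℂ {x : HTensor H K | ∃ ξ η, x = htmul ξ η} :
    Set (HTensor H K)) := by
  refine htoL_dense.mono ?_
  rintro _ ⟨x, rfl⟩
  induction x with
  | zero => rw [map_zero]; exact zero_mem _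
  | tmul ξ η => exact Submodule.subset_span ⟨ξ, η, rfl⟩
  | add x y hx hy =>
    rw [map_add]; exact add_mem hx hy

lemma clm_ext_dense {E F : Type*} [NormedAddCommGroup E] [NormedSpace ℂ E]
    [NormedAddCommGroup F] [NormedSpace ℂ F] {s : Set E}
    (hs : Dense (Submodule.span ℂ s : Set E)) {S T : E →L[ℂ] F} (h : ∀ x ∈ s, S x = T x) :
    S = T := by
  refine ContinuousLinearMap.ext_on hs h

lemma dense_of_le_closure {E : Type*} [NormedAddCommGroup E] [NormedSpace ℂ E] {s : Set E}
    (hs : Dense (Submodule.span ℂ s : Set E)) {W : Submodule ℂ E}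
    (h : s ⊆ W.topologicalClosure) : Dense (W : Set E) := by
  have h1 : Dense (W.topologicalClosure : Set E) := hs.mono (Submodule.span_le.2 h)
  have h2 := (Submodule.isClosed_topologicalClosure W).closure_eq
  rw [h1.closure_eq] at h2
  rw [dense_iff_closure_eq, ← Submodule.topologicalClosure_coe, ← h2]

lemma hmap_ext {F : Type*} [NormedAddCommGroup F] [NormedSpace ℂ F] {S T : HTensor H K →L[ℂ] F}
    (h : ∀ ξ η, S (htmul ξ η) = T (htmul ξ η)) : S = T :=
  clm_ext_dense dense_htmul (by rintro _ ⟨ξ, η, rfl⟩; exact h ξ η)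

lemma hmap_mul (S S' : H →L[ℂ] H) (T T' : K →L[ℂ] K) :
    hmap (S * S') (T * T') = hmap S T * hmap S' T' := hmap_ext (by simp)

lemma hmap_one : hmap (1 : H →L[ℂ] H) (1 : K →L[ℂ] K) = 1 := hmap_ext (by simp)

lemma continuous_htmul : Continuous fun p : H × K => htmul p.1 p.2 :=
  htoL.continuous.comp TensorProduct.continuous_tmul

lemma htmul_inner (ξ ξ' : H) (η η' : K) :
    inner ℂ (htmul ξ η) (htmul ξ' η') = inner ℂ ξ ξ' * inner ℂ η η' := by
  rw [htmul, htmul, htoL_inner, TensorProduct.inner_tmul]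

lemma htmul_add_left (ξ ξ' : H) (η : K) : htmul (ξ + ξ') η = htmul ξ η + htmul ξ' η := by
  rw [htmul, TensorProduct.add_tmul, map_add]; rfl

lemma htmul_smul_left (c : ℂ) (ξ : H) (η : K) : htmul (c • ξ) η = c • htmul ξ η := by
  rw [htmul, ← TensorProduct.smul_tmul', map_smul]; rfl

lemma htmul_zero_left (η : K) : htmul (0 : H) η = 0 := by
  rw [htmul, TensorProduct.zero_tmul, map_zero]

lemma hmap_star [CompleteSpace H] [CompleteSpace K] (S : H →L[ℂ] H) (T : K →L[ℂ] K) :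
    hmap (star S) (star T) = star (hmap S T) := by
  rw [ContinuousLinearMap.star_eq_adjoint (hmap S T), ContinuousLinearMap.eq_adjoint_iff]
  intro x y
  refine dense_htmul.induction (P := fun x => inner ℂ (hmap (star S) (star T) x) y
    = inner ℂ x (hmap S T y)) ?_ (isClosed_eq (by fun_prop) (by fun_prop)) x
  intro x hx
  refine dense_htmul.induction (P := fun y => inner ℂ (hmap (star S) (star T) x) y
    = inner ℂ x (hmap S T y)) ?_ (isClosed_eq (by fun_prop) (by fun_prop)) y
  intro y hy
  induction hx using Submodule.span_induction with
  | zero => simp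
  | add x x' _ _ h h' => simp only [map_add, inner_add_left, h, h']
  | smul c x _ h => simp only [map_smul, inner_smul_left, h]
  | mem x hx =>
    obtain ⟨ξ, η, rfl⟩ := hx
    induction hy using Submodule.span_induction with
    | zero => simp
    | add x x' _ _ h h' => simp only [map_add, inner_add_right, h, h']
    | smul c x _ h => simp only [map_smul, inner_smul_right, h]
    | mem y hy =>
      obtain ⟨ξ', η', rfl⟩ := hy
      simp [htmul_inner, ContinuousLinearMap.star_eq_adjoint, ContinuousLinearMap.adjoint_inner_left]

/-- A uniformly bounded family of operators that is strongly continuous on a total set is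
strongly continuous. -/
lemma strongCont_of_dense {X E : Type*} [TopologicalSpace X] [NormedAddCommGroup E]
    [NormedSpace ℂ E] {F : Type*} [NormedAddCommGroup F] [NormedSpace ℂ F]
    (U : X → E →L[ℂ] F) (hU : ∀ s ξ, ‖U s ξ‖ ≤ ‖ξ‖) (S : Set E)
    (hS : Dense (Submodule.span ℂ S : Set E)) (h : ∀ ξ ∈ S, Continuous fun s => U s ξ) (ξ : E) :
    Continuous fun s => U s ξ := by
  have h' : ∀ ξ ∈ Submodule.span ℂ S, Continuous fun s => U s ξ := by
    intro ξ hξ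
    induction hξ using Submodule.span_induction with
    | zero => simpa using continuous_const
    | add x y _ _ hx hy => simp only [map_add]; exact hx.add hy
    | smul c x _ hx => simp only [map_smul]; exact hx.const_smul c
    | mem x hx => exact h x hx
  have hlip : ∀ s : X, ∀ x y : E, dist (U s x) (U s y) ≤ dist x y := fun s x y => by
    rw [dist_eq_norm, dist_eq_norm, ← map_sub]; exact hU s _
  rw [continuous_iff_continuousAt]
  intro s
  rw [ContinuousAt, Metric.tendsto_nhds]
  intro ε hε
  obtain ⟨η, hη, hd⟩ := Metric.dense_iff.1 hS ξ (ε / 3) (by positivity)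
  have h3 := (Metric.tendsto_nhds.1 ((h' η hd).continuousAt (x := s))) (ε / 3) (by positivity)
  rw [Metric.mem_ball, dist_comm] at hη
  filter_upwards [h3] with t ht
  calc dist (U t ξ) (U s ξ) ≤ dist (U t ξ) (U t η) + dist (U t η) (U s η) + dist (U s η) (U s ξ) :=
        dist_triangle4 _ _ _ _
    _ < ε / 3 + ε / 3 + ε / 3 := by
        have := hlip t ξ η
        have := hlip s η ξ
        rw [dist_comm η ξ] at this
        linarith
    _ = ε := by ring

end Hat

section Coaction

variable {G Γ : Type u} [Group G] [TopologicalSpace G] [Group Γ] [TopologicalSpace Γ]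
  {A : Type v} [NonUnitalCStarAlgebra A]

/-- The strongly continuous unitary representations of `G` on all Hilbert spaces. -/
structure URepFam (G : Type u) [Group G] [TopologicalSpace G] where
  H : Type u
  [nacg : NormedAddCommGroup H]
  [ips : InnerProductSpace ℂ H]
  [complete : CompleteSpace H]
  rep : URep G H

attribute [instance] URepFam.nacg URepFam.ips URepFam.complete

/-- Bounded families of operators indexed by the unitary representations of `G`. -/
abbrev URepFam.Prod (G : Type u) [Group G] [TopologicalSpace G] :=
  BFam (fun j : URepFam G => j.H)

/-- The full group `C⋆`-algebra `C⋆(G)`. -/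
def groupCStar [MeasurableSpace G] (μ : Measure G) : NonUnitalStarSubalgebra ℂ (URepFam.Prod G) :=
  closedGen {T : URepFam.Prod G | ∃ f : G → ℂ, Continuous f ∧
    HasCompactSupport f ∧ ∀ (j : URepFam G) (η : j.H),
      T.ap j η = ∫ g, f g • (j.rep.U g : j.H →L[ℂ] j.H) η ∂μ}

/-- Bounded families of operators on the Hilbert spaces `H_i ⊗ K_j`. -/
abbrev TensorProd (σ : Twist G Γ) (α : Γ → A → A) (χ : Circle →* Circle) :=
  BFam (fun p : CovFam σ α χ × URepFam G => HTensor p.1.H p.2.H)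

/-- The family `x ⊗ c = (x_i ⊗ c_j)`. -/
def IsElemTensor {σ : Twist G Γ} {α : Γ → A → A} {χ : Circle →* Circle}
    (x : CovFam.Prod σ α χ) (c : URepFam.Prod G) (T : TensorProd σ α χ) : Prop :=
  ∀ p, T.ap p = hmap (x.ap p.1) (c.ap p.2)

/-- The spatial (minimal) tensor product `(A ⋊_{(α, χ)} G) ⊗ C⋆(G)`. -/
def tensorCStar [MeasurableSpace Γ] [MeasurableSpace G] (μΓ : Measure Γ) (μ : Measure G)
    (σ : Twist G Γ) (α : Γ → A → A) (χ : Circle →* Circle) :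
    NonUnitalStarSubalgebra ℂ (TensorProd σ α χ) :=
  closedGen {T : TensorProd σ α χ |
    ∃ x ∈ crossedProduct μΓ σ α χ, ∃ c ∈ groupCStar μ, IsElemTensor x c T}

variable {H : Type*} [NormedAddCommGroup H] [InnerProductSpace ℂ H] [CompleteSpace H]
  {K : Type*} [NormedAddCommGroup K] [InnerProductSpace ℂ K] [CompleteSpace K]

/-- The covariant representation `(π ⊗ 1, U ⊗ V)` for a covariant representation `(π, U)` and a
unitary representation `V` of `G`. -/
def CovRep.tensor {σ : Twist G Γ} {α : Γ → A → A} {χ : Circle →* Circle} (c : CovRep σ α χ H)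
    (V : URep G K) : CovRep σ α χ (HTensor H K) where
  U :=
    { toFun := fun s => ⟨hmap (c.U s : H →L[ℂ] H) (V.U (σ.q s) : K →L[ℂ] K), by
        rw [Unitary.mem_iff, ← hmap_star, ← hmap_mul, ← hmap_mul]
        simp [hmap_one]⟩
      map_one' := by
        ext1; exact hmap_ext (by simp)
      map_mul' := fun s t => by
        ext1; simp [hmap_mul] }
  cont := by
    intro ξ
    refine strongCont_of_dense (fun s => hmap (c.U s : H →L[ℂ] H) (V.U (σ.q s) : K →L[ℂ] K)) ?_
      _ dense_htmul ?_ ξ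
    · intro s ξ
      refine le_of_eq (ContinuousLinearMap.norm_map_of_mem_unitary (?_ : _ ∈ unitary _) ξ)
      rw [Unitary.mem_iff, ← hmap_star, ← hmap_mul, ← hmap_mul]
      simp [hmap_one]
    · rintro _ ⟨ξ, η, rfl⟩
      simp only [hmap_htmul]
      exact continuous_htmul.comp ((c.cont ξ).prodMk ((V.cont η).comp σ.q_cont))
  π :=
    { toFun := fun a => hmap (c.π a) 1
      map_smul' := fun k a => hmap_ext (by simp [htmul_smul_left])
      map_zero' := hmap_ext (by simp [htmul_zero_left])
      map_add' := fun a b => hmap_ext (by simp [htmul_add_left])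
      map_mul' := fun a b => hmap_ext (by simp)
      map_star' := fun a => by
        rw [map_star, ← hmap_star, star_one] }
  nondeg := by
    refine dense_of_le_closure dense_htmul ?_
    rintro _ ⟨ξ, η, rfl⟩
    refine c.nondeg.induction (P := fun ξ => htmul ξ η ∈ _) ?_
      ((Submodule.isClosed_topologicalClosure _).preimage
        (continuous_htmul.comp (continuous_id.prodMk continuous_const))) ξ
    intro ξ hξ
    induction hξ using Submodule.span_induction with
    | zero => rw [htmul_zero_left]; exact zero_mem _
    | add x y _ _ hx hy => rw [htmul_add_left]; exact add_mem hx hy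
    | smul k x _ hx => rw [htmul_smul_left]; exact Submodule.smul_mem _ _ hx
    | mem x hx =>
      obtain ⟨a, ξ, rfl⟩ := hx
      exact Submodule.le_topologicalClosure _
        (Submodule.subset_span ⟨a, htmul ξ η, (hmap_htmul (c.π a) 1 ξ η).symm⟩)
  covariant := fun s a ξ => by
    refine DFunLike.congr_fun (?_ : hmap (c.U s : H →L[ℂ] H) (V.U (σ.q s) : K →L[ℂ] K) *
      hmap (c.π a) 1 = hmap (c.π (α s a)) 1 *
        hmap (c.U s : H →L[ℂ] H) (V.U (σ.q s) : K →L[ℂ] K)) ξ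
    exact hmap_ext (by simp [c.covariant])
  twist := fun z ξ => by
    refine DFunLike.congr_fun (?_ : hmap (c.U (σ.ι z) : H →L[ℂ] H)
      (V.U (σ.q (σ.ι z)) : K →L[ℂ] K) = (χ z : ℂ) • 1) ξ
    exact hmap_ext (by simp [c.twist, σ.q_ι, htmul_smul_left])

/-- The dual coaction `A ⋊ G → M((A ⋊ G) ⊗ C⋆(G))`: the integrated form of `(i_A ⊗ 1, i_Γ ⊗ u)`.
In the component of `H_i ⊗ K_j` it is the component of `(π_i ⊗ 1, U_i ⊗ V_j)`. -/
def dualCoaction {σ : Twist G Γ} {α : Γ → A → A} {χ : Circle →* Circle}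
    (x : CovFam.Prod σ α χ) : TensorProd σ α χ :=
  x.reindex fun p : CovFam σ α χ × URepFam G => ⟨HTensor p.1.H p.2.H, p.1.rep.tensor p.2.rep⟩

end Coaction

/-! ### Extending nondegenerate representations -/

section Extend

variable {A : Type*} [NonUnitalCStarAlgebra A] {H : Type*} [NormedAddCommGroup H]
  [InnerProductSpace ℂ H] [CompleteSpace H] {F : Type*} [NormedAddCommGroup F] [NormedSpace ℂ F]
  [CompleteSpace F]

/-- The linear map `A ⊗ H → F`, `a ⊗ ξ ↦ T a ξ`. -/
def evalTensor (T : A →ₗ[ℂ] (H →L[ℂ] F)) : A ⊗[ℂ] H →ₗ[ℂ] F :=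
  TensorProduct.lift (LinearMap.mk₂ ℂ (fun a ξ => T a ξ) (by simp) (by simp) (by simp) (by simp))

/-- A representation as a linear map. -/
def repLin (π : A →⋆ₙₐ[ℂ] (H →L[ℂ] H)) : A →ₗ[ℂ] (H →L[ℂ] H) where
  toFun := π
  map_add' := map_add π
  map_smul' := map_smul π

/-- For a nondegenerate representation `π` of `A` on `H` and a bounded `T : A → B(H, F)` with
`T (a b) = T a π(b)`, the unique bounded operator `T'` with `T' π(a) ξ = T a ξ`. -/
def extendND (π : A →⋆ₙₐ[ℂ] (H →L[ℂ] H)) (T : A →ₗ[ℂ] (H →L[ℂ] F)) : H →L[ℂ] F :=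
  (evalTensor T).extendOfNorm (evalTensor (repLin π))

lemma extendND_apply {π : A →⋆ₙₐ[ℂ] (H →L[ℂ] H)}
    (hπ : Dense (Submodule.span ℂ {η | ∃ a ξ, η = π a ξ} : Set H)) {T : A →ₗ[ℂ] (H →L[ℂ] F)}
    (C : ℝ) (hC : ∀ a, ‖T a‖ ≤ C * ‖a‖) (hT : ∀ a b ξ, T (a * b) ξ = T a (π b ξ)) (a : A) (ξ : H) :
    extendND π T (π a ξ) = T a ξ := by
  have hd : DenseRange (evalTensor (repLin π)) := by
    refine hπ.mono ?_
    have : (Submodule.span ℂ {η | ∃ a ξ, η = π a ξ}) ≤ LinearMap.range (evalTensor (repLin π)) := by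
      rw [Submodule.span_le]
      rintro _ ⟨a, ξ, rfl⟩
      exact ⟨a ⊗ₜ ξ, rfl⟩
    exact this
  let _ : PartialOrder A := CStarAlgebra.spectralOrder A
  have _ : StarOrderedRing A := CStarAlgebra.spectralOrderedRing A
  have hC0 : 0 ≤ |C| := abs_nonneg C
  let Tc : A →L[ℂ] (H →L[ℂ] F) := T.mkContinuous C hC
  have hb : ∀ x, ‖evalTensor T x‖ ≤ |C| * ‖evalTensor (repLin π) x‖ := by
    intro x
    have hlim : Tendsto (fun e : A => Tc e (evalTensor (repLin π) x))
        (CStarAlgebra.approximateUnit A) (𝓝 (evalTensor T x)) := by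
      induction x with
      | zero => simp
      | add x y hx hy => simpa using hx.add hy
      | tmul a ξ =>
        have h1 : Tendsto (fun e : A => e * a) (CStarAlgebra.approximateUnit A) (𝓝 a) :=
          (CStarAlgebra.increasingApproximateUnit A).tendsto_mul_right a
        have h2 := ((Tc.continuous.tendsto a).comp h1)
        have h3 := ((ContinuousLinearMap.apply ℂ F ξ).continuous.tendsto _).comp h2
        refine h3.congr fun e => ?_
        exact hT e a ξ
    refine le_of_tendsto hlim.norm ?_
    filter_upwards [(CStarAlgebra.increasingApproximateUnit A).eventually_norm] with e he
    calc ‖Tc e (evalTensor (repLin π) x)‖ ≤ ‖Tc e‖ * ‖evalTensor (repLin π) x‖ :=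
          ContinuousLinearMap.le_opNorm _ _
      _ ≤ |C| * ‖evalTensor (repLin π) x‖ := by
          gcongr
          calc ‖Tc e‖ ≤ C * ‖e‖ := hC e
            _ ≤ |C| * ‖e‖ := by gcongr; exact le_abs_self C
            _ ≤ |C| * 1 := by gcongr
            _ = |C| := mul_one _
  exact LinearMap.extendOfNorm_eq hd ⟨_, hb⟩ (a ⊗ₜ ξ)

end Extend

/-! ### Functions on `G` and `Γ` -/

section Functions

variable {G Γ : Type u} [Group G] [TopologicalSpace G] [IsTopologicalGroup G]
  [Group Γ] [TopologicalSpace Γ] [IsTopologicalGroup Γ]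

/-- Right translation on `C₀(G)`: `(rt g f) t = f (t g)`. -/
def rt (g : G) (f : C₀(G, ℂ)) : C₀(G, ℂ) :=
  ⟨⟨fun t => f (t * g), by fun_prop⟩, by
    have := (Homeomorph.mulRight g).isClosedEmbedding.tendsto_cocompact
    exact (zero_at_infty f).comp this⟩

@[simp] lemma rt_apply (g t : G) (f : C₀(G, ℂ)) : rt g f t = f (t * g) := rfl

/-- A continuous function dominated by a `C₀` function is `C₀`. -/
def c0OfLe {X : Type*} [TopologicalSpace X] (f : X → ℂ) (hf : Continuous f) (g : C₀(X, ℂ))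
    (C : ℝ) (h : ∀ x, ‖f x‖ ≤ C * ‖g x‖) : C₀(X, ℂ) :=
  ⟨⟨f, hf⟩, squeeze_zero_norm h (by
    have := (zero_at_infty g).norm.const_mul C
    simpa using this)⟩

@[simp] lemma c0OfLe_apply {X : Type*} [TopologicalSpace X] (f : X → ℂ) (hf : Continuous f)
    (g : C₀(X, ℂ)) (C : ℝ) (h : ∀ x, ‖f x‖ ≤ C * ‖g x‖) (x : X) : c0OfLe f hf g C h x = f x := rfl

/-- The subspace `C₀(Γ, ῑ)` of the functions `f ∈ C₀(Γ)` with `f (s z) = z̄ f s`. -/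
def c0barSubmodule (σ : Twist G Γ) : Submodule ℂ C₀(Γ, ℂ) where
  carrier := {f | ∀ s z, f (s * σ.ι z) = conj (z : ℂ) * f s}
  add_mem' hf hg s z := by simp [hf s z, hg s z, mul_add]
  zero_mem' s z := by simp
  smul_mem' c f hf s z := by simp [hf s z]; ring

/-- `C₀(Γ, ῑ)` as a type. -/
def C0bar (σ : Twist G Γ) : Type u := ↥(c0barSubmodule σ)

instance (σ : Twist G Γ) : NormedAddCommGroup (C0bar σ) :=
  inferInstanceAs (NormedAddCommGroup ↥(c0barSubmodule σ))

instance (σ : Twist G Γ) : NormedSpace ℂ (C0bar σ) :=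
  inferInstanceAs (NormedSpace ℂ ↥(c0barSubmodule σ))

/-- The underlying function. -/
def C0bar.fn {σ : Twist G Γ} (f : C0bar σ) : C₀(Γ, ℂ) := f.1

lemma C0bar.prop {σ : Twist G Γ} (f : C0bar σ) (s : Γ) (z : Circle) :
    f.fn (s * σ.ι z) = conj (z : ℂ) * f.fn s := f.2 s z

@[ext] lemma C0bar.ext {σ : Twist G Γ} {f g : C0bar σ} (h : ∀ s, f.fn s = g.fn s) : f = g :=
  Subtype.ext (ZeroAtInftyContinuousMap.ext h)

/-- Constructor for `C₀(Γ, ῑ)`. -/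
def C0bar.mk {σ : Twist G Γ} (f : C₀(Γ, ℂ)) (hf : ∀ s z, f (s * σ.ι z) = conj (z : ℂ) * f s) :
    C0bar σ := ⟨f, hf⟩

@[simp] lemma C0bar.fn_mk {σ : Twist G Γ} (f : C₀(Γ, ℂ)) (hf) :
    (C0bar.mk (σ := σ) f hf).fn = f := rfl
@[simp] lemma C0bar.fn_add {σ : Twist G Γ} (f g : C0bar σ) : (f + g).fn = f.fn + g.fn := rfl
@[simp] lemma C0bar.fn_smul {σ : Twist G Γ} (k : ℂ) (f : C0bar σ) : (k • f).fn = k • f.fn := rfl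

lemma lift_invariant (σ : Twist G Γ) {f : Γ → ℂ} (hf : ∀ s z, f (s * σ.ι z) = f s) (s : Γ) :
    f (Function.surjInv σ.q_surj (σ.q s)) = f s := by
  have h1 : σ.q (s⁻¹ * Function.surjInv σ.q_surj (σ.q s)) = 1 := by
    rw [map_mul, Function.surjInv_eq σ.q_surj, map_inv, inv_mul_cancel]
  obtain ⟨z, hz⟩ : s⁻¹ * Function.surjInv σ.q_surj (σ.q s) ∈ σ.ι.range := by
    rw [← σ.ker_q]; exact h1
  rw [← hf s z, hz, mul_inv_cancel_left]

/-- A `𝕋`-invariant function in `C₀(Γ)` as a function in `C₀(G)`. -/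
def descend (σ : Twist G Γ) (f : C₀(Γ, ℂ)) (hf : ∀ s z, f (s * σ.ι z) = f s) : C₀(G, ℂ) :=
  ⟨⟨fun g => f (Function.surjInv σ.q_surj g), by
    have hq : IsQuotientMap σ.q := σ.q_open.isQuotientMap σ.q_cont σ.q_surj
    rw [hq.continuous_iff]
    exact (map_continuous f).congr fun s => (lift_invariant σ hf s).symm⟩, by
    intro V hV
    obtain ⟨K, hK, hKV⟩ := mem_cocompact.1 ((zero_at_infty f) hV)
    refine mem_cocompact.2 ⟨σ.q '' K, hK.image σ.q_cont, fun g hg => hKV ?_⟩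
    intro h
    exact hg ⟨_, h, Function.surjInv_eq _ _⟩⟩

@[simp] lemma descend_q (σ : Twist G Γ) (f : C₀(Γ, ℂ)) (hf : ∀ s z, f (s * σ.ι z) = f s) (s : Γ) :
    descend σ f hf (σ.q s) = f s := lift_invariant σ hf s

lemma c0_ext_q (σ : Twist G Γ) {a b : C₀(G, ℂ)} (h : ∀ s, a (σ.q s) = b (σ.q s)) : a = b := by
  ext g
  obtain ⟨s, rfl⟩ := σ.q_surj g
  exact h s

lemma conj_mul_circle (z : Circle) : conj (z : ℂ) * (z : ℂ) = 1 := by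
  rw [mul_comm, Complex.mul_conj]; simp

/-- The right `C₀(G)`-valued inner product `⟨f, g⟩ = f̄ g` on `C₀(Γ, ῑ)`. -/
def rinner₀ (σ : Twist G Γ) (f g : C0bar σ) : C₀(G, ℂ) :=
  descend σ (star f.fn * g.fn) (fun s z => by
    simp only [ZeroAtInftyContinuousMap.mul_apply, ZeroAtInftyContinuousMap.star_apply, f.prop s z,
      g.prop s z, star_mul, RCLike.star_def, Complex.conj_conj]
    linear_combination conj (f.fn s) * g.fn s * conj_mul_circle z)

/-- The left `C₀(G)`-valued inner product `⟨f, g⟩ = f ḡ` on `C₀(Γ, ῑ)`. -/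
def linner₀ (σ : Twist G Γ) (f g : C0bar σ) : C₀(G, ℂ) :=
  descend σ (f.fn * star g.fn) (fun s z => by
    simp only [ZeroAtInftyContinuousMap.mul_apply, ZeroAtInftyContinuousMap.star_apply, f.prop s z,
      g.prop s z, star_mul, RCLike.star_def, Complex.conj_conj]
    linear_combination f.fn s * conj (g.fn s) * conj_mul_circle z)

@[simp] lemma rinner₀_q (σ : Twist G Γ) (f g : C0bar σ) (s : Γ) :
    rinner₀ σ f g (σ.q s) = conj (f.fn s) * g.fn s := by
  simp [rinner₀]

@[simp] lemma linner₀_q (σ : Twist G Γ) (f g : C0bar σ) (s : Γ) :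
    linner₀ σ f g (σ.q s) = f.fn s * conj (g.fn s) := by
  simp [linner₀]

/-- Pointwise multiplication of `f ∈ C₀(Γ, ῑ)` with a bounded continuous function on `G`. -/
def actC (σ : Twist G Γ) (c : BoundedContinuousFunction G ℂ) : C0bar σ →ₗ[ℂ] C0bar σ where
  toFun f := C0bar.mk (c0OfLe (fun s => c (σ.q s) * f.fn s)
    ((c.continuous.comp σ.q_cont).mul (map_continuous f.fn)) f.fn ‖c‖ (fun s => by
      rw [norm_mul]; gcongr; exact c.norm_coe_le_norm _)) (fun s z => by
      simp [σ.q_ι, f.prop s z]; ring)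
  map_add' f g := by ext s; simp [mul_add]
  map_smul' k f := by ext s; simp; ring

@[simp] lemma actC_apply (σ : Twist G Γ) (c : BoundedContinuousFunction G ℂ) (f : C0bar σ) (s : Γ) :
    (actC σ c f).fn s = c (σ.q s) * f.fn s := rfl

/-- Right translation `rt^σ` of `Γ` on `C₀(Γ, ῑ)`. -/
def rtσ (σ : Twist G Γ) (s : Γ) : C0bar σ →ₗ[ℂ] C0bar σ where
  toFun f := C0bar.mk (rt s f.fn) (fun t z => by
    simp only [rt_apply]; rw [mul_assoc, σ.central, ← mul_assoc, f.prop])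
  map_add' f g := by ext; simp
  map_smul' k f := by ext; simp

@[simp] lemma rtσ_apply (σ : Twist G Γ) (s t : Γ) (f : C0bar σ) : (rtσ σ s f).fn t = f.fn (t * s) :=
  rfl

end Functions

/-! ### Nondegenerate actions of `C₀(G)` by multipliers -/

section C0Actions

variable {G Γ : Type u} [Group G] [TopologicalSpace G] [IsTopologicalGroup G]
  [Group Γ] [TopologicalSpace Γ] [IsTopologicalGroup Γ] {A : Type v} [NonUnitalCStarAlgebra A]

/-- An `rt`-`α`-equivariant nondegenerate `*`-homomorphism from `C₀(G)` to the multiplier algebra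
of `A`, the latter viewed as the algebra of adjointable operators on the Hilbert module `A_A`. -/
structure C0Action (σ : Twist G Γ) (α : Γ → A → A) where
  m : C₀(G, ℂ) →ₙₐ[ℂ] (A →L[ℂ] A)
  m_mul : ∀ c a b, m c (a * b) = m c a * b
  m_star : ∀ c a b, star (m c a) * b = star a * m (star c) b
  nondeg : Dense (Submodule.span ℂ {b | ∃ c a, b = m c a} : Set A)
  equivariant : ∀ s c a, α s (m c a) = m (rt (σ.q s) c) (α s a)

variable {σ : Twist G Γ} {α : Γ → A → A} {χ : Circle →* Circle}
  {H : Type*} [NormedAddCommGroup H] [InnerProductSpace ℂ H] [CompleteSpace H]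

/-- The representation `π̄ ∘ φ` of `C₀(G)`, where `π̄` is the extension of `π` to multipliers. -/
def C0Action.op (Φ : C0Action σ α) (r : CovRep σ α χ H) (c : C₀(G, ℂ)) : H →L[ℂ] H :=
  extendND r.π (repLin r.π ∘ₗ (Φ.m c).toLinearMap)

lemma C0Action.op_apply (Φ : C0Action σ α) (r : CovRep σ α χ H) (c : C₀(G, ℂ)) (a : A) (ξ : H) :
    Φ.op r c (r.π a ξ) = r.π (Φ.m c a) ξ := by
  refine extendND_apply r.nondeg ‖Φ.m c‖ (fun a => ?_) (fun a b ξ => ?_) a ξ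
  · exact (NonUnitalStarAlgHom.norm_apply_le r.π _).trans ((Φ.m c).le_opNorm a)
  · simp [repLin, Φ.m_mul]

lemma CovRep.ext_clm (r : CovRep σ α χ H) {F : Type*} [NormedAddCommGroup F] [NormedSpace ℂ F]
    {S T : H →L[ℂ] F} (h : ∀ a ξ, S (r.π a ξ) = T (r.π a ξ)) : S = T :=
  clm_ext_dense r.nondeg (by rintro _ ⟨a, ξ, rfl⟩; exact h a ξ)

lemma CovRep.ext_inner (r : CovRep σ α χ H) {x y : H}
    (h : ∀ a ξ, inner ℂ x (r.π a ξ) = inner ℂ y (r.π a ξ)) : x = y := by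
  have := r.ext_clm (S := innerSL ℂ x) (T := innerSL ℂ y) (by simpa using h)
  refine ext_inner_right ℂ fun v => ?_
  simpa using DFunLike.congr_fun this v

lemma C0Action.op_nondeg (Φ : C0Action σ α) (r : CovRep σ α χ H) :
    Dense (Submodule.span ℂ {η | ∃ c ξ, η = Φ.op r c ξ} : Set H) := by
  refine dense_of_le_closure r.nondeg ?_
  rintro _ ⟨a, ξ, rfl⟩
  have hcont : Continuous fun a => r.π a ξ :=
    (ContinuousLinearMap.apply ℂ H ξ).continuous.comp
      ((repLin r.π).mkContinuous 1 fun a => by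
        rw [one_mul]; exact NonUnitalStarAlgHom.norm_apply_le r.π a).continuous
  refine Φ.nondeg.induction (P := fun a => r.π a ξ ∈ _) ?_
    ((Submodule.isClosed_topologicalClosure _).preimage hcont) a
  intro a ha
  induction ha using Submodule.span_induction with
  | zero => rw [map_zero]; exact zero_mem _
  | add x y _ _ hx hy => rw [map_add]; exact add_mem hx hy
  | smul k x _ hx => rw [map_smul]; exact Submodule.smul_mem _ _ hx
  | mem x hx =>
    obtain ⟨c, a, rfl⟩ := hx
    exact Submodule.le_topologicalClosure _
      (Submodule.subset_span ⟨c, r.π a ξ, (Φ.op_apply r c a ξ).symm⟩)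

/-- The covariant representation `(π̄ ∘ φ, U)` of `(C₀(G), rt)`. -/
def C0Action.pull (Φ : C0Action σ α) (r : CovRep σ α χ H) :
    CovRep σ (fun s => rt (σ.q s)) χ H where
  U := r.U
  cont := r.cont
  π :=
    { toFun := Φ.op r
      map_smul' := fun k c => r.ext_clm fun a ξ => by simp [Φ.op_apply]
      map_zero' := r.ext_clm fun a ξ => by simp [Φ.op_apply]
      map_add' := fun c d => r.ext_clm fun a ξ => by simp [Φ.op_apply]
      map_mul' := fun c d => r.ext_clm fun a ξ => by simp [Φ.op_apply]
      map_star' := fun c => r.ext_clm fun a ξ => r.ext_inner fun b η => by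
        simp only [ContinuousLinearMap.star_eq_adjoint, ContinuousLinearMap.adjoint_inner_left,
          Φ.op_apply]
        have h : ∀ x y : A, inner ℂ (r.π x ξ) (r.π y η) = inner ℂ ξ (r.π (star x * y) η) := by
          intro x y
          rw [map_mul, map_star, ContinuousLinearMap.star_eq_adjoint]
          simp [ContinuousLinearMap.adjoint_inner_right]
        rw [h, h, Φ.m_star, star_star] }
  nondeg := Φ.op_nondeg r
  covariant := fun s c ξ => by
    refine DFunLike.congr_fun (?_ : (r.U s : H →L[ℂ] H) * Φ.op r c =
      Φ.op r (rt (σ.q s) c) * (r.U s : H →L[ℂ] H)) ξ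
    exact r.ext_clm fun a ξ => by
      simp [Φ.op_apply, r.covariant, Φ.equivariant]
  twist := r.twist

/-- The descent `φ ⋊ G : C₀(G) ⋊ G → M(A ⋊ G)`, the integrated form of `(i_A ∘ φ, i_Γ)`: in the
component of `(π, U)` it is the component of `(π̄ ∘ φ, U)`. -/
def C0Action.descent (Φ : C0Action σ α) (χ : Circle →* Circle)
    (x : CovFam.Prod σ (fun s => rt (σ.q s)) χ) : CovFam.Prod σ α χ :=
  x.reindex fun i : CovFam σ α χ => ⟨i.H, Φ.pull i.rep⟩

end C0Actions

/-! ### Bimodules -/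

section Bimod

variable {G Γ : Type u} [Group G] [TopologicalSpace G] [IsTopologicalGroup G]
  [Group Γ] [TopologicalSpace Γ] [IsTopologicalGroup Γ]
  {A : Type*} [NonUnitalCStarAlgebra A] {B : Type*} [NonUnitalCStarAlgebra B]
  {X : Type*} [NormedAddCommGroup X] [NormedSpace ℂ X]

/-- The operations of an equivariant `A`-`B` equivalence bimodule `X`. -/
structure BimodOps (Γ : Type u) (A B X : Type*) where
  α : Γ → A → A
  β : Γ → B → B
  γ : Γ → X → X
  lact : A → X → X
  ract : X → B → X
  linner : X → X → A
  rinner : X → X → B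

/-- Covariant imprimitivity bimodule representations on a pair `(H, H')` of Hilbert spaces, for the
twisted actions `(α, 1)` on `A` and `(β, ι)` on `B`. They correspond to the covariant
representations on `H ⊕ H'` of the linking algebra `L(X)` with twist `diag(1, ι)`. -/
structure BimodRep (σ : Twist G Γ) (O : BimodOps Γ A B X) (H H' : Type w) [NormedAddCommGroup H]
    [InnerProductSpace ℂ H] [CompleteSpace H] [NormedAddCommGroup H'] [InnerProductSpace ℂ H']
    [CompleteSpace H'] where
  left : CovRep σ O.α 1 H
  right : CovRep σ O.β (MonoidHom.id Circle) H'
  πX : X →ₗ[ℂ] (H' →L[ℂ] H)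
  map_linner : ∀ x y, left.π (O.linner x y) = πX x ∘L ContinuousLinearMap.adjoint (πX y)
  map_rinner : ∀ x y, right.π (O.rinner x y) = ContinuousLinearMap.adjoint (πX x) ∘L πX y
  map_lact : ∀ a x, πX (O.lact a x) = left.π a ∘L πX x
  map_ract : ∀ x b, πX (O.ract x b) = πX x ∘L right.π b
  covariant : ∀ s x ξ,
    (left.U s : H →L[ℂ] H) (πX x ξ) = πX (O.γ s x) ((right.U s : H' →L[ℂ] H') ξ)

/-- All covariant bimodule representations. -/
structure BimodFam (σ : Twist G Γ) (O : BimodOps Γ A B X) where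
  H : Type u
  H' : Type u
  [nacg : NormedAddCommGroup H]
  [ips : InnerProductSpace ℂ H]
  [complete : CompleteSpace H]
  [nacg' : NormedAddCommGroup H']
  [ips' : InnerProductSpace ℂ H']
  [complete' : CompleteSpace H']
  rep : BimodRep σ O H H'

attribute [instance] BimodFam.nacg BimodFam.ips BimodFam.complete BimodFam.nacg' BimodFam.ips'
  BimodFam.complete'

variable {σ : Twist G Γ} {O : BimodOps Γ A B X}

/-- The restriction of a bimodule representation to the left algebra. -/
def BimodFam.leftIdx (k : BimodFam σ O) : CovFam σ O.α 1 := ⟨k.H, k.rep.left⟩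

/-- The restriction of a bimodule representation to the right algebra. -/
def BimodFam.rightIdx (k : BimodFam σ O) : CovFam σ O.β (MonoidHom.id Circle) :=
  ⟨k.H', k.rep.right⟩

/-- Bounded families `(T_k)`, `T_k ∈ B(H'_k, H_k)`. -/
abbrev BimodFam.Prod (σ : Twist G Γ) (O : BimodOps Γ A B X) :=
  lp (fun k : BimodFam σ O => k.H' →L[ℂ] k.H) ∞

/-- The crossed product `X ⋊_γ G`: the closure of the integrated forms `∫ π_X(f(s)) V_s ds`,
`f ∈ C_c(Γ, X, ι)`; this is the upper right corner of the crossed product of the linking algebra. -/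
def bimodCrossedProduct [MeasurableSpace Γ] (μ : Measure Γ) (σ : Twist G Γ)
    (O : BimodOps Γ A B X) : Set (BimodFam.Prod σ O) :=
  closure (Submodule.span ℂ {T : BimodFam.Prod σ O | ∃ f : Γ → X,
    IsCcTwisted σ (MonoidHom.id Circle) f ∧ ∀ (k : BimodFam σ O) (ξ : k.H'),
      T k ξ = ∫ s, k.rep.πX (f s) ((k.rep.right.U s : k.H' →L[ℂ] k.H') ξ) ∂μ})

/-- `T ∈ M(X ⋊_γ G)`: `T (B ⋊ G) ⊆ X ⋊ G` and `(A ⋊ G) T ⊆ X ⋊ G`. -/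
def IsBimodMultiplier [MeasurableSpace Γ] (μ : Measure Γ) (σ : Twist G Γ)
    (O : BimodOps Γ A B X) (T : BimodFam.Prod σ O) : Prop :=
  (∀ b ∈ crossedProduct μ σ O.β (MonoidHom.id Circle), ∃ x ∈ bimodCrossedProduct μ σ O,
    ∀ k, x k = T k ∘L (BFam.ap b k.rightIdx : k.H' →L[ℂ] k.H')) ∧
  (∀ a ∈ crossedProduct μ σ O.α 1, ∃ x ∈ bimodCrossedProduct μ σ O,
    ∀ k, x k = (BFam.ap a k.leftIdx : k.H →L[ℂ] k.H) ∘L T k)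

end Bimod

/-! ### Hilbert modules -/

section HilbertModules

/-- (Right) Hilbert `B`-modules; the inner product is linear in the second variable. -/
class HilbMod (B : outParam Type*) [NonUnitalCStarAlgebra B] (E : Type*) [NormedAddCommGroup E]
    [NormedSpace ℂ E] [CompleteSpace E] where
  ip : E →L⋆[ℂ] E →L[ℂ] B
  rs : E →L[ℂ] B →L[ℂ] E
  ip_star : ∀ x y, star (ip x y) = ip y x
  ip_pos : ∀ x, ∃ c, ip x x = star c * c
  ip_norm : ∀ x, ‖ip x x‖ = ‖x‖ ^ 2
  ip_le : ∀ x y, ‖ip x y‖ ≤ ‖x‖ * ‖y‖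
  ip_rs : ∀ x y b, ip x (rs y b) = ip x y * b

/-- A (possibly degenerate) positive `B`-valued inner product on a right `B`-module `V`. -/
structure PreIP (B : Type*) [NonUnitalCStarAlgebra B] (V : Type*) [AddCommGroup V]
    [Module ℂ V] where
  ip : V →ₗ⋆[ℂ] V →ₗ[ℂ] B
  rs : V →ₗ[ℂ] B →ₗ[ℂ] V
  ip_star : ∀ x y, star (ip x y) = ip y x
  ip_pos : ∀ x, ∃ c, ip x x = star c * c
  ip_rs : ∀ x y b, ip x (rs y b) = ip x y * b

namespace PreIP

variable {B : Type*} [NonUnitalCStarAlgebra B] {V : Type*} [AddCommGroup V] [Module ℂ V]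
  (P : PreIP B V)

lemma rs_ip (x y : V) (b : B) : P.ip (P.rs x b) y = star b * P.ip x y := by
  rw [← P.ip_star, P.ip_rs, star_mul, P.ip_star]

lemma cauchySchwarz (x y : V) : ‖P.ip x y‖ ^ 2 ≤ ‖P.ip x x‖ * ‖P.ip y y‖ := by
  let _ : PartialOrder B := CStarAlgebra.spectralOrder B
  have _ : StarOrderedRing B := CStarAlgebra.spectralOrderedRing B
  have key : ∀ t : ℝ, ‖P.ip x x‖ < t → ‖P.ip x y‖ ^ 2 ≤ t * ‖P.ip y y‖ := by
    intro t ht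
    have ht0 : 0 < t := (norm_nonneg _).trans_lt ht
    set a := P.ip x y with ha
    have hyx : P.ip y x = star a := (P.ip_star x y).symm
    have hsa : IsSelfAdjoint (P.ip x x) := P.ip_star x x
    have h0 : 0 ≤ P.ip (P.rs x a - (t : ℂ) • y) (P.rs x a - (t : ℂ) • y) := by
      obtain ⟨c, hc⟩ := P.ip_pos (P.rs x a - (t : ℂ) • y)
      rw [hc]; exact star_mul_self_nonneg c
    have h1 : P.ip (P.rs x a - (t : ℂ) • y) (P.rs x a - (t : ℂ) • y) =
        star a * P.ip x x * a - t • (star a * a) - t • (star a * a) + t • (t • P.ip y y) := by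
      simp only [map_sub, LinearMap.sub_apply, P.ip_rs, P.rs_ip, LinearMap.map_smulₛₗ, map_smul,
        LinearMap.smul_apply, hyx, ← ha, Complex.conj_ofReal, mul_assoc]
      simp only [Complex.coe_smul, smul_sub]
      abel
    have h2 : star a * P.ip x x * a ≤ t • (star a * a) :=
      (CStarAlgebra.star_left_conjugate_le_norm_smul hsa).trans (by
        have := star_mul_self_nonneg a
        gcongr)
    have h3 : t • (star a * a) ≤ t • (t • P.ip y y) := by
      rw [h1] at h0
      have h4 : star a * P.ip x x * a - t • (star a * a) - t • (star a * a) + t • (t • P.ip y y) ≤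
          t • (t • P.ip y y) - t • (star a * a) := by
        have : star a * P.ip x x * a - t • (star a * a) ≤ 0 := sub_nonpos.2 h2
        calc _ ≤ 0 - t • (star a * a) + t • (t • P.ip y y) := by gcongr
          _ = _ := by abel
      exact sub_nonneg.1 (h0.trans h4)
    have h5 : star a * a ≤ t • P.ip y y := (smul_le_smul_iff_of_pos_left ht0).1 h3
    calc ‖a‖ ^ 2 = ‖star a * a‖ := by rw [CStarRing.norm_star_mul_self, sq]
      _ ≤ ‖t • P.ip y y‖ := CStarAlgebra.norm_le_norm_of_nonneg_of_le (star_mul_self_nonneg a) h5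
      _ = t * ‖P.ip y y‖ := by rw [norm_smul, Real.norm_of_nonneg ht0.le]
  refine le_of_forall_pos_le_add fun ε hε => ?_
  have hpos : 0 < ‖P.ip y y‖ + 1 := by positivity
  have := key (‖P.ip x x‖ + ε / (‖P.ip y y‖ + 1)) (by linarith [div_pos hε hpos])
  refine this.trans ?_
  rw [add_mul]
  gcongr
  rw [div_mul_eq_mul_div, div_le_iff₀ hpos]
  nlinarith [norm_nonneg (P.ip y y)]

/-- `V` with the seminorm `‖x‖ = ‖⟨x, x⟩‖^{1/2}`. -/
def Space (_ : PreIP B V) : Type _ := V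

instance : AddCommGroup P.Space := inferInstanceAs (AddCommGroup V)
instance : Module ℂ P.Space := inferInstanceAs (Module ℂ V)

/-- The inner product of `P` on `P.Space`. -/
def sip : P.Space →ₗ⋆[ℂ] P.Space →ₗ[ℂ] B := P.ip

/-- The right action of `P` on `P.Space`. -/
def srs : P.Space →ₗ[ℂ] B →ₗ[ℂ] P.Space := P.rs

instance : Norm P.Space := ⟨fun x => √‖P.sip x x‖⟩

lemma space_norm (x : P.Space) : ‖x‖ = √‖P.sip x x‖ := rfl
lemma space_norm_sq (x : P.Space) : ‖x‖ ^ 2 = ‖P.sip x x‖ := Real.sq_sqrt (norm_nonneg _)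
lemma space_norm_nonneg (x : P.Space) : 0 ≤ ‖x‖ := Real.sqrt_nonneg _

lemma space_norm_ip (x y : P.Space) : ‖P.sip x y‖ ≤ ‖x‖ * ‖y‖ := by
  rw [space_norm, space_norm, ← Real.sqrt_mul (norm_nonneg _)]
  exact Real.le_sqrt_of_sq_le (P.cauchySchwarz x y)

lemma space_core : SeminormedSpace.Core ℂ P.Space where
  norm_nonneg x := Real.sqrt_nonneg _
  norm_smul c x := by
    have : P.sip (c • x) (c • x) = (conj c * c) • P.sip x x := by
      simp only [LinearMap.map_smulₛₗ, LinearMap.smul_apply, RingHom.id_apply, smul_smul, mul_comm]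
    rw [space_norm, space_norm, this, norm_smul, norm_mul, RCLike.norm_conj,
      Real.sqrt_mul (by positivity), Real.sqrt_mul_self (norm_nonneg _)]
  norm_triangle x y := by
    refine Real.sqrt_le_iff.2 ⟨add_nonneg (Real.sqrt_nonneg _) (Real.sqrt_nonneg _), ?_⟩
    have h : P.sip (x + y) (x + y) = P.sip x x + P.sip x y + P.sip y x + P.sip y y := by
      simp only [map_add, LinearMap.add_apply]; abel
    rw [h]
    calc _ ≤ ‖P.sip x x‖ + ‖P.sip x y‖ + ‖P.sip y x‖ + ‖P.sip y y‖ := norm_add₄_le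
      _ ≤ ‖x‖ ^ 2 + ‖x‖ * ‖y‖ + ‖y‖ * ‖x‖ + ‖y‖ ^ 2 := by
          gcongr
          · exact (P.space_norm_sq x).ge
          · exact P.space_norm_ip x y
          · exact P.space_norm_ip y x
          · exact (P.space_norm_sq y).ge
      _ = (‖x‖ + ‖y‖) ^ 2 := by ring

instance : SeminormedAddCommGroup P.Space := SeminormedAddCommGroup.ofCore P.space_core
instance : NormedSpace ℂ P.Space := ⟨fun c x => (P.space_core.norm_smul c x).le⟩

/-- The Hilbert `B`-module obtained by (Hausdorff) completion. -/
def Hilb : Type _ := UniformSpace.Completion P.Space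

instance : NormedAddCommGroup P.Hilb :=
  inferInstanceAs (NormedAddCommGroup (UniformSpace.Completion P.Space))
instance : NormedSpace ℂ P.Hilb :=
  inferInstanceAs (NormedSpace ℂ (UniformSpace.Completion P.Space))
instance : CompleteSpace P.Hilb :=
  inferInstanceAs (CompleteSpace (UniformSpace.Completion P.Space))

/-- The canonical map from `V` to the completion. -/
def toHilb : P.Space →L[ℂ] P.Hilb := UniformSpace.Completion.toComplL

lemma toHilb_dense : DenseRange P.toHilb := UniformSpace.Completion.denseRange_coe
lemma toHilb_ui : IsUniformInducing P.toHilb := UniformSpace.Completion.isUniformInducing_coe _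
lemma toHilb_norm (x : P.Space) : ‖P.toHilb x‖ = ‖x‖ := UniformSpace.Completion.norm_coe x

lemma hilb_ind {p : P.Hilb → Prop} (x : P.Hilb) (hp : IsClosed {x | p x})
    (h : ∀ v, p (P.toHilb v)) : p x :=
  UniformSpace.Completion.induction_on x hp h

/-- The inner product on `P.Space` as a bounded map. -/
def ipL : P.Space →L⋆[ℂ] P.Space →L[ℂ] B :=
  LinearMap.mkContinuous₂ P.sip 1 fun x y => by
    rw [one_mul]; exact P.space_norm_ip x y

lemma space_norm_rs (x : P.Space) (b : B) : ‖P.srs x b‖ ≤ 1 * ‖x‖ * ‖b‖ := by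
  rw [one_mul]
  refine Real.sqrt_le_iff.2 ⟨by positivity, ?_⟩
  have h : P.sip (P.srs x b) (P.srs x b) = star b * P.sip x x * b :=
    (P.ip_rs _ _ _).trans (congrArg (· * b) (P.rs_ip _ _ _))
  rw [h, mul_pow, P.space_norm_sq]
  calc ‖star b * P.sip x x * b‖ ≤ ‖star b‖ * ‖P.sip x x‖ * ‖b‖ :=
        (norm_mul_le _ _).trans (by gcongr; exact norm_mul_le _ _)
    _ = _ := by rw [norm_star]; ring

/-- The right action on `P.Space` as a bounded map. -/
def rsL : P.Space →L[ℂ] B →L[ℂ] P.Space :=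
  LinearMap.mkContinuous₂ P.srs 1 P.space_norm_rs

/-- The inner product on the completion. -/
def ipH : P.Hilb →L⋆[ℂ] P.Hilb →L[ℂ] B :=
  ((P.ipL.extend P.toHilb).flip.extend P.toHilb).flip

/-- The right action on the completion. -/
def rsH : P.Hilb →L[ℂ] B →L[ℂ] P.Hilb :=
  ((ContinuousLinearMap.compL ℂ B P.Space P.Hilb P.toHilb).comp P.rsL).extend P.toHilb

lemma ipH_coe (x y : P.Space) : P.ipH (P.toHilb x) (P.toHilb y) = P.sip x y := by
  rw [ipH, ContinuousLinearMap.flip_apply,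
    ContinuousLinearMap.extend_eq _ P.toHilb_dense P.toHilb_ui, ContinuousLinearMap.flip_apply,
    ContinuousLinearMap.extend_eq _ P.toHilb_dense P.toHilb_ui]
  rfl

lemma rsH_coe (x : P.Space) (b : B) : P.rsH (P.toHilb x) b = P.toHilb (P.srs x b) := by
  rw [rsH, ContinuousLinearMap.extend_eq _ P.toHilb_dense P.toHilb_ui]
  rfl

instance : HilbMod B P.Hilb where
  ip := P.ipH
  rs := P.rsH
  ip_star x y := by
    refine P.hilb_ind (p := fun x => star (P.ipH x y) = P.ipH y x) x
      (isClosed_eq (by fun_prop) (by fun_prop)) fun x => ?_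
    refine P.hilb_ind (p := fun y => star (P.ipH _ y) = P.ipH y _) y
      (isClosed_eq (by fun_prop) (by fun_prop)) fun y => ?_
    rw [ipH_coe, ipH_coe]
    exact P.ip_star x y
  ip_pos x := by
    let _ : PartialOrder B := CStarAlgebra.spectralOrder B
    have _ : StarOrderedRing B := CStarAlgebra.spectralOrderedRing B
    refine CStarAlgebra.nonneg_iff_eq_star_mul_self.1 ?_
    refine P.hilb_ind (p := fun x => 0 ≤ P.ipH x x) x
      (isClosed_le continuous_const (by fun_prop)) fun x => ?_
    rw [ipH_coe]
    exact CStarAlgebra.nonneg_iff_eq_star_mul_self.2 (P.ip_pos x)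
  ip_norm x := by
    refine P.hilb_ind (p := fun x => ‖P.ipH x x‖ = ‖x‖ ^ 2) x
      (isClosed_eq (by fun_prop) (by fun_prop)) fun x => ?_
    rw [ipH_coe, toHilb_norm, space_norm_sq]
  ip_le x y := by
    refine P.hilb_ind (p := fun x => ‖P.ipH x y‖ ≤ ‖x‖ * ‖y‖) x
      (isClosed_le (by fun_prop) (by fun_prop)) fun x => ?_
    refine P.hilb_ind (p := fun y => ‖P.ipH _ y‖ ≤ ‖_‖ * ‖y‖) y
      (isClosed_le (by fun_prop) (by fun_prop)) fun y => ?_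
    rw [ipH_coe, toHilb_norm, toHilb_norm]
    exact P.space_norm_ip x y
  ip_rs x y b := by
    refine P.hilb_ind (p := fun x => P.ipH x (P.rsH y b) = P.ipH x y * b) x
      (isClosed_eq (by fun_prop) (by fun_prop)) fun x => ?_
    refine P.hilb_ind (p := fun y => P.ipH _ (P.rsH y b) = P.ipH _ y * b) y
      (isClosed_eq (by fun_prop) (by fun_prop)) fun y => ?_
    rw [rsH_coe, ipH_coe, ipH_coe]
    exact P.ip_rs x y b

/-- The canonical map from `V` to the completion. -/
def emb : V →ₗ[ℂ] P.Hilb := (P.toHilb : P.Space →ₗ[ℂ] P.Hilb)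

lemma emb_dense : DenseRange P.emb := P.toHilb_dense

lemma emb_ind {p : P.Hilb → Prop} (x : P.Hilb) (hp : IsClosed {x | p x})
    (h : ∀ v, p (P.emb v)) : p x := P.hilb_ind x hp h

lemma ip_emb (v w : V) : HilbMod.ip (P.emb v) (P.emb w) = P.ip v w := P.ipH_coe v w

lemma rs_emb (v : V) (b : B) : HilbMod.rs (P.emb v) b = P.emb (P.rs v b) := P.rsH_coe v b

lemma emb_norm (v : V) : ‖P.emb v‖ = √‖P.ip v v‖ := P.toHilb_norm v

end PreIP

end HilbertModules

/-! ### Adjointable and compact operators -/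

section Adjointable

variable {B : Type*} [NonUnitalCStarAlgebra B] {E : Type*} [NormedAddCommGroup E]
  [NormedSpace ℂ E] [CompleteSpace E] [HilbMod B E]

open HilbMod

lemma rs_ip (x y : E) (b : B) : ip (rs x b) y = star b * ip x y := by
  rw [← ip_star, ip_rs, star_mul, ip_star]

lemma ip_ext {x y : E} (h : ∀ z : E, ip z x = ip z y) : x = y := by
  have h1 : ‖x - y‖ ^ 2 = 0 := by
    rw [← ip_norm, map_sub, h (x - y), sub_self, norm_zero]
  rw [← sub_eq_zero, ← norm_eq_zero]
  exact pow_eq_zero_iff (two_ne_zero) |>.1 h1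

variable (E) in
/-- The adjointable operators on a Hilbert module. -/
def adjAlg : Subalgebra ℂ (E →L[ℂ] E) where
  carrier := {T | ∃ S : E →L[ℂ] E, ∀ x y : E, ip (T x) y = ip x (S y)}
  mul_mem' := by
    rintro T T' ⟨S, hS⟩ ⟨S', hS'⟩
    exact ⟨S' * S, fun x y => by simp [hS, hS']⟩
  add_mem' := by
    rintro T T' ⟨S, hS⟩ ⟨S', hS'⟩
    exact ⟨S + S', fun x y => by simp [hS, hS']⟩
  algebraMap_mem' c := ⟨conj c • 1, fun x y => by
    simp [Algebra.algebraMap_eq_smul_one]⟩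

variable (E) in
/-- The `C⋆`-algebra of adjointable operators on a Hilbert module. -/
abbrev Adj := ↥(adjAlg E)

/-- The adjoint. -/
def Adj.adj (T : Adj E) : E →L[ℂ] E := T.2.choose

lemma Adj.ip_adj (T : Adj E) (x y : E) : ip (T.1 x) y = ip x (T.adj y) := T.2.choose_spec x y

lemma Adj.adj_ip (T : Adj E) (x y : E) : ip (T.adj x) y = ip x (T.1 y) := by
  rw [← ip_star, ← T.ip_adj, ip_star]

lemma Adj.adj_eq {T : Adj E} {S : E →L[ℂ] E} (h : ∀ x y : E, ip (T.1 x) y = ip x (S y)) :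
    T.adj = S := by
  ext y
  exact ip_ext fun z => by rw [← T.ip_adj, h]

instance : Star (Adj E) := ⟨fun T => ⟨T.adj, T.1, T.adj_ip⟩⟩

lemma Adj.star_val (T : Adj E) : (star T).1 = T.adj := rfl

lemma Adj.star_eq {T S : Adj E} (h : ∀ x y : E, ip (T.1 x) y = ip x (S.1 y)) :
    star T = S := Subtype.ext (Adj.adj_eq h)

lemma Adj.ip_star' (T : Adj E) (x y : E) : ip (T.1 x) y = ip x ((star T).1 y) := T.ip_adj x y

instance : StarRing (Adj E) where
  star_involutive T := Adj.star_eq fun x y => T.adj_ip x y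
  star_mul T S := Adj.star_eq fun x y => by simp [Adj.ip_star']
  star_add T S := Adj.star_eq fun x y => by simp [Adj.ip_star']

instance : StarModule ℂ (Adj E) where
  star_smul c T := Adj.star_eq fun x y => by simp [Adj.ip_star']

lemma Adj.norm_le_star_mul (T : Adj E) : ‖T‖ * ‖T‖ ≤ ‖star T * T‖ := by
  have h : ‖T.1‖ ≤ √‖(star T * T).1‖ := by
    refine ContinuousLinearMap.opNorm_le_bound _ (Real.sqrt_nonneg _) fun x => ?_
    rw [← Real.sqrt_sq (norm_nonneg x), ← Real.sqrt_mul (norm_nonneg _)]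
    refine Real.le_sqrt_of_sq_le ?_
    rw [← ip_norm, Adj.ip_star']
    calc _ ≤ ‖x‖ * ‖(star T * T).1 x‖ := ip_le _ _
      _ ≤ ‖x‖ * (‖(star T * T).1‖ * ‖x‖) := by
        gcongr; exact ContinuousLinearMap.le_opNorm _ _
      _ = _ := by ring
  calc ‖T‖ * ‖T‖ ≤ √‖(star T * T).1‖ * √‖(star T * T).1‖ := by gcongr <;> exact h
    _ = _ := Real.mul_self_sqrt (norm_nonneg _)

instance : CStarRing (Adj E) where
  norm_mul_self_le := Adj.norm_le_star_mul

instance : CompleteSpace (Adj E) := by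
  have hc : IsClosed (adjAlg E : Set (E →L[ℂ] E)) := by
    rw [← isSeqClosed_iff_isClosed]
    intro u T hu hT
    let v : ℕ → Adj E := fun n => ⟨u n, hu n⟩
    have hv : CauchySeq v := by
      have := hT.cauchySeq
      rw [Metric.cauchySeq_iff] at this ⊢
      exact this
    have hvs : CauchySeq fun n => (star (v n)).1 := by
      have h1 : LipschitzWith 1 (fun T : Adj E => (star T).1) := by
        refine LipschitzWith.of_dist_le_mul fun S T => ?_
        have : (star S).1 - (star T).1 = (star (S - T)).1 := by rw [star_sub]; rfl
        rw [dist_eq_norm, this, NNReal.coe_one, one_mul, dist_eq_norm]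
        exact (norm_star (S - T)).le
      exact h1.uniformContinuous.comp_cauchySeq hv
    obtain ⟨S, hS⟩ := cauchySeq_tendsto_of_complete hvs
    refine ⟨S, fun x y => ?_⟩
    have h1 : Tendsto (fun n => ip (u n x) y) atTop (𝓝 (ip (T x) y)) := by
      have := ((by fun_prop : Continuous fun R : E →L[ℂ] E => ip (R x) y).tendsto T).comp hT
      exact this
    have h2 : Tendsto (fun n => ip x ((star (v n)).1 y)) atTop (𝓝 (ip x (S y))) := by
      have := ((by fun_prop : Continuous fun R : E →L[ℂ] E => ip x (R y)).tendsto S).comp hS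
      exact this
    exact tendsto_nhds_unique h1 (h2.congr fun n => ((v n).ip_star' x y).symm)
  exact hc.completeSpace_coe

instance : CStarAlgebra (Adj E) where

/-- The rank one operators `θ_{x, y} z = x ⟨y, z⟩`. -/
def theta (x y : E) : Adj E :=
  ⟨(rs x).comp (ip y), (rs y).comp (ip x), fun z w => by
    simp only [ContinuousLinearMap.comp_apply, rs_ip, ip_rs, ip_star]⟩

lemma theta_apply (x y z : E) : (theta x y).1 z = rs x (ip y z) := rfl

lemma star_theta (x y : E) : star (theta x y) = theta y x := Adj.star_eq fun z w => by
  simp only [theta_apply, rs_ip, ip_rs, ip_star]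

lemma rs_rs (x : E) (b c : B) : rs (rs x b) c = rs x (b * c) :=
  ip_ext fun z => by simp only [ip_rs, mul_assoc]

lemma Adj.map_rs (T : Adj E) (x : E) (b : B) : T.1 (rs x b) = rs (T.1 x) b :=
  ip_ext fun z => by
    rw [ip_rs, ← Adj.adj_ip, ip_rs, Adj.adj_ip]

lemma mul_theta (T : Adj E) (x y : E) : T * theta x y = theta (T.1 x) y := by
  ext z; exact T.map_rs _ _

lemma theta_mul (T : Adj E) (x y : E) : theta x y * T = theta x ((star T).1 y) := by
  rw [← star_star (theta x y * T), star_mul, star_theta, mul_theta, star_theta]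

variable (E) in
/-- The span of the rank one operators. -/
def finiteRank : Submodule ℂ (Adj E) := Submodule.span ℂ {T | ∃ x y, T = theta x y}

/-- The compact operators are the closure of `finiteRank`; they form an ideal. -/
lemma mul_mem_compact (T : Adj E) {k : Adj E} (hk : k ∈ (finiteRank E).topologicalClosure) :
    T * k ∈ (finiteRank E).topologicalClosure := by
  refine map_mem_closure (f := fun k => T * k) (by fun_prop) hk fun k hk => ?_
  induction hk using Submodule.span_induction with
  | zero => simp
  | add x y _ _ hx hy => simp only [mul_add] at *; exact add_mem hx hy
  | smul c x _ hx =>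
    simp only [mul_smul_comm] at *; exact Submodule.smul_mem _ _ hx
  | mem x hx =>
    obtain ⟨x, y, rfl⟩ := hx
    exact Submodule.subset_span ⟨_, _, mul_theta T x y⟩

lemma star_mem_compact {k : Adj E} (hk : k ∈ (finiteRank E).topologicalClosure) :
    star k ∈ (finiteRank E).topologicalClosure := by
  refine map_mem_closure (f := fun k : Adj E => star k) continuous_star hk fun k hk => ?_
  induction hk using Submodule.span_induction with
  | zero => simp
  | add x y _ _ hx hy => simp only [star_add] at *; exact add_mem hx hy
  | smul c x _ hx =>
    simp only [star_smul] at *; exact Submodule.smul_mem _ _ hx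
  | mem x hx =>
    obtain ⟨x, y, rfl⟩ := hx
    exact Submodule.subset_span ⟨_, _, star_theta x y⟩

variable (E) in
/-- The `C⋆`-algebra `K(E)` of compact operators. -/
def compactOps : NonUnitalStarSubalgebra ℂ (Adj E) where
  carrier := (finiteRank E).topologicalClosure
  add_mem' := add_mem
  zero_mem' := zero_mem _
  mul_mem' := fun _ hb => mul_mem_compact _ hb
  smul_mem' := fun c _ h => Submodule.smul_mem _ c h
  star_mem' := star_mem_compact

instance : IsClosed (compactOps E : Set (Adj E)) :=
  Submodule.isClosed_topologicalClosure (finiteRank E)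

variable (E) in
/-- The `C⋆`-algebra `K(E)` of compact operators, as a type. -/
def Comp : Type _ := ↥(compactOps E)

instance : NonUnitalCStarAlgebra (Comp E) := inferInstanceAs (NonUnitalCStarAlgebra ↥(compactOps E))

/-- Compact operators are adjointable. -/
def Comp.val (k : Comp E) : Adj E := k.1

lemma Comp.val_mem (k : Comp E) : k.val ∈ (finiteRank E).topologicalClosure := k.2

lemma Comp.ext {k l : Comp E} (h : k.val = l.val) : k = l := Subtype.ext h

@[simp] lemma Comp.val_add (k l : Comp E) : (k + l).val = k.val + l.val := rfl
@[simp] lemma Comp.val_zero : (0 : Comp E).val = 0 := rfl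
@[simp] lemma Comp.val_mul (k l : Comp E) : (k * l).val = k.val * l.val := rfl
@[simp] lemma Comp.val_smul (c : ℂ) (k : Comp E) : (c • k).val = c • k.val := rfl
@[simp] lemma Comp.val_star (k : Comp E) : (star k).val = star k.val := rfl
lemma Comp.norm_val (k : Comp E) : ‖k.val‖ = ‖k‖ := rfl

/-- Rank one operators as compact operators. -/
def ctheta (x y : E) : Comp E :=
  ⟨theta x y, Submodule.le_topologicalClosure _ (Submodule.subset_span ⟨x, y, rfl⟩)⟩

/-- The product of an adjointable operator and a compact operator. -/
def Adj.mulComp (T : Adj E) (k : Comp E) : Comp E := ⟨T * k.val, mul_mem_compact T k.val_mem⟩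

lemma dense_ctheta : Dense (Submodule.span ℂ {k : Comp E | ∃ x y, k = ctheta x y} :
    Set (Comp E)) := by
  intro k
  have hi : IsInducing (Comp.val : Comp E → Adj E) := ⟨rfl⟩
  rw [hi.closure_eq_preimage_closure_image]
  refine closure_mono ?_ k.val_mem
  intro T hT
  induction hT using Submodule.span_induction with
  | zero => exact ⟨0, zero_mem _, rfl⟩
  | add x y _ _ hx hy =>
    obtain ⟨a, ha, rfl⟩ := hx
    obtain ⟨b, hb, rfl⟩ := hy
    exact ⟨a + b, add_mem ha hb, rfl⟩
  | smul c x _ hx =>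
    obtain ⟨a, ha, rfl⟩ := hx
    exact ⟨c • a, Submodule.smul_mem _ _ ha, rfl⟩
  | mem x hx =>
    obtain ⟨x, y, rfl⟩ := hx
    exact ⟨ctheta x y, Submodule.subset_span ⟨x, y, rfl⟩, rfl⟩

/-- Conjugation `T ↦ V T V⁻¹` with an invertible `V` that preserves the inner product up to an
automorphism of `B`. -/
def conjAdj (V V' : E →L[ℂ] E) (b : B → B) (hb : ∀ x y : E, ip (V x) (V y) = b (ip x y))
    (hV : ∀ x, V (V' x) = x) (T : Adj E) : Adj E :=
  ⟨V * T.1 * V', V * T.adj * V', fun x y => by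
    have h1 := hb (T.1 (V' x)) (V' y)
    have h2 := hb (V' x) (T.adj (V' y))
    rw [hV] at h1 h2
    simp only [mul_apply_eq_comp]
    rw [h1, h2, T.ip_adj]⟩

end Adjointable

/-! ### Weak `G ⋊ G`-algebras and the bimodule `𝓔_σ(B)` -/

/-- A weak `G ⋊ G`-algebra `(B, β, φ)`: a strongly continuous action `β` of `G` on `B` and a
nondegenerate `rt`-`β`-equivariant `*`-homomorphism `φ : C₀(G) → M(B)`. -/
structure WeakAlg (G : Type u) [Group G] [TopologicalSpace G] [IsTopologicalGroup G]
    (B : Type v) [NonUnitalCStarAlgebra B] where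
  β : G →* (B ≃⋆ₐ[ℂ] B)
  cont : ∀ b, Continuous fun g => β g b
  φ : C₀(G, ℂ) →⋆ₙₐ[ℂ] 𝓜(ℂ, B)
  nondeg : Dense (Submodule.span ℂ {b | ∃ c a, b = (φ c).fst a} : Set B)
  equivariant : ∀ g c b, β g ((φ c).fst b) = (φ (rt g c)).fst (β g b)

section WeakAlgs

variable {G Γ : Type u} [Group G] [TopologicalSpace G] [IsTopologicalGroup G]
  [Group Γ] [TopologicalSpace Γ] [IsTopologicalGroup Γ] {B : Type v} [NonUnitalCStarAlgebra B]

/-- The action of `Γ` on `B` inflated from `β`. -/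
def WeakAlg.infl (W : WeakAlg G B) (σ : Twist G Γ) (s : Γ) (b : B) : B := W.β (σ.q s) b

lemma dc_mul (m : 𝓜(ℂ, B)) (a b : B) : m.fst (a * b) = m.fst a * b := by
  have h : ∀ z : B, z * (m.fst (a * b)) = z * (m.fst a * b) := fun z => by
    rw [← m.central, ← mul_assoc, m.central, mul_assoc]
  have h0 : star (m.fst (a * b) - m.fst a * b) * (m.fst (a * b) - m.fst a * b) = 0 := by
    rw [mul_sub, h, sub_self]
  exact sub_eq_zero.1 ((CStarRing.star_mul_self_eq_zero_iff _).1 h0)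

lemma WeakAlg.φ_star (W : WeakAlg G B) (c : C₀(G, ℂ)) (a b : B) :
    star ((W.φ c).fst a) * b = star a * (W.φ (star c)).fst b := by
  rw [map_star, DoubleCentralizer.star_fst]
  rw [← star_star b, ← star_mul, ← (W.φ c).central, star_mul, star_star]

/-- `φ : C₀(G) → M(B)` as an action of `C₀(G)` on `B`. -/
def WeakAlg.c0Action (W : WeakAlg G B) (σ : Twist G Γ) : C0Action σ (W.infl σ) where
  m :=
    { toFun := fun c => (W.φ c).fst
      map_smul' := fun k c => by rw [map_smul]; rfl
      map_zero' := by rw [map_zero]; rfl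
      map_add' := fun c d => by rw [map_add]; rfl
      map_mul' := fun c d => by rw [map_mul]; rfl }
  m_mul := fun c a b => dc_mul _ a b
  m_star := W.φ_star
  nondeg := W.nondeg
  equivariant := fun s c b => W.equivariant (σ.q s) c b

/-- The algebraic tensor product underlying `𝓔_σ(B) = C₀(Γ, ῑ) ⊗_{C₀(G)} B`. -/
abbrev PreE (σ : Twist G Γ) (B : Type v) [NonUnitalCStarAlgebra B] := C0bar σ ⊗[ℂ] B

lemma rinner₀_add_left (σ : Twist G Γ) (f f' g : C0bar σ) :
    rinner₀ σ (f + f') g = rinner₀ σ f g + rinner₀ σ f' g :=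
  c0_ext_q σ fun s => by simp [add_mul]

lemma rinner₀_smul_left (σ : Twist G Γ) (k : ℂ) (f g : C0bar σ) :
    rinner₀ σ (k • f) g = conj k • rinner₀ σ f g :=
  c0_ext_q σ fun s => by simp [mul_assoc]

lemma rinner₀_add_right (σ : Twist G Γ) (f g g' : C0bar σ) :
    rinner₀ σ f (g + g') = rinner₀ σ f g + rinner₀ σ f g' :=
  c0_ext_q σ fun s => by simp [mul_add]

lemma rinner₀_smul_right (σ : Twist G Γ) (k : ℂ) (f g : C0bar σ) :
    rinner₀ σ f (k • g) = k • rinner₀ σ f g :=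
  c0_ext_q σ fun s => by simp [mul_left_comm]

lemma rinner₀_star (σ : Twist G Γ) (f g : C0bar σ) : star (rinner₀ σ f g) = rinner₀ σ g f :=
  c0_ext_q σ fun s => by simp [mul_comm]

variable (W : WeakAlg G B) (σ : Twist G Γ)

/-- `φ(c) b`. -/
def WeakAlg.mb : C₀(G, ℂ) →ₗ[ℂ] B →ₗ[ℂ] B :=
  LinearMap.mk₂ ℂ (fun c b => (W.φ c).fst b) (fun c d b => by rw [map_add]; rfl)
    (fun k c b => by rw [map_smul]; rfl) (by simp) (by simp)

lemma WeakAlg.mb_star (c : C₀(G, ℂ)) (a b : B) :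
    star (W.mb c a) * b = star a * W.mb (star c) b := W.φ_star c a b

lemma WeakAlg.mb_mul (c : C₀(G, ℂ)) (a b : B) : W.mb c (a * b) = W.mb c a * b := dc_mul _ a b

lemma WeakAlg.mb_mb (c d : C₀(G, ℂ)) (a : B) : W.mb c (W.mb d a) = W.mb (c * d) a := by
  change _ = (W.φ (c * d)).fst a
  rw [map_mul]; rfl

/-- The inner product `⟨f ⊗ b, g ⊗ b'⟩ = b⋆ φ(f̄ g) b'` for fixed `f`, `b`. -/
def WeakAlg.ip₁ (f : C0bar σ) (b : B) : PreE σ B →ₗ[ℂ] B :=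
  TensorProduct.lift (LinearMap.mk₂ ℂ (fun g b' => star b * W.mb (rinner₀ σ f g) b')
    (by simp [rinner₀_add_right, mul_add]) (fun k g b' => by
      rw [rinner₀_smul_right, map_smul, LinearMap.smul_apply]; exact mul_smul_comm _ _ _)
    (by simp [mul_add]) (fun k g b' => by rw [map_smul]; exact mul_smul_comm _ _ _))

@[simp] lemma WeakAlg.ip₁_tmul (f g : C0bar σ) (b b' : B) :
    W.ip₁ σ f b (g ⊗ₜ b') = star b * W.mb (rinner₀ σ f g) b' := rfl

/-- The inner product `⟨f ⊗ b, g ⊗ b'⟩ = b⋆ φ(f̄ g) b'`. -/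
def WeakAlg.preIp : PreE σ B →ₗ⋆[ℂ] PreE σ B →ₗ[ℂ] B :=
  TensorProduct.lift (LinearMap.mk₂'ₛₗ (starRingEnd ℂ) (starRingEnd ℂ) (fun f b => W.ip₁ σ f b)
    (fun f f' b => TensorProduct.ext' fun g b' => by simp [rinner₀_add_left, mul_add])
    (fun k f b => TensorProduct.ext' fun g b' => by
      simp only [rinner₀_smul_left, W.ip₁_tmul, map_smul, LinearMap.smul_apply]
      exact mul_smul_comm _ _ _)
    (fun f b b' => TensorProduct.ext' fun g b' => by simp [add_mul])
    (fun k f b => TensorProduct.ext' fun g b' => by simp [smul_mul_assoc]))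

@[simp] lemma WeakAlg.preIp_tmul (f g : C0bar σ) (b b' : B) :
    W.preIp σ (f ⊗ₜ b) (g ⊗ₜ b') = star b * W.mb (rinner₀ σ f g) b' := rfl

lemma continuous_div_of_le {X : Type*} [TopologicalSpace X] {p : X → ℂ} {r bd : X → ℝ}
    (hp : Continuous p) (hr : Continuous r) (hbd : Continuous bd)
    (h : ∀ x, ‖p x / r x‖ ≤ bd x) (h0 : ∀ x, r x = 0 → bd x = 0) :
    Continuous fun x => p x / (r x : ℂ) := by
  rw [continuous_iff_continuousAt]
  intro x
  by_cases hx : r x = 0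
  · have h1 : ‖p x / r x‖ ≤ 0 := (h x).trans (h0 x hx).le
    have h2 : p x / r x = 0 := norm_le_zero_iff.1 h1
    rw [ContinuousAt, h2]
    refine squeeze_zero_norm h ?_
    have := hbd.tendsto x
    rwa [h0 x hx] at this
  · exact hp.continuousAt.div (Complex.continuous_ofReal.comp hr).continuousAt (by simpa using hx)

lemma exists_sqrt_matrix {n : ℕ} (f : Fin n → C0bar σ) :
    ∃ d : Fin n → Fin n → C₀(G, ℂ), ∀ i j,
      ∑ k, star (d k i) * d k j = rinner₀ σ (f i) (f j) := by
  let r : Γ → ℝ := fun s => √(∑ k, ‖(f k).fn s‖ ^ 2)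
  have hr : Continuous r := by
    refine Real.continuous_sqrt.comp (continuous_finsetSum _ fun k _ => ?_)
    exact (map_continuous (f k).fn).norm.pow 2
  have hle : ∀ k s, ‖(f k).fn s‖ ≤ r s := fun k s =>
    Real.le_sqrt_of_sq_le (Finset.single_le_sum (f := fun k => ‖(f k).fn s‖ ^ 2)
      (fun i _ => sq_nonneg _) (Finset.mem_univ k))
  have hr0 : ∀ s, 0 ≤ r s := fun s => Real.sqrt_nonneg _
  have hb : ∀ k j s, ‖conj ((f k).fn s) * (f j).fn s / (r s : ℂ)‖ ≤ 1 * ‖(f j).fn s‖ := by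
    intro k j s
    rw [norm_div, norm_mul, RCLike.norm_conj, Complex.norm_real, Real.norm_of_nonneg (hr0 s)]
    refine div_le_of_le_mul₀ (hr0 s) (by positivity) ?_
    rw [one_mul, mul_comm]
    gcongr
    exact hle k s
  have hc : ∀ k j, Continuous fun s => conj ((f k).fn s) * (f j).fn s / (r s : ℂ) := by
    intro k j
    refine continuous_div_of_le (bd := fun s => ‖(f j).fn s‖) ?_ hr
      (map_continuous (f j).fn).norm (fun s => by simpa using hb k j s) fun s hs => ?_
    · exact (Complex.continuous_conj.comp (map_continuous (f k).fn)).mul (map_continuous (f j).fn)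
    · exact le_antisymm ((hle j s).trans hs.le) (norm_nonneg _)
  have hrz : ∀ s z, r (s * σ.ι z) = r s := by
    intro s z
    simp only [r, (f _).prop s z, norm_mul, RCLike.norm_conj, Circle.norm_coe, one_mul]
  let d : Fin n → Fin n → C₀(G, ℂ) := fun k j => descend σ
    (c0OfLe _ (hc k j) (f j).fn 1 (hb k j)) (fun s z => by
      simp only [c0OfLe_apply, hrz, (f k).prop s z, (f j).prop s z, map_mul, Complex.conj_conj]
      rw [show (z : ℂ) * conj ((f k).fn s) * (conj (z : ℂ) * (f j).fn s) =
        (conj (z : ℂ) * z) * (conj ((f k).fn s) * (f j).fn s) by ring, conj_mul_circle, one_mul])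
  refine ⟨d, fun i j => c0_ext_q σ fun s => ?_⟩
  have hsum : (∑ k, star (d k i) * d k j) (σ.q s) = ∑ k, star (d k i (σ.q s)) * d k j (σ.q s) := by
    have : ∀ t : Finset (Fin n), (∑ k ∈ t, star (d k i) * d k j) (σ.q s) =
        ∑ k ∈ t, star (d k i (σ.q s)) * d k j (σ.q s) := by
      intro t
      induction t using Finset.cons_induction with
      | empty => simp
      | cons a t ha ih => rw [Finset.sum_cons, Finset.sum_cons, ZeroAtInftyContinuousMap.add_apply, ih]; rfl
    exact this _
  rw [hsum, rinner₀_q]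
  simp only [d, descend_q, c0OfLe_apply, RCLike.star_def, map_div₀, map_mul, Complex.conj_conj,
    Complex.conj_ofReal]
  by_cases hs : r s = 0
  · have hj : (f j).fn s = 0 := norm_le_zero_iff.1 ((hle j s).trans hs.le)
    simp [hj]
  · have hs' : (r s : ℂ) ≠ 0 := by simpa using hs
    have h2 : (∑ k, (f k).fn s * conj ((f k).fn s)) = (r s : ℂ) * r s := by
      have : r s * r s = ∑ k, ‖(f k).fn s‖ ^ 2 :=
        Real.mul_self_sqrt (Finset.sum_nonneg fun i _ => sq_nonneg _)
      rw [← Complex.ofReal_mul, this, Complex.ofReal_sum]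
      refine Finset.sum_congr rfl fun k _ => ?_
      rw [Complex.mul_conj, Complex.normSq_eq_norm_sq]
    calc _ = (∑ k, (f k).fn s * conj ((f k).fn s)) * (conj ((f i).fn s) * (f j).fn s) /
          ((r s : ℂ) * r s) := by
          rw [Finset.sum_mul, Finset.sum_div]
          refine Finset.sum_congr rfl fun k _ => ?_
          field_simp
      _ = _ := by rw [h2]; field_simp

lemma WeakAlg.preIp_pos (v : PreE σ B) : ∃ c, W.preIp σ v v = star c * c := by
  let _ : PartialOrder B := CStarAlgebra.spectralOrder B
  have _ : StarOrderedRing B := CStarAlgebra.spectralOrderedRing B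
  refine CStarAlgebra.nonneg_iff_eq_star_mul_self.1 ?_
  obtain ⟨n, f, b, rfl⟩ : ∃ (n : ℕ) (f : Fin n → C0bar σ) (b : Fin n → B),
      v = ∑ i, f i ⊗ₜ[ℂ] b i := by
    obtain ⟨n, f, b, h⟩ := TensorProduct.exists_sum_tmul_eq v
    exact ⟨n, f, b, h⟩
  obtain ⟨d, hd⟩ := exists_sqrt_matrix σ f
  have : W.preIp σ (∑ i, f i ⊗ₜ[ℂ] b i) (∑ i, f i ⊗ₜ[ℂ] b i) =
      ∑ k, star (∑ i, W.mb (d k i) (b i)) * (∑ i, W.mb (d k i) (b i)) := by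
    calc _ = ∑ i, ∑ j, ∑ k, star (W.mb (d k i) (b i)) * W.mb (d k j) (b j) := by
          simp only [map_sum, LinearMap.sum_apply, W.preIp_tmul, ← hd, Finset.mul_sum, W.mb_star,
            W.mb_mb]
          rw [Finset.sum_comm]
      _ = _ := by
          simp only [star_sum, Finset.sum_mul, Finset.mul_sum]
          rw [Finset.sum_comm' (t' := Finset.univ) (s' := fun _ => Finset.univ) (by simp)]
          rw [Finset.sum_congr rfl fun y _ => Finset.sum_comm, Finset.sum_comm]
  rw [this]
  exact Finset.sum_nonneg fun k _ => star_mul_self_nonneg _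

lemma pre_ind₂ {p : PreE σ B → PreE σ B → Prop} (h0 : ∀ w, p 0 w) (h0' : ∀ v, p v 0)
    (ha : ∀ v v' w, p v w → p v' w → p (v + v') w) (ha' : ∀ v w w', p v w → p v w' → p v (w + w'))
    (h : ∀ f b g b', p (f ⊗ₜ b) (g ⊗ₜ b')) (v w : PreE σ B) : p v w := by
  induction v using TensorProduct.induction_on with
  | zero => exact h0 w
  | add v v' hv hv' => exact ha _ _ _ hv hv'
  | tmul f b =>
    induction w using TensorProduct.induction_on with
    | zero => exact h0' _
    | add v v' hv hv' => exact ha' _ _ _ hv hv'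
    | tmul g b' => exact h f b g b'

/-- The semi-inner product module underlying `𝓔_σ(B)`. -/
def WeakAlg.preE : PreIP B (PreE σ B) where
  ip := W.preIp σ
  rs := (LinearMap.lTensorHom (C0bar σ)).comp (LinearMap.mul ℂ B).flip |>.flip
  ip_star := pre_ind₂ σ (by simp) (by simp) (fun v v' w h h' => by simp [h, h'])
    (fun v v' w h h' => by simp [h, h']) (fun f b g b' => by
      rw [W.preIp_tmul, W.preIp_tmul, star_mul, star_star, W.mb_star, rinner₀_star])
  ip_pos := W.preIp_pos σ
  ip_rs x y b := by
    revert x y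
    refine pre_ind₂ σ (by simp) (by simp) (fun v v' w h h' => ?_)
      (fun v v' w h h' => ?_) (fun f b g b' => ?_)
    · simp only [map_add, LinearMap.add_apply, h, h', add_mul]
    · simp only [map_add, LinearMap.add_apply, h, h', add_mul]
    · simp [W.mb_mul, mul_assoc]

/-- The Hilbert `B`-module `𝓔_σ(B) = C₀(Γ, ῑ) ⊗_{C₀(G)} B`. -/
abbrev WeakAlg.E : Type _ := (W.preE σ).Hilb

/-- The vector `f ⊗ b ∈ 𝓔_σ(B)`. -/
def WeakAlg.tens (f : C0bar σ) (b : B) : W.E σ := (W.preE σ).emb (f ⊗ₜ[ℂ] b)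

end WeakAlgs

section Operators

namespace PreIP

variable {B : Type*} [NonUnitalCStarAlgebra B] {V : Type*} [AddCommGroup V] [Module ℂ V]
  (P : PreIP B V)

/-- The extension of a bounded operator on `V` to the completion. -/
def lift (T : V →ₗ[ℂ] V) : P.Hilb →L[ℂ] P.Hilb := (P.emb ∘ₗ T).extendOfNorm P.emb

/-- Boundedness of an operator with respect to the seminorm of `V`. -/
def Bdd (T : V →ₗ[ℂ] V) : Prop := ∃ C : ℝ, 0 ≤ C ∧ ∀ v, ‖P.ip (T v) (T v)‖ ≤ C ^ 2 * ‖P.ip v v‖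

lemma lift_emb {T : V →ₗ[ℂ] V} (hT : P.Bdd T) (v : V) : P.lift T (P.emb v) = P.emb (T v) := by
  obtain ⟨C, hC, h⟩ := hT
  refine LinearMap.extendOfNorm_eq (f := P.emb ∘ₗ T) P.emb_dense ⟨C, fun v => ?_⟩ v
  rw [LinearMap.comp_apply, emb_norm, emb_norm, ← Real.sqrt_sq hC,
    ← Real.sqrt_mul (sq_nonneg C)]
  exact Real.sqrt_le_sqrt (h v)

lemma emb_ext {F : Type*} [NormedAddCommGroup F] [NormedSpace ℂ F] {S T : P.Hilb →L[ℂ] F}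
    (h : ∀ v, S (P.emb v) = T (P.emb v)) : S = T := by
  ext x
  exact P.emb_ind (p := fun x => S x = T x) x (isClosed_eq S.continuous T.continuous) h

end PreIP

variable {G Γ : Type u} [Group G] [TopologicalSpace G] [IsTopologicalGroup G]
  [Group Γ] [TopologicalSpace Γ] [IsTopologicalGroup Γ] {B : Type v} [NonUnitalCStarAlgebra B]
  (W : WeakAlg G B) (σ : Twist G Γ)

lemma preE_ext {F : Type*} [NormedAddCommGroup F] [NormedSpace ℂ F] {S T : W.E σ →L[ℂ] F}
    (h : ∀ f b, S (W.tens σ f b) = T (W.tens σ f b)) : S = T := by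
  refine (W.preE σ).emb_ext fun v => ?_
  induction v using TensorProduct.induction_on with
  | zero => simp
  | add v v' hv hv' => simp [hv, hv']
  | tmul f b => exact h f b

lemma ip_tens (f g : C0bar σ) (b b' : B) :
    HilbMod.ip (W.tens σ f b) (W.tens σ g b') = star b * W.mb (rinner₀ σ f g) b' :=
  (W.preE σ).ip_emb _ _

lemma rs_tens (f : C0bar σ) (b b' : B) :
    HilbMod.rs (W.tens σ f b) b' = W.tens σ f (b * b') :=
  (W.preE σ).rs_emb _ _

lemma dense_tens : Dense (Submodule.span ℂ {x : W.E σ | ∃ f b, x = W.tens σ f b} :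
    Set (W.E σ)) := by
  refine (W.preE σ).emb_dense.mono ?_
  rintro _ ⟨v, rfl⟩
  induction v using TensorProduct.induction_on with
  | zero => rw [map_zero]; exact zero_mem _
  | add v v' hv hv' => rw [map_add]; exact add_mem hv hv'
  | tmul f b => exact Submodule.subset_span ⟨f, b, rfl⟩

/-- `f ⊗ b` as a bilinear map. -/
def WeakAlg.tensL : C0bar σ →ₗ[ℂ] B →ₗ[ℂ] W.E σ :=
  (TensorProduct.mk ℂ (C0bar σ) B).compr₂ (W.preE σ).emb

lemma WeakAlg.tensL_apply (f : C0bar σ) (b : B) : W.tensL σ f b = W.tens σ f b := rfl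

lemma norm_tens (f : C0bar σ) (b : B) :
    ‖W.tens σ f b‖ ≤ √‖(W.φ (rinner₀ σ f f)).fst‖ * ‖b‖ := by
  rw [← Real.sqrt_sq (norm_nonneg b), ← Real.sqrt_mul (norm_nonneg _)]
  refine Real.le_sqrt_of_sq_le ?_
  rw [← HilbMod.ip_norm, ip_tens]
  calc _ ≤ ‖star b‖ * (‖(W.φ (rinner₀ σ f f)).fst‖ * ‖b‖) :=
        (norm_mul_le _ _).trans (by gcongr; exact ContinuousLinearMap.le_opNorm _ _)
    _ = _ := by rw [norm_star]; ring

/-! #### Left multiplication by functions -/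

/-- Multiplication by `c` on the algebraic tensor product. -/
def preMul (c : BoundedContinuousFunction G ℂ) : PreE σ B →ₗ[ℂ] PreE σ B :=
  TensorProduct.map (actC σ c) LinearMap.id

lemma preMul_ip (c : BoundedContinuousFunction G ℂ) (v w : PreE σ B) :
    W.preIp σ (preMul σ c v) w = W.preIp σ v (preMul σ (star c) w) := by
  revert v w
  refine pre_ind₂ σ (by simp) (by simp) (fun v v' w h h' => ?_)
      (fun v v' w h h' => ?_) (fun f b g b' => ?_)
  · simp only [map_add, LinearMap.add_apply, h, h']
  · simp only [map_add, h, h']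
  · simp only [preMul, TensorProduct.map_tmul, LinearMap.id_apply, W.preIp_tmul]
    congr 3
    exact c0_ext_q σ fun s => by simp; ring

lemma preMul_bdd (c : BoundedContinuousFunction G ℂ) : (W.preE σ).Bdd (preMul σ c) := by
  refine ⟨‖c‖, norm_nonneg _, fun v => ?_⟩
  let _ : PartialOrder B := CStarAlgebra.spectralOrder B
  have _ : StarOrderedRing B := CStarAlgebra.spectralOrderedRing B
  have hnn : ∀ g : G, 0 ≤ ‖c‖ ^ 2 - ‖c g‖ ^ 2 := fun g => by
    have := c.norm_coe_le_norm g
    nlinarith [norm_nonneg (c g), norm_nonneg c]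
  let d : BoundedContinuousFunction G ℂ := BoundedContinuousFunction.ofNormedAddCommGroup
    (fun g => ((√(‖c‖ ^ 2 - ‖c g‖ ^ 2) : ℝ) : ℂ)) (by
      have := c.continuous
      fun_prop) ‖c‖ (fun g => by
      rw [Complex.norm_real, Real.norm_of_nonneg (Real.sqrt_nonneg _)]
      refine Real.sqrt_le_iff.2 ⟨norm_nonneg _, ?_⟩
      nlinarith [sq_nonneg ‖c g‖])
  have hsum : (W.preE σ).ip (preMul σ c v) (preMul σ c v) +
      (W.preE σ).ip (preMul σ d v) (preMul σ d v) = (‖c‖ ^ 2) • (W.preE σ).ip v v := by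
    have h1 : ∀ c : BoundedContinuousFunction G ℂ, (W.preE σ).ip (preMul σ c v) (preMul σ c v) =
      (W.preE σ).ip v (preMul σ (star c) (preMul σ c v)) := fun c => preMul_ip W σ c v _
    rw [h1, h1, ← map_add]
    have h2 : preMul σ (star c) (preMul σ c v) + preMul σ (star d) (preMul σ d v) =
        ((‖c‖ ^ 2 : ℝ) : ℂ) • v := by
      clear h1
      induction v using TensorProduct.induction_on with
      | zero => simp
      | add v v' hv hv' =>
        rw [smul_add, ← hv, ← hv']
        simp only [map_add]; abel
      | tmul f b =>
        simp only [preMul, TensorProduct.map_tmul, LinearMap.id_apply]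
        rw [← TensorProduct.add_tmul, TensorProduct.smul_tmul']
        congr 1
        ext s
        have h3 : ((√(‖c‖ ^ 2 - ‖c (σ.q s)‖ ^ 2) : ℝ) : ℂ) * ((√(‖c‖ ^ 2 - ‖c (σ.q s)‖ ^ 2) : ℝ) : ℂ)
            = ((‖c‖ ^ 2 - ‖c (σ.q s)‖ ^ 2 : ℝ) : ℂ) := by
          rw [← Complex.ofReal_mul, Real.mul_self_sqrt (hnn _)]
        have h4 : conj (c (σ.q s)) * c (σ.q s) = ((‖c (σ.q s)‖ ^ 2 : ℝ) : ℂ) := by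
          rw [mul_comm, Complex.mul_conj, Complex.normSq_eq_norm_sq]
        have hd : d (σ.q s) = ((√(‖c‖ ^ 2 - ‖c (σ.q s)‖ ^ 2) : ℝ) : ℂ) := rfl
        simp only [C0bar.fn_add, ZeroAtInftyContinuousMap.add_apply, actC_apply,
          BoundedContinuousFunction.star_apply, RCLike.star_def, hd, Complex.conj_ofReal,
          C0bar.fn_smul, ZeroAtInftyContinuousMap.smul_apply, smul_eq_mul]
        push_cast at h3 h4 ⊢
        linear_combination f.fn s * h3 + f.fn s * h4
    rw [h2, map_smul, Complex.coe_smul]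
  obtain ⟨x, hx⟩ := (W.preE σ).ip_pos (preMul σ d v)
  obtain ⟨y, hy⟩ := (W.preE σ).ip_pos (preMul σ c v)
  have hle : (W.preE σ).ip (preMul σ c v) (preMul σ c v) ≤ (‖c‖ ^ 2) • (W.preE σ).ip v v := by
    rw [← hsum, hx]
    exact le_add_of_nonneg_right (star_mul_self_nonneg x)
  refine (CStarAlgebra.norm_le_norm_of_nonneg_of_le ?_ hle).trans_eq ?_
  · rw [hy]; exact star_mul_self_nonneg y
  · rw [norm_smul, Real.norm_of_nonneg (sq_nonneg _)]

lemma lift_preMul_ip (c : BoundedContinuousFunction G ℂ) (x y : W.E σ) :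
    HilbMod.ip ((W.preE σ).lift (preMul σ c) x) y =
      HilbMod.ip x ((W.preE σ).lift (preMul σ (star c)) y) := by
  refine (W.preE σ).emb_ind (p := fun x => HilbMod.ip ((W.preE σ).lift (preMul σ c) x) y =
    HilbMod.ip x ((W.preE σ).lift (preMul σ (star c)) y)) x
    (isClosed_eq (by fun_prop) (by fun_prop)) fun x => ?_
  refine (W.preE σ).emb_ind (p := fun y => HilbMod.ip ((W.preE σ).lift (preMul σ c) _) y =
    HilbMod.ip _ ((W.preE σ).lift (preMul σ (star c)) y)) y
    (isClosed_eq (by fun_prop) (by fun_prop)) fun y => ?_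
  rw [(W.preE σ).lift_emb (preMul_bdd W σ c), (W.preE σ).lift_emb (preMul_bdd W σ (star c))]
  rw [(W.preE σ).ip_emb, (W.preE σ).ip_emb]
  exact preMul_ip W σ c x y

/-- Left multiplication by a bounded continuous function as an adjointable operator. -/
def WeakAlg.mulOp (c : BoundedContinuousFunction G ℂ) : Adj (W.E σ) :=
  ⟨(W.preE σ).lift (preMul σ c), (W.preE σ).lift (preMul σ (star c)), lift_preMul_ip W σ c⟩

lemma mulOp_star (c : BoundedContinuousFunction G ℂ) :
    star (W.mulOp σ c) = W.mulOp σ (star c) :=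
  Adj.star_eq (lift_preMul_ip W σ c)

lemma mulOp_tens (c : BoundedContinuousFunction G ℂ) (f : C0bar σ) (b : B) :
    (W.mulOp σ c).1 (W.tens σ f b) = W.tens σ (actC σ c f) b :=
  (W.preE σ).lift_emb (preMul_bdd W σ c) _

/-! #### The action `γ = rt^σ ⊗ β` -/

/-- `γ_s` on the algebraic tensor product. -/
def preγ (s : Γ) : PreE σ B →ₗ[ℂ] PreE σ B :=
  TensorProduct.map (rtσ σ s) ((W.β (σ.q s)) : B →ₗ[ℂ] B)

lemma preγ_ip (s : Γ) (v w : PreE σ B) :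
    W.preIp σ (preγ W σ s v) (preγ W σ s w) = W.β (σ.q s) (W.preIp σ v w) := by
  revert v w
  refine pre_ind₂ σ (by simp) (by simp) (fun v v' w h h' => ?_)
      (fun v v' w h h' => ?_) (fun f b g b' => ?_)
  · simp only [map_add, LinearMap.add_apply, h, h']
  · simp only [map_add, h, h']
  · simp only [preγ, TensorProduct.map_tmul, W.preIp_tmul]
    change star (W.β (σ.q s) b) * W.mb _ (W.β (σ.q s) b') = _
    rw [map_mul, map_star]
    congr 1
    have := W.equivariant (σ.q s) (rinner₀ σ f g) b'
    refine Eq.trans ?_ this.symm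
    have h : rinner₀ σ (rtσ σ s f) (rtσ σ s g) = rt (σ.q s) (rinner₀ σ f g) :=
      c0_ext_q σ fun t => by rw [rinner₀_q, rt_apply, ← map_mul, rinner₀_q]; simp
    rw [h]; rfl

lemma preγ_bdd (s : Γ) : (W.preE σ).Bdd (preγ W σ s) := by
  refine ⟨1, zero_le_one, fun v => ?_⟩
  have : (W.preE σ).ip (preγ W σ s v) (preγ W σ s v) = _ := preγ_ip W σ s v v
  rw [this, one_pow, one_mul]
  exact NonUnitalStarAlgHom.norm_apply_le _ _

/-- The action `γ = rt^σ ⊗ β` of `Γ` on `𝓔_σ(B)`. -/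
def WeakAlg.γ (s : Γ) : W.E σ →L[ℂ] W.E σ := (W.preE σ).lift (preγ W σ s)

lemma γ_tens (s : Γ) (f : C0bar σ) (b : B) :
    W.γ σ s (W.tens σ f b) = W.tens σ (rtσ σ s f) (W.β (σ.q s) b) :=
  (W.preE σ).lift_emb (preγ_bdd W σ s) _

lemma γ_ip (s : Γ) (x y : W.E σ) :
    HilbMod.ip (W.γ σ s x) (W.γ σ s y) = W.β (σ.q s) (HilbMod.ip x y) := by
  have hc : Continuous (W.β (σ.q s)) := by
    refine AddMonoidHomClass.continuous_of_bound (W.β (σ.q s)) 1 fun b => ?_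
    rw [one_mul]; exact NonUnitalStarAlgHom.norm_apply_le _ _
  refine (W.preE σ).emb_ind (p := fun x => HilbMod.ip (W.γ σ s x) (W.γ σ s y) =
    W.β (σ.q s) (HilbMod.ip x y)) x (isClosed_eq (by fun_prop) (by fun_prop)) fun x => ?_
  refine (W.preE σ).emb_ind (p := fun y => HilbMod.ip (W.γ σ s _) (W.γ σ s y) =
    W.β (σ.q s) (HilbMod.ip _ y)) y (isClosed_eq (by fun_prop) (by fun_prop)) fun y => ?_
  rw [WeakAlg.γ, (W.preE σ).lift_emb (preγ_bdd W σ s), (W.preE σ).lift_emb (preγ_bdd W σ s)]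
  rw [(W.preE σ).ip_emb, (W.preE σ).ip_emb]
  exact preγ_ip W σ s x y

lemma γ_mul (s t : Γ) : W.γ σ s * W.γ σ t = W.γ σ (s * t) :=
  preE_ext W σ fun f b => by
    simp only [mul_apply_eq_comp, γ_tens]
    congr 1
    · ext r; simp [mul_assoc]
    · simp

lemma γ_one : W.γ σ 1 = 1 :=
  preE_ext W σ fun f b => by
    simp only [γ_tens]
    change _ = W.tens σ f b
    congr 1
    · ext r; simp
    · simp

lemma γ_inv (s : Γ) (x : W.E σ) : W.γ σ s (W.γ σ s⁻¹ x) = x := by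
  have := DFunLike.congr_fun (γ_mul W σ s s⁻¹) x
  rwa [mul_inv_cancel, γ_one] at this

end Operators

/-! ### The deformed algebra `B^σ = K(𝓔_σ(B))` -/

section Deformed

variable {G Γ : Type u} [Group G] [TopologicalSpace G] [IsTopologicalGroup G]
  [Group Γ] [TopologicalSpace Γ] [IsTopologicalGroup Γ] {B : Type v} [NonUnitalCStarAlgebra B]
  (W : WeakAlg G B) (σ : Twist G Γ)

open HilbMod

/-- The deformed algebra `B^σ = K(𝓔_σ(B))`. -/
abbrev WeakAlg.Bσ : Type _ := Comp (W.E σ)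

lemma γ_rs (s : Γ) (x : W.E σ) (b : B) :
    W.γ σ s (rs x b) = rs (W.γ σ s x) (W.β (σ.q s) b) := by
  refine ip_ext fun z => ?_
  rw [← γ_inv W σ s z, γ_ip, ip_rs, ip_rs, γ_ip, map_mul]

/-- `Ad γ_s` on adjointable operators. -/
def WeakAlg.adγ (s : Γ) (T : Adj (W.E σ)) : Adj (W.E σ) :=
  conjAdj (W.γ σ s) (W.γ σ s⁻¹) (W.β (σ.q s)) (γ_ip W σ s) (γ_inv W σ s) T

lemma adγ_theta (s : Γ) (x y : W.E σ) :
    W.adγ σ s (theta x y) = theta (W.γ σ s x) (W.γ σ s y) := by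
  ext z
  change W.γ σ s (rs x (ip y (W.γ σ s⁻¹ z))) = rs (W.γ σ s x) (ip (W.γ σ s y) z)
  rw [γ_rs, ← γ_ip, γ_inv]

lemma adγ_mem (s : Γ) {k : Adj (W.E σ)} (hk : k ∈ (finiteRank (W.E σ)).topologicalClosure) :
    W.adγ σ s k ∈ (finiteRank (W.E σ)).topologicalClosure := by
  have hcont : Continuous (W.adγ σ s) :=
    Continuous.subtype_mk ((continuous_const.mul continuous_subtype_val).mul continuous_const) _
  refine map_mem_closure hcont hk fun k hk => ?_
  induction hk using Submodule.span_induction with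
  | zero =>
    have : W.adγ σ s 0 = 0 := by
      ext z; change W.γ σ s 0 = 0; exact map_zero _
    rw [this]; exact zero_mem _
  | add x y _ _ hx hy =>
    have : W.adγ σ s (x + y) = W.adγ σ s x + W.adγ σ s y := by
      ext z; exact map_add (W.γ σ s) _ _
    rw [this]; exact add_mem hx hy
  | smul c x _ hx =>
    have : W.adγ σ s (c • x) = c • W.adγ σ s x := by
      ext z; exact map_smul (W.γ σ s) c _
    rw [this]; exact Submodule.smul_mem _ _ hx
  | mem x hx =>
    obtain ⟨x, y, rfl⟩ := hx
    exact Submodule.subset_span ⟨_, _, adγ_theta W σ s x y⟩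

/-- The deformed action `β^σ = Ad γ` (inflated to `Γ`). -/
def WeakAlg.βσ (s : Γ) (k : W.Bσ σ) : W.Bσ σ := ⟨W.adγ σ s k.val, adγ_mem W σ s k.val_mem⟩

lemma βσ_val (s : Γ) (k : W.Bσ σ) : (W.βσ σ s k).val = W.adγ σ s k.val := rfl

/-- The operator of left multiplication by `c ∈ C₀(G)` on `𝓔_σ(B)`. -/
def WeakAlg.mul₀ (c : C₀(G, ℂ)) : Adj (W.E σ) := W.mulOp σ c.toBCF

lemma mul₀_tens (c : C₀(G, ℂ)) (f : C0bar σ) (b : B) :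
    (W.mul₀ σ c).1 (W.tens σ f b) = W.tens σ (actC σ c.toBCF f) b := mulOp_tens W σ _ f b

lemma adj_ext_tens {S T : Adj (W.E σ)}
    (h : ∀ f b, S.1 (W.tens σ f b) = T.1 (W.tens σ f b)) : S = T :=
  Subtype.ext (preE_ext W σ h)

lemma mul₀_star (c : C₀(G, ℂ)) : star (W.mul₀ σ c) = W.mul₀ σ (star c) :=
  mulOp_star W σ c.toBCF

lemma mul₀_add (c d : C₀(G, ℂ)) : W.mul₀ σ (c + d) = W.mul₀ σ c + W.mul₀ σ d :=
  adj_ext_tens W σ fun f b => by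
    change _ = (W.mul₀ σ c).1 _ + (W.mul₀ σ d).1 _
    rw [mul₀_tens, mul₀_tens, mul₀_tens, ← W.tensL_apply, ← W.tensL_apply, ← W.tensL_apply,
      ← LinearMap.add_apply, ← map_add]
    congr 2
    ext s; simp [add_mul]

lemma mul₀_smul (k : ℂ) (c : C₀(G, ℂ)) : W.mul₀ σ (k • c) = k • W.mul₀ σ c :=
  adj_ext_tens W σ fun f b => by
    change _ = k • (W.mul₀ σ c).1 _
    rw [mul₀_tens, mul₀_tens, ← W.tensL_apply, ← W.tensL_apply,
      ← LinearMap.smul_apply, ← map_smul]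
    congr 2
    ext s; simp [mul_assoc]

lemma mul₀_mul (c d : C₀(G, ℂ)) : W.mul₀ σ (c * d) = W.mul₀ σ c * W.mul₀ σ d :=
  adj_ext_tens W σ fun f b => by
    change _ = (W.mul₀ σ c).1 ((W.mul₀ σ d).1 _)
    rw [mul₀_tens, mul₀_tens, mul₀_tens]
    congr 1
    ext s; simp [mul_assoc]

lemma γ_mul₀ (s : Γ) (c : C₀(G, ℂ)) :
    W.γ σ s * (W.mul₀ σ c).1 = (W.mul₀ σ (rt (σ.q s) c)).1 * W.γ σ s :=
  preE_ext W σ fun f b => by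
    change W.γ σ s ((W.mul₀ σ c).1 _) = (W.mul₀ σ _).1 (W.γ σ s _)
    rw [mul₀_tens, γ_tens, γ_tens, mul₀_tens]
    congr 1
    ext t; simp

/-- Every `f ∈ C₀(Γ, ῑ)` is of the form `c f'` with `c ∈ C₀(G)`, `f' ∈ C₀(Γ, ῑ)`. -/
lemma exists_factor (f : C0bar σ) : ∃ (c : C₀(G, ℂ)) (f' : C0bar σ), f = actC σ c.toBCF f' := by
  let r : Γ → ℝ := fun s => √‖f.fn s‖
  have hr : Continuous r := Real.continuous_sqrt.comp (map_continuous f.fn).norm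
  have hrz : ∀ s z, r (s * σ.ι z) = r s := fun s z => by
    simp only [r, f.prop, norm_mul, RCLike.norm_conj, Circle.norm_coe, one_mul]
  have hlim : Tendsto r (cocompact Γ) (𝓝 0) := by
    have := (Real.continuous_sqrt.tendsto _).comp (zero_at_infty f.fn).norm
    rwa [norm_zero, Real.sqrt_zero] at this
  have hdiv : ∀ s, ‖f.fn s / (r s : ℂ)‖ = r s := fun s => by
    rw [norm_div, Complex.norm_real, Real.norm_of_nonneg (Real.sqrt_nonneg _)]
    exact Real.div_sqrt
  have hcd : Continuous fun s => f.fn s / (r s : ℂ) :=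
    continuous_div_of_le (map_continuous f.fn) hr hr (fun s => (hdiv s).le) (fun s h => h)
  let a : C₀(Γ, ℂ) := ⟨⟨fun s => (r s : ℂ), Complex.continuous_ofReal.comp hr⟩, by
    have := (Complex.continuous_ofReal.tendsto _).comp hlim
    rwa [Complex.ofReal_zero] at this⟩
  let g : C₀(Γ, ℂ) := ⟨⟨fun s => f.fn s / (r s : ℂ), hcd⟩,
    squeeze_zero_norm (fun s => (hdiv s).le) hlim⟩
  have hg : ∀ s, g s = f.fn s / (r s : ℂ) := fun s => rfl
  have ha : ∀ s, a s = r s := fun s => rfl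
  have hinv : ∀ s z, a (s * σ.ι z) = a s := fun s z => by rw [ha, ha, hrz]
  refine ⟨descend σ a hinv, C0bar.mk g (fun s z => by
    rw [hg, hg, hrz, f.prop, mul_div_assoc]), ?_⟩
  ext s
  rw [actC_apply, C0bar.fn_mk, hg]
  refine Eq.trans ?_ (congrArg (· * (f.fn s / (r s : ℂ))) (descend_q σ a hinv s).symm)
  rw [ha]
  by_cases hs : r s = 0
  · have : f.fn s = 0 := by
      have : ‖f.fn s‖ = 0 := by
        simpa [r, Real.sqrt_eq_zero (norm_nonneg _)] using hs
      exact norm_eq_zero.1 this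
    simp [this]
  · have : (r s : ℂ) ≠ 0 := by simpa using hs
    field_simp

lemma norm_theta (x y : W.E σ) : ‖theta x y‖ ≤ ‖rs (B := B) (E := W.E σ)‖ * ‖y‖ * ‖x‖ := by
  refine ContinuousLinearMap.opNorm_le_bound _ (by positivity) fun z => ?_
  calc ‖rs x (ip y z)‖ ≤ ‖rs (B := B) (E := W.E σ)‖ * ‖x‖ * ‖ip y z‖ :=
        ContinuousLinearMap.le_opNorm₂ _ _ _
    _ ≤ ‖rs (B := B) (E := W.E σ)‖ * ‖x‖ * (‖y‖ * ‖z‖) := by gcongr; exact ip_le _ _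
    _ = _ := by ring

/-- `θ_{x, y}` as a function of `x`. -/
def cthetaL (y : W.E σ) : W.E σ →L[ℂ] W.Bσ σ :=
  LinearMap.mkContinuous
    { toFun := fun x => ctheta x y
      map_add' := fun x x' => Comp.ext (by
        ext z; change rs (x + x') _ = rs x _ + rs x' _; rw [map_add]; rfl)
      map_smul' := fun k x => Comp.ext (by
        ext z; change rs (k • x) _ = k • rs x _; rw [map_smul]; rfl) }
    (‖rs (B := B) (E := W.E σ)‖ * ‖y‖) (fun x => norm_theta W σ x y)

/-- Left multiplication of compact operators by an adjointable operator. -/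
def leftMulL (T : Adj (W.E σ)) : W.Bσ σ →L[ℂ] W.Bσ σ :=
  LinearMap.mkContinuous
    { toFun := fun k => T.mulComp k
      map_add' := fun k l => Comp.ext (mul_add T k.val l.val)
      map_smul' := fun t k => Comp.ext (mul_smul_comm t T k.val) }
    ‖T‖ (fun k => norm_mul_le T k.val)

lemma leftMulL_val (T : Adj (W.E σ)) (k : W.Bσ σ) : (leftMulL W σ T k).val = T * k.val := rfl

lemma mul₀_zero : W.mul₀ σ 0 = 0 := by
  have := mul₀_smul W σ 0 0
  rwa [zero_smul, zero_smul] at this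

/-- The left multiplication `φ^σ : C₀(G) → M(B^σ)`. -/
def WeakAlg.φσ : C₀(G, ℂ) →ₙₐ[ℂ] (W.Bσ σ →L[ℂ] W.Bσ σ) where
  toFun c := leftMulL W σ (W.mul₀ σ c)
  map_smul' t c := ContinuousLinearMap.ext fun k => Comp.ext (by
    rw [leftMulL_val, mul₀_smul, smul_mul_assoc]; rfl)
  map_zero' := ContinuousLinearMap.ext fun k => Comp.ext (by
    rw [leftMulL_val, mul₀_zero, zero_mul]; rfl)
  map_add' c d := ContinuousLinearMap.ext fun k => Comp.ext (by
    rw [leftMulL_val, mul₀_add, add_mul]; rfl)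
  map_mul' c d := ContinuousLinearMap.ext fun k => Comp.ext (by
    rw [leftMulL_val, mul₀_mul, mul_assoc]; rfl)

lemma φσ_val (c : C₀(G, ℂ)) (k : W.Bσ σ) : (W.φσ σ c k).val = W.mul₀ σ c * k.val := rfl

lemma φσ_nondeg : Dense (Submodule.span ℂ {b | ∃ c a, b = W.φσ σ c a} : Set (W.Bσ σ)) := by
  refine dense_of_le_closure dense_ctheta ?_
  rintro _ ⟨x, y, rfl⟩
  change cthetaL W σ y x ∈ _
  refine (dense_tens W σ).induction (P := fun x => cthetaL W σ y x ∈
    (Submodule.span ℂ {b | ∃ c a, b = W.φσ σ c a}).topologicalClosure) ?_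
    ((Submodule.isClosed_topologicalClosure _).preimage (cthetaL W σ y).continuous) x
  intro x hx
  induction hx using Submodule.span_induction with
  | zero => rw [map_zero]; exact zero_mem _
  | add x y _ _ hx hy => rw [map_add]; exact add_mem hx hy
  | smul k x _ hx => rw [map_smul]; exact Submodule.smul_mem _ _ hx
  | mem x hx =>
    obtain ⟨f, b, rfl⟩ := hx
    obtain ⟨c, f', hf⟩ := exists_factor σ f
    refine Submodule.le_topologicalClosure _
      (Submodule.subset_span ⟨c, ctheta (W.tens σ f' b) y, Comp.ext ?_⟩)
    rw [φσ_val]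
    change theta (W.tens σ f b) y = W.mul₀ σ c * theta (W.tens σ f' b) y
    rw [mul_theta, mul₀_tens, ← hf]

lemma φσ_equivariant (s : Γ) (c : C₀(G, ℂ)) (k : W.Bσ σ) :
    W.βσ σ s (W.φσ σ c k) = W.φσ σ (rt (σ.q s) c) (W.βσ σ s k) := by
  refine Comp.ext (Subtype.ext ?_)
  change W.γ σ s * ((W.mul₀ σ c).1 * k.val.1) * W.γ σ s⁻¹ =
    (W.mul₀ σ (rt (σ.q s) c)).1 * (W.γ σ s * k.val.1 * W.γ σ s⁻¹)
  rw [← mul_assoc, γ_mul₀]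
  simp only [mul_assoc]

/-- The equivariant nondegenerate homomorphism `φ^σ : C₀(G) → M(B^σ)`. -/
def WeakAlg.c0Actionσ : C0Action σ (W.βσ σ) where
  m := W.φσ σ
  m_mul c a b := Comp.ext (by
    rw [φσ_val, Comp.val_mul, Comp.val_mul, φσ_val, mul_assoc])
  m_star c a b := Comp.ext (by
    rw [Comp.val_mul, Comp.val_mul, Comp.val_star, Comp.val_star, φσ_val, φσ_val, star_mul,
      mul₀_star, mul_assoc])
  nondeg := φσ_nondeg W σ
  equivariant := φσ_equivariant W σ

/-- The `B^σ`-`B` equivalence bimodule `(𝓔_σ(B), γ)`. -/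
def WeakAlg.bimod : BimodOps Γ (W.Bσ σ) B (W.E σ) where
  α := W.βσ σ
  β := W.infl σ
  γ := fun s => W.γ σ s
  lact k x := k.val.1 x
  ract x b := rs x b
  linner x y := ctheta x y
  rinner x y := ip x y

/-- The `C₀(G)`-`C₀(G)` equivalence bimodule `(C₀(Γ, ῑ), rt^σ)`. -/
def bimod₀ (σ : Twist G Γ) : BimodOps Γ C₀(G, ℂ) C₀(G, ℂ) (C0bar σ) where
  α := fun s => rt (σ.q s)
  β := fun s => rt (σ.q s)
  γ := fun s => rtσ σ s
  lact c f := actC σ c.toBCF f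
  ract f c := actC σ c.toBCF f
  linner := linner₀ σ
  rinner := rinner₀ σ

end Deformed

/-! ### The descent of `ψ : C₀(Γ, ῑ) → M(𝓔_σ(B))`, `ψ(f) b = f ⊗ b` -/

section Pull

variable {G Γ : Type u} [Group G] [TopologicalSpace G] [IsTopologicalGroup G]
  [Group Γ] [TopologicalSpace Γ] [IsTopologicalGroup Γ] {B : Type v} [NonUnitalCStarAlgebra B]
  {W : WeakAlg G B} {σ : Twist G Γ}
  {H H' : Type w} [NormedAddCommGroup H] [InnerProductSpace ℂ H] [CompleteSpace H]
  [NormedAddCommGroup H'] [InnerProductSpace ℂ H'] [CompleteSpace H']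

open HilbMod

lemma tens_balanced (c : C₀(G, ℂ)) (f : C0bar σ) (b : B) :
    W.tens σ (actC σ c.toBCF f) b = W.tens σ f (W.mb c b) := by
  refine ip_ext fun z => ?_
  rw [← ip_star, ← ip_star (W.tens σ f (W.mb c b))]
  congr 1
  refine DFunLike.congr_fun (preE_ext W σ (S := ip (W.tens σ (actC σ c.toBCF f) b))
    (T := ip (W.tens σ f (W.mb c b))) fun g b' => ?_) z
  rw [ip_tens, ip_tens, W.mb_star, W.mb_mb]
  congr 2
  refine congrArg W.mb (c0_ext_q σ fun s => ?_)
  simp only [rinner₀_q, actC_apply, ZeroAtInftyContinuousMap.mul_apply,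
    ZeroAtInftyContinuousMap.star_apply, map_mul, RCLike.star_def, mul_assoc]
  rfl

namespace BimodRep

variable (r : BimodRep σ (W.bimod σ) H H')

/-- The restriction to the left algebra `B^σ`. -/
def l : CovRep σ (W.βσ σ) 1 H := r.left

/-- The restriction to the right algebra `B`. -/
def r' : CovRep σ (W.infl σ) (MonoidHom.id Circle) H' := r.right

lemma e_rinner (x y : W.E σ) :
    r.r'.π (ip x y) = ContinuousLinearMap.adjoint (r.πX x) ∘L r.πX y := r.map_rinner x y

lemma e_ract (x : W.E σ) (b : B) : r.πX (rs x b) = r.πX x ∘L r.r'.π b := r.map_ract x b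

lemma e_lact (k : W.Bσ σ) (x : W.E σ) : r.πX (k.val.1 x) = r.l.π k ∘L r.πX x := r.map_lact k x

lemma e_linner (x y : W.E σ) :
    r.l.π (ctheta x y) = r.πX x ∘L ContinuousLinearMap.adjoint (r.πX y) := r.map_linner x y

lemma e_cov (s : Γ) (x : W.E σ) (ξ : H') : (r.l.U s : H →L[ℂ] H) (r.πX x ξ) =
    r.πX (W.γ σ s x) ((r.r'.U s : H' →L[ℂ] H') ξ) := r.covariant s x ξ

lemma norm_πX (x : W.E σ) : ‖r.πX x‖ ≤ ‖x‖ := by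
  refine le_of_sq_le_sq ?_ (norm_nonneg x)
  have h : ‖ContinuousLinearMap.adjoint (r.πX x) ∘L r.πX x‖ = ‖r.πX x‖ * ‖r.πX x‖ :=
    ContinuousLinearMap.norm_adjoint_comp_self _
  rw [sq, ← h, ← r.e_rinner, ← ip_norm]
  exact NonUnitalStarAlgHom.norm_apply_le _ _

/-- The map `f ↦ (b ↦ π_X(f ⊗ b))`. -/
def tX (f : C0bar σ) : B →ₗ[ℂ] (H' →L[ℂ] H) := r.πX ∘ₗ W.tensL σ f

/-- The representation `π̄_X ∘ ψ` of `C₀(Γ, ῑ)`, determined by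
`(π̄_X ∘ ψ)(f) π_B(b) = π_X(f ⊗ b)`. -/
def opX (f : C0bar σ) : H' →L[ℂ] H := extendND r.r'.π (r.tX f)

lemma opX_apply (f : C0bar σ) (b : B) (ξ : H') :
    r.opX f (r.r'.π b ξ) = r.πX (W.tens σ f b) ξ := by
  refine extendND_apply r.r'.nondeg (T := r.tX f) (√‖(W.φ (rinner₀ σ f f)).fst‖) (fun b => ?_)
    (fun a b ξ => ?_) b ξ
  · exact (r.norm_πX _).trans (norm_tens W σ f b)
  · change r.πX (W.tens σ f (a * b)) ξ = r.πX (W.tens σ f a) (r.r'.π b ξ)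
    rw [← rs_tens, r.e_ract]; rfl

lemma adj_opX (f g : C0bar σ) (b : B) (ξ : H') :
    ContinuousLinearMap.adjoint (r.opX f) (r.opX g (r.r'.π b ξ)) =
      r.r'.π (W.mb (rinner₀ σ f g) b) ξ := by
  refine r.r'.ext_inner fun b' ξ' => ?_
  have h : ∀ x y : B, inner ℂ (r.r'.π x ξ) (r.r'.π y ξ') =
      inner ℂ ξ (r.r'.π (star x * y) ξ') := by
    intro x y
    rw [map_mul, map_star, ContinuousLinearMap.star_eq_adjoint, mul_apply_eq_comp,
      ContinuousLinearMap.adjoint_inner_right]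
  rw [ContinuousLinearMap.adjoint_inner_left, opX_apply, opX_apply, h, W.mb_star, rinner₀_star,
    ← ip_tens, r.e_rinner, ContinuousLinearMap.comp_apply,
    ContinuousLinearMap.adjoint_inner_right]

lemma dense_πX : Dense (Submodule.span ℂ {η | ∃ f b ξ, η = r.πX (W.tens σ f b) ξ} : Set H) := by
  set D := Submodule.span ℂ {η | ∃ f b ξ, η = r.πX (W.tens σ f b) ξ}
  have h1 : ∀ (x : W.E σ) (ξ : H'), r.πX x ξ ∈ D.topologicalClosure := by
    intro x ξ
    have hc : Continuous fun x => r.πX x ξ :=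
      (ContinuousLinearMap.apply ℂ H ξ).continuous.comp
        (r.πX.mkContinuous 1 fun x => by rw [one_mul]; exact r.norm_πX x).continuous
    refine (dense_tens W σ).induction (P := fun x => r.πX x ξ ∈ D.topologicalClosure) ?_
      ((Submodule.isClosed_topologicalClosure _).preimage hc) x
    intro x hx
    induction hx using Submodule.span_induction with
    | zero => rw [map_zero]; exact zero_mem _
    | add x y _ _ hx hy => rw [map_add]; exact add_mem hx hy
    | smul k x _ hx => rw [map_smul]; exact Submodule.smul_mem _ _ hx
    | mem x hx =>
      obtain ⟨f, b, rfl⟩ := hx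
      exact Submodule.le_topologicalClosure _ (Submodule.subset_span ⟨f, b, ξ, rfl⟩)
  refine dense_of_le_closure r.l.nondeg ?_
  rintro _ ⟨k, η, rfl⟩
  have hc : Continuous fun k => r.l.π k η :=
    (ContinuousLinearMap.apply ℂ H η).continuous.comp
      ((repLin r.l.π).mkContinuous 1 fun x => by
        rw [one_mul]; exact NonUnitalStarAlgHom.norm_apply_le r.l.π x).continuous
  refine dense_ctheta.induction (P := fun k => r.l.π k η ∈ D.topologicalClosure) ?_
    ((Submodule.isClosed_topologicalClosure _).preimage hc) k
  intro x hx
  induction hx using Submodule.span_induction with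
  | zero => rw [map_zero]; exact zero_mem _
  | add x y _ _ hx hy => rw [map_add]; exact add_mem hx hy
  | smul k x _ hx => rw [map_smul]; exact Submodule.smul_mem _ _ hx
  | mem x hx =>
    obtain ⟨x, y, rfl⟩ := hx
    rw [r.e_linner]
    exact h1 _ _

lemma op_πX (c : C₀(G, ℂ)) (x : W.E σ) (ξ : H') :
    (W.c0Actionσ σ).op r.l c (r.πX x ξ) = r.πX ((W.mul₀ σ c).1 x) ξ := by
  refine r.l.ext_inner fun k η => ?_
  have h1 : (W.c0Actionσ σ).op r.l c =
      ContinuousLinearMap.adjoint ((W.c0Actionσ σ).op r.l (star c)) := by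
    have := map_star ((W.c0Actionσ σ).pull r.l).π (star c)
    rw [star_star] at this
    exact this
  have h2 : ∀ (k : W.Bσ σ) (x : W.E σ), inner ℂ (r.πX x ξ) (r.l.π k η) =
      inner ℂ (r.πX ((star k).val.1 x) ξ) η := by
    intro k x
    rw [r.e_lact, map_star, ContinuousLinearMap.star_eq_adjoint, ContinuousLinearMap.comp_apply,
      ContinuousLinearMap.adjoint_inner_left]
  rw [h1, ContinuousLinearMap.adjoint_inner_left, C0Action.op_apply, h2, h2]
  congr 3
  change (star (W.mul₀ σ (star c) * k.val)).1 x = (star k.val * W.mul₀ σ c).1 x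
  rw [star_mul, mul₀_star, star_star]

/-- The bimodule representation of `C₀(Γ, ῑ)` obtained from one of `𝓔_σ(B)` by composition with
`φ^σ`, `ψ` and `φ`. -/
def pull : BimodRep σ (bimod₀ σ) H H' where
  left := (W.c0Actionσ σ).pull r.l
  right := (W.c0Action σ).pull r.r'
  πX :=
    { toFun := r.opX
      map_add' := fun f g => r.r'.ext_clm fun b ξ => by
        rw [add_apply, opX_apply, opX_apply, opX_apply, ← W.tensL_apply,
          map_add, LinearMap.add_apply, map_add]
        rfl
      map_smul' := fun k f => r.r'.ext_clm fun b ξ => by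
        rw [smul_apply, opX_apply, opX_apply, ← W.tensL_apply,
          map_smul, LinearMap.smul_apply, map_smul]
        rfl }
  map_linner f g := by
    refine clm_ext_dense r.dense_πX ?_
    rintro _ ⟨g', b, ξ, rfl⟩
    change (W.c0Actionσ σ).op r.l (linner₀ σ f g) _ =
      r.opX f (ContinuousLinearMap.adjoint (r.opX g) (r.πX (W.tens σ g' b) ξ))
    rw [r.op_πX, mul₀_tens, ← r.opX_apply g', r.adj_opX, r.opX_apply, ← tens_balanced]
    congr 3
    ext s
    rw [actC_apply, actC_apply]
    change linner₀ σ f g (σ.q s) * _ = rinner₀ σ g g' (σ.q s) * _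
    rw [linner₀_q, rinner₀_q]; ring
  map_rinner f g := r.r'.ext_clm fun b ξ => by
    change (W.c0Action σ).op r.r' (rinner₀ σ f g) (r.r'.π b ξ) =
      ContinuousLinearMap.adjoint (r.opX f) (r.opX g (r.r'.π b ξ))
    rw [r.adj_opX, C0Action.op_apply]
    rfl
  map_lact c f := r.r'.ext_clm fun b ξ => by
    change r.opX (actC σ c.toBCF f) (r.r'.π b ξ) =
      (W.c0Actionσ σ).op r.l c (r.opX f (r.r'.π b ξ))
    rw [opX_apply, opX_apply, op_πX, mul₀_tens]
  map_ract f c := r.r'.ext_clm fun b ξ => by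
    change r.opX (actC σ c.toBCF f) (r.r'.π b ξ) =
      r.opX f ((W.c0Action σ).op r.r' c (r.r'.π b ξ))
    rw [opX_apply, C0Action.op_apply, tens_balanced, opX_apply]
    rfl
  covariant s f ξ := by
    refine DFunLike.congr_fun (?_ : (r.l.U s : H →L[ℂ] H) ∘L r.opX f =
      r.opX (rtσ σ s f) ∘L (r.r'.U s : H' →L[ℂ] H')) ξ
    refine r.r'.ext_clm fun b ξ => ?_
    rw [ContinuousLinearMap.comp_apply, ContinuousLinearMap.comp_apply, opX_apply, r.e_cov,
      r.r'.covariant, opX_apply, γ_tens]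
    rfl

end BimodRep

/-- The descent `ψ ⋊ G : M(C₀(Γ, ῑ) ⋊ G) → M(𝓔_σ(B) ⋊ G)`. -/
def psiDescent (W : WeakAlg G B) (σ : Twist G Γ) (S : BimodFam.Prod σ (bimod₀ σ)) :
    BimodFam.Prod σ (W.bimod σ) :=
  ⟨fun k => S ⟨k.H, k.H', k.rep.pull⟩, memℓp_infty ⟨‖S‖, by
    rintro _ ⟨k, rfl⟩
    exact lp.norm_apply_le_norm ENNReal.top_ne_zero S _⟩⟩

end Pull

/-! ### The regular representations -/

section Regular

open Measure

variable {Γ : Type u} [Group Γ] [TopologicalSpace Γ] [IsTopologicalGroup Γ]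
  [LocallyCompactSpace Γ] [MeasurableSpace Γ] [BorelSpace Γ] (μ : Measure Γ) [IsHaarMeasure μ]
  [Regular μ]

lemma map_mul_right_haar (s : Γ) : map (· * s) μ = modularCharacterFun s • μ := by
  rw [modularCharacterFun_eq_haarScalarFactor μ s]
  have : Regular (map (· * s) μ) := Regular.map (Homeomorph.mulRight s)
  exact isMulLeftInvariant_eq_smul_of_regular _ μ

lemma qmp_mul_right (s : Γ) : QuasiMeasurePreserving (· * s) μ μ :=
  ⟨measurable_mul_const s, by
    rw [map_mul_right_haar]
    exact smul_absolutelyContinuous⟩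

/-- `Δ(s)^{1/2}` for the modular function `Δ`, for which `Δ(s) ∫ f(t s) dt = ∫ f(t) dt`. -/
def sqrtModular (s : Γ) : ℝ := (√(modularCharacterFun s : ℝ))⁻¹

lemma sqrtModular_mul (s t : Γ) : sqrtModular (s * t) = sqrtModular s * sqrtModular t := by
  rw [sqrtModular, modularCharacterFun_map_mul, NNReal.coe_mul, Real.sqrt_mul (NNReal.coe_nonneg _),
    mul_inv]; rfl

lemma sqrtModular_one : sqrtModular (1 : Γ) = 1 := by
  simp [sqrtModular, modularCharacterFun_map_one]

lemma sqrtModular_pos (s : Γ) : 0 < sqrtModular s :=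
  inv_pos.2 (Real.sqrt_pos.2 (modularCharacterFun_pos s))

lemma memLp_transl (s : Γ) {ξ : Γ → ℂ} (hξ : MemLp ξ 2 μ) : MemLp (fun t => ξ (t * s)) 2 μ := by
  have h1 : MemLp ξ 2 (map (· * s) μ) := by
    rw [map_mul_right_haar]
    exact hξ.smul_measure (by simp)
  exact (memLp_map_measure_iff h1.1 (measurable_mul_const s).aemeasurable).1 h1

lemma eLpNorm_transl (s : Γ) {ξ : Γ → ℂ} (hξ : MemLp ξ 2 μ) :
    eLpNorm (fun t => ξ (t * s)) 2 μ = ENNReal.ofReal (sqrtModular s)⁻¹ * eLpNorm ξ 2 μ := by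
  have h1 : AEStronglyMeasurable ξ (map (· * s) μ) := by
    rw [map_mul_right_haar]
    exact hξ.1.smul_measure _
  have h2 := eLpNorm_map_measure (p := 2) h1 (measurable_mul_const s).aemeasurable
  rw [map_mul_right_haar] at h2
  refine h2.symm.trans ?_
  have h3 : (modularCharacterFun s • μ) = ((modularCharacterFun s : ℝ≥0∞) • μ) := rfl
  rw [h3, eLpNorm_smul_measure_of_ne_top (by simp), smul_eq_mul]
  congr 1
  rw [sqrtModular, inv_inv, Real.sqrt_eq_rpow, ← ENNReal.ofReal_rpow_of_nonneg (by simp) (by simp)]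
  simp

lemma memLp_rho (s : Γ) (ξ : Lp ℂ 2 μ) :
    MemLp (fun t => (sqrtModular s : ℂ) * ξ (t * s)) 2 μ :=
  (memLp_transl μ s (Lp.memLp ξ)).const_mul (sqrtModular s : ℂ)

/-- The right regular representation `(ρ_s ξ)(t) = Δ(s)^{1/2} ξ(t s)` on `L²(Γ)`. -/
def transl (s : Γ) : Lp ℂ 2 μ →ₗᵢ[ℂ] Lp ℂ 2 μ where
  toFun ξ := (memLp_rho μ s ξ).toLp
  map_add' ξ η := by
    refine Lp.ext ?_
    refine (MemLp.coeFn_toLp _).trans (.trans ?_ (Lp.coeFn_add _ _).symm)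
    filter_upwards [MemLp.coeFn_toLp (memLp_rho μ s ξ),
      MemLp.coeFn_toLp (memLp_rho μ s η),
      (qmp_mul_right μ s).ae (Lp.coeFn_add ξ η)] with t h1 h2 h3
    rw [Pi.add_apply, h1, h2, h3, Pi.add_apply, mul_add]
  map_smul' k ξ := by
    refine Lp.ext ?_
    refine (MemLp.coeFn_toLp _).trans (.trans ?_ (Lp.coeFn_smul _ _).symm)
    filter_upwards [MemLp.coeFn_toLp (memLp_rho μ s ξ),
      (qmp_mul_right μ s).ae (Lp.coeFn_smul k ξ)] with t h1 h3
    rw [Pi.smul_apply, RingHom.id_apply, h1, h3, Pi.smul_apply, smul_eq_mul, smul_eq_mul]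
    ring
  norm_map' ξ := by
    have h1 : eLpNorm (fun t => (sqrtModular s : ℂ) * ξ (t * s)) 2 μ = eLpNorm ξ 2 μ := by
      have := eLpNorm_const_smul (sqrtModular s : ℂ) (fun t => ξ (t * s)) 2 μ
      refine this.trans ?_
      rw [eLpNorm_transl μ s (Lp.memLp ξ), ← mul_assoc]
      have h2 : ‖(sqrtModular s : ℂ)‖ₑ = ENNReal.ofReal (sqrtModular s) := by
        rw [← ofReal_norm, Complex.norm_real, Real.norm_of_nonneg (sqrtModular_pos s).le]
      rw [h2, ← ENNReal.ofReal_mul (sqrtModular_pos s).le,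
        mul_inv_cancel₀ (sqrtModular_pos s).ne', ENNReal.ofReal_one, one_mul]
    change ‖(memLp_rho μ s ξ).toLp‖ = _
    rw [Lp.norm_toLp, h1, Lp.norm_def]

lemma transl_coe (s : Γ) (ξ : Lp ℂ 2 μ) :
    transl μ s ξ =ᵐ[μ] fun t => (sqrtModular s : ℂ) * ξ (t * s) :=
  MemLp.coeFn_toLp (memLp_rho μ s ξ)

lemma transl_transl (s t : Γ) (ξ : Lp ℂ 2 μ) :
    transl μ s (transl μ t ξ) = transl μ (s * t) ξ := by
  refine Lp.ext ?_
  filter_upwards [transl_coe μ s (transl μ t ξ), (qmp_mul_right μ s).ae (transl_coe μ t ξ),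
    transl_coe μ (s * t) ξ] with r h1 h2 h3
  rw [h1, h2, h3, sqrtModular_mul, mul_assoc r, Complex.ofReal_mul, mul_assoc]

lemma transl_one (ξ : Lp ℂ 2 μ) : transl μ 1 ξ = ξ := by
  refine Lp.ext ?_
  filter_upwards [transl_coe μ 1 ξ] with r h1
  rw [h1, sqrtModular_one, mul_one, Complex.ofReal_one, one_mul]

lemma memLp_mul {h : Γ → ℂ} (hm : Measurable h) (hb : ∃ C : ℝ, ∀ t, ‖h t‖ ≤ C) (ξ : Lp ℂ 2 μ) :
    MemLp (fun t => h t * ξ t) 2 μ := by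
  obtain ⟨C, hC⟩ := hb
  refine (Lp.memLp ξ).of_le_mul (c := C) (hm.aestronglyMeasurable.mul (Lp.aestronglyMeasurable ξ))
    (.of_forall fun t => ?_)
  rw [norm_mul]; gcongr; exact hC t

/-- Multiplication by a bounded measurable function on `L²(Γ)`. -/
def mulL2 (h : Γ → ℂ) (hm : Measurable h) (hb : ∃ C : ℝ, ∀ t, ‖h t‖ ≤ C) :
    Lp ℂ 2 μ →L[ℂ] Lp ℂ 2 μ :=
  LinearMap.mkContinuousOfExistsBound
    { toFun := fun ξ => (memLp_mul μ hm hb ξ).toLp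
      map_add' := fun ξ η => by
        refine Lp.ext ?_
        refine (MemLp.coeFn_toLp _).trans (.trans ?_ (Lp.coeFn_add _ _).symm)
        filter_upwards [MemLp.coeFn_toLp (memLp_mul μ hm hb ξ),
          MemLp.coeFn_toLp (memLp_mul μ hm hb η), Lp.coeFn_add ξ η] with t h1 h2 h3
        rw [Pi.add_apply, h1, h2, h3, Pi.add_apply, mul_add]
      map_smul' := fun k ξ => by
        refine Lp.ext ?_
        refine (MemLp.coeFn_toLp _).trans (.trans ?_ (Lp.coeFn_smul _ _).symm)
        filter_upwards [MemLp.coeFn_toLp (memLp_mul μ hm hb ξ), Lp.coeFn_smul k ξ] with t h1 h3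
        rw [Pi.smul_apply, RingHom.id_apply, h1, h3, Pi.smul_apply, smul_eq_mul, smul_eq_mul]
        ring }
    (by
      obtain ⟨C, hC⟩ := id hb
      refine ⟨C, fun ξ => Lp.norm_le_mul_norm_of_ae_le_mul ?_⟩
      filter_upwards [MemLp.coeFn_toLp (memLp_mul μ hm hb ξ)] with t h1
      refine (congrArg norm h1).trans_le ?_
      rw [norm_mul]; gcongr; exact hC t)

lemma mulL2_coe {h : Γ → ℂ} (hm : Measurable h) (hb : ∃ C : ℝ, ∀ t, ‖h t‖ ≤ C) (ξ : Lp ℂ 2 μ) :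
    mulL2 μ h hm hb ξ =ᵐ[μ] fun t => h t * ξ t := MemLp.coeFn_toLp (memLp_mul μ hm hb ξ)

lemma continuous_modular : Continuous fun s : Γ => (modularCharacterFun s : ℝ) := by
  let μ : Measure Γ := haar
  obtain ⟨⟨f, f_cont⟩, f_comp, f_nonneg, f_one⟩ :
    ∃ f : C(Γ, ℝ), HasCompactSupport f ∧ 0 ≤ f ∧ f 1 ≠ 0 := exists_continuous_nonneg_pos 1
  have hpos : 0 < ∫ x, f x ∂μ :=
    f_cont.integral_pos_of_hasCompactSupport_nonneg_nonzero f_comp f_nonneg f_one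
  have h1 : ∀ s, ∫ t, f (t * s) ∂μ = modularCharacterFun s * ∫ t, f t ∂μ := fun s => by
    have := integral_map (μ := μ) (measurable_mul_const s).aemeasurable (f := f)
      (f_cont.measurable.aestronglyMeasurable)
    rw [← this, map_mul_right_haar, integral_smul_nnreal_measure]; rfl
  have h2 : Continuous fun s => ∫ t, f (t * s) ∂μ := by
    rw [continuous_iff_continuousAt]
    intro s
    obtain ⟨N, hN, hsN⟩ := exists_compact_mem_nhds s
    have : ContinuousOn (fun s => ∫ t, f (t * s) ∂μ) N := by
      refine continuousOn_integral_of_compact_support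
        (f_comp.isCompact.mul hN.inv) (f := fun s t => f (t * s)) ?_ ?_
      · exact (f_cont.comp (continuous_snd.mul continuous_fst)).continuousOn
      · intro p x hp hx
        refine image_eq_zero_of_notMem_tsupport fun h => hx ?_
        exact ⟨x * p, h, p⁻¹, by simpa using hp, by simp⟩
    exact this.continuousAt hsN
  have h3 : (fun s : Γ => (modularCharacterFun s : ℝ)) =
      fun s => (∫ t, f (t * s) ∂μ) / ∫ t, f t ∂μ := by
    ext s; rw [h1, mul_div_cancel_right₀ _ hpos.ne']
  rw [h3]
  exact h2.div_const _

lemma continuous_sqrtModular : Continuous (sqrtModular : Γ → ℝ) :=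
  (Real.continuous_sqrt.comp continuous_modular).inv₀ fun s =>
    (Real.sqrt_pos.2 (modularCharacterFun_pos s)).ne'

lemma exists_cc_approx {f : Γ → ℂ} (hf : MemLp f 2 μ) {ε : ℝ≥0∞} (hε : ε ≠ 0) :
    ∃ g : Γ → ℂ, eLpNorm (f - g) 2 μ ≤ ε ∧ Continuous g ∧ HasCompactSupport g := by
  refine hf.induction_dense (by simp) _ ?_ (fun f g hf hg => ⟨hf.1.add hg.1, hf.2.add hg.2⟩)
    (fun f hf => hf.1.measurable.aestronglyMeasurable) hε
  intro c t ht htμ ε hε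
  obtain ⟨δ, δpos, hδ⟩ := exists_Lp_half ℂ μ 2 hε
  obtain ⟨η, ηpos, hη⟩ := exists_eLpNorm_indicator_le (μ := μ) (p := 2) (by simp) c δpos.ne'
  have hη' : (η : ℝ≥0∞) ≠ 0 := (ENNReal.coe_pos.2 ηpos).ne'
  obtain ⟨s, st, s_compact, s_closed, μs⟩ := ht.exists_isCompact_isClosed_sdiff_lt htμ.ne hη'
  have hsμ : μ s < ∞ := (measure_mono st).trans_lt htμ
  have I1 : eLpNorm ((s.indicator fun _ => c) - t.indicator fun _ => c) 2 μ ≤ δ := by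
    rw [← eLpNorm_neg, neg_sub, ← Set.indicator_sdiff st]
    exact hη _ μs.le
  obtain ⟨V, sV, V_open, -, hV⟩ := s_closed.measurableSet.exists_isOpen_sdiff_lt hsμ.ne hη'
  obtain ⟨g, hg1, hg0, hgc, hgI⟩ := exists_continuous_one_zero_of_isCompact s_compact
    V_open.isClosed_compl (Set.disjoint_compl_right_iff_subset.2 sV)
  have hgcont : Continuous fun x => (g x : ℂ) * c := by fun_prop
  have I2 : eLpNorm ((fun x => (g x : ℂ) * c) - s.indicator fun _ => c) 2 μ ≤ δ := by
    refine (eLpNorm_mono fun x => ?_).trans (hη _ hV.le)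
    by_cases hxs : x ∈ s
    · simp [hg1 hxs, hxs]
    · by_cases hxV : x ∈ V
      · have : ‖(g x : ℂ) * c‖ ≤ ‖c‖ := by
          rw [norm_mul, Complex.norm_real, Real.norm_of_nonneg (hgI x).1]
          exact mul_le_of_le_one_left (norm_nonneg _) (hgI x).2
        simpa [hxs, hxV] using this
      · have : g x = 0 := hg0 hxV
        simp [hxs, hxV, this]
  refine ⟨fun x => (g x : ℂ) * c, ?_, hgcont, ?_⟩
  · have := (hδ _ _ (hgcont.measurable.aestronglyMeasurable.sub
      (aestronglyMeasurable_const.indicator s_closed.measurableSet))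
      ((aestronglyMeasurable_const.indicator s_closed.measurableSet).sub
        (aestronglyMeasurable_const.indicator ht)) I2 I1).le
    rwa [sub_add_sub_cancel] at this
  · refine hgc.mono fun x hx => ?_
    simp only [Function.mem_support, ne_eq, mul_eq_zero, Complex.ofReal_eq_zero, not_or] at hx
    exact hx.1

lemma dense_cc : Dense (Submodule.span ℂ {ξ : Lp ℂ 2 μ | ∃ f : Γ → ℂ, Continuous f ∧
    HasCompactSupport f ∧ ξ =ᵐ[μ] f} : Set (Lp ℂ 2 μ)) := by
  rw [Metric.dense_iff]
  intro ξ ε hε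
  obtain ⟨g, hg2, hg3, hg1⟩ := exists_cc_approx μ (Lp.memLp ξ) (ε := ENNReal.ofReal (ε / 2))
    (by simpa using hε)
  have hg4 : MemLp g 2 μ := hg3.memLp_of_hasCompactSupport hg1
  refine ⟨hg4.toLp, ?_, Submodule.subset_span ⟨g, hg3, hg1, hg4.coeFn_toLp⟩⟩
  rw [Metric.mem_ball, dist_comm, Lp.dist_def]
  have : eLpNorm (⇑ξ - ⇑hg4.toLp) 2 μ = eLpNorm (⇑ξ - g) 2 μ :=
    eLpNorm_congr_ae (by filter_upwards [hg4.coeFn_toLp] with t ht; simp [ht])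
  rw [this]
  have := ENNReal.toReal_le_of_le_ofReal (by positivity) hg2
  linarith

lemma continuous_transl (ξ : Lp ℂ 2 μ) : Continuous fun s => transl μ s ξ := by
  refine strongCont_of_dense (fun s => (transl μ s).toContinuousLinearMap)
    (fun s ξ => ((transl μ s).norm_map ξ).le) _ (dense_cc μ) ?_ ξ
  rintro ξ ⟨f, hf, hfc, hξ⟩
  change Continuous fun s => transl μ s ξ
  have key : ∀ s, Continuous fun t => inner ℂ (transl μ s ξ) (transl μ t ξ) := by
    intro s
    have h1 : ∀ t, inner ℂ (transl μ s ξ) (transl μ t ξ) =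
        (sqrtModular s : ℂ) * (sqrtModular t : ℂ) * ∫ r, conj (f (r * s)) * f (r * t) ∂μ := by
      intro t
      rw [L2.inner_def, ← integral_const_mul]
      refine integral_congr_ae ?_
      filter_upwards [transl_coe μ s ξ, transl_coe μ t ξ, (qmp_mul_right μ s).ae hξ,
        (qmp_mul_right μ t).ae hξ] with r h1 h2 h3 h4
      rw [h1, h2, h3, h4]
      simp only [RCLike.inner_apply, map_mul, Complex.conj_ofReal]
      ring
    simp only [h1]
    refine (continuous_const.mul (Complex.continuous_ofReal.comp continuous_sqrtModular)).mul ?_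
    rw [← continuousOn_univ]
    refine continuousOn_integral_of_compact_support
        (hfc.isCompact.mul (isCompact_singleton (x := s⁻¹)))
        (f := fun t r => conj (f (r * s)) * f (r * t)) ?_ ?_
    · refine Continuous.continuousOn ?_
      exact (Complex.continuous_conj.comp (hf.comp (continuous_snd.mul continuous_const))).mul
        (hf.comp (continuous_snd.mul continuous_fst))
    · intro p x _ hx
      have : f (x * s) = 0 := image_eq_zero_of_notMem_tsupport fun h => hx
        ⟨x * s, h, s⁻¹, rfl, by simp⟩
      simp [this]
  rw [continuous_iff_continuousAt]
  intro s
  rw [ContinuousAt, tendsto_iff_norm_sub_tendsto_zero]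
  have h2 : ∀ t, ‖transl μ t ξ - transl μ s ξ‖ =
      √(2 * ‖ξ‖ ^ 2 - 2 * (inner ℂ (transl μ s ξ) (transl μ t ξ)).re) := by
    intro t
    rw [← Real.sqrt_sq (norm_nonneg (transl μ t ξ - transl μ s ξ)), norm_sub_sq (𝕜 := ℂ),
      (transl μ t).norm_map, (transl μ s).norm_map, inner_re_symm]
    congr 1
    simp only [RCLike.re_to_complex]
    ring
  simp only [h2]
  have h3 : Continuous fun t => √(2 * ‖ξ‖ ^ 2 - 2 * (inner ℂ (transl μ s ξ) (transl μ t ξ)).re) :=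
    Real.continuous_sqrt.comp (continuous_const.sub
      (continuous_const.mul (Complex.continuous_re.comp (key s))))
  have h4 := h3.tendsto s
  have h5 : 2 * ‖ξ‖ ^ 2 - 2 * (inner ℂ (transl μ s ξ) (transl μ s ξ)).re = 0 := by
    rw [inner_self_eq_norm_sq_to_K, (transl μ s).norm_map]
    simp [← Complex.ofReal_pow]
  rwa [h5, Real.sqrt_zero] at h4

end Regular

section RegularBimod

open Measure

variable {G Γ : Type u} [Group G] [TopologicalSpace G] [IsTopologicalGroup G]
  [Group Γ] [TopologicalSpace Γ] [IsTopologicalGroup Γ]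
  [LocallyCompactSpace Γ] [MeasurableSpace Γ] [BorelSpace Γ] (μ : Measure Γ) [IsHaarMeasure μ]
  [Regular μ] (σ : Twist G Γ)

/-- The closed subspace `L²(Γ, χ)` of `L²(Γ)` of all `ξ` with `ξ(s z) = χ(z) ξ(s)` for `z ∈ 𝕋`
(note that the modular function is trivial on the central compact subgroup `𝕋`). For `χ = id` this is
`L²(G_σ, ι)`; for `χ = 1` it is the space of `𝕋`-invariant functions, that is, `L²(G)`. -/
def lchiSub (χ : Circle →* Circle) : Submodule ℂ (Lp ℂ 2 μ) where
  carrier := {ξ | ∀ z, transl μ (σ.ι z) ξ = (χ z : ℂ) • ξ}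
  add_mem' hξ hη z := by rw [map_add, hξ z, hη z, smul_add]
  zero_mem' z := by simp
  smul_mem' c ξ hξ z := by rw [map_smul, hξ z, smul_comm]

/-- `L²(Γ, χ)` as a Hilbert space. -/
def Lchi (χ : Circle →* Circle) : Type u := ↥(lchiSub μ σ χ)

instance (χ : Circle →* Circle) : NormedAddCommGroup (Lchi μ σ χ) :=
  inferInstanceAs (NormedAddCommGroup ↥(lchiSub μ σ χ))

instance (χ : Circle →* Circle) : InnerProductSpace ℂ (Lchi μ σ χ) :=
  inferInstanceAs (InnerProductSpace ℂ ↥(lchiSub μ σ χ))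

instance (χ : Circle →* Circle) : CompleteSpace (Lchi μ σ χ) := by
  have : IsClosed (lchiSub μ σ χ : Set (Lp ℂ 2 μ)) := by
    have h : (lchiSub μ σ χ : Set (Lp ℂ 2 μ)) =
        ⋂ z, {ξ | transl μ (σ.ι z) ξ = (χ z : ℂ) • ξ} := by
      ext ξ; simp [lchiSub]
    rw [h]
    exact isClosed_iInter fun z => isClosed_eq (transl μ (σ.ι z)).continuous
      (continuous_const_smul _)
  exact this.completeSpace_coe

variable {σ} {χ χ' χ'' : Circle →* Circle}

/-- The underlying element of `L²(Γ)`. -/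
def Lchi.fn : Lchi μ σ χ →ₗᵢ[ℂ] Lp ℂ 2 μ := (lchiSub μ σ χ).subtypeₗᵢ

lemma Lchi.prop (ξ : Lchi μ σ χ) (z : Circle) :
    transl μ (σ.ι z) (Lchi.fn μ ξ) = (χ z : ℂ) • Lchi.fn μ ξ := ξ.2 z

lemma Lchi.ext {ξ η : Lchi μ σ χ} (h : Lchi.fn μ ξ = Lchi.fn μ η) : ξ = η := Subtype.ext h

lemma Lchi.ext_ae {ξ η : Lchi μ σ χ} (h : Lchi.fn μ ξ =ᵐ[μ] Lchi.fn μ η) : ξ = η :=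
  Lchi.ext μ (Lp.ext h)

/-- The right regular representation on `L²(Γ, χ)`. -/
def rhoIso (s : Γ) : Lchi μ σ χ →ₗᵢ[ℂ] Lchi μ σ χ where
  toFun ξ := ⟨transl μ s (Lchi.fn μ ξ), fun z => by
    rw [transl_transl, σ.central, ← transl_transl, Lchi.prop, map_smul]⟩
  map_add' ξ η := Lchi.ext μ (map_add (transl μ s) _ _)
  map_smul' k ξ := Lchi.ext μ (map_smul (transl μ s) _ _)
  norm_map' ξ := (transl μ s).norm_map _

lemma rhoIso_fn (s : Γ) (ξ : Lchi μ σ χ) : Lchi.fn μ (rhoIso μ s ξ) = transl μ s (Lchi.fn μ ξ) :=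
  rfl

lemma rhoIso_coe (s : Γ) (ξ : Lchi μ σ χ) : Lchi.fn μ (rhoIso μ s ξ) =ᵐ[μ]
    fun t => (sqrtModular s : ℂ) * Lchi.fn μ ξ (t * s) := transl_coe μ s _

lemma rhoIso_rhoIso (s t : Γ) (ξ : Lchi μ σ χ) :
    rhoIso μ s (rhoIso μ t ξ) = rhoIso μ (s * t) ξ := Lchi.ext μ (transl_transl μ s t _)

lemma rhoIso_one (ξ : Lchi μ σ χ) : rhoIso μ 1 ξ = ξ := Lchi.ext μ (transl_one μ _)

/-- The right regular representation `ρ` on `L²(Γ, χ)`, `(ρ_s ξ)(t) = Δ(s)^{1/2} ξ(t s)`. -/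
def rhoRep : URep Γ (Lchi μ σ χ) where
  U :=
    { toFun := fun s => Unitary.linearIsometryEquiv.symm
        { toLinearEquiv := LinearEquiv.ofLinearMap (rhoIso μ s).toLinearMap
            (rhoIso μ s⁻¹).toLinearMap
            (LinearMap.ext fun ξ => by
              refine (rhoIso_rhoIso μ s s⁻¹ ξ).trans ?_
              rw [mul_inv_cancel]; exact rhoIso_one μ ξ)
            (LinearMap.ext fun ξ => by
              refine (rhoIso_rhoIso μ s⁻¹ s ξ).trans ?_
              rw [inv_mul_cancel]; exact rhoIso_one μ ξ)
          norm_map' := (rhoIso μ s).norm_map }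
      map_one' := by
        ext ξ; exact rhoIso_one μ ξ
      map_mul' := fun s t => by
        ext ξ; exact (rhoIso_rhoIso μ s t ξ).symm }
  cont ξ := by
    refine continuous_induced_rng.2 ?_
    exact continuous_transl μ (Lchi.fn μ ξ)

variable (σ) in
/-- Bounded Borel functions `h` on `Γ` with `h(s z) = χ'(z) conj(χ(z)) h(s)`; multiplication
by such a function maps `L²(Γ, χ)` to `L²(Γ, χ')`. -/
structure TwFn (χ χ' : Circle →* Circle) where
  fn : Γ → ℂ
  meas : Measurable fn
  bdd : ∃ C : ℝ, ∀ t, ‖fn t‖ ≤ C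
  cov : ∀ s z, fn (s * σ.ι z) = (χ' z : ℂ) * conj (χ z : ℂ) * fn s

/-- Multiplication by a function as an operator `L²(Γ, χ) → L²(Γ, χ')`. -/
def TwFn.op (F : TwFn σ χ χ') : Lchi μ σ χ →L[ℂ] Lchi μ σ χ' :=
  ContinuousLinearMap.codRestrict
    ((mulL2 μ F.fn F.meas F.bdd).comp (Lchi.fn μ).toContinuousLinearMap) (lchiSub μ σ χ')
    (fun ξ z => by
      refine Lp.ext ?_
      have hξ := Lchi.prop μ ξ z
      have h0 : ((χ z : ℂ) • Lchi.fn μ ξ : Lp ℂ 2 μ) =ᵐ[μ] (χ z : ℂ) • ⇑(Lchi.fn μ ξ) :=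
        Lp.coeFn_smul _ _
      rw [← hξ] at h0
      refine (transl_coe μ _ _).trans (.trans ?_ (Lp.coeFn_smul _ _).symm)
      filter_upwards [(qmp_mul_right μ (σ.ι z)).ae (mulL2_coe μ F.meas F.bdd (Lchi.fn μ ξ)),
        mulL2_coe μ F.meas F.bdd (Lchi.fn μ ξ), h0, transl_coe μ (σ.ι z) (Lchi.fn μ ξ)]
        with t h1 h2 h3 h4
      rw [h4] at h3
      change (sqrtModular (σ.ι z) : ℂ) * mulL2 μ F.fn F.meas F.bdd (Lchi.fn μ ξ) (t * σ.ι z) =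
        (χ' z : ℂ) * mulL2 μ F.fn F.meas F.bdd (Lchi.fn μ ξ) t
      rw [h1, h2, F.cov]
      have h5 : (sqrtModular (σ.ι z) : ℂ) * Lchi.fn μ ξ (t * σ.ι z) =
        (χ z : ℂ) * Lchi.fn μ ξ t := h3
      linear_combination ((χ' z : ℂ) * conj (χ z : ℂ) * F.fn t) * h5 +
        (χ' z : ℂ) * F.fn t * Lchi.fn μ ξ t * conj_mul_circle (χ z))

lemma TwFn.op_coe (F : TwFn σ χ χ') (ξ : Lchi μ σ χ) :
    Lchi.fn μ (F.op μ ξ) =ᵐ[μ] fun t => F.fn t * Lchi.fn μ ξ t :=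
  mulL2_coe μ F.meas F.bdd (Lchi.fn μ ξ)

lemma TwFn.op_comp {F : TwFn σ χ χ''} {F₁ : TwFn σ χ' χ''} {F₂ : TwFn σ χ χ'}
    (h : ∀ t, F.fn t = F₁.fn t * F₂.fn t) (ξ : Lchi μ σ χ) :
    F.op μ ξ = F₁.op μ (F₂.op μ ξ) := by
  refine Lchi.ext_ae μ ?_
  filter_upwards [F.op_coe μ ξ, F₁.op_coe μ (F₂.op μ ξ), F₂.op_coe μ ξ] with t h1 h2 h3
  rw [h1, h2, h3, h, mul_assoc]

lemma TwFn.op_adjoint {F : TwFn σ χ χ'} {F' : TwFn σ χ' χ} (h : ∀ t, F'.fn t = conj (F.fn t)) :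
    F'.op μ = ContinuousLinearMap.adjoint (F.op μ) := by
  rw [ContinuousLinearMap.eq_adjoint_iff]
  intro ξ η
  change inner ℂ (Lchi.fn μ (F'.op μ ξ)) (Lchi.fn μ η) =
    inner ℂ (Lchi.fn μ ξ) (Lchi.fn μ (F.op μ η))
  rw [L2.inner_def, L2.inner_def]
  refine integral_congr_ae ?_
  filter_upwards [F'.op_coe μ ξ, F.op_coe μ η] with t h1 h2
  rw [h1, h2, h]
  simp only [RCLike.inner_apply, map_mul, Complex.conj_conj]
  ring

lemma TwFn.op_rho {F F' : TwFn σ χ χ'} (s : Γ) (h : ∀ t, F'.fn t = F.fn (t * s))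
    (ξ : Lchi μ σ χ) : rhoIso μ s (F.op μ ξ) = F'.op μ (rhoIso μ s ξ) := by
  refine Lchi.ext_ae μ ?_
  filter_upwards [rhoIso_coe μ s (F.op μ ξ), F'.op_coe μ (rhoIso μ s ξ),
    (qmp_mul_right μ s).ae (F.op_coe μ ξ), rhoIso_coe μ s ξ] with t h1 h2 h3 h4
  rw [h1, h2, h3, h4, h]
  ring

/-- A function `c ∈ C₀(G)`, viewed on `Γ`. -/
def TwFn.ofC0 (σ : Twist G Γ) (χ : Circle →* Circle) (c : C₀(G, ℂ)) : TwFn σ χ χ where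
  fn t := c (σ.q t)
  meas := ((map_continuous c).comp σ.q_cont).measurable
  bdd := ⟨‖c.toBCF‖, fun t => c.toBCF.norm_coe_le_norm (σ.q t)⟩
  cov s z := by
    rw [map_mul, σ.q_ι, mul_one, mul_comm (χ z : ℂ), conj_mul_circle, one_mul]

/-- Functions in `C₀(Γ, ῑ)`. -/
def TwFn.ofC0bar (f : C0bar σ) : TwFn σ (MonoidHom.id Circle) 1 where
  fn t := f.fn t
  meas := (map_continuous f.fn).measurable
  bdd := ⟨‖f.fn.toBCF‖, fun t => f.fn.toBCF.norm_coe_le_norm t⟩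
  cov s z := by simp [f.prop]

/-- Complex conjugates of functions in `C₀(Γ, ῑ)`. -/
def TwFn.ofC0barConj (f : C0bar σ) : TwFn σ 1 (MonoidHom.id Circle) where
  fn t := conj (f.fn t)
  meas := (Complex.continuous_conj.comp (map_continuous f.fn)).measurable
  bdd := ⟨‖f.fn.toBCF‖, fun t => by
    rw [RCLike.norm_conj]; exact f.fn.toBCF.norm_coe_le_norm t⟩
  cov s z := by simp [f.prop]

/-- Borel functions `ϕ : Γ → 𝕋` with `ϕ(s z) = z̄ ϕ(s)`. -/
def TwFn.ofBorel (ϕ : Γ → Circle) (hm : Measurable fun t => (ϕ t : ℂ)) (hϕ : ∀ s z, ϕ (s * σ.ι z) = z⁻¹ * ϕ s) :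
    TwFn σ (MonoidHom.id Circle) 1 where
  fn t := ϕ t
  meas := hm
  bdd := ⟨1, fun t => (Circle.norm_coe (ϕ t)).le⟩
  cov s z := by rw [hϕ, Circle.coe_mul, Circle.coe_inv_eq_conj]; simp

variable [LocallyCompactSpace G]

lemma ofC0_nondeg (χ : Circle →* Circle) :
    Dense (Submodule.span ℂ {η | ∃ (c : C₀(G, ℂ)) (ξ : Lchi μ σ χ),
      η = (TwFn.ofC0 σ χ c).op μ ξ} : Set (Lchi μ σ χ)) := by
  rw [Metric.dense_iff]
  intro ξ ε hε
  obtain ⟨g, hg2, hg3, hg1⟩ := exists_cc_approx μ (Lp.memLp (Lchi.fn μ ξ))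
    (ε := ENNReal.ofReal (ε / 4)) (by simpa using hε)
  obtain ⟨c, hc1, -, hcc, hcI⟩ := exists_continuous_one_zero_of_isCompact
    (hg1.isCompact.image σ.q_cont) isClosed_empty (Set.disjoint_empty _)
  let c' : C₀(G, ℂ) := ⟨⟨fun x => (c x : ℂ), Complex.continuous_ofReal.comp c.continuous⟩,
    (hcc.comp_left (g := fun r : ℝ => (r : ℂ)) Complex.ofReal_zero).is_zero_at_infty⟩
  refine ⟨(TwFn.ofC0 σ χ c').op μ ξ, ?_, Submodule.subset_span ⟨c', ξ, rfl⟩⟩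
  rw [Metric.mem_ball, dist_comm, ← (Lchi.fn μ).dist_map, Lp.dist_def]
  have hle : eLpNorm (⇑(Lchi.fn μ ξ) - ⇑(Lchi.fn μ ((TwFn.ofC0 σ χ c').op μ ξ))) 2 μ ≤
      eLpNorm (⇑(Lchi.fn μ ξ) - g) 2 μ := by
    refine eLpNorm_mono_ae ?_
    filter_upwards [(TwFn.ofC0 σ χ c').op_coe μ ξ] with t ht
    rw [Pi.sub_apply, ht, Pi.sub_apply]
    change ‖_ - (c (σ.q t) : ℂ) * _‖ ≤ _
    by_cases hgt : g t = 0
    · rw [hgt, sub_zero, show ∀ x : ℂ, x - (c (σ.q t) : ℂ) * x = ((1 - c (σ.q t) : ℝ) : ℂ) * x by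
        intro x; push_cast; ring, norm_mul, Complex.norm_real,
        Real.norm_of_nonneg (by linarith [(hcI (σ.q t)).2])]
      exact mul_le_of_le_one_left (norm_nonneg _) (by linarith [(hcI (σ.q t)).1])
    · have : c (σ.q t) = 1 := hc1 ⟨t, subset_tsupport _ hgt, rfl⟩
      simp [this]
  have := ENNReal.toReal_le_of_le_ofReal (by positivity) (hle.trans hg2)
  linarith

/-- The covariant representation `(M^χ, ρ^χ)` of `(C₀(G), rt)` on `L²(Γ, χ)` by multiplication and
right translation. -/
def regRep (χ : Circle →* Circle) : CovRep σ (fun s => rt (σ.q s)) χ (Lchi μ σ χ) where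
  toURep := rhoRep μ
  π :=
    { toFun := fun c => (TwFn.ofC0 σ χ c).op μ
      map_smul' := fun k c => ContinuousLinearMap.ext fun ξ => Lchi.ext_ae μ (by
        refine .trans ?_ (Lp.coeFn_smul k (Lchi.fn μ ((TwFn.ofC0 σ χ c).op μ ξ))).symm
        filter_upwards [(TwFn.ofC0 σ χ (k • c)).op_coe μ ξ, (TwFn.ofC0 σ χ c).op_coe μ ξ]
          with t h1 h2
        rw [h1, Pi.smul_apply, h2]
        exact mul_assoc _ _ _)
      map_zero' := ContinuousLinearMap.ext fun ξ => Lchi.ext_ae μ (by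
        refine .trans ?_ (Lp.coeFn_zero ℂ 2 μ).symm
        filter_upwards [(TwFn.ofC0 σ χ 0).op_coe μ ξ] with t h1
        rw [h1]
        exact zero_mul _)
      map_add' := fun c d => ContinuousLinearMap.ext fun ξ => Lchi.ext_ae μ (by
        refine .trans ?_ (Lp.coeFn_add (Lchi.fn μ ((TwFn.ofC0 σ χ c).op μ ξ))
          (Lchi.fn μ ((TwFn.ofC0 σ χ d).op μ ξ))).symm
        filter_upwards [(TwFn.ofC0 σ χ (c + d)).op_coe μ ξ, (TwFn.ofC0 σ χ c).op_coe μ ξ,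
          (TwFn.ofC0 σ χ d).op_coe μ ξ] with t h1 h2 h3
        rw [h1, Pi.add_apply, h2, h3]
        exact add_mul _ _ _)
      map_mul' := fun c d => ContinuousLinearMap.ext fun ξ =>
        TwFn.op_comp μ (fun _ => rfl) ξ
      map_star' := fun c => TwFn.op_adjoint μ (fun _ => rfl) }
  nondeg := ofC0_nondeg μ χ
  covariant s c ξ := TwFn.op_rho μ s (fun t => by simp [TwFn.ofC0]) ξ
  twist z ξ := Lchi.ext μ (Lchi.prop μ ξ z)

/-- `L^σ(f) ξ = f ξ` for `f ∈ C₀(Γ, ῑ)`. -/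
def regX : C0bar σ →ₗ[ℂ] (Lchi μ σ (MonoidHom.id Circle) →L[ℂ] Lchi μ σ 1) where
  toFun f := (TwFn.ofC0bar f).op μ
  map_smul' k f := ContinuousLinearMap.ext fun ξ => Lchi.ext_ae μ (by
    refine .trans ?_ (Lp.coeFn_smul k (Lchi.fn μ ((TwFn.ofC0bar f).op μ ξ))).symm
    filter_upwards [(TwFn.ofC0bar (k • f)).op_coe μ ξ, (TwFn.ofC0bar f).op_coe μ ξ]
      with t h1 h2
    rw [h1, Pi.smul_apply, h2]
    exact mul_assoc _ _ _)
  map_add' c d := ContinuousLinearMap.ext fun ξ => Lchi.ext_ae μ (by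
    refine .trans ?_ (Lp.coeFn_add (Lchi.fn μ ((TwFn.ofC0bar c).op μ ξ))
      (Lchi.fn μ ((TwFn.ofC0bar d).op μ ξ))).symm
    filter_upwards [(TwFn.ofC0bar (c + d)).op_coe μ ξ, (TwFn.ofC0bar c).op_coe μ ξ,
      (TwFn.ofC0bar d).op_coe μ ξ] with t h1 h2 h3
    rw [h1, Pi.add_apply, h2, h3]
    exact add_mul _ _ _)

lemma regX_linner (f g : C0bar σ) : (TwFn.ofC0 σ 1 (linner₀ σ f g)).op μ =
    (TwFn.ofC0bar f).op μ ∘L ContinuousLinearMap.adjoint ((TwFn.ofC0bar g).op μ) := by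
  rw [← TwFn.op_adjoint μ (F := TwFn.ofC0bar g) (F' := TwFn.ofC0barConj g) fun _ => rfl]
  exact ContinuousLinearMap.ext fun ξ => TwFn.op_comp μ
    (F := TwFn.ofC0 σ 1 (linner₀ σ f g)) (F₁ := TwFn.ofC0bar f) (F₂ := TwFn.ofC0barConj g)
    (linner₀_q σ f g) ξ

lemma regX_rinner (f g : C0bar σ) :
    (TwFn.ofC0 σ (MonoidHom.id Circle) (rinner₀ σ f g)).op μ =
      ContinuousLinearMap.adjoint ((TwFn.ofC0bar f).op μ) ∘L (TwFn.ofC0bar g).op μ := by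
  rw [← TwFn.op_adjoint μ (F := TwFn.ofC0bar f) (F' := TwFn.ofC0barConj f) fun _ => rfl]
  exact ContinuousLinearMap.ext fun ξ => TwFn.op_comp μ
    (F := TwFn.ofC0 σ (MonoidHom.id Circle) (rinner₀ σ f g)) (F₁ := TwFn.ofC0barConj f)
    (F₂ := TwFn.ofC0bar g) (rinner₀_q σ f g) ξ

lemma regX_lact (c : C₀(G, ℂ)) (f : C0bar σ) : (TwFn.ofC0bar (actC σ c.toBCF f)).op μ =
    (TwFn.ofC0 σ 1 c).op μ ∘L (TwFn.ofC0bar f).op μ :=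
  ContinuousLinearMap.ext fun ξ => TwFn.op_comp μ (F := TwFn.ofC0bar (actC σ c.toBCF f))
    (F₁ := TwFn.ofC0 σ 1 c) (F₂ := TwFn.ofC0bar f) (actC_apply σ c.toBCF f) ξ

lemma regX_ract (c : C₀(G, ℂ)) (f : C0bar σ) : (TwFn.ofC0bar (actC σ c.toBCF f)).op μ =
    (TwFn.ofC0bar f).op μ ∘L (TwFn.ofC0 σ (MonoidHom.id Circle) c).op μ :=
  ContinuousLinearMap.ext fun ξ => TwFn.op_comp μ (F := TwFn.ofC0bar (actC σ c.toBCF f))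
    (F₁ := TwFn.ofC0bar f) (F₂ := TwFn.ofC0 σ (MonoidHom.id Circle) c)
    (fun t => (actC_apply σ c.toBCF f t).trans (mul_comm _ _)) ξ

lemma regX_cov (s : Γ) (f : C0bar σ) (ξ : Lchi μ σ (MonoidHom.id Circle)) :
    rhoIso μ s ((TwFn.ofC0bar f).op μ ξ) = (TwFn.ofC0bar (rtσ σ s f)).op μ (rhoIso μ s ξ) :=
  TwFn.op_rho μ s (fun _ => rfl) ξ

/-- The regular representation `(M ⋊ ρ, L^σ ⋊ ρ^σ, M^σ ⋊ ρ^σ)` of `(C₀(Γ, ῑ), rt^σ)` on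
`(L²(G), L²(G_σ, ι))`, with `L^σ(f) ξ = f ξ`. -/
def regBimodRep : BimodRep σ (bimod₀ σ) (Lchi μ σ 1) (Lchi μ σ (MonoidHom.id Circle)) where
  left := regRep μ 1
  right := regRep μ (MonoidHom.id Circle)
  πX := regX μ
  map_linner := regX_linner μ
  map_rinner := regX_rinner μ
  map_lact := regX_lact μ
  map_ract f c := regX_ract μ c f
  covariant := regX_cov μ

variable (σ) in
/-- The regular representation as an index. -/
def regIdx : BimodFam σ (bimod₀ σ) := ⟨Lchi μ σ 1, Lchi μ σ (MonoidHom.id Circle), regBimodRep μ⟩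

/-- The unitary `L_ϕ : L²(G_σ, ι) → L²(G)`, `L_ϕ ξ = ϕ ξ`. -/
def Lphi (ϕ : Γ → Circle) (hm : Measurable fun t => (ϕ t : ℂ)) (hϕ : ∀ s z, ϕ (s * σ.ι z) = z⁻¹ * ϕ s) :
    Lchi μ σ (MonoidHom.id Circle) →L[ℂ] Lchi μ σ 1 := (TwFn.ofBorel ϕ hm hϕ).op μ

end RegularBimod

/-! ### The multipliers `S_ϕ`, `R_ϕ` and the isomorphisms they implement -/

section Main

open Measure

variable {G Γ : Type u} [Group G] [TopologicalSpace G] [IsTopologicalGroup G]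
  [Group Γ] [TopologicalSpace Γ] [IsTopologicalGroup Γ] [MeasurableSpace Γ]
  {A B X : Type*} [NonUnitalCStarAlgebra A] [NonUnitalCStarAlgebra B] [NormedAddCommGroup X]
  [NormedSpace ℂ X]

/-- `C₀(G) ⋊_{(rt, χ)} G`; this is `C₀(G) ⋊_rt G` for `χ = 1` and `C₀(G) ⋊_{(rt, ι^σ)} G` for
`χ = id`. -/
abbrev c0Cross (μ : Measure Γ) (σ : Twist G Γ) (χ : Circle →* Circle) :=
  crossedProduct μ σ (fun s => rt (σ.q s)) χ

/-- `B ⋊_{(β, ι^σ)} G`. -/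
abbrev WeakAlg.twCross (W : WeakAlg G B) (μ : Measure Γ) (σ : Twist G Γ) :=
  crossedProduct μ σ (W.infl σ) (MonoidHom.id Circle)

/-- `B^σ ⋊_{β^σ} G`. -/
abbrev WeakAlg.defCross (W : WeakAlg G B) (μ : Measure Γ) (σ : Twist G Γ) :=
  crossedProduct μ σ (W.βσ σ) 1

/-- `(B ⋊_{(β, ι^σ)} G) ⊗ C⋆(G)`. -/
abbrev WeakAlg.twTensor [MeasurableSpace G] (W : WeakAlg G B) (μΓ : Measure Γ) (μ : Measure G)
    (σ : Twist G Γ) := tensorCStar μΓ μ σ (W.infl σ) (MonoidHom.id Circle)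

/-- `(B^σ ⋊_{β^σ} G) ⊗ C⋆(G)`. -/
abbrev WeakAlg.defTensor [MeasurableSpace G] (W : WeakAlg G B) (μΓ : Measure Γ) (μ : Measure G)
    (σ : Twist G Γ) := tensorCStar μΓ μ σ (W.βσ σ) 1

/-- `φ ⋊ G : C₀(G) ⋊_{(rt, ι^σ)} G → M(B ⋊_{(β, ι^σ)} G)`. -/
def WeakAlg.phiDescent (W : WeakAlg G B) (σ : Twist G Γ)
    (x : CovFam.Prod σ (fun s => rt (σ.q s)) (MonoidHom.id Circle)) :
    CovFam.Prod σ (W.infl σ) (MonoidHom.id Circle) :=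
  (W.c0Action σ).descent (MonoidHom.id Circle) x

/-- `φ^σ ⋊ G : C₀(G) ⋊_rt G → M(B^σ ⋊_{β^σ} G)`. -/
def WeakAlg.phiσDescent (W : WeakAlg G B) (σ : Twist G Γ)
    (x : CovFam.Prod σ (fun s => rt (σ.q s)) 1) : CovFam.Prod σ (W.βσ σ) 1 :=
  (W.c0Actionσ σ).descent 1 x

/-- `T⋆ T = 1` and `T T⋆ = 1`. -/
def IsUnitaryFam {σ : Twist G Γ} {O : BimodOps Γ A B X} (T : BimodFam.Prod σ O) : Prop :=
  ∀ k, ContinuousLinearMap.adjoint (T k) ∘L T k = ContinuousLinearMap.id ℂ k.H' ∧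
    T k ∘L ContinuousLinearMap.adjoint (T k) = ContinuousLinearMap.id ℂ k.H

/-- `y = T x T⋆`, for `x` in (the multiplier algebra of) the right crossed product and `y` in (the
multiplier algebra of) the left crossed product. -/
def IsAd {σ : Twist G Γ} {O : BimodOps Γ A B X} (T : BimodFam.Prod σ O)
    (x : CovFam.Prod σ O.β (MonoidHom.id Circle)) (y : CovFam.Prod σ O.α 1) : Prop :=
  ∀ k : BimodFam σ O, (BFam.ap y k.leftIdx : k.H →L[ℂ] k.H) =
    T k ∘L (BFam.ap x k.rightIdx : k.H' →L[ℂ] k.H') ∘L ContinuousLinearMap.adjoint (T k)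

/-- `S = S_ϕ`: the multiplier of `C₀(Γ, ῑ) ⋊ G` that is mapped to `L_ϕ` by the regular
representation. -/
def IsSphi [LocallyCompactSpace G] [LocallyCompactSpace Γ] [BorelSpace Γ] (μ : Measure Γ)
    [IsHaarMeasure μ] [Regular μ] (σ : Twist G Γ) (ϕ : Γ → Circle)
    (hm : Measurable fun t => (ϕ t : ℂ)) (hϕ : ∀ s z, ϕ (s * σ.ι z) = z⁻¹ * ϕ s)
    (S : BimodFam.Prod σ (bimod₀ σ)) : Prop :=
  IsBimodMultiplier μ σ (bimod₀ σ) S ∧ S (regIdx μ σ) = Lphi μ ϕ hm hϕ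

end Main

end TwistDeform

end

universe u

open MeasureTheory MeasureTheory.Measure Filter Topology TwistDeform
open scoped ZeroAtInfty MultiplierAlgebra ENNReal TensorProduct ComplexConjugate CompactlySupported

noncomputable section

namespace TwistDeform

set_option linter.unusedSectionVars false

/-! ### Bounded families -/

section Fam

variable {I J : Type*} {H' H H'' : I → Type*} {K : J → Type*} {K' : I → Type*}
  [∀ i, NormedAddCommGroup (H i)] [∀ i, InnerProductSpace ℂ (H i)] [∀ i, CompleteSpace (H i)]
  [∀ i, NormedAddCommGroup (H' i)] [∀ i, InnerProductSpace ℂ (H' i)] [∀ i, CompleteSpace (H' i)]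
  [∀ i, NormedAddCommGroup (H'' i)] [∀ i, InnerProductSpace ℂ (H'' i)]
  [∀ i, CompleteSpace (H'' i)]
  [∀ i, NormedAddCommGroup (K' i)] [∀ i, InnerProductSpace ℂ (K' i)] [∀ i, CompleteSpace (K' i)]
  [∀ j, NormedAddCommGroup (K j)] [∀ j, InnerProductSpace ℂ (K j)] [∀ j, CompleteSpace (K j)]

/-- Bounded families of operators `H'_i → H_i`. -/
def Fam (H' H : I → Type*) [∀ i, NormedAddCommGroup (H i)] [∀ i, InnerProductSpace ℂ (H i)]
    [∀ i, NormedAddCommGroup (H' i)] [∀ i, InnerProductSpace ℂ (H' i)] : Type _ :=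
  ↥(lp (fun i => H' i →L[ℂ] H i) ∞)

instance : NormedAddCommGroup (Fam H' H) :=
  inferInstanceAs (NormedAddCommGroup ↥(lp (fun i => H' i →L[ℂ] H i) ∞))

instance : NormedSpace ℂ (Fam H' H) :=
  inferInstanceAs (NormedSpace ℂ ↥(lp (fun i => H' i →L[ℂ] H i) ∞))

instance : CompleteSpace (Fam H' H) :=
  inferInstanceAs (CompleteSpace ↥(lp (fun i => H' i →L[ℂ] H i) ∞))

instance : CoeFun (Fam H' H) (fun _ => ∀ i, H' i →L[ℂ] H i) := ⟨fun x => x.1⟩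

/-- A uniformly bounded family of operators. -/
def famMk (T : ∀ i, H' i →L[ℂ] H i) (C : ℝ) (hC : ∀ i, ‖T i‖ ≤ C) : Fam H' H :=
  ⟨T, memℓp_infty ⟨C, by rintro _ ⟨i, rfl⟩; exact hC i⟩⟩

@[simp] lemma famMk_apply (T : ∀ i, H' i →L[ℂ] H i) (C : ℝ) (hC : ∀ i, ‖T i‖ ≤ C) (i : I) :
    famMk T C hC i = T i := rfl

lemma fam_le (x : Fam H' H) (i : I) : ‖x i‖ ≤ ‖x‖ :=
  lp.norm_apply_le_norm (E := fun i => H' i →L[ℂ] H i) ENNReal.top_ne_zero x i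

lemma fam_norm_le {x : Fam H' H} {C : ℝ} (hC : 0 ≤ C) (h : ∀ i, ‖x i‖ ≤ C) : ‖x‖ ≤ C :=
  lp.norm_le_of_forall_le (E := fun i => H' i →L[ℂ] H i) hC h

lemma fam_norm_le_of_apply {x : Fam H' H} {C : ℝ} (hC : 0 ≤ C)
    (h : ∀ i ξ, ‖x i ξ‖ ≤ C * ‖ξ‖) : ‖x‖ ≤ C :=
  fam_norm_le hC fun i => ContinuousLinearMap.opNorm_le_bound _ hC (h i)

@[simp] lemma Fam.add_apply (x y : Fam H' H) (i : I) : (x + y) i = x i + y i := rfl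
@[simp] lemma Fam.sub_apply (x y : Fam H' H) (i : I) : (x - y) i = x i - y i := rfl
@[simp] lemma Fam.zero_apply (i : I) : (0 : Fam H' H) i = 0 := rfl
@[simp] lemma Fam.smul_apply (k : ℂ) (x : Fam H' H) (i : I) : (k • x) i = k • x i := rfl

lemma fam_ext' {x y : Fam H' H} (h : ∀ i, x i = y i) : x = y := Subtype.ext (funext h)

lemma fam_ext {x y : Fam H' H} (h : ∀ i ξ, x i ξ = y i ξ) : x = y :=
  fam_ext' fun i => ContinuousLinearMap.ext (h i)

/-- Evaluation of a family at an index and a vector. -/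
def evalAt (i : I) (ξ : H' i) : Fam H' H →L[ℂ] H i :=
  LinearMap.mkContinuous
    { toFun := fun x => x i ξ
      map_add' := fun _ _ => rfl
      map_smul' := fun _ _ => rfl } ‖ξ‖ (fun x => by
    rw [mul_comm]; exact (x i).le_of_opNorm_le (fam_le x i) ξ)

@[simp] lemma evalAt_apply (i : I) (ξ : H' i) (x : Fam H' H) : evalAt i ξ x = x i ξ := rfl

lemma integral_fam_apply {Γ : Type*} [MeasurableSpace Γ] {μ : Measure Γ} {F : Γ → Fam H' H}
    (hF : Integrable F μ) (i : I) (ξ : H' i) : (∫ s, F s ∂μ) i ξ = ∫ s, F s i ξ ∂μ :=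
  ((evalAt i ξ).integral_comp_comm hF).symm

/-- Composition of bounded families along a map of index sets. -/
def fcomp (r : J → I) : Fam H' H →L[ℂ] Fam K (fun j => H' (r j)) →L[ℂ] Fam K (fun j => H (r j)) :=
  LinearMap.mkContinuous₂
    (LinearMap.mk₂ ℂ (fun S z => famMk (fun j => (S (r j)).comp (z j)) (‖S‖ * ‖z‖) (fun j =>
      (ContinuousLinearMap.opNorm_comp_le _ _).trans
        (mul_le_mul (fam_le S _) (fam_le z _) (norm_nonneg _) (norm_nonneg _))))
      (fun S T z => fam_ext fun j ξ => rfl)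
      (fun c S z => fam_ext fun j ξ => rfl)
      (fun S y z => fam_ext fun j ξ => map_add (S (r j)) _ _)
      (fun c S z => fam_ext fun j ξ => map_smul (S (r j)) c _)) 1 (fun S z => by
    rw [one_mul]
    exact fam_norm_le (by positivity) fun j =>
      (ContinuousLinearMap.opNorm_comp_le _ _).trans
        (mul_le_mul (fam_le S _) (fam_le z _) (norm_nonneg _) (norm_nonneg _)))

@[simp] lemma fcomp_apply (r : J → I) (S : Fam H' H) (z : Fam K (fun j => H' (r j))) (j : J) :
    fcomp r S z j = (S (r j)).comp (z j) := rfl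

lemma norm_fcomp_le (r : J → I) (S : Fam H' H) (z : Fam K (fun j => H' (r j))) :
    ‖fcomp r S z‖ ≤ ‖S‖ * ‖z‖ :=
  fam_norm_le (by positivity) fun j =>
      (ContinuousLinearMap.opNorm_comp_le _ _).trans
        (mul_le_mul (fam_le S _) (fam_le z _) (norm_nonneg _) (norm_nonneg _))

/-- Componentwise composition of bounded families. -/
def fmul : Fam H' H →L[ℂ] Fam K' H' →L[ℂ] Fam K' H := fcomp id

@[simp] lemma fmul_apply (x : Fam H' H) (z : Fam K' H') (i : I) :
    fmul x z i = (x i).comp (z i) := rfl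

lemma norm_fmul_le (x : Fam H' H) (z : Fam K' H') : ‖fmul x z‖ ≤ ‖x‖ * ‖z‖ := norm_fcomp_le id x z

lemma fmul_assoc (x : Fam H'' H) (y : Fam H' H'') (z : Fam K' H') :
    fmul (fmul x y) z = fmul x (fmul y z) :=
  fam_ext fun _ _ => by simp only [fmul_apply, ContinuousLinearMap.comp_apply]

/-- The family of adjoints. -/
def fadj (x : Fam H' H) : Fam H H' :=
  famMk (fun i => ContinuousLinearMap.adjoint (x i)) ‖x‖ (fun i => by
    rw [LinearIsometryEquiv.norm_map]; exact fam_le x i)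

@[simp] lemma fadj_apply (x : Fam H' H) (i : I) :
    fadj x i = ContinuousLinearMap.adjoint (x i) := rfl

lemma fadj_fadj (x : Fam H' H) : fadj (fadj x) = x :=
  fam_ext' fun i => by simp

lemma fadj_fmul (x : Fam H' H) (z : Fam K' H') : fadj (fmul x z) = fmul (fadj z) (fadj x) :=
  fam_ext' fun _ => ContinuousLinearMap.adjoint_comp _ _

lemma fadj_add (x y : Fam H' H) : fadj (x + y) = fadj x + fadj y :=
  fam_ext' fun i => map_add ContinuousLinearMap.adjoint (x i) (y i)

lemma fadj_smul (c : ℂ) (x : Fam H' H) : fadj (c • x) = conj c • fadj x :=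
  fam_ext' fun i => LinearIsometryEquiv.map_smulₛₗ ContinuousLinearMap.adjoint c (x i)

lemma norm_fadj_le (x : Fam H' H) : ‖fadj x‖ ≤ ‖x‖ :=
  fam_norm_le (norm_nonneg _) fun i => by
    rw [fadj_apply, LinearIsometryEquiv.norm_map]; exact fam_le x i

/-- Taking adjoints, as a continuous conjugate-linear map. -/
def fadjL : Fam H' H →L⋆[ℂ] Fam H H' :=
  LinearMap.mkContinuous
    { toFun := fadj
      map_add' := fadj_add
      map_smul' := fadj_smul } 1 (fun x => by rw [one_mul]; exact norm_fadj_le x)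

lemma continuous_fadj : Continuous (fadj : Fam H' H → Fam H H') := fadjL.continuous

end Fam

lemma isClosed_strongCont {P E F : Type*} [TopologicalSpace P] [NormedAddCommGroup E]
    [NormedSpace ℂ E] [NormedAddCommGroup F] [NormedSpace ℂ F] (U : P → E →L[ℂ] F) (C : ℝ)
    (hU : ∀ s ξ, ‖U s ξ‖ ≤ C * ‖ξ‖) : IsClosed {ξ | Continuous fun s => U s ξ} := by
  rw [← isSeqClosed_iff_isClosed]
  intro x y hx hy
  refine continuous_of_uniform_approx_of_continuous fun v hv => ?_
  obtain ⟨ε, hε, hv⟩ := Metric.mem_uniformity_dist.1 hv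
  have h0 : 0 < ε / (|C| + 1) := by positivity
  obtain ⟨n, hn⟩ := (Metric.tendsto_atTop.1 hy) _ h0
  refine ⟨fun s => U s (x n), hx n, fun s => hv ?_⟩
  rw [dist_eq_norm, ← map_sub]
  have h1 := hn n le_rfl
  rw [dist_comm, dist_eq_norm] at h1
  calc _ ≤ C * ‖y - x n‖ := hU _ _
    _ ≤ (|C| + 1) * ‖y - x n‖ := by gcongr; linarith [le_abs_self C]
    _ < (|C| + 1) * (ε / (|C| + 1)) := by gcongr
    _ = ε := by field_simp

/-! ### Integrated forms -/

/-- Families of representations `ρ_i : Y → B(H'_i, H_i)` and unitary representations `V_i`. -/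
structure Corner (Γ : Type*) [Group Γ] [TopologicalSpace Γ] (Y : Type*) [NormedAddCommGroup Y]
    [NormedSpace ℂ Y] {I : Type*} (H' H : I → Type*) [∀ i, NormedAddCommGroup (H i)]
    [∀ i, InnerProductSpace ℂ (H i)] [∀ i, CompleteSpace (H i)]
    [∀ i, NormedAddCommGroup (H' i)] [∀ i, InnerProductSpace ℂ (H' i)]
    [∀ i, CompleteSpace (H' i)] where
  ρ : ∀ i, Y →ₗ[ℂ] (H' i →L[ℂ] H i)
  V : ∀ i, URep Γ (H' i)
  le : ∀ i y, ‖ρ i y‖ ≤ ‖y‖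

lemma URep.norm_apply {G H : Type*} [Group G] [TopologicalSpace G] [NormedAddCommGroup H]
    [InnerProductSpace ℂ H] [CompleteSpace H] (V : URep G H) (s : G) (ξ : H) :
    ‖(V.U s : H →L[ℂ] H) ξ‖ = ‖ξ‖ :=
  ContinuousLinearMap.norm_map_of_mem_unitary (V.U s).2 ξ

lemma URep.opNorm_le {G H : Type*} [Group G] [TopologicalSpace G] [NormedAddCommGroup H]
    [InnerProductSpace ℂ H] [CompleteSpace H] (V : URep G H) (s : G) :
    ‖(V.U s : H →L[ℂ] H)‖ ≤ 1 :=
  ContinuousLinearMap.opNorm_le_bound _ zero_le_one fun ξ => by rw [V.norm_apply, one_mul]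

lemma URep.mul_apply {G H : Type*} [Group G] [TopologicalSpace G] [NormedAddCommGroup H]
    [InnerProductSpace ℂ H] [CompleteSpace H] (V : URep G H) (s t : G) (ξ : H) :
    (V.U (s * t) : H →L[ℂ] H) ξ = (V.U s : H →L[ℂ] H) ((V.U t : H →L[ℂ] H) ξ) := by
  rw [map_mul]; rfl

lemma URep.inv_apply {G H : Type*} [Group G] [TopologicalSpace G] [NormedAddCommGroup H]
    [InnerProductSpace ℂ H] [CompleteSpace H] (V : URep G H) (s : G) (ξ : H) :
    (V.U s⁻¹ : H →L[ℂ] H) ((V.U s : H →L[ℂ] H) ξ) = ξ := by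
  rw [← V.mul_apply, inv_mul_cancel, map_one]; rfl

lemma URep.apply_inv {G H : Type*} [Group G] [TopologicalSpace G] [NormedAddCommGroup H]
    [InnerProductSpace ℂ H] [CompleteSpace H] (V : URep G H) (s : G) (ξ : H) :
    (V.U s : H →L[ℂ] H) ((V.U s⁻¹ : H →L[ℂ] H) ξ) = ξ := by
  rw [← V.mul_apply, mul_inv_cancel, map_one]; rfl

lemma URep.adjoint_eq {G H : Type*} [Group G] [TopologicalSpace G] [NormedAddCommGroup H]
    [InnerProductSpace ℂ H] [CompleteSpace H] (V : URep G H) (s : G) :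
    ContinuousLinearMap.adjoint (V.U s : H →L[ℂ] H) = (V.U s⁻¹ : H →L[ℂ] H) := by
  rw [map_inv]; rfl

namespace Corner

variable {Γ : Type*} [Group Γ] [TopologicalSpace Γ] [IsTopologicalGroup Γ]
  [MeasurableSpace Γ] [BorelSpace Γ] {Y : Type*} [NormedAddCommGroup Y]
  [NormedSpace ℂ Y] {I : Type*} {H' H : I → Type*} [∀ i, NormedAddCommGroup (H i)]
  [∀ i, InnerProductSpace ℂ (H i)] [∀ i, CompleteSpace (H i)]
  [∀ i, NormedAddCommGroup (H' i)] [∀ i, InnerProductSpace ℂ (H' i)]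
  [∀ i, CompleteSpace (H' i)] (c : Corner Γ Y H' H)
  (μ : Measure Γ) [IsHaarMeasure μ]

/-- `ρ_i` as a bounded map. -/
def ρL (i : I) : Y →L[ℂ] (H' i →L[ℂ] H i) :=
  (c.ρ i).mkContinuous 1 fun y => by rw [one_mul]; exact c.le i y

@[simp] lemma ρL_apply (i : I) (y : Y) : c.ρL i y = c.ρ i y := rfl

/-- The family `(ρ_i(y))`. -/
def ρF : Y →L[ℂ] Fam H' H :=
  LinearMap.mkContinuous
    { toFun := fun y => famMk (fun i => c.ρ i y) ‖y‖ (fun i => c.le i y)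
      map_add' := fun x y => fam_ext' fun i => map_add (c.ρ i) x y
      map_smul' := fun k y => fam_ext' fun i => map_smul (c.ρ i) k y } 1 (fun y => by
    rw [one_mul]
    exact fam_norm_le (norm_nonneg _) fun i => c.le i y)

@[simp] lemma ρF_apply (y : Y) (i : I) : c.ρF y i = c.ρ i y := rfl

/-- The family `(V_i(s))`. -/
def VF (s : Γ) : Fam H' H' := famMk (fun i => ((c.V i).U s : H' i →L[ℂ] H' i)) 1
  (fun i => (c.V i).opNorm_le s)

@[simp] lemma VF_apply (s : Γ) (i : I) : c.VF s i = ((c.V i).U s : H' i →L[ℂ] H' i) := rfl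

lemma norm_VF_le (s : Γ) : ‖c.VF s‖ ≤ 1 :=
  fam_norm_le zero_le_one fun i => (c.V i).opNorm_le s

lemma continuous_integrand (i : I) {f : Γ → Y} (hf : Continuous f) (ξ : H' i) :
    Continuous fun s => c.ρ i (f s) (((c.V i).U s : H' i →L[ℂ] H' i) ξ) :=
  (((c.ρL i).continuous.comp hf)).clm_apply ((c.V i).cont ξ)

lemma hasCompactSupport_integrand (i : I) {f : Γ → Y} (hf : HasCompactSupport f) (ξ : H' i) :
    HasCompactSupport fun s => c.ρ i (f s) (((c.V i).U s : H' i →L[ℂ] H' i) ξ) :=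
  hf.mono fun s hs h => hs (by simp [h])

lemma integrable_integrand (i : I) (f : C_c(Γ, Y)) (ξ : H' i) :
    Integrable (fun s => c.ρ i (f s) (((c.V i).U s : H' i →L[ℂ] H' i) ξ)) μ :=
  (c.continuous_integrand i f.continuous ξ).integrable_of_hasCompactSupport
    (c.hasCompactSupport_integrand i f.hasCompactSupport ξ)

lemma integrable_cc {E : Type*} [NormedAddCommGroup E] (f : C_c(Γ, E)) :
    Integrable (fun s => f s) μ :=
  f.continuous.integrable_of_hasCompactSupport f.hasCompactSupport

lemma norm_integrand (i : I) (f : C_c(Γ, Y)) (ξ : H' i) :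
    ‖∫ s, c.ρ i (f s) (((c.V i).U s : H' i →L[ℂ] H' i) ξ) ∂μ‖ ≤ (∫ s, ‖f s‖ ∂μ) * ‖ξ‖ := by
  rw [← integral_mul_const]
  refine norm_integral_le_of_norm_le ((integrable_cc μ f).norm.mul_const _)
    (.of_forall fun s => ?_)
  refine (ContinuousLinearMap.le_opNorm _ _).trans ?_
  rw [URep.norm_apply]
  gcongr
  exact c.le i _

/-- The integrated form in the `i`-th component. -/
def intOp (i : I) (f : C_c(Γ, Y)) : H' i →L[ℂ] H i :=
  LinearMap.mkContinuous
    { toFun := fun ξ => ∫ s, c.ρ i (f s) (((c.V i).U s : H' i →L[ℂ] H' i) ξ) ∂μ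
      map_add' := fun ξ η => by
        simp only [map_add]
        exact integral_add (c.integrable_integrand μ i f ξ) (c.integrable_integrand μ i f η)
      map_smul' := fun k ξ => by
        simp only [map_smul]
        exact integral_smul _ _ }
    (∫ s, ‖f s‖ ∂μ) (c.norm_integrand μ i f)

lemma norm_intOp_le (i : I) (f : C_c(Γ, Y)) : ‖c.intOp μ i f‖ ≤ ∫ s, ‖f s‖ ∂μ :=
  ContinuousLinearMap.opNorm_le_bound _ (integral_nonneg fun s => norm_nonneg _)
    (c.norm_integrand μ i f)

/-- The integrated form `f ↦ (∫ ρ_i(f(s)) V_i(s) ds)_i`. -/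
def integ : C_c(Γ, Y) →ₗ[ℂ] Fam H' H where
  toFun f := famMk (fun i => c.intOp μ i f) (∫ s, ‖f s‖ ∂μ) (fun i => c.norm_intOp_le μ i f)
  map_add' f g := fam_ext' fun i => by
    ext ξ
    refine Eq.trans ?_ (integral_add (c.integrable_integrand μ i f ξ)
      (c.integrable_integrand μ i g ξ))
    exact integral_congr_ae (.of_forall fun s => by
      simp)
  map_smul' k f := fam_ext' fun i => by
    ext ξ
    refine Eq.trans ?_ (integral_smul (μ := μ) k _)
    exact integral_congr_ae (.of_forall fun s => by simp)

lemma integ_apply (f : C_c(Γ, Y)) (i : I) (ξ : H' i) :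
    c.integ μ f i ξ = ∫ s, c.ρ i (f s) (((c.V i).U s : H' i →L[ℂ] H' i) ξ) ∂μ := rfl

lemma norm_integ_le (f : C_c(Γ, Y)) : ‖c.integ μ f‖ ≤ ∫ s, ‖f s‖ ∂μ :=
  fam_norm_le (integral_nonneg fun s => norm_nonneg _) fun i => c.norm_intOp_le μ i f

/-- The closure of the integrated forms. -/
def cross : Submodule ℂ (Fam H' H) := (LinearMap.range (c.integ μ)).topologicalClosure

lemma isClosed_cross : IsClosed (c.cross μ : Set (Fam H' H)) :=
  Submodule.isClosed_topologicalClosure _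

lemma integ_mem (f : C_c(Γ, Y)) : c.integ μ f ∈ c.cross μ :=
  Submodule.le_topologicalClosure _ ⟨f, rfl⟩

lemma cross_le {M : Submodule ℂ (Fam H' H)} (hM : IsClosed (M : Set (Fam H' H)))
    (h : ∀ f, c.integ μ f ∈ M) : c.cross μ ≤ M :=
  Submodule.topologicalClosure_minimal _ (by rintro _ ⟨f, rfl⟩; exact h f) hM

lemma continuous_integ {P : Type*} [TopologicalSpace P] (f : P → C_c(Γ, Y))
    (hf : Continuous fun p : P × Γ => f p.1 p.2)
    (hK : ∀ p, ∃ N ∈ 𝓝 p, ∃ K : Set Γ, IsCompact K ∧ ∀ p' ∈ N, ∀ s, s ∉ K → f p' s = 0) :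
    Continuous fun p => c.integ μ (f p) := by
  rw [continuous_iff_continuousAt]
  intro p
  obtain ⟨N, hN, K, hKc, hK⟩ := hK p
  rw [ContinuousAt, tendsto_iff_norm_sub_tendsto_zero]
  have h1 : ContinuousOn (fun p' => ∫ s, ‖(f p' - f p) s‖ ∂μ) N := by
    refine continuousOn_integral_of_compact_support hKc (f := fun p' s => ‖(f p' - f p) s‖) ?_ ?_
    · refine Continuous.continuousOn ?_
      exact (hf.sub ((f p).continuous.comp continuous_snd)).norm
    · intro p' s hp' hs
      simp [hK p' hp' s hs, hK p (mem_of_mem_nhds hN) s hs]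
  have h2 := (h1.continuousAt hN).tendsto
  simp only [sub_self, CompactlySupportedContinuousMap.coe_zero, Pi.zero_apply, norm_zero,
    integral_zero] at h2
  refine squeeze_zero (fun _ => norm_nonneg _) (fun p' => ?_) h2
  rw [← map_sub]
  exact c.norm_integ_le μ _

/-- The elementary tensor `h ⊗ y`. -/
def tens (h : C_c(Γ, ℂ)) (y : Y) : C_c(Γ, Y) :=
  ⟨⟨fun s => h s • y, h.continuous.smul continuous_const⟩,
    h.hasCompactSupport.mono fun s hs h' => hs (by simp [h'])⟩

@[simp] lemma tens_apply (h : C_c(Γ, ℂ)) (y : Y) (s : Γ) : tens h y s = h s • y := rfl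

lemma exists_approx_tens [T2Space Γ] [LocallyCompactSpace Γ] (f : C_c(Γ, Y)) {ε : ℝ} (hε : 0 < ε) :
    ∃ g ∈ Submodule.span ℂ {g | ∃ (h : C_c(Γ, ℂ)) (y : Y), g = tens h y},
      ∫ s, ‖f s - g s‖ ∂μ < ε := by
  obtain ⟨K, hK, hfK⟩ := exists_compact_superset f.hasCompactSupport.isCompact
  obtain ⟨δ, hδ, hδε⟩ : ∃ δ > 0, δ * (μ.real K + 1) ≤ ε / 2 :=
    ⟨ε / 2 / (μ.real K + 1), by positivity, by field_simp; rfl⟩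
  let W : Γ → Set Γ := fun x => {s | ‖f s - f x‖ < δ} ∩ interior K
  have hW : ∀ x, IsOpen (W x) := fun x =>
    (isOpen_lt (f.continuous.sub continuous_const).norm continuous_const).inter isOpen_interior
  obtain ⟨t, ht⟩ := f.hasCompactSupport.isCompact.elim_finite_subcover W hW (fun x hx =>
    Set.mem_iUnion.2 ⟨x, by simpa using hδ, hfK hx⟩)
  let e := t.equivFin.symm
  obtain ⟨p, hp1, hp2, hp3, hp4⟩ := exists_continuous_sum_one_of_isOpen_isCompact
    (s := fun n : Fin t.card => W (e n)) (fun n => hW _) f.hasCompactSupport.isCompact (by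
      intro x hx
      obtain ⟨y, hy, hxy⟩ := Set.mem_iUnion₂.1 (ht hx)
      refine Set.mem_iUnion.2 ⟨t.equivFin ⟨y, hy⟩, ?_⟩
      simpa [e] using hxy)
  let S : Γ → ℝ := fun s => max 1 (∑ n, p n s)
  have hS : Continuous S := continuous_const.max (continuous_finsetSum _ fun n _ => (p n).continuous)
  have hS1 : ∀ s, 1 ≤ S s := fun s => le_max_left _ _
  have hS0 : ∀ s, 0 < S s := fun s => one_pos.trans_le (hS1 s)
  let h : Fin t.card → C_c(Γ, ℂ) := fun n =>
    ⟨⟨fun s => ((p n s / S s : ℝ) : ℂ), Complex.continuous_ofReal.comp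
      ((p n).continuous.div hS fun s => (hS0 s).ne')⟩, (hp4 n).mono fun s hs h' => hs (by simp [h'])⟩
  have hh : ∀ n s, h n s = ((p n s / S s : ℝ) : ℂ) := fun n s => rfl
  refine ⟨∑ n, tens (h n) (f (e n)), Submodule.sum_mem _ fun n _ =>
    Submodule.subset_span ⟨_, _, rfl⟩, ?_⟩
  have hval : ∀ s, (∑ n, tens (h n) (f (e n))) s = ∑ n, h n s • f (e n) := fun s => by
    rw [CompactlySupportedContinuousMap.sum_apply]; rfl
  have hmul : ∀ s, f s = ∑ n, h n s • f s := by
    intro s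
    by_cases hs : f s = 0
    · simp [hs]
    · have h1 : ∑ n, p n s = 1 := by
        have := hp2 (subset_tsupport _ hs)
        simpa using this
      have h2 : S s = 1 := by simp [S, h1]
      rw [← Finset.sum_smul]
      have : ∑ n, h n s = 1 := by
        simp only [hh, h2, div_one]
        rw [← Complex.ofReal_sum, h1, Complex.ofReal_one]
      rw [this, one_smul]
  have hb : ∀ s, ‖f s - (∑ n, tens (h n) (f (e n))) s‖ ≤ K.indicator (fun _ => δ) s := by
    intro s
    rw [hval]
    conv_lhs => rw [hmul s, ← Finset.sum_sub_distrib]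
    have hterm : ∀ n, ‖h n s • f s - h n s • f (e n)‖ ≤ p n s / S s * δ := by
      intro n
      rw [← smul_sub, norm_smul, hh, Complex.norm_real, Real.norm_of_nonneg
        (div_nonneg (hp3 n s).1 (hS0 s).le)]
      by_cases hs : p n s = 0
      · simp [hs]
      · have := (hp1 n (subset_tsupport _ hs)).1
        have h0 := div_nonneg (hp3 n s).1 (hS0 s).le
        gcongr
        exact le_of_lt this
    by_cases hs : s ∈ K
    · rw [Set.indicator_of_mem hs]
      calc _ ≤ ∑ n, p n s / S s * δ := norm_sum_le_of_le _ fun n _ => hterm n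
        _ = (∑ n, p n s) / S s * δ := by rw [← Finset.sum_mul, Finset.sum_div]
        _ ≤ 1 * δ := by
          gcongr
          exact div_le_one_of_le₀ (le_max_right _ _) (hS0 s).le
        _ = δ := one_mul _
    · rw [Set.indicator_of_notMem hs]
      have h0 : ∀ n, h n s = 0 := fun n => by
        have : p n s = 0 := by
          by_contra hne
          exact hs (interior_subset (hp1 n (subset_tsupport _ hne)).2)
        simp [hh, this]
      simp [h0]
  calc ∫ s, ‖f s - (∑ n, tens (h n) (f (e n))) s‖ ∂μ ≤ ∫ s, K.indicator (fun _ => δ) s ∂μ := by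
        refine integral_mono_of_nonneg (.of_forall fun s => norm_nonneg _) ?_ (.of_forall hb)
        rw [integrable_indicator_iff hK.measurableSet]
        exact integrableOn_const hK.measure_lt_top.ne
    _ = μ.real K * δ := by
        rw [integral_indicator hK.measurableSet]; simp
    _ < ε := by
        have : 0 ≤ μ.real K := measureReal_nonneg
        nlinarith

lemma cross_le_of_tens [T2Space Γ] [LocallyCompactSpace Γ] {M : Submodule ℂ (Fam H' H)}
    (hM : IsClosed (M : Set (Fam H' H))) (h : ∀ g y, c.integ μ (tens g y) ∈ M) :
    c.cross μ ≤ M := by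
  refine c.cross_le μ hM fun f => ?_
  change c.integ μ f ∈ (M : Set (Fam H' H))
  rw [← hM.closure_eq, Metric.mem_closure_iff]
  intro ε hε
  obtain ⟨g, hg, hgf⟩ := exists_approx_tens μ f hε
  refine ⟨c.integ μ g, ?_, ?_⟩
  · change c.integ μ g ∈ M
    have : Submodule.span ℂ {g | ∃ (h : C_c(Γ, ℂ)) (y : Y), g = tens h y} ≤
        M.comap (c.integ μ) := Submodule.span_le.2 (by
      rintro _ ⟨h', y, rfl⟩; exact h h' y)
    exact this hg
  · rw [dist_eq_norm, ← map_sub]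
    exact (c.norm_integ_le μ _).trans_lt hgf

end Corner

/-! ### Haar measure -/

section Haar

variable {Γ : Type*} [Group Γ] [TopologicalSpace Γ] [IsTopologicalGroup Γ]
  [LocallyCompactSpace Γ] [MeasurableSpace Γ] [BorelSpace Γ] (μ : Measure Γ) [IsHaarMeasure μ]
  [Regular μ]

lemma integral_mul_right_modular {E : Type*} [NormedAddCommGroup E] [NormedSpace ℝ E] (f : Γ → E)
    (s : Γ) : ∫ t, f (t * s) ∂μ = (modularCharacterFun s : ℝ) • ∫ t, f t ∂μ := by
  have := integral_map_equiv (μ := μ) (MeasurableEquiv.mulRight s) f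
  rw [MeasurableEquiv.coe_mulRight, map_mul_right_haar, integral_smul_nnreal_measure] at this
  exact this.symm

lemma modular_inv (s : Γ) :
    (modularCharacterFun s⁻¹ : ℝ) = (modularCharacterFun s : ℝ)⁻¹ := by
  refine eq_inv_of_mul_eq_one_left ?_
  rw [← NNReal.coe_mul, ← modularCharacterFun_map_mul, inv_mul_cancel,
    modularCharacterFun_map_one, NNReal.coe_one]

lemma modular_pos (s : Γ) : 0 < (modularCharacterFun s : ℝ) := modularCharacterFun_pos s

lemma integral_inv_modular_real {f : Γ → ℝ} (hf : Continuous f) (hc : HasCompactSupport f) :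
    ∫ s, f s⁻¹ * (modularCharacterFun s : ℝ) ∂μ = ∫ s, f s ∂μ := by
  obtain ⟨⟨g, g_cont⟩, g_comp, g_nonneg, g_one⟩ :
    ∃ g : C(Γ, ℝ), HasCompactSupport g ∧ 0 ≤ g ∧ g 1 ≠ 0 := exists_continuous_nonneg_pos 1
  have hpos : 0 < ∫ x, g x ∂μ :=
    g_cont.integral_pos_of_hasCompactSupport_nonneg_nonzero g_comp g_nonneg g_one
  have h1 := integral_isMulLeftInvariant_isMulRightInvariant_combo (μ := μ) (ν := μ.inv) hf hc
    g_cont g_comp g_nonneg g_one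
  have h2 : ∀ y, ∫ z, g (z⁻¹ * y) ∂μ.inv = (modularCharacterFun y : ℝ) * ∫ x, g x ∂μ := by
    intro y
    have := integral_map_equiv (μ := μ) (MeasurableEquiv.inv Γ) (fun z => g (z⁻¹ * y))
    rw [Measure.inv]
    refine this.trans ?_
    simpa using integral_mul_right_modular μ g y
  have h3 := integral_map_equiv (μ := μ) (MeasurableEquiv.inv Γ)
    (fun y => f y * ((modularCharacterFun y : ℝ) * ∫ x, g x ∂μ)⁻¹)
  simp only [h2] at h1
  rw [h1, Measure.inv, ← integral_mul_const]
  have h4 := integral_map_equiv (μ := μ) (MeasurableEquiv.inv Γ)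
    (fun y => f y * ((modularCharacterFun y : ℝ) * ∫ x, g x ∂μ)⁻¹ * ∫ x, g x ∂μ)
  refine Eq.trans ?_ h4.symm
  refine integral_congr_ae (.of_forall fun s => ?_)
  simp only [MeasurableEquiv.inv_apply, modular_inv]
  have := (modular_pos s).ne'
  field_simp

lemma integral_inv_modular {f : Γ → ℂ} (hf : Continuous f) (hc : HasCompactSupport f) :
    ∫ s, (modularCharacterFun s : ℂ) * f s⁻¹ ∂μ = ∫ s, f s ∂μ := by
  have hi : Integrable f μ := hf.integrable_of_hasCompactSupport hc
  have hre := integral_inv_modular_real μ (Complex.continuous_re.comp hf)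
    (hc.comp_left (g := Complex.re) rfl)
  have him := integral_inv_modular_real μ (Complex.continuous_im.comp hf)
    (hc.comp_left (g := Complex.im) rfl)
  have hc' : HasCompactSupport fun s => f s⁻¹ := hc.comp_homeomorph (Homeomorph.inv Γ)
  have hi' : Integrable (fun s => (modularCharacterFun s : ℂ) * f s⁻¹) μ := by
    refine Continuous.integrable_of_hasCompactSupport ?_
      (hc'.mono fun s hs h => hs (by simp [h]))
    exact (Complex.continuous_ofReal.comp continuous_modular).mul (hf.comp continuous_inv)
  refine Complex.ext ?_ ?_
  · refine (integral_re hi').symm.trans (.trans ?_ (integral_re hi))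
    refine Eq.trans ?_ hre
    refine integral_congr_ae (.of_forall fun s => ?_)
    simp [mul_comm]
  · refine (integral_im hi').symm.trans (.trans ?_ (integral_im hi))
    refine Eq.trans ?_ him
    refine integral_congr_ae (.of_forall fun s => ?_)
    simp [mul_comm]

lemma exists_bump [T2Space Γ] {E : Type*} [NormedAddCommGroup E] [NormedSpace ℂ E]
    [CompleteSpace E] {F : Γ → E} (hF : Continuous F) {U : Set Γ} (hU : U ∈ 𝓝 (1 : Γ)) {ε : ℝ}
    (hε : 0 < ε) :
    ∃ h : C_c(Γ, ℂ), (∫ s, ‖h s‖ ∂μ) = 1 ∧ (∀ s, s ∉ U → h s = 0) ∧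
      ‖(∫ s, h s • F s ∂μ) - F 1‖ ≤ ε := by
  have hN : U ∩ {s | ‖F s - F 1‖ < ε} ∈ 𝓝 (1 : Γ) := by
    refine inter_mem hU ?_
    exact (isOpen_lt (hF.sub continuous_const).norm continuous_const).mem_nhds (by simpa using hε)
  obtain ⟨g, hg1, hg0, hgc, hgI⟩ := exists_continuous_one_zero_of_isCompact
    (isCompact_singleton (x := (1 : Γ))) (isOpen_interior (s := U ∩ {s | ‖F s - F 1‖ < ε})).isClosed_compl
    (Set.disjoint_compl_right_iff_subset.2 (by
      simpa using mem_interior_iff_mem_nhds.2 hN))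
  have hpos : 0 < ∫ x, g x ∂μ :=
    g.continuous.integral_pos_of_hasCompactSupport_nonneg_nonzero hgc (fun x => (hgI x).1)
      (x := 1) (by rw [hg1 (Set.mem_singleton 1)]; simp)
  set c := ∫ x, g x ∂μ
  have hgi : Integrable (fun s => g s) μ := g.continuous.integrable_of_hasCompactSupport hgc
  let h : C_c(Γ, ℂ) := ⟨⟨fun s => ((g s / c : ℝ) : ℂ), by fun_prop⟩,
    hgc.mono fun s hs h' => hs (by simp [h'])⟩
  have hh : ∀ s, h s = ((g s / c : ℝ) : ℂ) := fun s => rfl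
  have hn : ∀ s, ‖h s‖ = g s / c := fun s => by
    rw [hh, Complex.norm_real, Real.norm_of_nonneg (div_nonneg (hgI s).1 hpos.le)]
  have h1 : ∫ s, ‖h s‖ ∂μ = 1 := by
    simp only [hn]
    rw [integral_div, div_self hpos.ne']
  have h1' : ∫ s, h s ∂μ = 1 := by
    have : ∫ s, h s ∂μ = ((∫ s, ‖h s‖ ∂μ : ℝ) : ℂ) := by
      rw [integral_congr_ae (.of_forall hn)]
      exact integral_ofReal (𝕜 := ℂ)
    rw [this, h1, Complex.ofReal_one]
  have h0 : ∀ s, s ∉ U ∩ {s | ‖F s - F 1‖ < ε} → h s = 0 := fun s hs => by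
    have : g s = 0 := hg0 (fun hi => hs (interior_subset hi))
    simp [hh, this]
  refine ⟨h, h1, fun s hs => h0 s fun h => hs h.1, ?_⟩
  have hi : Integrable (fun s => h s) μ := h.continuous.integrable_of_hasCompactSupport
    h.hasCompactSupport
  have hi2 : Integrable (fun s => h s • F s) μ :=
    (h.continuous.smul hF).integrable_of_hasCompactSupport
      (h.hasCompactSupport.mono fun s hs h' => hs (by simp [h']))
  have : (∫ s, h s • F s ∂μ) - F 1 = ∫ s, h s • (F s - F 1) ∂μ := by
    simp only [smul_sub]
    rw [integral_sub hi2 (hi.smul_const _), integral_smul_const, h1', one_smul]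
  rw [this]
  calc _ ≤ ∫ s, ‖h s‖ * ε ∂μ := by
        refine norm_integral_le_of_norm_le (hi.norm.mul_const _) (.of_forall fun s => ?_)
        rw [norm_smul]
        by_cases hs : s ∈ U ∩ {s | ‖F s - F 1‖ < ε}
        · gcongr; exact hs.2.le
        · simp [h0 s hs]
    _ = ε := by rw [integral_mul_const, h1, one_mul]

end Haar

lemma integral_mem_of_isClosed {Γ : Type*} [MeasurableSpace Γ] {μ : Measure Γ} {E : Type*}
    [NormedAddCommGroup E] [NormedSpace ℂ E] [CompleteSpace E] {M : Submodule ℂ E}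
    (hM : IsClosed (M : Set E)) {F : Γ → E} (hF : ∀ s, F s ∈ M) : ∫ s, F s ∂μ ∈ M := by
  by_cases hi : Integrable F μ
  · have : IsClosed (M : Set E) := hM
    have h := M.mkQL.integral_comp_comm hi
    have h0 : ∀ s, M.mkQL (F s) = 0 := fun s => (Submodule.Quotient.mk_eq_zero M).2 (hF s)
    simp only [h0, integral_zero] at h
    exact (Submodule.Quotient.mk_eq_zero M).1 h.symm
  · rw [integral_undef hi]; exact zero_mem M

namespace Corner

variable {Γ : Type*} [Group Γ] [TopologicalSpace Γ] [IsTopologicalGroup Γ]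
  [MeasurableSpace Γ] [BorelSpace Γ] {Y : Type*} [NormedAddCommGroup Y]
  [NormedSpace ℂ Y] {I : Type*} {H' H : I → Type*} [∀ i, NormedAddCommGroup (H i)]
  [∀ i, InnerProductSpace ℂ (H i)] [∀ i, CompleteSpace (H i)]
  [∀ i, NormedAddCommGroup (H' i)] [∀ i, InnerProductSpace ℂ (H' i)]
  [∀ i, CompleteSpace (H' i)] (c : Corner Γ Y H' H)
  (μ : Measure Γ) [IsHaarMeasure μ]

section Comp

variable {J : Type*} (r : J → I) {K : J → Type*} [∀ j, NormedAddCommGroup (K j)]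
  [∀ j, InnerProductSpace ℂ (K j)] [∀ j, CompleteSpace (K j)]

lemma integrable_fcomp (f : C_c(Γ, Y)) {z : Fam K (fun j => H' (r j))}
    (hz : Continuous fun s => fcomp r (c.VF s) z) :
    Integrable (fun s => fcomp r (c.ρF (f s)) (fcomp r (c.VF s) z)) μ := by
  refine Continuous.integrable_of_hasCompactSupport ?_
    (f.hasCompactSupport.mono fun s hs h => hs ?_)
  · exact ((fcomp (K := K) r).continuous.comp (c.ρF.continuous.comp f.continuous)).clm_apply hz
  · simp only [h, map_zero]
    exact map_zero ((fcomp (H' := H') (H := H) (K := K) r).flip (fcomp r (c.VF s) z))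

lemma fcomp_integ (f : C_c(Γ, Y)) {z : Fam K (fun j => H' (r j))}
    (hz : Continuous fun s => fcomp r (c.VF s) z) :
    fcomp r (c.integ μ f) z = ∫ s, fcomp r (c.ρF (f s)) (fcomp r (c.VF s) z) ∂μ :=
  fam_ext fun j ξ => by
    rw [integral_fam_apply (c.integrable_fcomp μ r f hz)]; rfl

lemma fcomp_mem {M : Submodule ℂ (Fam K (fun j => H (r j)))}
    (hM : IsClosed (M : Set (Fam K (fun j => H (r j))))) {z : Fam K (fun j => H' (r j))}
    (hz : Continuous fun s => fcomp r (c.VF s) z)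
    (h : ∀ y s, fcomp r (c.ρF y) (fcomp r (c.VF s) z) ∈ M) {x : Fam H' H}
    (hx : x ∈ c.cross μ) : fcomp r x z ∈ M := by
  let T : Fam H' H →L[ℂ] Fam K (fun j => H (r j)) := (fcomp r).flip z
  have : c.cross μ ≤ M.comap (T : Fam H' H →ₗ[ℂ] Fam K (fun j => H (r j))) :=
    c.cross_le μ (hM.preimage T.continuous) fun f => by
      change fcomp r (c.integ μ f) z ∈ M
      rw [c.fcomp_integ μ r f hz]
      exact integral_mem_of_isClosed hM fun s => h _ _
  exact this hx

end Comp

/-- The unitary representations alone, as a corner over `ℂ`. -/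
def scal : Corner Γ ℂ H' H' where
  ρ _ := LinearMap.toSpanSingleton ℂ _ 1
  V := c.V
  le i y := by
    refine (norm_smul_le y (1 : H' i →L[ℂ] H' i)).trans ?_
    have : ‖(1 : H' i →L[ℂ] H' i)‖ ≤ 1 := ContinuousLinearMap.norm_id_le
    nlinarith [norm_nonneg y]

@[simp] lemma scal_VF (s : Γ) : c.scal.VF s = c.VF s := rfl

lemma integ_tens (h : C_c(Γ, ℂ)) (y : Y) :
    c.integ μ (tens h y) = fmul (c.ρF y) (c.scal.integ μ h) :=
  fam_ext fun i ξ => by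
    change _ = c.ρ i y (∫ s, (h s • (1 : H' i →L[ℂ] H' i)) (((c.V i).U s : H' i →L[ℂ] H' i) ξ) ∂μ)
    refine Eq.trans ?_ (ContinuousLinearMap.integral_comp_comm (c.ρ i y)
      (c.scal.integrable_integrand μ i h ξ))
    refine integral_congr_ae (.of_forall fun s => ?_)
    change c.ρ i (h s • y) _ = c.ρ i y ((h s • (1 : H' i →L[ℂ] H' i)) _)
    simp

open scoped Pointwise

variable [LocallyCompactSpace Γ] [T2Space Γ] [Regular μ]

lemma exists_scal_approx {J : Type*} (r : J → I) {K : J → Type*} [∀ j, NormedAddCommGroup (K j)]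
    [∀ j, InnerProductSpace ℂ (K j)] [∀ j, CompleteSpace (K j)] {z : Fam K (fun j => H' (r j))}
    (hz : Continuous fun s => fcomp r (c.VF s) z) {U : Set Γ} (hU : U ∈ 𝓝 (1 : Γ)) {ε : ℝ}
    (hε : 0 < ε) : ∃ h : C_c(Γ, ℂ), (∀ s, s ∉ U → h s = 0) ∧
      ‖fcomp r (c.scal.integ μ h) z - z‖ ≤ ε := by
  obtain ⟨h, -, h2, h3⟩ := exists_bump μ hz hU hε
  refine ⟨h, h2, ?_⟩
  have h1 : fcomp r (c.VF 1) z = z := fam_ext (H := fun j => H' (r j)) fun j ξ => by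
    change ((c.V (r j)).U 1 : H' (r j) →L[ℂ] H' (r j)) (z j ξ) = _
    rw [map_one]; rfl
  rw [h1] at h3
  rw [c.scal.fcomp_integ μ r h hz]
  convert h3 using 3
  refine integral_congr_ae (.of_forall fun s => fam_ext fun j ξ => ?_)
  change (h s • (1 : H' (r j) →L[ℂ] H' (r j))) _ = _
  simp

/-- The function `s ↦ m(s) f(s⁻¹)`. -/
def flip {E : Type*} [NormedAddCommGroup E] [NormedSpace ℂ E] (f : C_c(Γ, E)) : C_c(Γ, E) :=
  ⟨⟨fun s => (modularCharacterFun s : ℂ) • f s⁻¹,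
    (Complex.continuous_ofReal.comp continuous_modular).smul (f.continuous.comp continuous_inv)⟩,
    (f.hasCompactSupport.comp_homeomorph (Homeomorph.inv Γ)).mono fun s hs h => hs (by
      simp only [Function.comp_apply, Homeomorph.coe_inv] at h
      simp [h])⟩

lemma flip_apply {E : Type*} [NormedAddCommGroup E] [NormedSpace ℂ E] (f : C_c(Γ, E)) (s : Γ) :
    flip f s = (modularCharacterFun s : ℂ) • f s⁻¹ := rfl

lemma integ_flip (f : C_c(Γ, Y)) (i : I) (ξ : H' i) : c.integ μ (flip f) i ξ =
    ∫ s, c.ρ i (f s) (((c.V i).U s⁻¹ : H' i →L[ℂ] H' i) ξ) ∂μ := by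
  refine ext_inner_left ℂ fun v => ?_
  have hc : Continuous fun s => c.ρ i (f s) (((c.V i).U s⁻¹ : H' i →L[ℂ] H' i) ξ) :=
    ((c.ρL i).continuous.comp f.continuous).clm_apply (((c.V i).cont ξ).comp continuous_inv)
  have hs : HasCompactSupport fun s => c.ρ i (f s) (((c.V i).U s⁻¹ : H' i →L[ℂ] H' i) ξ) :=
    f.hasCompactSupport.mono fun s hs h => hs (by simp [h])
  rw [integ_apply, ← integral_inner (c.integrable_integrand μ i (flip f) ξ),
    ← integral_inner (hc.integrable_of_hasCompactSupport hs),
    ← integral_inv_modular μ (f := fun s => inner ℂ v (c.ρ i (f s) _))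
      (continuous_const.inner hc) (hs.mono fun s hs h => hs (by simp only at h; simp only [h, inner_zero_right]))]
  refine integral_congr_ae (.of_forall fun s => ?_)
  simp only [flip_apply, map_smul, inv_inv]
  exact inner_smul_right _ _ _

/-- The function `s ↦ m(t) f(s t⁻¹)`. -/
def rtrans (t : Γ) (f : C_c(Γ, Y)) : C_c(Γ, Y) :=
  ⟨⟨fun s => (modularCharacterFun t : ℂ) • f (s * t⁻¹),
    continuous_const.smul (f.continuous.comp (continuous_mul_const _))⟩,
    (f.hasCompactSupport.comp_homeomorph (Homeomorph.mulRight t⁻¹)).mono fun s hs h => hs (by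
      simp only [Function.comp_apply, Homeomorph.coe_mulRight] at h
      simp [h])⟩

lemma rtrans_apply (t : Γ) (f : C_c(Γ, Y)) (s : Γ) :
    rtrans t f s = (modularCharacterFun t : ℂ) • f (s * t⁻¹) := rfl

lemma integ_mul_VF (f : C_c(Γ, Y)) (t : Γ) :
    fmul (c.integ μ f) (c.VF t) = c.integ μ (rtrans t f) :=
  fam_ext fun i ξ => by
    have := integral_mul_right_modular μ
      (fun s => c.ρ i (f (s * t⁻¹)) (((c.V i).U s : H' i →L[ℂ] H' i) ξ)) t
    simp only [mul_inv_cancel_right, URep.mul_apply] at this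
    refine this.trans ?_
    rw [integ_apply, ← integral_smul]
    refine integral_congr_ae (.of_forall fun s => ?_)
    simp only [rtrans_apply, map_smul]
    rfl

lemma continuous_mul_VF {x : Fam H' H} (hx : x ∈ c.cross μ) :
    Continuous fun t => fmul x (c.VF t) := by
  let M : Submodule ℂ (Fam H' H) :=
    { carrier := {x | Continuous fun t => fmul x (c.VF t)}
      add_mem' := fun {x y} hx hy => by
        simp only [Set.mem_ofPred_eq, map_add] at *
        exact hx.add hy
      zero_mem' := by
        simp only [Set.mem_ofPred_eq, map_zero]
        exact continuous_const
      smul_mem' := fun k x hx => by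
        simp only [Set.mem_ofPred_eq, map_smul] at *
        exact hx.const_smul k }
  have hM : IsClosed (M : Set (Fam H' H)) :=
    isClosed_strongCont (fun t => (fmul (H := H)).flip (c.VF t)) 1 (fun t x => by
      refine (norm_fmul_le x (c.VF t)).trans ?_
      rw [mul_comm]
      gcongr
      exact c.norm_VF_le t)
  refine c.cross_le μ hM (fun f => ?_) hx
  change Continuous fun t => fmul (c.integ μ f) (c.VF t)
  simp only [integ_mul_VF]
  refine c.continuous_integ μ _ ?_ fun t => ?_
  · change Continuous fun p : Γ × Γ => (modularCharacterFun p.1 : ℂ) • f (p.2 * p.1⁻¹)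
    exact (Complex.continuous_ofReal.comp (continuous_modular.comp continuous_fst)).smul
      (f.continuous.comp (by fun_prop))
  · obtain ⟨N, hNc, hN⟩ := exists_compact_mem_nhds t
    refine ⟨N, hN, tsupport f * N, f.hasCompactSupport.isCompact.mul hNc, fun t' ht' s hs => ?_⟩
    rw [rtrans_apply, image_eq_zero_of_notMem_tsupport (f := f), smul_zero]
    intro h
    exact hs ⟨_, h, t', ht', by simp⟩

lemma mul_VF_mem {x : Fam H' H} (hx : x ∈ c.cross μ) (t : Γ) : fmul x (c.VF t) ∈ c.cross μ := by
  let T : Fam H' H →L[ℂ] Fam H' H := (fmul (H := H) (K' := H')).flip (c.VF t)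
  have : c.cross μ ≤ (c.cross μ).comap (T : Fam H' H →ₗ[ℂ] Fam H' H) :=
    c.cross_le μ ((c.isClosed_cross μ).preimage T.continuous) fun f => by
      change fmul (c.integ μ f) (c.VF t) ∈ c.cross μ
      rw [integ_mul_VF]; exact c.integ_mem μ _
  exact this hx

end Corner

/-- A corner with unitary representations on the range spaces as well, for which it is covariant. -/
structure CovCorner (Γ : Type*) [Group Γ] [TopologicalSpace Γ] (Y : Type*) [NormedAddCommGroup Y]
    [NormedSpace ℂ Y] {I : Type*} (H' H : I → Type*) [∀ i, NormedAddCommGroup (H i)]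
    [∀ i, InnerProductSpace ℂ (H i)] [∀ i, CompleteSpace (H i)]
    [∀ i, NormedAddCommGroup (H' i)] [∀ i, InnerProductSpace ℂ (H' i)]
    [∀ i, CompleteSpace (H' i)] extends Corner Γ Y H' H where
  U : ∀ i, URep Γ (H i)
  γ : Γ → Y → Y
  γ_zero : ∀ s, γ s 0 = 0
  γ_cont : Continuous fun p : Γ × Y => γ p.1 p.2
  cov : ∀ i s y ξ, ((U i).U s : H i →L[ℂ] H i) (ρ i y ξ) =
    ρ i (γ s y) (((V i).U s : H' i →L[ℂ] H' i) ξ)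

namespace CovCorner

variable {Γ : Type*} [Group Γ] [TopologicalSpace Γ] [IsTopologicalGroup Γ]
  [MeasurableSpace Γ] [BorelSpace Γ] {Y : Type*} [NormedAddCommGroup Y]
  [NormedSpace ℂ Y] {I : Type*} {H' H : I → Type*} [∀ i, NormedAddCommGroup (H i)]
  [∀ i, InnerProductSpace ℂ (H i)] [∀ i, CompleteSpace (H i)]
  [∀ i, NormedAddCommGroup (H' i)] [∀ i, InnerProductSpace ℂ (H' i)]
  [∀ i, CompleteSpace (H' i)] (c : CovCorner Γ Y H' H)
  (μ : Measure Γ) [IsHaarMeasure μ]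

/-- The family `(U_i(s))`. -/
def UF (s : Γ) : Fam H H := famMk (fun i => ((c.U i).U s : H i →L[ℂ] H i)) 1
  (fun i => (c.U i).opNorm_le s)

@[simp] lemma UF_apply (s : Γ) (i : I) : c.UF s i = ((c.U i).U s : H i →L[ℂ] H i) := rfl

lemma norm_UF_le (s : Γ) : ‖c.UF s‖ ≤ 1 :=
  fam_norm_le zero_le_one fun i => (c.U i).opNorm_le s

/-- The function `t ↦ γ_s (f (s⁻¹ t))`. -/
def ltrans (s : Γ) (f : C_c(Γ, Y)) : C_c(Γ, Y) :=
  ⟨⟨fun t => c.γ s (f (s⁻¹ * t)), c.γ_cont.comp (continuous_const.prodMk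
    (f.continuous.comp (continuous_const_mul _)))⟩,
    (f.hasCompactSupport.comp_homeomorph (Homeomorph.mulLeft s⁻¹)).mono fun t ht h => ht (by
      simp only [Function.comp_apply, Homeomorph.coe_mulLeft] at h
      simp [h, c.γ_zero])⟩

lemma ltrans_apply (s : Γ) (f : C_c(Γ, Y)) (t : Γ) : c.ltrans s f t = c.γ s (f (s⁻¹ * t)) := rfl

lemma UF_mul_integ (f : C_c(Γ, Y)) (s : Γ) :
    fmul (c.UF s) (c.integ μ f) = c.integ μ (c.ltrans s f) :=
  fam_ext fun i ξ => by
    change ((c.U i).U s : H i →L[ℂ] H i) (∫ t, c.ρ i (f t) (((c.V i).U t : H' i →L[ℂ] H' i) ξ) ∂μ)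
      = _
    rw [← ContinuousLinearMap.integral_comp_comm _ (c.integrable_integrand μ i f ξ)]
    simp only [c.cov, ← URep.mul_apply]
    rw [c.integ_apply, ← integral_mul_left_eq_self (μ := μ) (fun t => c.ρ i (c.ltrans s f t) _) s]
    refine integral_congr_ae (.of_forall fun t => ?_)
    simp only [ltrans_apply, inv_mul_cancel_left]

open scoped Pointwise

variable [LocallyCompactSpace Γ]

lemma continuous_UF_mul {x : Fam H' H} (hx : x ∈ c.cross μ) :
    Continuous fun t => fmul (c.UF t) x := by
  let M : Submodule ℂ (Fam H' H) :=
    { carrier := {x | Continuous fun t => fmul (c.UF t) x}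
      add_mem' := fun {x y} hx hy => by
        simp only [Set.mem_ofPred_eq, map_add] at *
        exact hx.add hy
      zero_mem' := by
        simp only [Set.mem_ofPred_eq, map_zero]
        exact continuous_const
      smul_mem' := fun k x hx => by
        simp only [Set.mem_ofPred_eq, map_smul] at *
        exact hx.const_smul k }
  have hM : IsClosed (M : Set (Fam H' H)) :=
    isClosed_strongCont (fun t => fmul (c.UF t)) 1 (fun t x => by
      refine (norm_fmul_le _ _).trans ?_
      gcongr
      exact c.norm_UF_le t)
  refine c.cross_le μ hM (fun f => ?_) hx
  change Continuous fun t => fmul (c.UF t) (c.integ μ f)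
  simp only [UF_mul_integ]
  refine c.continuous_integ μ _ ?_ fun t => ?_
  · change Continuous fun p : Γ × Γ => c.γ p.1 (f (p.1⁻¹ * p.2))
    exact c.γ_cont.comp (continuous_fst.prodMk (f.continuous.comp (by fun_prop)))
  · obtain ⟨N, hNc, hN⟩ := exists_compact_mem_nhds t
    refine ⟨N, hN, N * tsupport f, hNc.mul f.hasCompactSupport.isCompact, fun t' ht' s hs => ?_⟩
    rw [ltrans_apply, image_eq_zero_of_notMem_tsupport (f := f), c.γ_zero]
    intro h
    exact hs ⟨t', ht', _, h, by simp⟩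

lemma UF_mul_mem {x : Fam H' H} (hx : x ∈ c.cross μ) (s : Γ) : fmul (c.UF s) x ∈ c.cross μ := by
  let T : Fam H' H →L[ℂ] Fam H' H := fmul (c.UF s)
  have : c.cross μ ≤ (c.cross μ).comap (T : Fam H' H →ₗ[ℂ] Fam H' H) :=
    c.cross_le μ ((c.isClosed_cross μ).preimage T.continuous) fun f => by
      change fmul (c.UF s) (c.integ μ f) ∈ c.cross μ
      rw [UF_mul_integ]; exact c.integ_mem μ _
  exact this hx

end CovCorner

/-! ### Averaging over the circle -/

section Avg

open scoped Pointwise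

variable {G Γ : Type u} [Group G] [TopologicalSpace G] [Group Γ] [TopologicalSpace Γ]
  [IsTopologicalGroup Γ] (σ : Twist G Γ) (χ : Circle →* Circle)

/-- The Borel `σ`-algebra of the circle. -/
@[reducible] def circleBorel : MeasurableSpace Circle := borel Circle

attribute [local instance] circleBorel

lemma circleBorel_borel : BorelSpace Circle := ⟨rfl⟩

attribute [local instance] circleBorel_borel

/-- The normalised Haar measure of the circle. -/
def circleHaar : Measure Circle := haarMeasure ⊤

instance : IsHaarMeasure circleHaar := isHaarMeasure_haarMeasure _

instance : IsProbabilityMeasure circleHaar := ⟨haarMeasure_self⟩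

/-- The function `s ↦ ∫ χ(z) h(s z) dz` for `h ∈ C_c(Γ)`. -/
def avg (hχ : Continuous χ) (h : C_c(Γ, ℂ)) : C_c(Γ, ℂ) :=
  ⟨⟨fun s => ∫ z, (χ z : ℂ) * h (s * σ.ι z) ∂circleHaar, by
    have := σ.ι_cont
    rw [← continuousOn_univ]
    refine continuousOn_integral_of_compact_support isCompact_univ
      (f := fun (s : Γ) (z : Circle) => (χ z : ℂ) * h (s * σ.ι z)) (Continuous.continuousOn ?_)
      (fun _ z _ hz => absurd (Set.mem_univ z) hz)
    exact (continuous_subtype_val.comp (hχ.comp continuous_snd)).mul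
      (h.continuous.comp (by fun_prop))⟩,
    HasCompactSupport.intro (h.hasCompactSupport.isCompact.mul
      (isCompact_range σ.ι_cont)) (fun s hs => by
      have : ∀ z, h (s * σ.ι z) = 0 := fun z => image_eq_zero_of_notMem_tsupport (f := h) fun hz =>
        hs ⟨_, hz, σ.ι z⁻¹, ⟨_, rfl⟩, by simp⟩
      simp [this])⟩

lemma avg_apply (hχ : Continuous χ) (h : C_c(Γ, ℂ)) (s : Γ) :
    avg σ χ hχ h s = ∫ z, (χ z : ℂ) * h (s * σ.ι z) ∂circleHaar := rfl

lemma avg_mul (hχ : Continuous χ) (h : C_c(Γ, ℂ)) (s : Γ) (w : Circle) :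
    avg σ χ hχ h (s * σ.ι w) = conj (χ w : ℂ) * avg σ χ hχ h s := by
  rw [avg_apply, avg_apply,
    ← integral_mul_left_eq_self (μ := circleHaar) (fun z => (χ z : ℂ) * h (s * σ.ι z)) w,
    ← integral_const_mul]
  refine integral_congr_ae (.of_forall fun z => ?_)
  simp only [map_mul, Circle.coe_mul, mul_assoc]
  linear_combination (-(χ z : ℂ) * h (s * (σ.ι w * σ.ι z))) * conj_mul_circle (χ w)

variable [MeasurableSpace Γ] [BorelSpace Γ] {Y : Type*} [NormedAddCommGroup Y]
  [NormedSpace ℂ Y] {I : Type*} {H' H : I → Type*} [∀ i, NormedAddCommGroup (H i)]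
  [∀ i, InnerProductSpace ℂ (H i)] [∀ i, CompleteSpace (H i)]
  [∀ i, NormedAddCommGroup (H' i)] [∀ i, InnerProductSpace ℂ (H' i)]
  [∀ i, CompleteSpace (H' i)] (c : Corner Γ Y H' H)
  (μ : Measure Γ) [IsHaarMeasure μ]

lemma Corner.scal_integ_avg (hχ : Continuous χ)
    (hV : ∀ i z ξ, ((c.V i).U (σ.ι z) : H' i →L[ℂ] H' i) ξ = (χ z : ℂ) • ξ) (h : C_c(Γ, ℂ)) :
    c.scal.integ μ (avg σ χ hχ h) = c.scal.integ μ h := by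
  refine fam_ext fun i ξ => ?_
  let F : Γ → Circle → H' i := fun s z =>
    ((χ z : ℂ) * h (s * σ.ι z)) • ((c.V i).U s : H' i →L[ℂ] H' i) ξ
  have h1 : ∀ z, ∫ s, F s z ∂μ = c.scal.integ μ h i ξ := by
    intro z
    have : c.scal.integ μ h i ξ = ∫ s, h s • ((c.V i).U s : H' i →L[ℂ] H' i) ξ ∂μ := rfl
    rw [this, ← integral_mul_left_eq_self (μ := μ) (fun s => h s • _) (σ.ι z)]
    refine integral_congr_ae (.of_forall fun s => ?_)
    beta_reduce
    rw [σ.central, URep.mul_apply, hV, map_smul, smul_smul, mul_comm (h _)]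
  have h2 : ∀ s, ∫ z, F s z ∂circleHaar =
      avg σ χ hχ h s • ((c.V i).U s : H' i →L[ℂ] H' i) ξ := fun s => by
    rw [avg_apply, ← integral_smul_const]
  have h3 : ∫ s, ∫ z, F s z ∂circleHaar ∂μ = ∫ z, ∫ s, F s z ∂μ ∂circleHaar := by
    refine integral_integral_swap_of_hasCompactSupport ?_ ?_
    · have := σ.ι_cont
      exact ((continuous_subtype_val.comp (hχ.comp continuous_snd)).mul
        (h.continuous.comp (by fun_prop))).smul (((c.V i).cont ξ).comp continuous_fst)
    · refine HasCompactSupport.intro ((h.hasCompactSupport.isCompact.mul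
        (isCompact_range σ.ι_cont)).prod isCompact_univ) ?_
      rintro ⟨s, z⟩ hs
      have : h (s * σ.ι z) = 0 := image_eq_zero_of_notMem_tsupport (f := h) fun hz =>
        hs ⟨⟨_, hz, σ.ι z⁻¹, ⟨_, rfl⟩, by simp⟩, Set.mem_univ _⟩
      simp [F, this]
  simp only [h1, h2, integral_const, probReal_univ, one_smul] at h3
  exact h3

lemma Corner.integ_tens_avg (hχ : Continuous χ)
    (hV : ∀ i z ξ, ((c.V i).U (σ.ι z) : H' i →L[ℂ] H' i) ξ = (χ z : ℂ) • ξ) (h : C_c(Γ, ℂ))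
    (y : Y) : c.integ μ (Corner.tens (avg σ χ hχ h) y) = c.integ μ (Corner.tens h y) := by
  rw [c.integ_tens, c.integ_tens, c.scal_integ_avg σ χ μ hχ hV]

lemma isCcTwisted_tens_avg (hχ : Continuous χ) (h : C_c(Γ, ℂ)) (y : Y) :
    IsCcTwisted σ χ (Corner.tens (avg σ χ hχ h) y) := by
  refine ⟨(Corner.tens _ y).continuous, (Corner.tens _ y).hasCompactSupport, fun z s => ?_⟩
  rw [Corner.tens_apply, Corner.tens_apply, σ.central, avg_mul, mul_smul]

/-- The twisted integrated forms are dense in all integrated forms. -/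
lemma Corner.cross_le_of_twisted [T2Space Γ] [LocallyCompactSpace Γ] (hχ : Continuous χ)
    (hV : ∀ i z ξ, ((c.V i).U (σ.ι z) : H' i →L[ℂ] H' i) ξ = (χ z : ℂ) • ξ)
    {M : Submodule ℂ (Fam H' H)} (hM : IsClosed (M : Set (Fam H' H)))
    (h : ∀ f : C_c(Γ, Y), IsCcTwisted σ χ f → c.integ μ f ∈ M) : c.cross μ ≤ M :=
  c.cross_le_of_tens μ hM fun g y => by
    rw [← c.integ_tens_avg σ χ μ hχ hV]
    exact h _ (isCcTwisted_tens_avg σ χ hχ g y)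

end Avg

section Cross

variable {Γ : Type*} [Group Γ] [TopologicalSpace Γ] [IsTopologicalGroup Γ]
  [MeasurableSpace Γ] [BorelSpace Γ] {Y Y₂ : Type*} [NormedAddCommGroup Y]
  [NormedSpace ℂ Y] [NormedAddCommGroup Y₂] [NormedSpace ℂ Y₂]
  {I J : Type*} {H' H H₂ : I → Type*} [∀ i, NormedAddCommGroup (H i)]
  [∀ i, InnerProductSpace ℂ (H i)] [∀ i, CompleteSpace (H i)]
  [∀ i, NormedAddCommGroup (H' i)] [∀ i, InnerProductSpace ℂ (H' i)]
  [∀ i, CompleteSpace (H' i)] [∀ i, NormedAddCommGroup (H₂ i)]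
  [∀ i, InnerProductSpace ℂ (H₂ i)] [∀ i, CompleteSpace (H₂ i)]

/-- Restriction of a bounded family along a map of index sets. -/
def freindex (r : J → I) : Fam H' H →L[ℂ] Fam (fun j => H' (r j)) (fun j => H (r j)) :=
  LinearMap.mkContinuous
    { toFun := fun x => famMk (fun j => x (r j)) ‖x‖ (fun j => fam_le x _)
      map_add' := fun _ _ => rfl
      map_smul' := fun _ _ => rfl } 1 (fun x => by
    rw [one_mul]; exact fam_norm_le (norm_nonneg _) fun j => fam_le x _)

@[simp] lemma freindex_apply (r : J → I) (x : Fam H' H) (j : J) : freindex r x j = x (r j) := rfl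

namespace Corner

variable (c : Corner Γ Y H' H) (c₂ : Corner Γ Y₂ H' H₂) (μ : Measure Γ) [IsHaarMeasure μ]

/-- Restriction of a corner along a map of index sets. -/
def comap (r : J → I) : Corner Γ Y (fun j => H' (r j)) (fun j => H (r j)) where
  ρ j := c.ρ (r j)
  V j := c.V (r j)
  le j := c.le (r j)

lemma freindex_mem (r : J → I) {x : Fam H' H} (hx : x ∈ c.cross μ) :
    freindex r x ∈ (c.comap r).cross μ := by
  have : c.cross μ ≤ ((c.comap r).cross μ).comap
      (freindex r : Fam H' H →L[ℂ] _).toLinearMap :=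
    c.cross_le μ (((c.comap r).isClosed_cross μ).preimage (freindex r).continuous) fun f =>
      (c.comap r).integ_mem μ f
  exact this hx

/-- Composition of a compactly supported function with a bounded map. -/
def postComp (L : Y →L[ℂ] Y₂) (f : C_c(Γ, Y)) : C_c(Γ, Y₂) :=
  ⟨⟨fun s => L (f s), L.continuous.comp f.continuous⟩,
    f.hasCompactSupport.comp_left (g := L) (map_zero L)⟩

lemma fmul_integ {T : Fam H H₂} {L : Y →L[ℂ] Y₂}
    (hV : ∀ i, c.V i = c₂.V i) (hT : ∀ i y, (T i).comp (c.ρ i y) = c₂.ρ i (L y)) (f : C_c(Γ, Y)) :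
    fmul T (c.integ μ f) = c₂.integ μ (postComp L f) :=
  fam_ext fun i ξ => by
    change T i (∫ s, c.ρ i (f s) (((c.V i).U s : H' i →L[ℂ] H' i) ξ) ∂μ) = _
    rw [← ContinuousLinearMap.integral_comp_comm _ (c.integrable_integrand μ i f ξ),
      c₂.integ_apply]
    refine integral_congr_ae (.of_forall fun s => ?_)
    change ((T i).comp (c.ρ i (f s))) _ = _
    rw [hT, hV]; rfl

lemma fmul_mem {T : Fam H H₂} {L : Y →L[ℂ] Y₂} (hV : ∀ i, c.V i = c₂.V i)
    (hT : ∀ i y, (T i).comp (c.ρ i y) = c₂.ρ i (L y)) {x : Fam H' H} (hx : x ∈ c.cross μ) :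
    fmul T x ∈ c₂.cross μ := by
  let T' : Fam H' H →L[ℂ] Fam H' H₂ := fmul T
  have : c.cross μ ≤ (c₂.cross μ).comap (T' : Fam H' H →ₗ[ℂ] Fam H' H₂) :=
    c.cross_le μ ((c₂.isClosed_cross μ).preimage T'.continuous) fun f => by
      change fmul T (c.integ μ f) ∈ c₂.cross μ
      rw [c.fmul_integ c₂ μ hV hT]; exact c₂.integ_mem μ _
  exact this hx

lemma adjoint_scal_integ (h : C_c(Γ, ℂ)) (i : I) (w : H' i) :
    ContinuousLinearMap.adjoint (c.scal.integ μ h i) w =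
      ∫ s, conj (h s) • ((c.V i).U s⁻¹ : H' i →L[ℂ] H' i) w ∂μ := by
  refine ext_inner_left ℂ fun v => ?_
  have hc : Continuous fun s => conj (h s) • ((c.V i).U s⁻¹ : H' i →L[ℂ] H' i) w :=
    (Complex.continuous_conj.comp h.continuous).smul (((c.V i).cont w).comp continuous_inv)
  have hi := hc.integrable_of_hasCompactSupport (μ := μ)
    (h.hasCompactSupport.mono fun s hs h' => hs (by simp [h']))
  rw [ContinuousLinearMap.adjoint_inner_right, c.scal.integ_apply, ← integral_inner hi]
  have h1 := integral_inner (𝕜 := ℂ) (c.scal.integrable_integrand μ i h v) w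
  rw [← inner_conj_symm, ← h1, ← integral_conj]
  refine integral_congr_ae (.of_forall fun s => ?_)
  change conj (inner ℂ w ((h s • (1 : H' i →L[ℂ] H' i)) (((c.V i).U s : H' i →L[ℂ] H' i) v))) = _
  beta_reduce
  rw [inner_conj_symm, ← URep.adjoint_eq, inner_smul_right,
    ContinuousLinearMap.adjoint_inner_right]
  change inner ℂ (h s • ((c.V i).U s : H' i →L[ℂ] H' i) v) w = _
  rw [inner_smul_left]

end Corner

namespace CovCorner

variable (c : CovCorner Γ Y H' H) (μ : Measure Γ) [IsHaarMeasure μ]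

/-- The unitary representations on the range spaces, as a corner over `ℂ`. -/
def scalU : Corner Γ ℂ H H where
  ρ _ := LinearMap.toSpanSingleton ℂ _ 1
  V := c.U
  le i y := by
    refine (norm_smul_le y (1 : H i →L[ℂ] H i)).trans ?_
    have : ‖(1 : H i →L[ℂ] H i)‖ ≤ 1 := ContinuousLinearMap.norm_id_le
    nlinarith [norm_nonneg y]

/-- The function `s ↦ h̄(s) γ_{s⁻¹} y`. -/
def adjFun (h : C_c(Γ, ℂ)) (y : Y) : C_c(Γ, Y) :=
  ⟨⟨fun s => conj (h s) • c.γ s⁻¹ y, (Complex.continuous_conj.comp h.continuous).smul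
    (c.γ_cont.comp (continuous_inv.prodMk continuous_const))⟩,
    h.hasCompactSupport.mono fun s hs h' => hs (by simp [h'])⟩

variable [LocallyCompactSpace Γ] [T2Space Γ] [Regular μ]

lemma adj_mul_ρF (h : C_c(Γ, ℂ)) (y : Y) :
    fmul (fadj (c.scalU.integ μ h)) (c.ρF y) = c.integ μ (Corner.flip (c.adjFun h y)) :=
  fam_ext fun i ξ => by
    rw [Corner.integ_flip]
    refine (c.scalU.adjoint_scal_integ μ h i (c.ρ i y ξ)).trans ?_
    refine integral_congr_ae (.of_forall fun s => ?_)
    change conj (h s) • ((c.U i).U s⁻¹ : H i →L[ℂ] H i) (c.ρ i y ξ) = c.ρ i (conj (h s) • _) _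
    rw [c.cov, map_smul]; rfl

section Alg

variable {A : Type*} [NonUnitalCStarAlgebra A] (c : CovCorner Γ A H H)

lemma alg_mul_mem (hU : ∀ i, c.U i = c.V i)
    (hmul : ∀ i a b, c.ρ i (a * b) = c.ρ i a * c.ρ i b) {x y : Fam H H}
    (hx : x ∈ c.cross μ) (hy : y ∈ c.cross μ) : fmul x y ∈ c.cross μ := by
  have hUV : ∀ s, c.UF s = c.VF s := fun s => fam_ext' fun i => by
    rw [UF_apply, c.VF_apply, hU]
  have h1 := c.continuous_UF_mul μ hy
  have h2 := c.UF_mul_mem μ hy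
  simp only [hUV] at h1 h2
  exact c.fcomp_mem μ id (c.isClosed_cross μ) h1 (fun a s => c.fmul_mem c.toCorner μ
    (T := c.ρF a) (L := ContinuousLinearMap.mul ℂ A a) (fun i => rfl)
    (fun i b => (hmul i a b).symm) (h2 s)) hx

lemma alg_adj_mem (hU : ∀ i, c.U i = c.V i) (hstar : ∀ i a, c.ρ i (star a) = star (c.ρ i a))
    {x : Fam H H} (hx : x ∈ c.cross μ) : fadj x ∈ c.cross μ := by
  let M : Submodule ℂ (Fam H H) := (c.cross μ).comap fadjL.toLinearMap
  have hM : IsClosed (M : Set (Fam H H)) := (c.isClosed_cross μ).preimage continuous_fadj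
  refine c.cross_le_of_tens μ hM (fun h a => ?_) hx
  change fadj _ ∈ c.cross μ
  have h1 : fadj (c.ρF a) = c.ρF (star a) := fam_ext' fun i => (hstar i a).symm
  have h2 : c.scal.integ μ h = c.scalU.integ μ h := fam_ext fun i ξ => by
    rw [Corner.integ_apply, Corner.integ_apply]
    change ∫ s, (h s • (1 : H i →L[ℂ] H i)) (((c.V i).U s : H i →L[ℂ] H i) ξ) ∂μ =
      ∫ s, (h s • (1 : H i →L[ℂ] H i)) (((c.U i).U s : H i →L[ℂ] H i) ξ) ∂μ
    rw [hU]
  rw [Corner.integ_tens, fadj_fmul, h1, h2, c.adj_mul_ρF μ h (star a)]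
  exact c.integ_mem μ _

end Alg

end CovCorner

end Cross

/-! ### The crossed products as closures of integrated forms -/

section Reps

variable {G Γ : Type u} [Group G] [TopologicalSpace G] [Group Γ] [TopologicalSpace Γ]
  [IsTopologicalGroup Γ] [MeasurableSpace Γ] [BorelSpace Γ]
  {A : Type*} [NonUnitalCStarAlgebra A] (σ : Twist G Γ) (α : Γ → A → A) (χ : Circle →* Circle)

/-- The corner of all covariant representations. -/
def covCor : Corner Γ A (fun i : CovFam σ α χ => i.H) (fun i => i.H) where
  ρ i := repLin i.rep.π
  V i := i.rep.toURep
  le i := NonUnitalStarAlgHom.norm_apply_le i.rep.π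

/-- The corner of all covariant representations, for a continuous action. -/
def covCov (hα : Continuous fun p : Γ × A => α p.1 p.2) (hα0 : ∀ s, α s 0 = 0) :
    CovCorner Γ A (fun i : CovFam σ α χ => i.H) (fun i => i.H) where
  toCorner := covCor σ α χ
  U i := i.rep.toURep
  γ := α
  γ_zero := hα0
  γ_cont := hα
  cov i := i.rep.covariant

/-- The families underlying a `BFam`. -/
def BFam.toFam {I : Type*} {H : I → Type*} [∀ i, NormedAddCommGroup (H i)]
    [∀ i, InnerProductSpace ℂ (H i)] [∀ i, CompleteSpace (H i)] (x : BFam H) : Fam H H := x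

/-- A bounded family of operators as an element of `BFam`. -/
def Fam.toB {I : Type*} {H : I → Type*} [∀ i, NormedAddCommGroup (H i)]
    [∀ i, InnerProductSpace ℂ (H i)] [∀ i, CompleteSpace (H i)] (x : Fam H H) : BFam H := x

end Reps

section BFam

variable {I : Type*} {H : I → Type*} [∀ i, NormedAddCommGroup (H i)]
    [∀ i, InnerProductSpace ℂ (H i)] [∀ i, CompleteSpace (H i)]

@[simp] lemma BFam.toFam_apply (x : BFam H) (i : I) : x.toFam i = x.ap i := rfl
@[simp] lemma Fam.toB_ap (x : Fam H H) (i : I) : x.toB.ap i = x i := rfl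
@[simp] lemma BFam.toFam_toB (x : BFam H) : x.toFam.toB = x := rfl
@[simp] lemma Fam.toB_toFam (x : Fam H H) : x.toB.toFam = x := rfl

lemma BFam.ext {x y : BFam H} (h : ∀ i, x.ap i = y.ap i) : x = y := Subtype.ext (funext h)

@[simp] lemma BFam.mul_ap (x y : BFam H) (i : I) : (x * y).ap i = x.ap i * y.ap i := rfl
@[simp] lemma BFam.star_ap (x : BFam H) (i : I) : (star x).ap i = star (x.ap i) := rfl
@[simp] lemma BFam.add_ap (x y : BFam H) (i : I) : (x + y).ap i = x.ap i + y.ap i := rfl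
@[simp] lemma BFam.sub_ap (x y : BFam H) (i : I) : (x - y).ap i = x.ap i - y.ap i := rfl
@[simp] lemma BFam.smul_ap (k : ℂ) (x : BFam H) (i : I) : (k • x).ap i = k • x.ap i := rfl
@[simp] lemma BFam.zero_ap (i : I) : (0 : BFam H).ap i = 0 := rfl

lemma BFam.norm_ap_le (x : BFam H) (i : I) : ‖x.ap i‖ ≤ ‖x‖ := fam_le x.toFam i

lemma BFam.norm_le {x : BFam H} {C : ℝ} (hC : 0 ≤ C) (h : ∀ i, ‖x.ap i‖ ≤ C) : ‖x‖ ≤ C :=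
  fam_norm_le (x := x.toFam) hC h

lemma BFam.toFam_mul (x y : BFam H) : (x * y).toFam = fmul x.toFam y.toFam := rfl
lemma BFam.toFam_star (x : BFam H) : (star x).toFam = fadj x.toFam := rfl

lemma closedGen_closed {P : Type*} [NonUnitalCStarAlgebra P] (S : Set P) :
    IsClosed (closedGen S : Set P) :=
  NonUnitalStarSubalgebra.isClosed_topologicalClosure _

lemma subset_closedGen {P : Type*} [NonUnitalCStarAlgebra P] (S : Set P) :
    S ⊆ closedGen S := fun _ hx =>
  NonUnitalStarSubalgebra.le_topologicalClosure _ (NonUnitalStarAlgebra.subset_adjoin ℂ S hx)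

lemma closedGen_le {P : Type*} [NonUnitalCStarAlgebra P] {S : Set P}
    {D : NonUnitalStarSubalgebra ℂ P} (hD : IsClosed (D : Set P)) (h : S ⊆ D) :
    closedGen S ≤ D :=
  NonUnitalStarSubalgebra.topologicalClosure_minimal _ (NonUnitalStarAlgebra.adjoin_le h) hD

end BFam

section Mem

variable {G Γ : Type u} [Group G] [TopologicalSpace G] [Group Γ] [TopologicalSpace Γ]
  [IsTopologicalGroup Γ] [MeasurableSpace Γ] [BorelSpace Γ]
  [LocallyCompactSpace Γ] [T2Space Γ] (μ : Measure Γ) [IsHaarMeasure μ] [Regular μ]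
  {A : Type*} [NonUnitalCStarAlgebra A] (σ : Twist G Γ) {α : Γ → A → A} {χ : Circle →* Circle}

lemma covCor_mul_mem (hα : Continuous fun p : Γ × A => α p.1 p.2) (hα0 : ∀ s, α s 0 = 0)
    {x y : Fam (fun i : CovFam σ α χ => i.H) (fun i => i.H)} (hx : x ∈ (covCor σ α χ).cross μ)
    (hy : y ∈ (covCor σ α χ).cross μ) : fmul x y ∈ (covCor σ α χ).cross μ :=
  (covCov σ α χ hα hα0).alg_mul_mem μ (fun _ => rfl) (fun i => map_mul i.rep.π) hx hy

lemma covCor_adj_mem (hα : Continuous fun p : Γ × A => α p.1 p.2) (hα0 : ∀ s, α s 0 = 0)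
    {x : Fam (fun i : CovFam σ α χ => i.H) (fun i => i.H)} (hx : x ∈ (covCor σ α χ).cross μ) :
    fadj x ∈ (covCor σ α χ).cross μ :=
  (covCov σ α χ hα hα0).alg_adj_mem μ (fun _ => rfl) (fun i => map_star i.rep.π) hx

/-- The crossed product consists of the closure of all integrated forms. -/
lemma mem_crossedProduct (hχ : Continuous χ) (hα : Continuous fun p : Γ × A => α p.1 p.2)
    (hα0 : ∀ s, α s 0 = 0) (x : CovFam.Prod σ α χ) :
    x ∈ crossedProduct μ σ α χ ↔ x.toFam ∈ (covCor σ α χ).cross μ := by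
  constructor
  · let D : NonUnitalStarSubalgebra ℂ (CovFam.Prod σ α χ) :=
      { carrier := {x | x.toFam ∈ (covCor σ α χ).cross μ}
        add_mem' := fun ha hb => Submodule.add_mem ((covCor σ α χ).cross μ) ha hb
        zero_mem' := zero_mem ((covCor σ α χ).cross μ)
        mul_mem' := fun ha hb => covCor_mul_mem μ σ hα hα0 ha hb
        smul_mem' := fun k _ ha => Submodule.smul_mem ((covCor σ α χ).cross μ) k ha
        star_mem' := fun ha => covCor_adj_mem μ σ hα hα0 ha }
    have : crossedProduct μ σ α χ ≤ D := by
      refine closedGen_le ((covCor σ α χ).isClosed_cross μ) ?_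
      rintro T ⟨f, ⟨h1, h2, -⟩, hT⟩
      have : T.toFam = (covCor σ α χ).integ μ ⟨⟨f, h1⟩, h2⟩ := fam_ext fun i ξ => hT i ξ
      change T.toFam ∈ _
      rw [this]
      exact (covCor σ α χ).integ_mem μ _
    exact fun h => this h
  · intro h
    let M : Submodule ℂ (Fam (fun i : CovFam σ α χ => i.H) (fun i => i.H)) :=
      (crossedProduct μ σ α χ).toSubmodule
    exact (covCor σ α χ).cross_le_of_twisted σ χ μ hχ (fun i => i.rep.twist) (M := M)
      (closedGen_closed (P := CovFam.Prod σ α χ) _)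
      (fun f hf => subset_closedGen (P := CovFam.Prod σ α χ) _ ⟨f, hf, fun i ξ => rfl⟩) h

end Mem

section GroupAlg

variable {G : Type u} [Group G] [TopologicalSpace G] [IsTopologicalGroup G] [MeasurableSpace G]
  [BorelSpace G] [LocallyCompactSpace G] [T2Space G] (μ : Measure G) [IsHaarMeasure μ] [Regular μ]

variable (G) in
/-- The corner of all unitary representations of `G`. -/
def uCor : CovCorner G ℂ (fun j : URepFam G => j.H) (fun j => j.H) where
  ρ _ := LinearMap.toSpanSingleton ℂ _ 1
  V j := j.rep
  U j := j.rep
  le j y := by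
    refine (norm_smul_le y (1 : j.H →L[ℂ] j.H)).trans ?_
    have : ‖(1 : j.H →L[ℂ] j.H)‖ ≤ 1 := ContinuousLinearMap.norm_id_le
    nlinarith [norm_nonneg y]
  γ _ y := y
  γ_zero _ := rfl
  γ_cont := continuous_snd
  cov j s y ξ := by
    change (j.rep.U s : j.H →L[ℂ] j.H) (y • ξ) = y • (j.rep.U s : j.H →L[ℂ] j.H) ξ
    exact map_smul _ _ _

lemma mem_groupCStar (x : URepFam.Prod G) : x ∈ groupCStar μ ↔ x.toFam ∈ (uCor G).cross μ := by
  constructor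
  · let D : NonUnitalStarSubalgebra ℂ (URepFam.Prod G) :=
      { carrier := {x | x.toFam ∈ (uCor G).cross μ}
        add_mem' := fun ha hb => Submodule.add_mem ((uCor G).cross μ) ha hb
        zero_mem' := zero_mem ((uCor G).cross μ)
        mul_mem' := fun ha hb => (uCor G).alg_mul_mem μ (fun _ => rfl) (fun i a b => by
          change (a * b) • (1 : i.H →L[ℂ] i.H) = (a • 1) * (b • 1)
          rw [smul_mul_smul_comm, one_mul]) ha hb
        smul_mem' := fun k _ ha => Submodule.smul_mem ((uCor G).cross μ) k ha
        star_mem' := fun ha => (uCor G).alg_adj_mem μ (fun _ => rfl) (fun i a => by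
          change (star a) • (1 : i.H →L[ℂ] i.H) = star (a • (1 : i.H →L[ℂ] i.H))
          rw [star_smul, star_one]) ha }
    have : groupCStar μ ≤ D := by
      refine closedGen_le ((uCor G).isClosed_cross μ) ?_
      rintro T ⟨f, h1, h2, hT⟩
      have : T.toFam = (uCor G).integ μ ⟨⟨f, h1⟩, h2⟩ := fam_ext fun i ξ => hT i ξ
      change T.toFam ∈ _
      rw [this]
      exact (uCor G).integ_mem μ _
    exact fun h => this h
  · intro h
    let M : Submodule ℂ (Fam (fun j : URepFam G => j.H) (fun j => j.H)) :=
      (groupCStar μ).toSubmodule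
    exact (uCor G).cross_le μ (M := M) (closedGen_closed (P := URepFam.Prod G) _)
      (fun f => subset_closedGen (P := URepFam.Prod G) _
        ⟨f, f.continuous, f.hasCompactSupport, fun i ξ => rfl⟩) h

end GroupAlg

/-! ### Equivariant equivalence bimodules -/

section EqBimod

variable {G Γ : Type u} [Group G] [TopologicalSpace G] [IsTopologicalGroup G]
  [Group Γ] [TopologicalSpace Γ] [IsTopologicalGroup Γ]
  {A : Type*} [NonUnitalCStarAlgebra A] {B : Type*} [NonUnitalCStarAlgebra B]
  {X : Type*} [NormedAddCommGroup X] [NormedSpace ℂ X]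

/-- The laws of an equivariant equivalence bimodule (for the twist `1` on the left and `ι` on the
right). -/
structure EqBimod (σ : Twist G Γ) (O : BimodOps Γ A B X) : Prop where
  α_cont : Continuous fun p : Γ × A => O.α p.1 p.2
  β_cont : Continuous fun p : Γ × B => O.β p.1 p.2
  γ_cont : Continuous fun p : Γ × X => O.γ p.1 p.2
  β_star : ∀ s b, O.β s (star b) = star (O.β s b)
  α_zero : ∀ s, O.α s 0 = 0
  β_zero : ∀ s, O.β s 0 = 0
  γ_zero : ∀ s, O.γ s 0 = 0
  γ_one : ∀ x, O.γ 1 x = x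
  γ_mul : ∀ s t x, O.γ (s * t) x = O.γ s (O.γ t x)
  γ_ι : ∀ z x, O.γ (σ.ι z) x = conj (z : ℂ) • x
  lact_cont : ∀ a, Continuous (O.lact a)
  lact_add : ∀ a x y, O.lact a (x + y) = O.lact a x + O.lact a y
  lact_smul : ∀ a (k : ℂ) x, O.lact a (k • x) = k • O.lact a x
  add_lact : ∀ a b x, O.lact (a + b) x = O.lact a x + O.lact b x
  smul_lact : ∀ (k : ℂ) a x, O.lact (k • a) x = k • O.lact a x
  mul_lact : ∀ a b x, O.lact (a * b) x = O.lact a (O.lact b x)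
  ract_cont : ∀ x, Continuous (O.ract x)
  ract_add : ∀ x b c, O.ract x (b + c) = O.ract x b + O.ract x c
  ract_smul : ∀ x (k : ℂ) b, O.ract x (k • b) = k • O.ract x b
  add_ract : ∀ x y b, O.ract (x + y) b = O.ract x b + O.ract y b
  smul_ract : ∀ (k : ℂ) x b, O.ract (k • x) b = k • O.ract x b
  ract_mul : ∀ x b c, O.ract x (b * c) = O.ract (O.ract x b) c
  linner_cont : Continuous fun p : X × X => O.linner p.1 p.2
  norm_rinner : ∀ x, ‖O.rinner x x‖ ≤ ‖x‖ ^ 2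
  norm_linner : ∀ x, ‖O.linner x x‖ ≤ ‖x‖ ^ 2
  linner_star : ∀ x y, star (O.linner x y) = O.linner y x
  rinner_star : ∀ x y, star (O.rinner x y) = O.rinner y x
  linner_add : ∀ x y z, O.linner (x + y) z = O.linner x z + O.linner y z
  linner_smul : ∀ (k : ℂ) x y, O.linner (k • x) y = k • O.linner x y
  rinner_add : ∀ x y z, O.rinner x (y + z) = O.rinner x y + O.rinner x z
  rinner_smul : ∀ (k : ℂ) x y, O.rinner x (k • y) = k • O.rinner x y
  linner_lact : ∀ a x y, O.linner (O.lact a x) y = a * O.linner x y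
  rinner_ract : ∀ x y b, O.rinner x (O.ract y b) = O.rinner x y * b
  linner_ract : ∀ x y b, O.linner (O.ract x b) y = O.linner x (O.ract y (star b))
  rinner_lact : ∀ a x y, O.rinner (O.lact a x) y = O.rinner x (O.lact (star a) y)
  imprim : ∀ x y z, O.lact (O.linner x y) z = O.ract x (O.rinner y z)
  linner_pos : ∀ x, ∃ c, O.linner x x = star c * c
  rinner_pos : ∀ x, ∃ c, O.rinner x x = star c * c
  linner_dense : Dense (Submodule.span ℂ {a | ∃ x y, a = O.linner x y} : Set A)
  lact_dense : Dense (Submodule.span ℂ {y | ∃ a x, y = O.lact a x} : Set X)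
  ract_dense : Dense (Submodule.span ℂ {y | ∃ x b, y = O.ract x b} : Set X)
  γ_linner : ∀ s x y, O.linner (O.γ s x) (O.γ s y) = O.α s (O.linner x y)
  γ_rinner : ∀ s x y, O.rinner (O.γ s x) (O.γ s y) = O.β s (O.rinner x y)
  γ_lact : ∀ s a x, O.γ s (O.lact a x) = O.lact (O.α s a) (O.γ s x)
  γ_ract : ∀ s x b, O.γ s (O.ract x b) = O.ract (O.γ s x) (O.β s b)

namespace EqBimod

variable {σ : Twist G Γ} {O : BimodOps Γ A B X} (hO : EqBimod σ O)

lemma norm_πX {H H' : Type u} [NormedAddCommGroup H]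
    [InnerProductSpace ℂ H] [CompleteSpace H] [NormedAddCommGroup H'] [InnerProductSpace ℂ H']
    [CompleteSpace H'] (hO : EqBimod σ O) (r : BimodRep σ O H H') (x : X) : ‖r.πX x‖ ≤ ‖x‖ := by
  refine le_of_sq_le_sq ?_ (norm_nonneg x)
  have h : ‖ContinuousLinearMap.adjoint (r.πX x) ∘L r.πX x‖ = ‖r.πX x‖ * ‖r.πX x‖ :=
    ContinuousLinearMap.norm_adjoint_comp_self _
  rw [sq, ← h, ← r.map_rinner]
  exact (NonUnitalStarAlgHom.norm_apply_le _ _).trans (hO.norm_rinner x)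

/-- The corner of all bimodule representations. -/
def cor : CovCorner Γ X (fun k : BimodFam σ O => k.H') (fun k => k.H) where
  ρ k := k.rep.πX
  V k := k.rep.right.toURep
  le k := hO.norm_πX k.rep
  U k := k.rep.left.toURep
  γ := O.γ
  γ_zero := hO.γ_zero
  γ_cont := hO.γ_cont
  cov k := k.rep.covariant

variable (σ O) in
/-- The left covariant representations restricted to those coming from bimodules. -/
abbrev corA : Corner Γ A (fun k : BimodFam σ O => k.H) (fun k => k.H) :=
  (covCor σ O.α 1).comap (BimodFam.leftIdx (σ := σ) (O := O))

variable (σ O) in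
/-- The right covariant representations restricted to those coming from bimodules. -/
abbrev corB : Corner Γ B (fun k : BimodFam σ O => k.H') (fun k => k.H') :=
  (covCor σ O.β (MonoidHom.id Circle)).comap (BimodFam.rightIdx (σ := σ) (O := O))

variable [MeasurableSpace Γ] [BorelSpace Γ]
  [LocallyCompactSpace Γ] [T2Space Γ] (μ : Measure Γ) [IsHaarMeasure μ] [Regular μ]

lemma mem_bimodCrossedProduct (x : BimodFam.Prod σ O) :
    x ∈ bimodCrossedProduct μ σ O ↔
      (show Fam (fun k : BimodFam σ O => k.H') (fun k => k.H) from x) ∈ hO.cor.cross μ := by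
  constructor
  · intro h
    refine closure_minimal ?_ (hO.cor.isClosed_cross μ) h
    let M : Submodule ℂ (BimodFam.Prod σ O) := hO.cor.cross μ
    refine (Submodule.span_le (p := M)).2 ?_
    rintro T ⟨f, ⟨h1, h2, -⟩, hT⟩
    have : (show Fam (fun k : BimodFam σ O => k.H') (fun k => k.H) from T) =
      hO.cor.integ μ ⟨⟨f, h1⟩, h2⟩ := fam_ext fun i ξ => hT i ξ
    change (show Fam (fun k : BimodFam σ O => k.H') (fun k => k.H) from T) ∈ hO.cor.cross μ
    rw [this]
    exact hO.cor.integ_mem μ _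
  · intro h
    let N : Submodule ℂ (BimodFam.Prod σ O) := (Submodule.span ℂ {T : BimodFam.Prod σ O |
      ∃ f : Γ → X, IsCcTwisted σ (MonoidHom.id Circle) f ∧ ∀ (k : BimodFam σ O) (ξ : k.H'),
      T k ξ = ∫ s, k.rep.πX (f s) ((k.rep.right.U s : k.H' →L[ℂ] k.H') ξ) ∂μ}).topologicalClosure
    let M : Submodule ℂ (Fam (fun k : BimodFam σ O => k.H') (fun k => k.H)) := N
    exact hO.cor.cross_le_of_twisted σ (MonoidHom.id Circle) μ continuous_id
      (fun k => k.rep.right.twist) (M := M)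
      (Submodule.isClosed_topologicalClosure (M := BimodFam.Prod σ O) _)
      (fun f hf => Submodule.le_topologicalClosure (M := BimodFam.Prod σ O) _
        (Submodule.subset_span (M := BimodFam.Prod σ O) ⟨f, hf, fun k ξ => rfl⟩)) h

lemma πX_cov_adj (k : BimodFam σ O) (s : Γ) (y : X) (ξ : k.H) :
    (k.rep.right.U s : k.H' →L[ℂ] k.H') (ContinuousLinearMap.adjoint (k.rep.πX y) ξ) =
      ContinuousLinearMap.adjoint (k.rep.πX (O.γ s y)) ((k.rep.left.U s : k.H →L[ℂ] k.H) ξ) := by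
  refine ext_inner_left ℂ fun v => ?_
  rw [ContinuousLinearMap.adjoint_inner_right]
  have h1 := k.rep.covariant s y ((k.rep.right.U s⁻¹ : k.H' →L[ℂ] k.H') v)
  rw [k.rep.right.toURep.apply_inv] at h1
  rw [← h1, ← ContinuousLinearMap.adjoint_inner_right, k.rep.left.toURep.adjoint_eq,
    k.rep.left.toURep.inv_apply, ← ContinuousLinearMap.adjoint_inner_right, ← inv_inv s,
    ← k.rep.right.toURep.adjoint_eq, ContinuousLinearMap.adjoint_inner_right, inv_inv]

lemma ρF_mul_adj_mem (x : X) {y : Fam (fun k : BimodFam σ O => k.H') (fun k => k.H)}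
    (hy : y ∈ hO.cor.cross μ) :
    fmul (hO.cor.ρF x) (fadj y) ∈ (corA σ O).cross μ := by
  let M : Submodule ℂ (Fam (fun k : BimodFam σ O => k.H') (fun k => k.H)) :=
    ((corA σ O).cross μ).comap ((fmul (hO.cor.ρF x)).toLinearMap ∘ₛₗ fadjL.toLinearMap)
  have hM : IsClosed (M : Set (Fam (fun k : BimodFam σ O => k.H') (fun k => k.H))) :=
    ((corA σ O).isClosed_cross μ).preimage ((fmul (hO.cor.ρF x)).continuous.comp continuous_fadj)
  refine hO.cor.cross_le_of_tens μ hM (fun h y => ?_) hy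
  change fmul (hO.cor.ρF x) (fadj (hO.cor.integ μ (Corner.tens h y))) ∈ (corA σ O).cross μ
  let F : C_c(Γ, A) := ⟨⟨fun s => conj (h s) • O.linner x (O.γ s⁻¹ y),
    (Complex.continuous_conj.comp h.continuous).smul (hO.linner_cont.comp
      (continuous_const.prodMk (hO.γ_cont.comp (continuous_inv.prodMk continuous_const))))⟩,
    h.hasCompactSupport.mono fun s hs h' => hs (by simp [h'])⟩
  have : fmul (hO.cor.ρF x) (fadj (hO.cor.integ μ (Corner.tens h y))) =
      (corA σ O).integ μ (Corner.flip F) := by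
    rw [Corner.integ_tens, fadj_fmul]
    refine fam_ext fun k ξ => ?_
    change k.rep.πX x (ContinuousLinearMap.adjoint (hO.cor.scal.integ μ h k)
      (ContinuousLinearMap.adjoint (k.rep.πX y) ξ)) = _
    rw [hO.cor.adjoint_scal_integ, Corner.integ_flip]
    have hc : Continuous fun s => conj (h s) • (k.rep.right.U s⁻¹ : k.H' →L[ℂ] k.H')
        (ContinuousLinearMap.adjoint (k.rep.πX y) ξ) :=
      (Complex.continuous_conj.comp h.continuous).smul
        ((k.rep.right.cont _).comp continuous_inv)
    refine (ContinuousLinearMap.integral_comp_comm (k.rep.πX x)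
      (hc.integrable_of_hasCompactSupport (μ := μ)
        (h.hasCompactSupport.mono fun s hs h' => hs (by simp [h'])))).symm.trans ?_
    refine integral_congr_ae (.of_forall fun s => ?_)
    change k.rep.πX x (conj (h s) • _) = k.rep.left.π (conj (h s) • _) _
    rw [map_smul, map_smul, πX_cov_adj, k.rep.map_linner]
    rfl
  rw [this]
  exact (corA σ O).integ_mem μ _

lemma VF_mul_adj (y : Fam (fun k : BimodFam σ O => k.H') (fun k => k.H)) (s : Γ) :
    fmul (hO.cor.VF s) (fadj y) = fadj (fmul y (hO.cor.VF s⁻¹)) := by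
  rw [fadj_fmul]
  congr 2
  refine fam_ext' fun k => ?_
  change _ = ContinuousLinearMap.adjoint (k.rep.right.U s⁻¹ : k.H' →L[ℂ] k.H')
  rw [k.rep.right.toURep.adjoint_eq, inv_inv]; rfl

/-- `X X⋆ ⊆ A` for the crossed products. -/
lemma mul_adj_mem {x y : Fam (fun k : BimodFam σ O => k.H') (fun k => k.H)}
    (hx : x ∈ hO.cor.cross μ) (hy : y ∈ hO.cor.cross μ) :
    fmul x (fadj y) ∈ (corA σ O).cross μ := by
  refine hO.cor.fcomp_mem μ id (z := fadj y) ((corA σ O).isClosed_cross μ) ?_ (fun x s => ?_) hx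
  · change Continuous fun s => fmul (hO.cor.VF s) (fadj y)
    simp only [hO.VF_mul_adj]
    exact continuous_fadj.comp ((hO.cor.continuous_mul_VF μ hy).comp continuous_inv)
  · change fmul (hO.cor.ρF x) (fmul (hO.cor.VF s) (fadj y)) ∈ (corA σ O).cross μ
    rw [hO.VF_mul_adj]
    exact hO.ρF_mul_adj_mem μ x (hO.cor.mul_VF_mem μ hy _)

/-- The products `x y⋆` span a dense subspace of `A ⋊ G`. -/
lemma corA_cross_le {M : Submodule ℂ (Fam (fun k : BimodFam σ O => k.H) (fun k => k.H))}
    (hM : IsClosed (M : Set (Fam (fun k : BimodFam σ O => k.H) (fun k => k.H))))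
    (h : ∀ x ∈ hO.cor.cross μ, ∀ y ∈ hO.cor.cross μ, fmul x (fadj y) ∈ M) :
    (corA σ O).cross μ ≤ M := by
  refine (corA σ O).cross_le_of_tens μ hM fun g a => ?_
  rw [Corner.integ_tens]
  let T : A →L[ℂ] Fam (fun k : BimodFam σ O => k.H) (fun k => k.H) :=
    (fmul.flip ((corA σ O).scal.integ μ g)).comp (corA σ O).ρF
  refine hO.linner_dense.induction (P := fun a => T a ∈ M) ?_ (hM.preimage T.continuous) a
  intro a ha
  induction ha using Submodule.span_induction with
  | zero => rw [map_zero]; exact zero_mem _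
  | add x y _ _ hx hy => rw [map_add]; exact add_mem hx hy
  | smul k x _ hx => rw [map_smul]; exact Submodule.smul_mem _ _ hx
  | mem a ha =>
    obtain ⟨x, y, rfl⟩ := ha
    let w := fmul (fadj (hO.cor.scalU.integ μ g)) (hO.cor.ρF y)
    have hw : w ∈ hO.cor.cross μ := by
      change fmul (fadj (hO.cor.scalU.integ μ g)) (hO.cor.ρF y) ∈ _
      rw [hO.cor.adj_mul_ρF]; exact hO.cor.integ_mem μ _
    have hT : T (O.linner x y) = fmul (hO.cor.ρF x) (fadj w) := fam_ext fun k ξ => by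
      simp only [w, fadj_fmul, fadj_fadj]
      change k.rep.left.π (O.linner x y) _ = _
      rw [k.rep.map_linner]; rfl
    have hc : Continuous fun s => fmul (hO.cor.VF s) (fadj w) := by
      simp only [hO.VF_mul_adj]
      exact continuous_fadj.comp ((hO.cor.continuous_mul_VF μ hw).comp continuous_inv)
    rw [hT]
    change _ ∈ (M : Set (Fam (fun k : BimodFam σ O => k.H) (fun k => k.H)))
    rw [← hM.closure_eq, Metric.mem_closure_iff]
    intro ε hε
    obtain ⟨b, -, hb⟩ := hO.cor.exists_scal_approx μ id hc Filter.univ_mem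
      (ε := ε / (2 * (‖hO.cor.ρF x‖ + 1))) (by positivity)
    refine ⟨fmul (hO.cor.integ μ (Corner.tens b x)) (fadj w),
      h _ (hO.cor.integ_mem μ _) _ hw, ?_⟩
    rw [Corner.integ_tens, fmul_assoc, dist_comm, dist_eq_norm, ← map_sub]
    refine (norm_fmul_le _ _).trans_lt ?_
    calc _ ≤ (‖hO.cor.ρF x‖ + 1) * (ε / (2 * (‖hO.cor.ρF x‖ + 1))) := by
          gcongr
          · linarith
          · exact hb
      _ = ε / 2 := by field_simp
      _ < ε := by linarith

end EqBimod

end EqBimod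

/-! ### Induced representations -/

section Positivity

variable {B : Type*} [NonUnitalCStarAlgebra B] {V : Type*} [NormedAddCommGroup V]
  [InnerProductSpace ℂ V] [CompleteSpace V] (π : B →⋆ₙₐ[ℂ] (V →L[ℂ] V))

lemma rep_inner (b : B) (v w : V) : inner ℂ (π b v) w = inner ℂ v (π (star b) w) := by
  rw [map_star, ContinuousLinearMap.star_eq_adjoint, ContinuousLinearMap.adjoint_inner_right]

variable {X : Type*} [AddCommGroup X] {ip : X → X → B} {act : B → X → X}

/-- The closed cyclic subspace generated by a vector. -/
def cyclicSub (ζ : V) : Submodule ℂ V :=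
  (LinearMap.range ((LinearMap.applyₗ ζ ∘ₗ ContinuousLinearMap.coeLM ℂ) ∘ₗ
    repLin π)).topologicalClosure

lemma rep_mem_cyclicSub (ζ : V) (b : B) : π b ζ ∈ cyclicSub π ζ :=
  Submodule.le_topologicalClosure _ ⟨b, rfl⟩

lemma cyclicSub_le (ζ : V) {M : Submodule ℂ V} (hM : IsClosed (M : Set V))
    (h : ∀ b, π b ζ ∈ M) : cyclicSub π ζ ≤ M :=
  Submodule.topologicalClosure_minimal _ (by rintro _ ⟨b, rfl⟩; exact h b) hM

lemma rep_cyclicSub (ζ : V) (b : B) {v : V} (hv : v ∈ cyclicSub π ζ) :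
    π b v ∈ cyclicSub π ζ := by
  have : cyclicSub π ζ ≤ (cyclicSub π ζ).comap (π b).toLinearMap :=
    cyclicSub_le π ζ ((Submodule.isClosed_topologicalClosure _).preimage (π b).continuous) fun c => by
      change π b (π c ζ) ∈ cyclicSub π ζ
      have := rep_mem_cyclicSub π ζ (b * c)
      rwa [map_mul] at this
  exact this hv

instance (ζ : V) : CompleteSpace (cyclicSub π ζ) :=
  (Submodule.isClosed_topologicalClosure _).completeSpace_coe

lemma mem_cyclicSub (hπ : Dense (Submodule.span ℂ {η | ∃ a ξ, η = π a ξ} : Set V)) (ζ : V) :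
    ζ ∈ cyclicSub π ζ := by
  obtain ⟨p, hp, w, hwo, hζ⟩ := Submodule.exists_add_mem_mem_orthogonal (K := cyclicSub π ζ) ζ
  have h1 : ∀ a, π a w = 0 := by
    intro a
    have h5 : π a w = π a ζ - π a p := by rw [hζ, map_add, add_sub_cancel_left]
    have h6 : π a w ∈ cyclicSub π ζ :=
      h5 ▸ Submodule.sub_mem _ (rep_mem_cyclicSub π ζ a) (rep_cyclicSub π ζ a hp)
    have h2 : inner ℂ (π a w) (π a w) = 0 := by
      rw [rep_inner]
      exact Submodule.inner_left_of_mem_orthogonal (rep_cyclicSub π ζ _ h6) hwo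
    exact inner_self_eq_zero.1 h2
  have h3 : w = 0 := by
    have h4 : innerSL ℂ w = 0 := clm_ext_dense hπ (by
      rintro _ ⟨a, ξ, rfl⟩
      have := rep_inner π (star a) w ξ
      rw [star_star, h1, inner_zero_left] at this
      simpa using this.symm)
    have := DFunLike.congr_fun h4 w
    simpa using this
  rw [hζ, h3, add_zero]
  rw [h3, add_zero] at hζ
  rwa [← hζ] at hp ⊢

lemma kernel_pos (hπ : Dense (Submodule.span ℂ {η | ∃ a ξ, η = π a ξ} : Set V))
    (hal : ∀ x y z, ip (x + y) z = ip x z + ip y z) (har : ∀ x y z, ip x (y + z) = ip x y + ip x z)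
    (hact : ∀ a b x y, ip (act a x) (act b y) = star a * ip x y * b)
    (hpos : ∀ x, ∃ c, ip x x = star c * c) (s : Finset X) (v : X → V) :
    0 ≤ (∑ x ∈ s, ∑ y ∈ s, inner ℂ (v x) (π (ip x y) (v y))).re := by
  classical
  let Q : (X → V) → ℂ := fun v => ∑ x ∈ s, ∑ y ∈ s, inner ℂ (v x) (π (ip x y) (v y))
  have hQc : Continuous Q := continuous_finsetSum _ fun x _ => continuous_finsetSum _ fun y _ =>
    (continuous_apply x).inner ((π (ip x y)).continuous.comp (continuous_apply y))
  have h0l : ∀ y, ip 0 y = 0 := fun y => by have := hal 0 0 y; simpa using this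
  have h0r : ∀ y, ip y 0 = 0 := fun y => by have := har y 0 0; simpa using this
  have hsum : ∀ f : X → X, ip (∑ x ∈ s, f x) (∑ y ∈ s, f y) = ∑ x ∈ s, ∑ y ∈ s, ip (f x) (f y) := by
    intro f
    have h1 : ∀ z (t : Finset X), ip (∑ x ∈ t, f x) z = ∑ x ∈ t, ip (f x) z := fun z t => by
      induction t using Finset.induction_on with
      | empty => simp [h0l]
      | insert a t ha ih => rw [Finset.sum_insert ha, Finset.sum_insert ha, hal, ih]
    have h2 : ∀ z (t : Finset X), ip z (∑ x ∈ t, f x) = ∑ x ∈ t, ip z (f x) := fun z t => by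
      induction t using Finset.induction_on with
      | empty => simp [h0r]
      | insert a t ha ih => rw [Finset.sum_insert ha, Finset.sum_insert ha, har, ih]
    rw [h1]
    exact Finset.sum_congr rfl fun x _ => h2 _ _
  have hcyc : ∀ (ζ : V) (p : X → V), (∀ x, p x ∈ cyclicSub π ζ) → 0 ≤ (Q p).re := by
    intro ζ p hp
    let D : Set V := {w | ∃ b, w = π b ζ}
    have hD : (cyclicSub π ζ : Set V) ⊆ closure D := by
      refine closure_mono ?_
      rintro _ ⟨b, rfl⟩
      exact ⟨b, rfl⟩
    have hp' : p ∈ closure (Set.pi Set.univ fun _ : X => D) := by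
      rw [closure_pi_set]
      exact fun x _ => hD (hp x)
    have hcl : IsClosed {p : X → V | 0 ≤ (Q p).re} :=
      isClosed_le continuous_const (Complex.continuous_re.comp hQc)
    refine closure_minimal ?_ hcl hp'
    intro p hp
    choose b hb using fun x => hp x (Set.mem_univ x)
    obtain ⟨c, hc⟩ := hpos (∑ x ∈ s, act (b x) x)
    have : Q p = inner ℂ (π c ζ) (π c ζ) := by
      rw [rep_inner, ← mul_apply_eq_comp, ← map_mul, ← hc, hsum]
      simp only [_root_.map_sum, _root_.sum_apply, inner_sum]
      refine Finset.sum_congr rfl fun x _ => Finset.sum_congr rfl fun y _ => ?_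
      rw [hb, hb, rep_inner, hact, map_mul, map_mul]
      rfl
    change 0 ≤ (Q p).re
    rw [this]
    exact inner_self_nonneg (𝕜 := ℂ)
  suffices h : ∀ (n : ℕ) (v : X → V), (s.filter fun x => v x ≠ 0).card ≤ n → 0 ≤ (Q v).re from
    h _ v le_rfl
  intro n
  induction n with
  | zero =>
    intro v hv
    have hv0 : ∀ x ∈ s, v x = 0 := fun x hx => by
      have := Finset.card_eq_zero.1 (Nat.le_zero.1 hv)
      by_contra hne
      exact Finset.notMem_empty x (this ▸ Finset.mem_filter.2 ⟨hx, hne⟩)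
    have : Q v = 0 := Finset.sum_eq_zero fun x hx => Finset.sum_eq_zero fun y hy => by
      rw [hv0 x hx, inner_zero_left]
    rw [this, Complex.zero_re]
  | succ n ih =>
    intro v hv
    by_cases hex : ∃ x₀ ∈ s, v x₀ ≠ 0
    · obtain ⟨x₀, hx₀, hne⟩ := hex
      let M := cyclicSub π (v x₀)
      let P := M.starProjection
      let p : X → V := fun x => P (v x)
      let w : X → V := fun x => v x - P (v x)
      have hp : ∀ x, p x ∈ M := fun x => Submodule.starProjection_apply_mem _ _
      have hw : ∀ x, w x ∈ Mᗮ := fun x => Submodule.sub_starProjection_mem_orthogonal _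
      have hQ : Q v = Q p + Q w := by
        simp only [Q, ← Finset.sum_add_distrib]
        refine Finset.sum_congr rfl fun x _ => Finset.sum_congr rfl fun y _ => ?_
        have hx : v x = p x + w x := (add_sub_cancel _ _).symm
        have hy : v y = p y + w y := (add_sub_cancel _ _).symm
        rw [hx, hy, map_add, inner_add_left, inner_add_right, inner_add_right]
        have h1 : inner ℂ (w x) (π (ip x y) (p y)) = 0 :=
          Submodule.inner_left_of_mem_orthogonal (rep_cyclicSub π _ _ (hp y)) (hw x)
        have h2 : inner ℂ (p x) (π (ip x y) (w y)) = 0 := by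
          have := rep_inner π (star (ip x y)) (p x) (w y)
          rw [star_star] at this
          rw [← this]
          exact Submodule.inner_right_of_mem_orthogonal (rep_cyclicSub π _ _ (hp x)) (hw y)
        rw [h1, h2]; ring
      rw [hQ, Complex.add_re]
      refine add_nonneg (hcyc _ p hp) (ih w ?_)
      have hx0 : w x₀ = 0 := by
        change v x₀ - M.starProjection (v x₀) = 0
        rw [Submodule.starProjection_eq_self_iff.2 (mem_cyclicSub π hπ _), sub_self]
      have hlt : (s.filter fun x => w x ≠ 0) ⊂ (s.filter fun x => v x ≠ 0) := by
        refine Finset.ssubset_iff_subset_ne.2 ⟨fun x hx => ?_, fun heq => ?_⟩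
        · obtain ⟨h1, h2⟩ := Finset.mem_filter.1 hx
          refine Finset.mem_filter.2 ⟨h1, fun h3 => h2 ?_⟩
          simp [w, h3]
        · have : x₀ ∈ s.filter fun x => w x ≠ 0 := heq ▸ Finset.mem_filter.2 ⟨hx₀, hne⟩
          exact (Finset.mem_filter.1 this).2 hx0
      have := Finset.card_lt_card hlt
      omega
    · push Not at hex
      have : Q v = 0 := Finset.sum_eq_zero fun x hx => Finset.sum_eq_zero fun y hy => by
        rw [hex x hx, inner_zero_left]
      rw [this, Complex.zero_re]

end Positivity

section Kolmogorov

variable {X V : Type u} [NormedAddCommGroup V] [InnerProductSpace ℂ V] [CompleteSpace V]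

lemma exists_kolmogorov (K : X → X → V →L[ℂ] V)
    (hK : ∀ x y, ContinuousLinearMap.adjoint (K x y) = K y x)
    (hpos : ∀ (s : Finset X) (v : X → V), 0 ≤ (∑ x ∈ s, ∑ y ∈ s, inner ℂ (v x) (K x y (v y))).re) :
    ∃ (E : Type u) (_ : NormedAddCommGroup E) (_ : InnerProductSpace ℂ E) (_ : CompleteSpace E)
      (e : X → V →L[ℂ] E), (∀ x y, ContinuousLinearMap.adjoint (e x) ∘L e y = K x y) ∧
      Dense (Submodule.span ℂ {η | ∃ x v, η = e x v} : Set E) := by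
  let M : Matrix X X (V →L[ℂ] V) := Matrix.of K
  have hM : M.PosSemidef := by
    have h := (RKHS.posSemidef_tfae (K := M)).out 0 2
    refine h.2 ⟨?_, fun vv => ?_⟩
    · ext1 x y
      exact hK y x
    · have := hpos vv.support vv
      rw [Finset.sum_comm] at this
      simp only [Finsupp.sum, Complex.re_sum, _root_.map_sum] at this ⊢
      refine this.trans_eq (Finset.sum_congr rfl fun x _ => Finset.sum_congr rfl fun y _ => ?_)
      exact (inner_re_symm (𝕜 := ℂ) _ _)
  have : Fact M.PosSemidef := ⟨hM⟩
  refine ⟨RKHS.OfKernel M, inferInstance, inferInstance, inferInstance,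
    fun x => RKHS.kerFun (RKHS.OfKernel M) x, fun x y => ?_, ?_⟩
  · rw [← RKHS.kernel_apply, RKHS.OfKernel.kernel_ofKernel]; rfl
  · have := RKHS.kerFun_dense (𝕜 := ℂ) (RKHS.OfKernel M)
    rw [← Submodule.dense_iff_topologicalClosure_eq_top] at this
    have h : {η | ∃ x v, η = RKHS.kerFun (RKHS.OfKernel M) x v} =
        {η | ∃ x v, RKHS.kerFun (RKHS.OfKernel M) x v = η} := by
      ext η; exact ⟨fun ⟨x, v, h⟩ => ⟨x, v, h.symm⟩, fun ⟨x, v, h⟩ => ⟨x, v, h.symm⟩⟩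
    change Dense (Submodule.span ℂ {η | ∃ x v, η = RKHS.kerFun (RKHS.OfKernel M) x v} :
      Set (RKHS.OfKernel M))
    rw [h]
    exact this

variable {E : Type*} [NormedAddCommGroup E] [InnerProductSpace ℂ E] [CompleteSpace E]
  {e : X → V →L[ℂ] E}

lemma kolmogorov_ext (he : Dense (Submodule.span ℂ {η | ∃ x v, η = e x v} : Set E))
    {x : X} {T : V →L[ℂ] E}
    (h : ∀ y, ContinuousLinearMap.adjoint (e y) ∘L e x = ContinuousLinearMap.adjoint (e y) ∘L T) :
    e x = T := by
  ext1 v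
  refine ext_inner_left ℂ fun w => ?_
  have h4 : innerSL ℂ (e x v) = innerSL ℂ (T v) := clm_ext_dense he (by
    rintro _ ⟨y, v', rfl⟩
    have h5 := DFunLike.congr_fun (h y) v
    simp only [ContinuousLinearMap.comp_apply] at h5
    simp only [innerSL_apply_apply]
    rw [← ContinuousLinearMap.adjoint_inner_left, h5, ContinuousLinearMap.adjoint_inner_left])
  have h6 := DFunLike.congr_fun h4 w
  simp only [innerSL_apply_apply] at h6
  rw [← inner_conj_symm, h6, inner_conj_symm]

/-- Linear combinations of the vectors `e x v`. -/
def kolL (e : X → V →L[ℂ] E) : (X × V →₀ ℂ) →ₗ[ℂ] E := Finsupp.linearCombination ℂ fun p => e p.1 p.2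

lemma kolL_dense (he : Dense (Submodule.span ℂ {η | ∃ x v, η = e x v} : Set E)) :
    DenseRange (kolL e) := by
  have : (Set.range (kolL e)) = (Submodule.span ℂ {η | ∃ x v, η = e x v} : Set E) := by
    have h := Finsupp.range_linearCombination ℂ (v := fun p : X × V => e p.1 p.2)
    rw [← LinearMap.coe_range]
    change ((LinearMap.range (kolL e) : Submodule ℂ E) : Set E) = _
    rw [kolL, h]
    congr 2
    ext η
    exact ⟨fun ⟨p, hp⟩ => ⟨p.1, p.2, hp.symm⟩, fun ⟨x, v, hp⟩ => ⟨(x, v), hp.symm⟩⟩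
  rw [DenseRange, this]
  exact he

lemma inner_kolL {e₁ e₂ e₃ e₄ : X → V →L[ℂ] E}
    (h : ∀ x v y w, inner ℂ (e₁ x v) (e₂ y w) = inner ℂ (e₃ x v) (e₄ y w)) (p q : X × V →₀ ℂ) :
    inner ℂ (kolL e₁ p) (kolL e₂ q) = inner ℂ (kolL e₃ p) (kolL e₄ q) := by
  simp only [kolL, Finsupp.linearCombination_apply, Finsupp.sum, sum_inner, inner_sum,
    inner_smul_left, inner_smul_right, h]

lemma kolL_single (e : X → V →L[ℂ] E) (x : X) (v : V) : kolL e (Finsupp.single (x, v) 1) = e x v := by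
  simp [kolL]

lemma kolL_add (e e' : X → V →L[ℂ] E) (p : X × V →₀ ℂ) :
    kolL (fun x => e x + e' x) p = kolL e p + kolL e' p := by
  simp [kolL, Finsupp.linearCombination_apply, Finsupp.sum, smul_add, Finset.sum_add_distrib]

lemma kolL_smul (k : ℂ) (e : X → V →L[ℂ] E) (p : X × V →₀ ℂ) :
    kolL (fun x => k • e x) p = k • kolL e p := by
  simp [kolL, Finsupp.linearCombination_apply, Finsupp.sum, Finset.smul_sum, smul_comm k]

lemma exists_norm_sq_sub {D : Type*} [NonUnitalCStarAlgebra D] (a : D) :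
    ∃ (l : ℂ) (c : D), conj l * l = (‖a‖ : ℂ) ^ 2 ∧
      conj l • c + l • star c + star c * c = -(star a * a) := by
  let _ : PartialOrder (Unitization ℂ D) := CStarAlgebra.spectralOrder _
  have _ : StarOrderedRing (Unitization ℂ D) := CStarAlgebra.spectralOrderedRing _
  have h1 : star (a : Unitization ℂ D) * a ≤ algebraMap ℝ _ (‖(a : Unitization ℂ D)‖ ^ 2) :=
    CStarAlgebra.star_mul_le_algebraMap_norm_sq
  rw [← sub_nonneg, CStarAlgebra.nonneg_iff_eq_star_mul_self] at h1
  obtain ⟨d, hd⟩ := h1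
  rw [Unitization.norm_inr, sub_eq_add_neg] at hd
  refine ⟨d.fst, d.snd, ?_, ?_⟩
  · have := congrArg (fun z : Unitization ℂ D => z.fst) hd
    simpa [Unitization.algebraMap_eq_inl_comp] using this.symm
  · have := congrArg (fun z : Unitization ℂ D => z.snd) hd
    rw [Unitization.algebraMap_eq_inl_comp] at this
    simpa using this.symm

lemma exists_rep (he : Dense (Submodule.span ℂ {η | ∃ x v, η = e x v} : Set E))
    {D : Type*} [NonUnitalCStarAlgebra D] (act : D → X → X)
    (hadj : ∀ a x v y w, inner ℂ (e (act a x) v) (e y w) = inner ℂ (e x v) (e (act (star a) y) w))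
    (hadd : ∀ a b x, e (act (a + b) x) = e (act a x) + e (act b x))
    (hsmul : ∀ (k : ℂ) a x, e (act (k • a) x) = k • e (act a x))
    (hmul : ∀ a b x, e (act (a * b) x) = e (act a (act b x))) :
    ∃ π : D →⋆ₙₐ[ℂ] (E →L[ℂ] E), ∀ a x v, π a (e x v) = e (act a x) v := by
  let T : D → (X × V →₀ ℂ) →ₗ[ℂ] E := fun a => kolL fun x => e (act a x)
  have hTadd : ∀ a b p, T (a + b) p = T a p + T b p := fun a b p => by
    simp only [T, hadd]; exact kolL_add _ _ p
  have hTsmul : ∀ (k : ℂ) a p, T (k • a) p = k • T a p := fun k a p => by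
    simp only [T, hsmul]; exact kolL_smul _ _ p
  have hT1 : ∀ a p q, inner ℂ (T a p) (kolL e q) = inner ℂ (kolL e p) (T (star a) q) :=
    fun a p q => inner_kolL (fun x v y w => hadj a x v y w) p q
  have hT2 : ∀ a b p q, inner ℂ (T a p) (T b q) = inner ℂ (kolL e p) (T (star a * b) q) :=
    fun a b p q => inner_kolL (fun x v y w => by rw [hadj, hmul]) p q
  have hbd : ∀ a p, ‖T a p‖ ≤ ‖a‖ * ‖kolL e p‖ := by
    intro a p
    obtain ⟨l, c, hl, hc⟩ := exists_norm_sq_sub a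
    have h1 : inner ℂ (l • kolL e p + T c p) (l • kolL e p + T c p) =
        (‖a‖ : ℂ) ^ 2 * inner ℂ (kolL e p) (kolL e p) - inner ℂ (T a p) (T a p) := by
      have h2 : inner ℂ (kolL e p) (T (-(star a * a)) p) = - inner ℂ (T a p) (T a p) := by
        rw [hT2, ← inner_neg_right, ← neg_one_smul ℂ (star a * a), hTsmul, neg_one_smul]
      rw [sub_eq_add_neg, ← h2, ← hc, hTadd, hTadd, hTsmul, hTsmul, ← hl]
      simp only [inner_add_left, inner_add_right, inner_smul_left, inner_smul_right, hT2, hT1]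
      ring
    have h3 := congrArg Complex.re h1
    have h4 : ∀ x : E, (inner ℂ x x : ℂ) = ((‖x‖ ^ 2 : ℝ) : ℂ) := fun x => by
      rw [inner_self_eq_norm_sq_to_K]; push_cast; rfl
    rw [h4, h4, h4, ← Complex.ofReal_pow, ← Complex.ofReal_mul, ← Complex.ofReal_sub,
      Complex.ofReal_re, Complex.ofReal_re] at h3
    refine le_of_sq_le_sq ?_ (by positivity)
    rw [mul_pow]
    nlinarith [sq_nonneg ‖l • kolL e p + T c p‖]
  let P : D → E →L[ℂ] E := fun a => (T a).extendOfNorm (kolL e)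
  have hP : ∀ a p, P a (kolL e p) = T a p := fun a p =>
    LinearMap.extendOfNorm_eq (kolL_dense he) ⟨‖a‖, hbd a⟩ p
  have hPe : ∀ a x v, P a (e x v) = e (act a x) v := fun a x v => by
    have := hP a (Finsupp.single (x, v) 1)
    simpa only [T, kolL_single] using this
  refine ⟨{ toFun := P
            map_smul' := ?_
            map_zero' := ?_
            map_add' := ?_
            map_mul' := ?_
            map_star' := ?_ }, hPe⟩
  · intro k a
    refine clm_ext_dense he ?_
    rintro _ ⟨x, v, rfl⟩
    simp only [MonoidHom.id_apply, _root_.smul_apply, hPe, hsmul]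
  · refine clm_ext_dense he ?_
    rintro _ ⟨x, v, rfl⟩
    have := hsmul 0 0 x
    rw [zero_smul, zero_smul] at this
    rw [hPe, this]; rfl
  · intro a b
    refine clm_ext_dense he ?_
    rintro _ ⟨x, v, rfl⟩
    simp only [_root_.add_apply, hPe, hadd]
  · intro a b
    refine clm_ext_dense he ?_
    rintro _ ⟨x, v, rfl⟩
    rw [mul_apply_eq_comp, hPe, hPe, hPe, hmul]
  · intro a
    rw [ContinuousLinearMap.star_eq_adjoint, ContinuousLinearMap.eq_adjoint_iff]
    have h1 : ∀ x v (η : E), inner ℂ (P (star a) (e x v)) η = inner ℂ (e x v) (P a η) := by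
      intro x v η
      have : innerSL ℂ (P (star a) (e x v)) = (innerSL ℂ (e x v)) ∘L P a := clm_ext_dense he (by
        rintro _ ⟨y, w, rfl⟩
        simp only [ContinuousLinearMap.comp_apply, innerSL_apply_apply, hPe]
        rw [hadj, star_star])
      exact DFunLike.congr_fun this η
    intro ξ η
    have : innerSL ℂ η ∘L P (star a) = innerSL ℂ (P a η) := clm_ext_dense he (by
      rintro _ ⟨x, v, rfl⟩
      simp only [ContinuousLinearMap.comp_apply, innerSL_apply_apply]
      rw [← inner_conj_symm, h1, inner_conj_symm])
    have h2 := DFunLike.congr_fun this ξ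
    simp only [ContinuousLinearMap.comp_apply, innerSL_apply_apply] at h2
    rw [← inner_conj_symm, h2, inner_conj_symm]

lemma exists_urep (he : Dense (Submodule.span ℂ {η | ∃ x v, η = e x v} : Set E))
    {Γ : Type*} [Group Γ] [TopologicalSpace Γ] (U : URep Γ V) (γ : Γ → X → X)
    (hone : ∀ x, e (γ 1 x) = e x) (hmul : ∀ s t x, e (γ (s * t) x) = e (γ s (γ t x)))
    (hiso : ∀ s x v y w, inner ℂ (e (γ s x) ((U.U s : V →L[ℂ] V) v))
      (e (γ s y) ((U.U s : V →L[ℂ] V) w)) = inner ℂ (e x v) (e y w))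
    (hcont : ∀ x v, Continuous fun s => e (γ s x) ((U.U s : V →L[ℂ] V) v)) :
    ∃ W : URep Γ E, ∀ s x v, (W.U s : E →L[ℂ] E) (e x v) = e (γ s x) ((U.U s : V →L[ℂ] V) v) := by
  let T : Γ → (X × V →₀ ℂ) →ₗ[ℂ] E := fun s => kolL fun x => e (γ s x) ∘L (U.U s : V →L[ℂ] V)
  have hT : ∀ s p, ‖T s p‖ = ‖kolL e p‖ := fun s p => by
    have := inner_kolL (e₁ := fun x => e (γ s x) ∘L (U.U s : V →L[ℂ] V))
      (e₂ := fun x => e (γ s x) ∘L (U.U s : V →L[ℂ] V)) (e₃ := e) (e₄ := e)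
      (fun x v y w => hiso s x v y w) p p
    rw [norm_eq_sqrt_re_inner (𝕜 := ℂ), norm_eq_sqrt_re_inner (𝕜 := ℂ) (kolL e p), ← this]
  let P : Γ → E →L[ℂ] E := fun s => (T s).extendOfNorm (kolL e)
  have hP : ∀ s p, P s (kolL e p) = T s p := fun s p =>
    LinearMap.extendOfNorm_eq (kolL_dense he) ⟨1, fun p => by rw [hT, one_mul]⟩ p
  have hPe : ∀ s x v, P s (e x v) = e (γ s x) ((U.U s : V →L[ℂ] V) v) := fun s x v => by
    have := hP s (Finsupp.single (x, v) 1)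
    simpa only [T, kolL_single, ContinuousLinearMap.comp_apply] using this
  have hPn : ∀ s ξ, ‖P s ξ‖ = ‖ξ‖ := by
    intro s ξ
    refine (kolL_dense he).induction_on (p := fun ξ => ‖P s ξ‖ = ‖ξ‖) ξ
      (isClosed_eq (P s).continuous.norm continuous_norm) fun p => ?_
    rw [hP, hT]
  have hPmul : ∀ s t, P (s * t) = P s * P t := fun s t => by
    refine clm_ext_dense he ?_
    rintro _ ⟨x, v, rfl⟩
    rw [mul_apply_eq_comp, hPe, hPe, hPe, hmul, U.mul_apply]
  have hP1 : P 1 = 1 := by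
    refine clm_ext_dense he ?_
    rintro _ ⟨x, v, rfl⟩
    rw [hPe, hone, map_one]; rfl
  have hiso' : ∀ s, star (P s) * P s = 1 := fun s => by
    have := (ContinuousLinearMap.norm_map_iff_adjoint_comp_self (P s)).1 (hPn s)
    exact this
  have hinv : ∀ s, P s * P s⁻¹ = 1 := fun s => by rw [← hPmul, mul_inv_cancel, hP1]
  have hstar : ∀ s, star (P s) = P s⁻¹ := fun s => by
    rw [← mul_one (star (P s)), ← hinv s, ← mul_assoc, hiso', one_mul]
  refine ⟨⟨{ toFun := fun s => ⟨P s, Unitary.mem_iff.2 ⟨hiso' s, by rw [hstar]; exact hinv s⟩⟩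
             map_one' := Subtype.ext hP1
             map_mul' := fun s t => Subtype.ext (hPmul s t) }, fun ξ => ?_⟩, hPe⟩
  refine strongCont_of_dense P (fun s ξ => (hPn s ξ).le) _ he ?_ ξ
  rintro _ ⟨x, v, rfl⟩
  simp only [hPe]
  exact hcont x v

end Kolmogorov

section Induce

variable {G Γ : Type u} [Group G] [TopologicalSpace G] [Group Γ] [TopologicalSpace Γ]
  {A B : Type*} [NonUnitalCStarAlgebra A] [NonUnitalCStarAlgebra B]
  {X : Type u} [NormedAddCommGroup X] [NormedSpace ℂ X]
  {σ : Twist G Γ} {O : BimodOps Γ A B X} (hO : EqBimod σ O)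

namespace EqBimod

lemma add_rinner (hO : EqBimod σ O) (x y z : X) : O.rinner (x + y) z = O.rinner x z + O.rinner y z := by
  rw [← hO.rinner_star, hO.rinner_add, star_add, hO.rinner_star, hO.rinner_star]

lemma linner_add_right (hO : EqBimod σ O) (x y z : X) : O.linner z (x + y) = O.linner z x + O.linner z y := by
  rw [← hO.linner_star, hO.linner_add, star_add, hO.linner_star, hO.linner_star]

lemma linner_smul_right (hO : EqBimod σ O) (k : ℂ) (x y : X) :
    O.linner x (k • y) = conj k • O.linner x y := by
  rw [← hO.linner_star, hO.linner_smul, star_smul, hO.linner_star]; rfl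

lemma linner_lact_right (hO : EqBimod σ O) (a : A) (x y : X) :
    O.linner x (O.lact a y) = O.linner x y * star a := by
  rw [← hO.linner_star, hO.linner_lact, star_mul, hO.linner_star]

lemma ract_rinner (hO : EqBimod σ O) (x y : X) (b : B) :
    O.rinner (O.ract x b) y = star b * O.rinner x y := by
  rw [← hO.rinner_star, hO.rinner_ract, star_mul, hO.rinner_star]

lemma norm_le_of_adjoint_comp {V E : Type*} [NormedAddCommGroup V] [InnerProductSpace ℂ V]
    [CompleteSpace V] [NormedAddCommGroup E] [InnerProductSpace ℂ E] [CompleteSpace E]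
    {T : V →L[ℂ] E} {C : ℝ} (hC : 0 ≤ C)
    (h : ‖ContinuousLinearMap.adjoint T ∘L T‖ ≤ C ^ 2) : ‖T‖ ≤ C := by
  rw [ContinuousLinearMap.norm_adjoint_comp_self, ← sq] at h
  exact le_of_sq_le_sq h hC

lemma dense_span_image {V E : Type*} [NormedAddCommGroup V] [InnerProductSpace ℂ V]
    [NormedAddCommGroup E] [InnerProductSpace ℂ E] {e : X → V →L[ℂ] E}
    (he : Dense (Submodule.span ℂ {η | ∃ x v, η = e x v} : Set E))
    (hadd : ∀ x y, e (x + y) = e x + e y) (hsmul : ∀ (k : ℂ) x, ∃ l : ℂ, e (k • x) = l • e x)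
    (hn : ∀ x, ‖e x‖ ≤ ‖x‖) {S : Set X} (hS : Dense (Submodule.span ℂ S : Set X)) :
    Dense (Submodule.span ℂ {η | ∃ x ∈ S, ∃ v, η = e x v} : Set E) := by
  have hz : e 0 = 0 := by have := hadd 0 0; simpa using this
  have hsub : ∀ x y, e (x - y) = e x - e y := fun x y => by
    have := hadd (x - y) y
    rw [sub_add_cancel] at this
    rw [this, add_sub_cancel_right]
  have hcont : Continuous e := by
    refine continuous_iff_continuousAt.2 fun x => ?_
    rw [ContinuousAt, tendsto_iff_norm_sub_tendsto_zero]
    refine squeeze_zero (fun _ => norm_nonneg _) (fun y => (hsub y x ▸ hn (y - x))) ?_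
    exact tendsto_iff_norm_sub_tendsto_zero.1 tendsto_id
  refine dense_of_le_closure he ?_
  rintro _ ⟨x, v, rfl⟩
  let M : Submodule ℂ E := (Submodule.span ℂ {η | ∃ x ∈ S, ∃ v, η = e x v}).topologicalClosure
  have hM : IsClosed {x | e x v ∈ M} :=
    (Submodule.isClosed_topologicalClosure _).preimage
      ((ContinuousLinearMap.apply ℂ E v).continuous.comp hcont)
  have : closure (Submodule.span ℂ S : Set X) ⊆ {x | e x v ∈ M} := by
    refine closure_minimal (fun x hx => ?_) hM
    change e x v ∈ M
    induction hx using Submodule.span_induction with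
    | mem x hx => exact Submodule.le_topologicalClosure _ (Submodule.subset_span ⟨x, hx, v, rfl⟩)
    | zero => rw [hz]; exact M.zero_mem
    | add x y _ _ h1 h2 => rw [hadd]; exact M.add_mem h1 h2
    | smul k x _ h => obtain ⟨l, hl⟩ := hsmul k x; rw [hl]; exact M.smul_mem l h
  exact this (hS x)

lemma continuous_induced {V E : Type*} [NormedAddCommGroup V] [InnerProductSpace ℂ V]
    [CompleteSpace V] [NormedAddCommGroup E] [InnerProductSpace ℂ E] {e : X → V →L[ℂ] E}
    (hO : EqBimod σ O) (hadd : ∀ x y, e (x + y) = e x + e y) (hn : ∀ x, ‖e x‖ ≤ ‖x‖)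
    (U : URep Γ V) (x : X) (v : V) :
    Continuous fun s => e (O.γ s x) ((U.U s : V →L[ℂ] V) v) := by
  have hsub : ∀ x y, e (x - y) = e x - e y := fun x y => by
    have := hadd (x - y) y
    rw [sub_add_cancel] at this
    rw [this, add_sub_cancel_right]
  have hcont : Continuous e := by
    refine continuous_iff_continuousAt.2 fun x => ?_
    rw [ContinuousAt, tendsto_iff_norm_sub_tendsto_zero]
    refine squeeze_zero (fun _ => norm_nonneg _) (fun y => (hsub y x ▸ hn (y - x))) ?_
    exact tendsto_iff_norm_sub_tendsto_zero.1 tendsto_id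
  exact (hcont.comp (hO.γ_cont.comp (Continuous.prodMk_left x))).clm_apply (U.cont v)

theorem exists_rightIdx (hO : EqBimod σ O) (i : CovFam σ O.β (MonoidHom.id Circle)) :
    ∃ k : BimodFam σ O, k.rightIdx = i := by
  let π := i.rep.π
  obtain ⟨E, _, _, _, e, hK, he⟩ := exists_kolmogorov (fun x y => π (O.rinner x y))
    (fun x y => by
      rw [← ContinuousLinearMap.star_eq_adjoint, ← map_star, hO.rinner_star])
    (kernel_pos π (act := fun b x => O.ract x b) i.rep.nondeg hO.add_rinner hO.rinner_add
      (fun a b x y => by rw [hO.rinner_ract, hO.ract_rinner]) hO.rinner_pos)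
  have hin : ∀ x v y w, inner ℂ (e x v) (e y w) = inner ℂ v (π (O.rinner x y) w) := by
    intro x v y w
    rw [← hK, ContinuousLinearMap.comp_apply, ContinuousLinearMap.adjoint_inner_right]
  have hadd : ∀ x y, e (x + y) = e x + e y := fun x y => kolmogorov_ext he fun z => by
    rw [ContinuousLinearMap.comp_add, hK, hK, hK, hO.rinner_add, map_add]
  have hsmul : ∀ (k : ℂ) x, e (k • x) = k • e x := fun k x => kolmogorov_ext he fun z => by
    rw [ContinuousLinearMap.comp_smul, hK, hK, hO.rinner_smul, map_smul]
  have hract : ∀ x b, e (O.ract x b) = e x ∘L π b := fun x b => kolmogorov_ext he fun z => by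
    rw [← ContinuousLinearMap.comp_assoc, hK, hK, hO.rinner_ract, map_mul]; rfl
  have hn : ∀ x, ‖e x‖ ≤ ‖x‖ := fun x => norm_le_of_adjoint_comp (norm_nonneg _) (by
    rw [hK]; exact (NonUnitalStarAlgHom.norm_apply_le _ _).trans (hO.norm_rinner x))
  obtain ⟨πA, hπA⟩ := exists_rep he O.lact
    (fun a x v y w => by rw [hin, hin, hO.rinner_lact])
    (fun a b x => by rw [hO.add_lact, hadd]) (fun k a x => by rw [hO.smul_lact, hsmul])
    (fun a b x => by rw [hO.mul_lact])
  obtain ⟨UA, hUA⟩ := exists_urep he i.rep.toURep O.γ (fun x => by rw [hO.γ_one])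
    (fun s t x => by rw [hO.γ_mul])
    (fun s x v y w => by
      rw [hin, hin, hO.γ_rinner, ← i.rep.covariant,
        ← ContinuousLinearMap.adjoint_inner_left, i.rep.toURep.adjoint_eq, i.rep.toURep.inv_apply])
    (hO.continuous_induced hadd hn _)
  refine ⟨⟨E, i.H, ⟨⟨UA, πA, ?_, ?_, ?_⟩, i.rep, ⟨⟨e, hadd⟩, hsmul⟩, ?_, ?_, ?_, ?_, ?_⟩⟩, rfl⟩
  · have := dense_span_image he hadd (fun k x => ⟨k, hsmul k x⟩) hn hO.lact_dense
    refine this.mono (Submodule.span_mono ?_)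
    rintro _ ⟨_, ⟨a, x, rfl⟩, v, rfl⟩
    exact ⟨a, e x v, (hπA a x v).symm⟩
  · intro s a ξ
    have : (UA.U s : E →L[ℂ] E) * πA a = πA (O.α s a) * (UA.U s : E →L[ℂ] E) := clm_ext_dense he (by
      rintro _ ⟨x, v, rfl⟩
      rw [mul_apply_eq_comp, mul_apply_eq_comp, hπA, hUA, hUA, hπA, hO.γ_lact])
    exact DFunLike.congr_fun this ξ
  · intro z ξ
    have : (UA.U (σ.ι z) : E →L[ℂ] E) = 1 := clm_ext_dense he (by
      rintro _ ⟨x, v, rfl⟩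
      rw [hUA, hO.γ_ι, hsmul, i.rep.twist, _root_.smul_apply, map_smul, smul_smul]
      rw [MonoidHom.id_apply, conj_mul_circle, one_smul]; rfl)
    rw [this]; simp
  · intro x y
    refine clm_ext_dense he ?_
    rintro _ ⟨z, v, rfl⟩
    change πA (O.linner x y) (e z v) = e x (ContinuousLinearMap.adjoint (e y) (e z v))
    rw [hπA, hO.imprim, hract, ← hK]; rfl
  · intro x y
    exact (hK x y).symm
  · intro a x
    ext1 v
    exact (hπA a x v).symm
  · exact hract
  · intro s x ξ
    exact hUA s x ξ

set_option maxHeartbeats 1000000 in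
theorem exists_leftIdx (hO : EqBimod σ O) (i : CovFam σ O.α 1) :
    ∃ k : BimodFam σ O, k.leftIdx = i := by
  let π := i.rep.π
  obtain ⟨E, _, _, _, e, hK, he⟩ := exists_kolmogorov (fun x y => π (O.linner x y))
    (fun x y => by
      rw [← ContinuousLinearMap.star_eq_adjoint, ← map_star, hO.linner_star])
    (kernel_pos π (act := fun a x => O.lact (star a) x) i.rep.nondeg hO.linner_add
      (fun x y z => hO.linner_add_right y z x)
      (fun a b x y => by rw [hO.linner_lact, hO.linner_lact_right, star_star, mul_assoc])
      hO.linner_pos)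
  have hin : ∀ x v y w, inner ℂ (e x v) (e y w) = inner ℂ v (π (O.linner x y) w) := by
    intro x v y w
    rw [← hK, ContinuousLinearMap.comp_apply, ContinuousLinearMap.adjoint_inner_right]
  have hK' : ∀ x y v, ContinuousLinearMap.adjoint (e x) (e y v) = π (O.linner x y) v :=
    fun x y v => DFunLike.congr_fun (hK x y) v
  have hadd : ∀ x y, e (x + y) = e x + e y := fun x y => kolmogorov_ext he fun z => by
    rw [ContinuousLinearMap.comp_add, hK, hK, hK, hO.linner_add_right, map_add]
  have hsmul : ∀ (k : ℂ) x, e (k • x) = conj k • e x := fun k x => kolmogorov_ext he fun z => by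
    rw [ContinuousLinearMap.comp_smul, hK, hK, hO.linner_smul_right, map_smul]
  have hlact : ∀ a x, e (O.lact a x) = e x ∘L π (star a) := fun a x => kolmogorov_ext he fun z => by
    rw [← ContinuousLinearMap.comp_assoc, hK, hK, hO.linner_lact_right, map_mul]; rfl
  have hn : ∀ x, ‖e x‖ ≤ ‖x‖ := fun x => norm_le_of_adjoint_comp (norm_nonneg _) (by
    rw [hK]; exact (NonUnitalStarAlgHom.norm_apply_le _ _).trans (hO.norm_linner x))
  obtain ⟨πB, hπB⟩ := exists_rep he (fun b x => O.ract x (star b))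
    (fun b x v y w => by rw [hin, hin, hO.linner_ract])
    (fun a b x => by rw [star_add, hO.ract_add, hadd])
    (fun k a x => by rw [star_smul, hO.ract_smul, hsmul]; simp)
    (fun a b x => by rw [star_mul, hO.ract_mul])
  obtain ⟨UB, hUB⟩ := exists_urep he i.rep.toURep O.γ (fun x => by rw [hO.γ_one])
    (fun s t x => by rw [hO.γ_mul])
    (fun s x v y w => by
      rw [hin, hin, hO.γ_linner, ← i.rep.covariant,
        ← ContinuousLinearMap.adjoint_inner_left, i.rep.toURep.adjoint_eq, i.rep.toURep.inv_apply])
    (hO.continuous_induced hadd hn _)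
  refine ⟨⟨i.H, E, ⟨i.rep, ⟨UB, πB, ?_, ?_, ?_⟩,
    ⟨⟨fun x => ContinuousLinearMap.adjoint (e x), fun x y => by rw [hadd, map_add]⟩, fun k x => by
      simp only [hsmul, LinearIsometryEquiv.map_smulₛₗ, Complex.conj_conj, RingHom.id_apply]⟩,
    ?_, ?_, ?_, ?_, ?_⟩⟩, rfl⟩
  · have := dense_span_image he hadd (fun k x => ⟨_, hsmul k x⟩) hn hO.ract_dense
    refine this.mono (Submodule.span_mono ?_)
    rintro _ ⟨_, ⟨x, b, rfl⟩, v, rfl⟩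
    exact ⟨star b, e x v, by rw [hπB, star_star]⟩
  · intro s a ξ
    have : (UB.U s : E →L[ℂ] E) * πB a = πB (O.β s a) * (UB.U s : E →L[ℂ] E) := clm_ext_dense he (by
      rintro _ ⟨x, v, rfl⟩
      rw [mul_apply_eq_comp, mul_apply_eq_comp, hπB, hUB, hUB, hπB, hO.γ_ract, hO.β_star])
    exact DFunLike.congr_fun this ξ
  · intro z ξ
    have : (UB.U (σ.ι z) : E →L[ℂ] E) = (z : ℂ) • 1 := clm_ext_dense he (by
      rintro _ ⟨x, v, rfl⟩
      rw [hUB, hO.γ_ι, hsmul, i.rep.twist, _root_.smul_apply, map_smul, Complex.conj_conj]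
      simp)
    rw [this]; simp
  · intro x y
    change _ = ContinuousLinearMap.adjoint (e x) ∘L
      ContinuousLinearMap.adjoint (ContinuousLinearMap.adjoint (e y))
    rw [ContinuousLinearMap.adjoint_adjoint, hK]
  · intro x y
    change _ = ContinuousLinearMap.adjoint (ContinuousLinearMap.adjoint (e x)) ∘L
      ContinuousLinearMap.adjoint (e y)
    rw [ContinuousLinearMap.adjoint_adjoint]
    refine clm_ext_dense he ?_
    rintro _ ⟨z, v, rfl⟩
    rw [hπB, hO.rinner_star, ← hO.imprim, hlact, hO.linner_star, ← hK]; rfl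
  · intro a x
    change ContinuousLinearMap.adjoint (e (O.lact a x)) = _ ∘L ContinuousLinearMap.adjoint (e x)
    rw [hlact, ContinuousLinearMap.adjoint_comp, map_star, ContinuousLinearMap.star_eq_adjoint,
      ContinuousLinearMap.adjoint_adjoint]
  · intro x b
    change ContinuousLinearMap.adjoint (e (O.ract x b)) = ContinuousLinearMap.adjoint (e x) ∘L πB b
    have : e (O.ract x b) = πB (star b) ∘L e x := by
      ext1 v
      rw [ContinuousLinearMap.comp_apply, hπB, star_star]
    rw [this, ContinuousLinearMap.adjoint_comp, map_star, ContinuousLinearMap.star_eq_adjoint,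
      ContinuousLinearMap.adjoint_adjoint]
  · intro s x ξ
    have : (i.rep.U s : i.H →L[ℂ] i.H) ∘L ContinuousLinearMap.adjoint (e x) =
        ContinuousLinearMap.adjoint (e (O.γ s x)) ∘L (UB.U s : E →L[ℂ] E) := clm_ext_dense he (by
      rintro _ ⟨y, v, rfl⟩
      rw [ContinuousLinearMap.comp_apply, ContinuousLinearMap.comp_apply, hUB, hK', hK', hO.γ_linner]
      exact i.rep.covariant s _ v)
    exact DFunLike.congr_fun this ξ

end EqBimod

end Induce


/-! ### Conjugation by families of unitaries -/

section Rel

variable {I I' K : Type*} {H : I → Type*} {H' : I' → Type*}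
  [∀ i, NormedAddCommGroup (H i)] [∀ i, InnerProductSpace ℂ (H i)] [∀ i, CompleteSpace (H i)]
  [∀ i, NormedAddCommGroup (H' i)] [∀ i, InnerProductSpace ℂ (H' i)] [∀ i, CompleteSpace (H' i)]
  {r : K → I'} {l : K → I} {T : ∀ k, H' (r k) →L[ℂ] H (l k)}

/-- `y = T x T⋆` along the index maps `r` and `l`. -/
def AdRel (r : K → I') (l : K → I) (T : ∀ k, H' (r k) →L[ℂ] H (l k)) (x : BFam H') (y : BFam H) :
    Prop :=
  ∀ k, y.ap (l k) = T k ∘L x.ap (r k) ∘L ContinuousLinearMap.adjoint (T k)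

/-- Families of unitaries `H'_{r k} → H_{l k}`. -/
def AdUnit (r : K → I') (l : K → I) (T : ∀ k, H' (r k) →L[ℂ] H (l k)) : Prop :=
  ∀ k, ContinuousLinearMap.adjoint (T k) ∘L T k = ContinuousLinearMap.id ℂ (H' (r k)) ∧
    T k ∘L ContinuousLinearMap.adjoint (T k) = ContinuousLinearMap.id ℂ (H (l k))

/-- A set of families acts nondegenerately. -/
def ActsNondeg (D : NonUnitalStarSubalgebra ℂ (BFam H)) : Prop :=
  ∀ i, Dense (Submodule.span ℂ {η | ∃ d ∈ D, ∃ ξ : H i, η = d.ap i ξ} : Set (H i))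

namespace AdUnit

variable (hT : AdUnit r l T)

lemma adj_apply (hT : AdUnit r l T) (k : K) (ξ : H' (r k)) : ContinuousLinearMap.adjoint (T k) (T k ξ) = ξ :=
  DFunLike.congr_fun (hT k).1 ξ

lemma apply_adj (hT : AdUnit r l T) (k : K) (ξ : H (l k)) : T k (ContinuousLinearMap.adjoint (T k) ξ) = ξ :=
  DFunLike.congr_fun (hT k).2 ξ

lemma norm_apply (hT : AdUnit r l T) (k : K) (ξ : H' (r k)) : ‖T k ξ‖ = ‖ξ‖ :=
  (ContinuousLinearMap.norm_map_iff_adjoint_comp_self (T k)).2 (hT k).1 ξ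

lemma symm (hT : AdUnit r l T) : AdUnit l r fun k => ContinuousLinearMap.adjoint (T k) := fun k => by
  rw [ContinuousLinearMap.adjoint_adjoint]; exact ⟨(hT k).2, (hT k).1⟩

lemma norm_adj_apply (hT : AdUnit r l T) (k : K) (ξ : H (l k)) :
    ‖ContinuousLinearMap.adjoint (T k) ξ‖ = ‖ξ‖ := hT.symm.norm_apply k ξ

end AdUnit

namespace AdRel

lemma apply {x : BFam H'} {y : BFam H} (h : AdRel r l T x y) (k : K) (ξ : H (l k)) :
    y.ap (l k) ξ = T k (x.ap (r k) (ContinuousLinearMap.adjoint (T k) ξ)) := by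
  rw [h k]; rfl

lemma apply' (hT : AdUnit r l T) {x : BFam H'} {y : BFam H} (h : AdRel r l T x y) (k : K)
    (ξ : H' (r k)) : y.ap (l k) (T k ξ) = T k (x.ap (r k) ξ) := by
  rw [h.apply, hT.adj_apply]

lemma of_apply (hT : AdUnit r l T) {x : BFam H'} {y : BFam H}
    (h : ∀ k (ξ : H' (r k)), y.ap (l k) (T k ξ) = T k (x.ap (r k) ξ)) : AdRel r l T x y := by
  intro k
  ext1 ξ
  rw [← hT.apply_adj k ξ, h, hT.apply_adj]; rfl

lemma symm (hT : AdUnit r l T) {x : BFam H'} {y : BFam H} (h : AdRel r l T x y) :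
    AdRel l r (fun k => ContinuousLinearMap.adjoint (T k)) y x :=
  of_apply hT.symm fun k ξ => by rw [h.apply, hT.adj_apply]

lemma of_symm (hT : AdUnit r l T) {x : BFam H'} {y : BFam H}
    (h : AdRel l r (fun k => ContinuousLinearMap.adjoint (T k)) y x) : AdRel r l T x y :=
  of_apply hT fun k ξ => by
    have := h.apply' hT.symm k (T k ξ)
    rw [hT.adj_apply] at this
    rw [this, hT.apply_adj]

lemma add {x x' : BFam H'} {y y' : BFam H} (h : AdRel r l T x y) (h' : AdRel r l T x' y') :
    AdRel r l T (x + x') (y + y') := fun k => by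
  ext1 ξ
  simp [h.apply, h'.apply]

lemma smul (c : ℂ) {x : BFam H'} {y : BFam H} (h : AdRel r l T x y) :
    AdRel r l T (c • x) (c • y) := fun k => by
  ext1 ξ
  simp [h.apply]

lemma zero : AdRel r l T 0 0 := fun k => by
  ext1 ξ
  simp

lemma mul (hT : AdUnit r l T) {x x' : BFam H'} {y y' : BFam H} (h : AdRel r l T x y)
    (h' : AdRel r l T x' y') : AdRel r l T (x * x') (y * y') := fun k => by
  ext1 ξ
  rw [BFam.mul_ap, mul_apply_eq_comp, h'.apply, h.apply' hT]
  rfl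

lemma star {x : BFam H'} {y : BFam H} (h : AdRel r l T x y) :
    AdRel r l T (star x) (star y) := fun k => by
  rw [BFam.star_ap, BFam.star_ap, h k, ContinuousLinearMap.star_eq_adjoint,
    ContinuousLinearMap.star_eq_adjoint, ContinuousLinearMap.adjoint_comp,
    ContinuousLinearMap.adjoint_comp, ContinuousLinearMap.adjoint_adjoint]
  rfl

lemma unique_right (hl : Function.Surjective l) {x : BFam H'} {y y' : BFam H}
    (h : AdRel r l T x y) (h' : AdRel r l T x y') : y = y' := BFam.ext fun i => by
  obtain ⟨k, rfl⟩ := hl i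
  rw [h k, h' k]

lemma unique_left (hT : AdUnit r l T) (hr : Function.Surjective r) {x x' : BFam H'} {y : BFam H}
    (h : AdRel r l T x y) (h' : AdRel r l T x' y) : x = x' :=
  unique_right hr (h.symm hT) (h'.symm hT)

lemma norm_le (hT : AdUnit r l T) (hl : Function.Surjective l) {x : BFam H'} {y : BFam H}
    (h : AdRel r l T x y) : ‖y‖ ≤ ‖x‖ := by
  refine BFam.norm_le (norm_nonneg _) fun i => ?_
  obtain ⟨k, rfl⟩ := hl i
  refine ContinuousLinearMap.opNorm_le_bound _ (norm_nonneg _) fun ξ => ?_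
  rw [h.apply, hT.norm_apply, ← hT.norm_adj_apply k ξ]
  exact ContinuousLinearMap.le_of_opNorm_le _ (x.norm_ap_le _) _

/-- A relation that is bijective between two star subalgebras is a star isomorphism. -/
lemma exists_iso (hT : AdUnit r l T) (hr : Function.Surjective r) (hl : Function.Surjective l)
    {D' : NonUnitalStarSubalgebra ℂ (BFam H')} {D : NonUnitalStarSubalgebra ℂ (BFam H)}
    (h1 : ∀ x ∈ D', ∃ y ∈ D, AdRel r l T x y) (h2 : ∀ y ∈ D, ∃ x ∈ D', AdRel r l T x y) :
    ∃ e : D' ≃⋆ₐ[ℂ] D, ∀ x, AdRel r l T x.1 (e x).1 := by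
  choose f hf hf' using fun x : D' => h1 x.1 x.2
  choose g hg hg' using fun y : D => h2 y.1 y.2
  refine ⟨{ toFun := fun x => ⟨f x, hf x⟩
            invFun := fun y => ⟨g y, hg y⟩
            left_inv := fun x => Subtype.ext (unique_left hT hr (hg' ⟨f x, hf x⟩) (hf' x))
            right_inv := fun y => Subtype.ext (unique_right hl (hf' ⟨g y, hg y⟩) (hg' y))
            map_mul' := fun x y => Subtype.ext (unique_right hl (hf' _) ((hf' x).mul hT (hf' y)))
            map_add' := fun x y => Subtype.ext (unique_right hl (hf' _) ((hf' x).add (hf' y)))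
            map_star' := fun x => Subtype.ext (unique_right hl (hf' _) (hf' x).star)
            map_smul' := fun c x => Subtype.ext (unique_right hl (hf' _) ((hf' x).smul c)) }, hf'⟩

lemma exists_mult (hT : AdUnit r l T) (hl : Function.Surjective l)
    {D' : NonUnitalStarSubalgebra ℂ (BFam H')} {D : NonUnitalStarSubalgebra ℂ (BFam H)}
    (h1 : ∀ x ∈ D', ∃ y ∈ D, AdRel r l T x y) (h2 : ∀ y ∈ D, ∃ x ∈ D', AdRel r l T x y)
    (hD : ActsNondeg D) {m : BFam H'} (hm : m ∈ multiplierAlgebra D') :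
    ∃ n ∈ multiplierAlgebra D, AdRel r l T m n := by
  have key : ∀ i, ∃ n : H i →L[ℂ] H i, ‖n‖ ≤ ‖m‖ ∧ ∀ d' ∈ D', ∀ d e, AdRel r l T d' d →
      AdRel r l T (m * d') e → n ∘L d.ap i = e.ap i := by
    intro i
    obtain ⟨k, rfl⟩ := hl i
    refine ⟨T k ∘L m.ap (r k) ∘L ContinuousLinearMap.adjoint (T k),
      ContinuousLinearMap.opNorm_le_bound _ (norm_nonneg _) fun ξ => ?_, fun d' _ d e hd he => ?_⟩
    · change ‖T k (m.ap (r k) (ContinuousLinearMap.adjoint (T k) ξ))‖ ≤ _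
      rw [hT.norm_apply, ← hT.norm_adj_apply k ξ]
      exact ContinuousLinearMap.le_of_opNorm_le _ (m.norm_ap_le _) _
    · ext1 ξ
      change T k (m.ap (r k) (ContinuousLinearMap.adjoint (T k) (d.ap (l k) ξ))) = _
      rw [hd.apply, hT.adj_apply, he.apply]
      rfl
  choose n hn hn' using key
  let N : BFam H := (famMk (H' := H) (H := H) n ‖m‖ hn).toB
  have hN : AdRel r l T m N := by
    intro k
    refine clm_ext_dense (hD (l k)) ?_
    rintro _ ⟨d, hd, ξ, rfl⟩
    obtain ⟨d', hd', hdd⟩ := h2 d hd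
    obtain ⟨e, -, he⟩ := h1 _ (hm d' hd').1
    have := DFunLike.congr_fun (hn' (l k) d' hd' d e hdd he) ξ
    change n (l k) (d.ap (l k) ξ) = _
    refine this.trans ?_
    change _ = T k (m.ap (r k) (ContinuousLinearMap.adjoint (T k) (d.ap (l k) ξ)))
    rw [hdd.apply, hT.adj_apply, he.apply]
    rfl
  refine ⟨N, fun d hd => ?_, hN⟩
  obtain ⟨d', hd', hdd⟩ := h2 d hd
  obtain ⟨e, he, hee⟩ := h1 _ (hm d' hd').1
  obtain ⟨e', he', hee'⟩ := h1 _ (hm d' hd').2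
  rw [unique_right hl (hN.mul hT hdd) hee, unique_right hl (hdd.mul hT hN) hee']
  exact ⟨he, he'⟩

theorem exists_isos (hT : AdUnit r l T) (hr : Function.Surjective r) (hl : Function.Surjective l)
    {D' : NonUnitalStarSubalgebra ℂ (BFam H')} {D : NonUnitalStarSubalgebra ℂ (BFam H)}
    (h1 : ∀ x ∈ D', ∃ y ∈ D, AdRel r l T x y) (h2 : ∀ y ∈ D, ∃ x ∈ D', AdRel r l T x y)
    (hD' : ActsNondeg D') (hD : ActsNondeg D) :
    ∃ (e : D' ≃⋆ₐ[ℂ] D) (f : multiplierAlgebra D' ≃⋆ₐ[ℂ] multiplierAlgebra D),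
      (∀ x, AdRel r l T x.1 (e x).1) ∧ ∀ m, AdRel r l T m.1 (f m).1 := by
  obtain ⟨e, he⟩ := exists_iso hT hr hl h1 h2
  obtain ⟨f, hf⟩ := exists_iso (D' := multiplierAlgebra D') (D := multiplierAlgebra D) hT hr hl
    (fun m hm => exists_mult hT hl h1 h2 hD hm) (fun n hn => by
      obtain ⟨m, hm, hmn⟩ := exists_mult (m := n) hT.symm hr
        (fun y hy => (h2 y hy).imp fun x hx => ⟨hx.1, hx.2.symm hT⟩)
        (fun x hx => (h1 x hx).imp fun y hy => ⟨hy.1, hy.2.symm hT⟩) hD' hn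
      exact ⟨m, hm, of_symm hT hmn⟩)
  exact ⟨e, f, he, hf⟩

end AdRel

/-- The elements of `D'` with a partner in `D` form a closed set. -/
lemma isClosed_partner (hT : AdUnit r l T) (hl : Function.Surjective l)
    {D : NonUnitalStarSubalgebra ℂ (BFam H)} (hD : IsClosed (D : Set (BFam H))) :
    IsClosed {x : BFam H' | ∃ y ∈ D, AdRel r l T x y} := by
  refine IsSeqClosed.isClosed fun u x hu hx => ?_
  choose v hv hv' using hu
  have hc : CauchySeq v := by
    rw [Metric.cauchySeq_iff']
    intro ε hε
    obtain ⟨N, hN⟩ := Metric.cauchySeq_iff'.1 hx.cauchySeq ε hε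
    refine ⟨N, fun n hn => lt_of_le_of_lt ?_ (hN n hn)⟩
    rw [dist_eq_norm, dist_eq_norm]
    have h1 : AdRel r l T (u n - u N) (v n - v N) := by
      have := (hv' n).add ((hv' N).smul (-1))
      simpa only [neg_one_smul, ← sub_eq_add_neg] using this
    exact h1.norm_le hT hl
  obtain ⟨y, hy⟩ := cauchySeq_tendsto_of_complete hc
  refine ⟨y, hD.mem_of_tendsto hy (.of_forall hv), fun k => ?_⟩
  have c1 : ∀ i, Continuous fun z : BFam H => z.ap i := fun i => by
    let E : BFam H →L[ℂ] (H i →L[ℂ] H i) := LinearMap.mkContinuous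
      { toFun := fun z => z.ap i
        map_add' := fun _ _ => rfl
        map_smul' := fun _ _ => rfl } 1 (fun z => by rw [one_mul]; exact z.norm_ap_le i)
    exact E.continuous
  have c2 : ∀ i, Continuous fun z : BFam H' => z.ap i := fun i => by
    let E : BFam H' →L[ℂ] (H' i →L[ℂ] H' i) := LinearMap.mkContinuous
      { toFun := fun z => z.ap i
        map_add' := fun _ _ => rfl
        map_smul' := fun _ _ => rfl } 1 (fun z => by rw [one_mul]; exact z.norm_ap_le i)
    exact E.continuous
  refine tendsto_nhds_unique (((c1 (l k)).tendsto y).comp hy) ?_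
  have h3 := ((continuous_const (y := T k)).clm_comp ((c2 (r k)).clm_comp
    (continuous_const (y := ContinuousLinearMap.adjoint (T k))))).tendsto x
  refine (h3.comp hx).congr fun n => ?_
  exact ((hv' n) k).symm

end Rel

section Good

lemma comp_adjoint_comp {V W : Type*} [NormedAddCommGroup V] [InnerProductSpace ℂ V]
    [CompleteSpace V] [NormedAddCommGroup W] [InnerProductSpace ℂ W] [CompleteSpace W]
    (T : V →L[ℂ] W) (c : V →L[ℂ] V) : (T ∘L c) ∘L ContinuousLinearMap.adjoint (T ∘L c) =
      T ∘L (c * star c) ∘L ContinuousLinearMap.adjoint T := by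
  rw [ContinuousLinearMap.adjoint_comp]; rfl

lemma mem_span_mul_star {P : Type*} [NonUnitalCStarAlgebra P] (D : NonUnitalStarSubalgebra ℂ P)
    (hD : IsClosed (D : Set P)) {b : P} (hb : b ∈ D) :
    b ∈ Submodule.span ℂ {d | ∃ c ∈ D, d = c * star c} := by
  have : IsClosed (D : Set P) := hD
  let _ : PartialOrder D := CStarAlgebra.spectralOrder D
  have _ : StarOrderedRing D := CStarAlgebra.spectralOrderedRing D
  have h : (⟨b, hb⟩ : D) ∈ Submodule.span ℂ {a : D | 0 ≤ a} := by
    rw [CStarAlgebra.span_nonneg]; trivial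
  have h2 : ∀ a : D, a ∈ Submodule.span ℂ {a : D | 0 ≤ a} →
      a.1 ∈ Submodule.span ℂ {d | ∃ c ∈ D, d = c * star c} := by
    intro a ha
    induction ha using Submodule.span_induction with
    | zero => exact zero_mem _
    | add x y _ _ hx hy => exact add_mem hx hy
    | smul k x _ hx => exact Submodule.smul_mem _ k hx
    | mem a ha =>
      obtain ⟨c, hc⟩ := CStarAlgebra.nonneg_iff_eq_mul_star_self.1 (show 0 ≤ a from ha)
      exact Submodule.subset_span ⟨c.1, c.2, congrArg Subtype.val hc⟩
  exact h2 _ h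

variable {Γ : Type*} [Group Γ] [TopologicalSpace Γ] [IsTopologicalGroup Γ] [MeasurableSpace Γ]
  [BorelSpace Γ] {Y : Type*} [NormedAddCommGroup Y] [NormedSpace ℂ Y]
  {I J : Type*} {H' H : I → Type*} [∀ i, NormedAddCommGroup (H i)]
  [∀ i, InnerProductSpace ℂ (H i)] [∀ i, CompleteSpace (H i)]
  [∀ i, NormedAddCommGroup (H' i)] [∀ i, InnerProductSpace ℂ (H' i)]
  [∀ i, CompleteSpace (H' i)]

lemma isometry_freindex {r : J → I} (hr : Function.Surjective r) :
    Isometry (freindex r : Fam H' H →L[ℂ] Fam (fun j => H' (r j)) (fun j => H (r j))) := by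
  refine AddMonoidHomClass.isometry_of_norm _ fun x => le_antisymm ?_ ?_
  · exact fam_norm_le (norm_nonneg _) fun j => fam_le x (r j)
  · refine fam_norm_le (norm_nonneg _) fun i => ?_
    obtain ⟨j, rfl⟩ := hr i
    exact fam_le (freindex r x) j

lemma Corner.exists_of_mem_comap (c : Corner Γ Y H' H) (μ : Measure Γ) [IsHaarMeasure μ]
    {r : J → I} (hr : Function.Surjective r) {x : Fam (fun j => H' (r j)) (fun j => H (r j))}
    (hx : x ∈ (c.comap r).cross μ) : ∃ y ∈ c.cross μ, freindex r y = x := by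
  have : (c.comap r).cross μ ≤ (c.cross μ).map
      (freindex r : Fam H' H →L[ℂ] Fam (fun j => H' (r j)) (fun j => H (r j))).toLinearMap := by
    refine (c.comap r).cross_le μ ?_ fun f => ⟨c.integ μ f, c.integ_mem μ f, rfl⟩
    exact (isometry_freindex hr).isClosedEmbedding.isClosedMap _ (c.isClosed_cross μ)
  exact this hx

lemma Corner.rho_mem (c : Corner Γ Y H' H) (μ : Measure Γ) [IsHaarMeasure μ]
    [LocallyCompactSpace Γ] [T2Space Γ] [Regular μ] (i : I) (y : Y) (ξ : H' i)
    {M : Submodule ℂ (H i)} (hM : IsClosed (M : Set (H i))) (h : ∀ x ∈ c.cross μ, x i ξ ∈ M) :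
    c.ρ i y ξ ∈ M := by
  change _ ∈ (M : Set (H i))
  rw [← hM.closure_eq, Metric.mem_closure_iff]
  intro ε hε
  obtain ⟨b, -, -, hb⟩ := exists_bump μ (F := fun s => c.ρ i y (((c.V i).U s : H' i →L[ℂ] H' i) ξ))
    ((c.ρ i y).continuous.comp ((c.V i).cont ξ)) Filter.univ_mem (half_pos hε)
  refine ⟨c.integ μ (tens b y) i ξ, h _ (c.integ_mem μ _), ?_⟩
  rw [dist_comm, dist_eq_norm, integ_apply]
  have h1 : c.ρ i y (((c.V i).U 1 : H' i →L[ℂ] H' i) ξ) = c.ρ i y ξ := by rw [map_one]; rfl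
  have h2 : ∀ s, c.ρ i (tens b y s) (((c.V i).U s : H' i →L[ℂ] H' i) ξ) =
      b s • c.ρ i y (((c.V i).U s : H' i →L[ℂ] H' i) ξ) := fun s => by
    change c.ρ i (b s • y) _ = _
    rw [map_smul]; rfl
  simp only [h2]
  rw [h1] at hb
  linarith

end Good

section Good

variable {G Γ : Type u} [Group G] [TopologicalSpace G] [IsTopologicalGroup G] [Group Γ] [TopologicalSpace Γ]
  [IsTopologicalGroup Γ] [MeasurableSpace Γ] [BorelSpace Γ] [LocallyCompactSpace Γ] [T2Space Γ]
  {A B : Type*} [NonUnitalCStarAlgebra A] [NonUnitalCStarAlgebra B]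
  {σ : Twist G Γ} (μ : Measure Γ) [IsHaarMeasure μ] [Regular μ]

lemma actsNondeg_crossedProduct {χ : Circle →* Circle} (hχ : Continuous χ) {α : Γ → A → A}
    (hα : Continuous fun p : Γ × A => α p.1 p.2) (hα0 : ∀ s, α s 0 = 0) :
    ActsNondeg (crossedProduct μ σ α χ) := by
  intro i
  refine dense_of_le_closure i.rep.nondeg ?_
  rintro _ ⟨a, ξ, rfl⟩
  refine (covCor σ α χ).rho_mem μ i a ξ (M := (Submodule.span ℂ {η | ∃ d ∈ crossedProduct μ σ α χ,
    ∃ ξ : i.H, η = d.ap i ξ}).topologicalClosure) (Submodule.isClosed_topologicalClosure _) ?_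
  intro x hx
  exact Submodule.le_topologicalClosure _ (Submodule.subset_span
    ⟨x.toB, (mem_crossedProduct μ σ hχ hα hα0 x.toB).2 hx, ξ, rfl⟩)

variable {X : Type u} [NormedAddCommGroup X] [NormedSpace ℂ X] {O : BimodOps Γ A B X}

namespace EqBimod

variable (hO : EqBimod σ O)

lemma mem_right (hO : EqBimod σ O) (b : CovFam.Prod σ O.β (MonoidHom.id Circle)) :
    b ∈ crossedProduct μ σ O.β (MonoidHom.id Circle) ↔
      b.toFam ∈ (covCor σ O.β (MonoidHom.id Circle)).cross μ :=
  mem_crossedProduct μ σ continuous_id hO.β_cont hO.β_zero b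

lemma mem_left (hO : EqBimod σ O) (a : CovFam.Prod σ O.α 1) :
    a ∈ crossedProduct μ σ O.α 1 ↔ a.toFam ∈ (covCor σ O.α 1).cross μ :=
  mem_crossedProduct μ σ continuous_const hO.α_cont hO.α_zero a

/-- Unitary families `T` with `T (B ⋊ G) ⊆ X ⋊ G` and `T⋆ (X ⋊ G) ⊆ B ⋊ G`. -/
structure Good (hO : EqBimod σ O) (T : Fam (fun k : BimodFam σ O => k.H') (fun k => k.H)) : Prop where
  unit : IsUnitaryFam (σ := σ) (O := O) T
  mul_mem : ∀ b ∈ (corB σ O).cross μ, fmul T b ∈ hO.cor.cross μ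
  adj_mem : ∀ x ∈ hO.cor.cross μ, fmul (fadj T) x ∈ (corB σ O).cross μ

variable {μ} {hO} {T : Fam (fun k : BimodFam σ O => k.H') (fun k => k.H)}

lemma isAd_iff {x : CovFam.Prod σ O.β (MonoidHom.id Circle)} {y : CovFam.Prod σ O.α 1} :
    IsAd (σ := σ) (O := O) T x y ↔
      AdRel (H' := fun i : CovFam σ O.β (MonoidHom.id Circle) => i.H)
        (H := fun i : CovFam σ O.α 1 => i.H) BimodFam.rightIdx BimodFam.leftIdx (fun k => T k) x y :=
  Iff.rfl

namespace Good

lemma adUnit (hT : Good μ hO T) :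
    AdUnit (H' := fun i : CovFam σ O.β (MonoidHom.id Circle) => i.H)
      (H := fun i : CovFam σ O.α 1 => i.H) BimodFam.rightIdx BimodFam.leftIdx (fun k => T k) :=
  fun k => hT.unit k

lemma adj_apply (hT : Good μ hO T) (k : BimodFam σ O) (ξ : k.H') :
    ContinuousLinearMap.adjoint (T k) (T k ξ) = ξ := DFunLike.congr_fun (hT.unit k).1 ξ

lemma apply_adj (hT : Good μ hO T) (k : BimodFam σ O) (ξ : k.H) :
    T k (ContinuousLinearMap.adjoint (T k) ξ) = ξ := DFunLike.congr_fun (hT.unit k).2 ξ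

lemma exists_left (hT : Good μ hO T) {b : CovFam.Prod σ O.β (MonoidHom.id Circle)}
    (hb : b ∈ crossedProduct μ σ O.β (MonoidHom.id Circle)) :
    ∃ a ∈ crossedProduct μ σ O.α 1, IsAd (σ := σ) (O := O) T b a := by
  have h := mem_span_mul_star _ (closedGen_closed (P := CovFam.Prod σ O.β (MonoidHom.id Circle)) _) hb
  clear hb
  induction h using Submodule.span_induction with
  | zero => exact ⟨0, zero_mem _, isAd_iff.2 AdRel.zero⟩
  | add x y _ _ hx hy =>
    obtain ⟨a, ha, h1⟩ := hx
    obtain ⟨a', ha', h1'⟩ := hy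
    exact ⟨a + a', add_mem ha ha', isAd_iff.2 ((isAd_iff.1 h1).add (isAd_iff.1 h1'))⟩
  | smul k x _ hx =>
    obtain ⟨a, ha, h1⟩ := hx
    exact ⟨k • a, SMulMemClass.smul_mem k ha,
      isAd_iff.2 ((isAd_iff.1 h1).smul k)⟩
  | mem x hx =>
    obtain ⟨c, hc, rfl⟩ := hx
    have h2 := hT.mul_mem _ (Corner.freindex_mem _ μ BimodFam.rightIdx ((hO.mem_right μ c).1 hc))
    obtain ⟨a, ha, h3⟩ := Corner.exists_of_mem_comap (covCor σ O.α 1) μ hO.exists_leftIdx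
      (hO.mul_adj_mem μ h2 h2)
    refine ⟨a.toB, (hO.mem_left μ _).2 ha, fun k => ?_⟩
    have h4 := congrArg (fun z : Fam (fun k : BimodFam σ O => k.H) (fun k => k.H) => z k) h3
    refine h4.trans ?_
    exact comp_adjoint_comp (T k) (c.ap k.rightIdx)

lemma exists_right (hT : Good μ hO T) {a : CovFam.Prod σ O.α 1}
    (ha : a ∈ crossedProduct μ σ O.α 1) :
    ∃ b ∈ crossedProduct μ σ O.β (MonoidHom.id Circle), IsAd (σ := σ) (O := O) T b a := by
  let Ψ : Fam (fun i : CovFam σ O.β (MonoidHom.id Circle) => i.H) (fun i => i.H) →L[ℂ]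
      Fam (fun k : BimodFam σ O => k.H) (fun k => k.H) :=
    (fmul.flip (fadj T)).comp ((fmul T).comp (freindex BimodFam.rightIdx))
  have hΨa : ∀ b k ξ, Ψ b k ξ = T k (b k.rightIdx (ContinuousLinearMap.adjoint (T k) ξ)) :=
    fun _ _ _ => rfl
  have hΨ : Isometry Ψ := by
    refine AddMonoidHomClass.isometry_of_norm _ fun x => le_antisymm ?_ ?_
    · refine fam_norm_le_of_apply (norm_nonneg _) fun k ξ => ?_
      refine (hT.adUnit.norm_apply k _).le.trans ?_
      exact (ContinuousLinearMap.le_of_opNorm_le _ (fam_le x k.rightIdx) _).trans_eq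
        (congrArg (‖x‖ * ·) (hT.adUnit.norm_adj_apply k ξ))
    · refine fam_norm_le_of_apply (norm_nonneg _) fun i ξ => ?_
      obtain ⟨k, rfl⟩ := hO.exists_rightIdx i
      have h1 : Ψ x k (T k ξ) = T k (x k.rightIdx ξ) := congrArg (fun ζ => T k (x k.rightIdx ζ))
        (hT.adj_apply k ξ)
      have h2 : ‖Ψ x k (T k ξ)‖ ≤ ‖Ψ x‖ * ‖T k ξ‖ :=
        ContinuousLinearMap.le_of_opNorm_le _ (fam_le (Ψ x) k) _
      have h3 : ‖T k ξ‖ = ‖ξ‖ := hT.adUnit.norm_apply k ξ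
      have h4 : ‖T k (x k.rightIdx ξ)‖ = ‖x k.rightIdx ξ‖ := hT.adUnit.norm_apply k _
      rw [h1, h3, h4] at h2
      exact h2
  have hle : (corA σ O).cross μ ≤
      ((covCor σ O.β (MonoidHom.id Circle)).cross μ).map Ψ.toLinearMap := by
    refine hO.corA_cross_le μ
      (hΨ.isClosedEmbedding.isClosedMap _ (Corner.isClosed_cross _ μ)) fun x hx y hy => ?_
    obtain ⟨b, hb, hb'⟩ := Corner.exists_of_mem_comap _ μ hO.exists_rightIdx (hT.adj_mem x hx)
    obtain ⟨c, hc, hc'⟩ := Corner.exists_of_mem_comap _ μ hO.exists_rightIdx (hT.adj_mem y hy)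
    refine ⟨fmul b (fadj c), ?_, fam_ext fun k ξ => ?_⟩
    · have h1 := (hO.mem_right μ b.toB).2 hb
      have h2 := (hO.mem_right μ c.toB).2 hc
      exact (hO.mem_right μ _).1 (MulMemClass.mul_mem h1 (star_mem h2))
    · change T k (b k.rightIdx (ContinuousLinearMap.adjoint (c k.rightIdx)
        (ContinuousLinearMap.adjoint (T k) ξ))) = x k (ContinuousLinearMap.adjoint (y k) ξ)
      have h1 : b k.rightIdx = ContinuousLinearMap.adjoint (T k) ∘L x k :=
        congrArg (fun z : Fam (fun k : BimodFam σ O => k.H') (fun k => k.H') => z k) hb'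
      have h2 : c k.rightIdx = ContinuousLinearMap.adjoint (T k) ∘L y k :=
        congrArg (fun z : Fam (fun k : BimodFam σ O => k.H') (fun k => k.H') => z k) hc'
      rw [h1, h2]
      change T k (ContinuousLinearMap.adjoint (T k) (x k (ContinuousLinearMap.adjoint
        (ContinuousLinearMap.adjoint (T k) ∘L y k) (ContinuousLinearMap.adjoint (T k) ξ)))) = _
      rw [hT.apply_adj, ContinuousLinearMap.adjoint_comp, ContinuousLinearMap.adjoint_adjoint,
        ContinuousLinearMap.comp_apply, hT.apply_adj]
  obtain ⟨b, hb, h⟩ := hle (Corner.freindex_mem _ μ BimodFam.leftIdx ((hO.mem_left μ a).1 ha))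
  refine ⟨b.toB, (hO.mem_right μ _).2 hb, fun k => ?_⟩
  exact (congrArg (fun z : Fam (fun k : BimodFam σ O => k.H) (fun k => k.H) => z k) h).symm

lemma isBimodMultiplier (hT : Good μ hO T) : IsBimodMultiplier μ σ O T := by
  have h1 : ∀ b ∈ crossedProduct μ σ O.β (MonoidHom.id Circle),
      fmul T (freindex BimodFam.rightIdx b.toFam) ∈ hO.cor.cross μ := fun b hb =>
    hT.mul_mem _ (Corner.freindex_mem _ μ BimodFam.rightIdx ((hO.mem_right μ b).1 hb))
  refine ⟨fun b hb => ⟨_, (hO.mem_bimodCrossedProduct μ _).2 (h1 b hb), fun k => rfl⟩,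
    fun a ha => ?_⟩
  obtain ⟨b, hb, hab⟩ := hT.exists_right ha
  refine ⟨_, (hO.mem_bimodCrossedProduct μ _).2 (h1 b hb), fun k => ?_⟩
  ext1 ξ
  exact ((isAd_iff.1 hab).apply' hT.adUnit k ξ).symm

end Good

end EqBimod

end Good


/-! ### Tensor products -/

section HMap

variable {H H' H'' K K' K'' : Type*}
  [NormedAddCommGroup H] [InnerProductSpace ℂ H] [CompleteSpace H]
  [NormedAddCommGroup H'] [InnerProductSpace ℂ H'] [CompleteSpace H']
  [NormedAddCommGroup H''] [InnerProductSpace ℂ H''] [CompleteSpace H'']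
  [NormedAddCommGroup K] [InnerProductSpace ℂ K] [CompleteSpace K]
  [NormedAddCommGroup K'] [InnerProductSpace ℂ K'] [CompleteSpace K']
  [NormedAddCommGroup K''] [InnerProductSpace ℂ K''] [CompleteSpace K'']

/-- The operator `S ⊗ T` between Hilbert space tensor products. -/
def hmapL (S : H' →L[ℂ] H) (T : K' →L[ℂ] K) : HTensor H' K' →L[ℂ] HTensor H K :=
  (htoL.comp (TensorProduct.mapL S T)).extend htoL

lemma hmapL_coe (S : H' →L[ℂ] H) (T : K' →L[ℂ] K) (x : H' ⊗[ℂ] K') :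
    hmapL S T (htoL x) = htoL (TensorProduct.mapL S T x) :=
  ContinuousLinearMap.extend_eq _ htoL_dense
    (UniformSpace.Completion.isUniformInducing_coe _) x

@[simp] lemma hmapL_htmul (S : H' →L[ℂ] H) (T : K' →L[ℂ] K) (ξ : H') (η : K') :
    hmapL S T (htmul ξ η) = htmul (S ξ) (T η) := hmapL_coe _ _ _

lemma hmap_eq (S : H →L[ℂ] H) (T : K →L[ℂ] K) : hmap S T = hmapL S T := rfl

lemma norm_htoL (x : H ⊗[ℂ] K) : ‖htoL x‖ = ‖x‖ := UniformSpace.Completion.norm_coe x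

lemma norm_hmapL_le (S : H' →L[ℂ] H) (T : K' →L[ℂ] K) : ‖hmapL S T‖ ≤ ‖S‖ * ‖T‖ := by
  refine ContinuousLinearMap.opNorm_le_bound _ (by positivity) fun x => ?_
  refine htoL_dense.induction_on (p := fun x => ‖hmapL S T x‖ ≤ ‖S‖ * ‖T‖ * ‖x‖) x
    (isClosed_le (by fun_prop) (by fun_prop)) fun x => ?_
  rw [hmapL_coe, norm_htoL, norm_htoL]
  exact ContinuousLinearMap.le_of_opNorm_le _ (TensorProduct.norm_mapL_le S T) x

lemma htmul_add_right (ξ : H) (η η' : K) : htmul ξ (η + η') = htmul ξ η + htmul ξ η' := by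
  rw [htmul, TensorProduct.tmul_add, map_add]; rfl

lemma htmul_smul_right (c : ℂ) (ξ : H) (η : K) : htmul ξ (c • η) = c • htmul ξ η := by
  rw [htmul, TensorProduct.tmul_smul, map_smul]; rfl

lemma htmul_zero_right (ξ : H) : htmul ξ (0 : K) = 0 := by
  rw [htmul, TensorProduct.tmul_zero, map_zero]

lemma hmapL_comp (S : H' →L[ℂ] H) (S' : H'' →L[ℂ] H') (T : K' →L[ℂ] K) (T' : K'' →L[ℂ] K') :
    hmapL S T ∘L hmapL S' T' = hmapL (S ∘L S') (T ∘L T') := hmap_ext (by simp)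

lemma hmapL_id : hmapL (ContinuousLinearMap.id ℂ H) (ContinuousLinearMap.id ℂ K) =
    ContinuousLinearMap.id ℂ (HTensor H K) := hmap_ext (by simp)

lemma inner_hmapL (S : H' →L[ℂ] H) (T : K' →L[ℂ] K) (x : HTensor H' K') (y : HTensor H K) :
    inner ℂ (hmapL S T x) y = inner ℂ x (hmapL (ContinuousLinearMap.adjoint S)
      (ContinuousLinearMap.adjoint T) y) := by
  refine dense_htmul.induction (P := fun x => inner ℂ (hmapL S T x) y = inner ℂ x
    (hmapL (ContinuousLinearMap.adjoint S) (ContinuousLinearMap.adjoint T) y)) ?_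
    (isClosed_eq (by fun_prop) (by fun_prop)) x
  intro x hx
  refine dense_htmul.induction (P := fun y => inner ℂ (hmapL S T x) y = inner ℂ x
    (hmapL (ContinuousLinearMap.adjoint S) (ContinuousLinearMap.adjoint T) y)) ?_
    (isClosed_eq (by fun_prop) (by fun_prop)) y
  intro y hy
  induction hx using Submodule.span_induction with
  | zero => simp
  | add x x' _ _ h h' => simp only [map_add, inner_add_left, h, h']
  | smul c x _ h => simp only [map_smul, inner_smul_left, h]
  | mem x hx =>
    obtain ⟨ξ, η, rfl⟩ := hx
    induction hy using Submodule.span_induction with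
    | zero => simp
    | add x x' _ _ h h' => simp only [map_add, inner_add_right, h, h']
    | smul c x _ h => simp only [map_smul, inner_smul_right, h]
    | mem y hy =>
      obtain ⟨ξ', η', rfl⟩ := hy
      simp [htmul_inner, ContinuousLinearMap.adjoint_inner_right]

lemma adjoint_hmapL (S : H' →L[ℂ] H) (T : K' →L[ℂ] K) :
    ContinuousLinearMap.adjoint (hmapL S T) =
      hmapL (ContinuousLinearMap.adjoint S) (ContinuousLinearMap.adjoint T) := by
  symm
  rw [ContinuousLinearMap.eq_adjoint_iff]
  intro x y
  rw [← inner_conj_symm, ← inner_hmapL, inner_conj_symm]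

variable (K) in
/-- The amplification `T ⊗ 1`. -/
def hampl (T : H' →L[ℂ] H) : HTensor H' K →L[ℂ] HTensor H K := hmapL T (ContinuousLinearMap.id ℂ K)

@[simp] lemma hampl_htmul (S : H' →L[ℂ] H) (ξ : H') (η : K) :
    hampl K S (htmul ξ η) = htmul (S ξ) η := hmapL_htmul _ _ _ _

lemma adjoint_hampl (S : H' →L[ℂ] H) :
    ContinuousLinearMap.adjoint (hampl K S) = hampl K (ContinuousLinearMap.adjoint S) := by
  rw [hampl, adjoint_hmapL, ContinuousLinearMap.adjoint_id]; rfl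

lemma hampl_comp (S : H' →L[ℂ] H) (S' : H'' →L[ℂ] H') :
    hampl K S ∘L hampl K S' = hampl K (S ∘L S') := hmap_ext (by simp)

end HMap

section TensF

variable {I J : Type*} {H' H : I → Type*} {K' K : J → Type*}
  [∀ i, NormedAddCommGroup (H i)] [∀ i, InnerProductSpace ℂ (H i)] [∀ i, CompleteSpace (H i)]
  [∀ i, NormedAddCommGroup (H' i)] [∀ i, InnerProductSpace ℂ (H' i)] [∀ i, CompleteSpace (H' i)]
  [∀ i, NormedAddCommGroup (K i)] [∀ i, InnerProductSpace ℂ (K i)] [∀ i, CompleteSpace (K i)]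
  [∀ i, NormedAddCommGroup (K' i)] [∀ i, InnerProductSpace ℂ (K' i)] [∀ i, CompleteSpace (K' i)]

/-- The family `x_i ⊗ c_j`. -/
def tensF : Fam H' H →L[ℂ] Fam K' K →L[ℂ] Fam (fun p : I × J => HTensor (H' p.1) (K' p.2))
    (fun p : I × J => HTensor (H p.1) (K p.2)) :=
  LinearMap.mkContinuous₂
    (LinearMap.mk₂ ℂ (fun x c => famMk (fun p => hmapL (x p.1) (c p.2)) (‖x‖ * ‖c‖) (fun p =>
        (norm_hmapL_le _ _).trans (mul_le_mul (fam_le x _) (fam_le c _) (norm_nonneg _)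
          (norm_nonneg _))))
      (fun x x' c => fam_ext' fun p => hmap_ext (by simp [htmul_add_left]))
      (fun k x c => fam_ext' fun p => hmap_ext (by simp [htmul_smul_left]))
      (fun x c c' => fam_ext' fun p => hmap_ext (by simp [htmul_add_right]))
      (fun k x c => fam_ext' fun p => hmap_ext (by simp [htmul_smul_right]))) 1
    (fun x c => by
      rw [one_mul]
      exact fam_norm_le (by positivity) fun p => (norm_hmapL_le _ _).trans
        (mul_le_mul (fam_le x _) (fam_le c _) (norm_nonneg _) (norm_nonneg _)))

@[simp] lemma tensF_apply (x : Fam H' H) (c : Fam K' K) (p : I × J) :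
    tensF x c p = hmapL (x p.1) (c p.2) := rfl

variable {D : NonUnitalStarSubalgebra ℂ (BFam H)} {C : NonUnitalStarSubalgebra ℂ (BFam K)}

/-- The elementary tensors of two algebras of families. -/
def elemT (D : NonUnitalStarSubalgebra ℂ (BFam H)) (C : NonUnitalStarSubalgebra ℂ (BFam K)) :
    Set (BFam (fun p : I × J => HTensor (H p.1) (K p.2))) :=
  {T | ∃ x ∈ D, ∃ c ∈ C, ∀ p, T.ap p = hmap (x.ap p.1) (c.ap p.2)}

lemma tensF_mem_elemT {x : BFam H} {c : BFam K} (hx : x ∈ D) (hc : c ∈ C) :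
    (tensF x.toFam c.toFam).toB ∈ elemT D C := ⟨x, hx, c, hc, fun _ => rfl⟩

lemma elemT_eq {t : BFam (fun p : I × J => HTensor (H p.1) (K p.2))} {x : BFam H} {c : BFam K}
    (h : ∀ p, t.ap p = hmap (x.ap p.1) (c.ap p.2)) : t = (tensF x.toFam c.toFam).toB :=
  BFam.ext fun p => h p

lemma closedGen_elemT_le {M : Submodule ℂ (BFam (fun p : I × J => HTensor (H p.1) (K p.2)))}
    (hM : IsClosed (M : Set (BFam (fun p : I × J => HTensor (H p.1) (K p.2)))))
    (h : elemT D C ⊆ M) : ∀ t ∈ closedGen (elemT D C), t ∈ M := by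
  have hs : star (elemT D C) ⊆ elemT D C := by
    rintro t ⟨x, hx, c, hc, ht⟩
    refine ⟨star x, star_mem hx, star c, star_mem hc, fun p => ?_⟩
    have := congrArg star (ht p)
    rw [BFam.star_ap, star_star] at this
    rw [this, ← hmap_star]; rfl
  have hm : ∀ t ∈ Subsemigroup.closure (elemT D C ∪ star (elemT D C)), t ∈ elemT D C := by
    intro t ht
    rw [Set.union_eq_left.2 hs] at ht
    induction ht using Subsemigroup.closure_induction with
    | mem t ht => exact ht
    | mul t t' _ _ h1 h2 =>
      obtain ⟨x, hx, c, hc, ht⟩ := h1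
      obtain ⟨x', hx', c', hc', ht'⟩ := h2
      refine ⟨x * x', mul_mem hx hx', c * c', mul_mem hc hc', fun p => ?_⟩
      rw [BFam.mul_ap, ht, ht', ← hmap_mul]; rfl
  have h2 : ((NonUnitalStarAlgebra.adjoin ℂ (elemT D C)).toSubmodule) ≤ M := by
    rw [NonUnitalStarAlgebra.adjoin_eq_span]
    exact Submodule.span_le.2 fun t ht => h (hm t ht)
  exact fun t ht => closure_minimal h2 hM ht

lemma actsNondeg_elemT (hD : ActsNondeg D) (hC : ActsNondeg C) :
    ActsNondeg (closedGen (elemT D C)) := by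
  intro p
  refine dense_of_le_closure dense_htmul ?_
  rintro _ ⟨ξ, η, rfl⟩
  let M := (Submodule.span ℂ {ζ | ∃ d ∈ closedGen (elemT D C),
    ∃ ξ : HTensor (H p.1) (K p.2), ζ = d.ap p ξ}).topologicalClosure
  have hM : IsClosed (M : Set (HTensor (H p.1) (K p.2))) := Submodule.isClosed_topologicalClosure _
  change htmul ξ η ∈ M
  refine (hD p.1).induction (P := fun ξ => htmul ξ η ∈ M) ?_
    (hM.preimage (continuous_htmul.comp (continuous_id.prodMk continuous_const))) ξ
  intro ξ hξ
  refine (hC p.2).induction (P := fun η => htmul ξ η ∈ M) ?_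
    (hM.preimage (continuous_htmul.comp (continuous_const.prodMk continuous_id))) η
  intro η hη
  induction hξ using Submodule.span_induction with
  | zero => rw [htmul_zero_left]; exact zero_mem _
  | add x y _ _ hx hy => rw [htmul_add_left]; exact add_mem hx hy
  | smul k x _ hx => rw [htmul_smul_left]; exact Submodule.smul_mem _ _ hx
  | mem x hx =>
    obtain ⟨d, hd, ξ, rfl⟩ := hx
    induction hη using Submodule.span_induction with
    | zero => rw [htmul_zero_right]; exact zero_mem _
    | add x y _ _ hx hy => rw [htmul_add_right]; exact add_mem hx hy
    | smul k x _ hx => rw [htmul_smul_right]; exact Submodule.smul_mem _ _ hx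
    | mem y hy =>
      obtain ⟨c, hc, η, rfl⟩ := hy
      exact Submodule.le_topologicalClosure _ (Submodule.subset_span
        ⟨_, subset_closedGen _ (tensF_mem_elemT hd hc), htmul ξ η, (hmapL_htmul _ _ _ _).symm⟩)

end TensF

section TensRel

variable {I I' L J : Type*} {H : I → Type*} {H' : I' → Type*} {K : J → Type*}
  [∀ i, NormedAddCommGroup (H i)] [∀ i, InnerProductSpace ℂ (H i)] [∀ i, CompleteSpace (H i)]
  [∀ i, NormedAddCommGroup (H' i)] [∀ i, InnerProductSpace ℂ (H' i)] [∀ i, CompleteSpace (H' i)]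
  [∀ i, NormedAddCommGroup (K i)] [∀ i, InnerProductSpace ℂ (K i)] [∀ i, CompleteSpace (K i)]
  {r : L → I'} {l : L → I} {T : ∀ k, H' (r k) →L[ℂ] H (l k)}

/-- Amplification of index maps. -/
abbrev amplIdx (J : Type*) (r : L → I) : L × J → I × J := fun p => (r p.1, p.2)

lemma amplIdx_surjective {r : L → I} (hr : Function.Surjective r) :
    Function.Surjective (amplIdx J r) := fun ⟨i, j⟩ => by
  obtain ⟨k, rfl⟩ := hr i
  exact ⟨(k, j), rfl⟩

/-- The unitaries `T_k ⊗ 1`. -/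
abbrev amplFam (r : L → I') (l : L → I) (T : ∀ k, H' (r k) →L[ℂ] H (l k)) (p : L × J) :
    HTensor (H' (r p.1)) (K p.2) →L[ℂ] HTensor (H (l p.1)) (K p.2) := hampl (K p.2) (T p.1)

lemma AdUnit.ampl (hT : AdUnit r l T) :
    AdUnit (H' := fun p : I' × J => HTensor (H' p.1) (K p.2))
      (H := fun p : I × J => HTensor (H p.1) (K p.2)) (amplIdx J r) (amplIdx J l)
      (amplFam r l T) := fun p => by
  constructor
  · change ContinuousLinearMap.adjoint (hampl (K p.2) (T p.1)) ∘L hampl (K p.2) (T p.1) =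
      ContinuousLinearMap.id ℂ (HTensor (H' (r p.1)) (K p.2))
    rw [adjoint_hampl, hampl_comp, (hT p.1).1]
    exact hmapL_id
  · change hampl (K p.2) (T p.1) ∘L ContinuousLinearMap.adjoint (hampl (K p.2) (T p.1)) =
      ContinuousLinearMap.id ℂ (HTensor (H (l p.1)) (K p.2))
    rw [adjoint_hampl, hampl_comp, (hT p.1).2]
    exact hmapL_id

lemma AdRel.ampl {x : BFam H'} {y : BFam H} (h : AdRel r l T x y) (c : BFam K) :
    AdRel (amplIdx J r) (amplIdx J l) (amplFam r l T) (tensF x.toFam c.toFam).toB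
      (tensF y.toFam c.toFam).toB := fun p => by
  change hmapL (y.ap (l p.1)) (c.ap p.2) = hampl (K p.2) (T p.1) ∘L hmapL (x.ap (r p.1)) (c.ap p.2) ∘L
    ContinuousLinearMap.adjoint (hampl (K p.2) (T p.1))
  rw [adjoint_hampl, hampl, hampl, hmapL_comp, hmapL_comp, h p.1]
  rfl

variable {D' : NonUnitalStarSubalgebra ℂ (BFam H')} {D : NonUnitalStarSubalgebra ℂ (BFam H)}
  {C : NonUnitalStarSubalgebra ℂ (BFam K)}

lemma exists_tensor_partner (hT : AdUnit r l T) (hl : Function.Surjective l)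
    (h1 : ∀ x ∈ D', ∃ y ∈ D, AdRel r l T x y)
    {t : BFam (fun p : I' × J => HTensor (H' p.1) (K p.2))} (ht : t ∈ closedGen (elemT D' C)) :
    ∃ s ∈ closedGen (elemT D C), AdRel (amplIdx J r) (amplIdx J l) (amplFam r l T) t s := by
  let M : Submodule ℂ (BFam (fun p : I' × J => HTensor (H' p.1) (K p.2))) :=
    { carrier := {t | ∃ s ∈ closedGen (elemT D C),
        AdRel (amplIdx J r) (amplIdx J l) (amplFam r l T) t s}
      add_mem' := fun ⟨s, hs, h⟩ ⟨s', hs', h'⟩ => ⟨s + s', add_mem hs hs', h.add h'⟩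
      zero_mem' := ⟨0, zero_mem _, AdRel.zero⟩
      smul_mem' := fun k _ ⟨s, hs, h⟩ => ⟨k • s, SMulMemClass.smul_mem k hs, h.smul k⟩ }
  have hM : IsClosed (M : Set (BFam (fun p : I' × J => HTensor (H' p.1) (K p.2)))) :=
    isClosed_partner hT.ampl (amplIdx_surjective hl) (closedGen_closed _)
  refine closedGen_elemT_le hM ?_ t ht
  rintro t ⟨x, hx, c, hc, ht⟩
  obtain ⟨y, hy, hxy⟩ := h1 x hx
  rw [elemT_eq ht]
  exact ⟨_, subset_closedGen _ (tensF_mem_elemT hy hc), hxy.ampl c⟩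

theorem exists_tensor_iso (hT : AdUnit r l T) (hr : Function.Surjective r)
    (hl : Function.Surjective l)
    (h1 : ∀ x ∈ D', ∃ y ∈ D, AdRel r l T x y) (h2 : ∀ y ∈ D, ∃ x ∈ D', AdRel r l T x y)
    (hD' : ActsNondeg D') (hD : ActsNondeg D) (hC : ActsNondeg C) :
    ∃ f : multiplierAlgebra (closedGen (elemT D' C)) ≃⋆ₐ[ℂ]
        multiplierAlgebra (closedGen (elemT D C)),
      ∀ m, AdRel (amplIdx J r) (amplIdx J l) (amplFam r l T) m.1 (f m).1 := by
  obtain ⟨-, f, -, hf⟩ := AdRel.exists_isos (D' := closedGen (elemT D' C))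
    (D := closedGen (elemT D C)) hT.ampl (amplIdx_surjective hr)
    (amplIdx_surjective hl) (fun t ht => exists_tensor_partner hT hl h1 ht) (fun s hs => by
      obtain ⟨t, ht, h⟩ := exists_tensor_partner (C := C) hT.symm hr
        (fun y hy => (h2 y hy).imp fun x hx => ⟨hx.1, hx.2.symm hT⟩) hs
      refine ⟨t, ht, AdRel.of_symm hT.ampl ?_⟩
      intro p
      rw [h p]
      change hampl (K p.2) _ ∘L _ ∘L ContinuousLinearMap.adjoint (hampl (K p.2) _) =
        ContinuousLinearMap.adjoint (hampl (K p.2) _) ∘L _ ∘L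
        ContinuousLinearMap.adjoint (ContinuousLinearMap.adjoint (hampl (K p.2) _))
      rw [adjoint_hampl, adjoint_hampl, adjoint_hampl]) (actsNondeg_elemT hD' hC) (actsNondeg_elemT hD hC)
  exact ⟨f, hf⟩

end TensRel

section Coaction

variable {G Γ : Type u} [Group G] [TopologicalSpace G] [IsTopologicalGroup G] [MeasurableSpace G]
  [BorelSpace G] [LocallyCompactSpace G] [T2Space G] (μ : Measure G) [IsHaarMeasure μ] [Regular μ]
  [Group Γ] [TopologicalSpace Γ] [IsTopologicalGroup Γ] [MeasurableSpace Γ] [BorelSpace Γ]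
  [LocallyCompactSpace Γ] [T2Space Γ] (μΓ : Measure Γ) [IsHaarMeasure μΓ] [Regular μΓ]
  {A : Type*} [NonUnitalCStarAlgebra A] {σ : Twist G Γ} {α : Γ → A → A} {χ : Circle →* Circle}

lemma actsNondeg_groupCStar : ActsNondeg (groupCStar μ) := by
  intro j
  have h : Dense (Submodule.span ℂ (Set.univ : Set j.H) : Set j.H) := by simp
  refine dense_of_le_closure h fun ξ _ => ?_
  have := (uCor G).rho_mem μ j 1 ξ (M := (Submodule.span ℂ {η | ∃ d ∈ groupCStar μ,
    ∃ ξ : j.H, η = d.ap j ξ}).topologicalClosure) (Submodule.isClosed_topologicalClosure _)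
    (fun x hx => Submodule.le_topologicalClosure _ (Submodule.subset_span
    ⟨x.toB, (mem_groupCStar μ x.toB).2 hx, ξ, rfl⟩))
  have h1 : (uCor G).ρ j 1 ξ = ξ := one_smul ℂ ξ
  rwa [h1] at this

/-- The tensor product of covariant representations with unitary representations, as an index
map. -/
abbrev tensIdx (p : CovFam σ α χ × URepFam G) : CovFam σ α χ :=
  ⟨HTensor p.1.H p.2.H, p.1.rep.tensor p.2.rep⟩

lemma dualCoaction_mul_eq (x : CovFam.Prod σ α χ) (t : TensorProd σ α χ) :
    dualCoaction x * t = Fam.toB (fcomp (tensIdx (σ := σ) (α := α) (χ := χ) (G := G)) x.toFam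
      t.toFam) := BFam.ext fun _ => rfl

lemma tensIdx_VF (y : CovFam.Prod σ α χ) (c : URepFam.Prod G) (s : Γ) :
    fcomp (tensIdx (σ := σ) (α := α) (χ := χ) (G := G)) ((covCor σ α χ).VF s)
      (tensF y.toFam c.toFam) =
    tensF (fmul ((covCor σ α χ).VF s) y.toFam) (fmul ((uCor G).VF (σ.q s)) c.toFam) := by
  refine fam_ext' fun p => ?_
  rw [fcomp_apply, tensF_apply, tensF_apply, fmul_apply, fmul_apply, ← hmapL_comp]
  rfl

lemma tensIdx_ρF (a : A) (y : Fam (fun i : CovFam σ α χ => i.H) (fun i => i.H))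
    (c : Fam (fun j : URepFam G => j.H) (fun j => j.H)) :
    fcomp (tensIdx (σ := σ) (α := α) (χ := χ) (G := G)) ((covCor σ α χ).ρF a) (tensF y c) =
      tensF (fmul ((covCor σ α χ).ρF a) y) c := by
  refine fam_ext' fun p => ?_
  rw [fcomp_apply, tensF_apply, tensF_apply, fmul_apply,
    ← ContinuousLinearMap.id_comp (c p.2), ← hmapL_comp, ContinuousLinearMap.id_comp]
  rfl

lemma dualCoaction_mul_elem_mem (hχ : Continuous χ) (hα : Continuous fun p : Γ × A => α p.1 p.2)
    (hα0 : ∀ s, α s 0 = 0) {x y : CovFam.Prod σ α χ} (hx : x ∈ crossedProduct μΓ σ α χ)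
    (hy : y ∈ crossedProduct μΓ σ α χ) {c : URepFam.Prod G} (hc : c ∈ groupCStar μ) :
    Fam.toB (fcomp (tensIdx (σ := σ) (α := α) (χ := χ) (G := G)) x.toFam
      (tensF y.toFam c.toFam)) ∈ tensorCStar μΓ μ σ α χ := by
  let N : Submodule ℂ (Fam (fun p : CovFam σ α χ × URepFam G => HTensor p.1.H p.2.H)
    (fun p => (tensIdx p).H)) := (tensorCStar μΓ μ σ α χ).toSubmodule
  have hN : IsClosed (N : Set (Fam (fun p : CovFam σ α χ × URepFam G => HTensor p.1.H p.2.H)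
    (fun p => (tensIdx p).H))) := closedGen_closed (P := TensorProd σ α χ) _
  have hy' := (mem_crossedProduct μΓ σ hχ hα hα0 y).1 hy
  have hc' := (mem_groupCStar μ c).1 hc
  refine (covCor σ α χ).fcomp_mem μΓ (tensIdx (σ := σ) (α := α) (χ := χ) (G := G)) (M := N)
    (z := tensF y.toFam c.toFam) hN ?_ ?_ ((mem_crossedProduct μΓ σ hχ hα hα0 x).1 hx)
  · simp only [tensIdx_VF]
    have h1 := (covCov σ α χ hα hα0).continuous_UF_mul μΓ hy'
    have h2 := ((uCor G).continuous_UF_mul μ hc').comp σ.q_cont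
    exact (tensF.continuous.comp h1).clm_apply h2
  · intro a s
    rw [tensIdx_VF]
    have h1 : fmul ((covCor σ α χ).ρF a) (fmul ((covCor σ α χ).VF s) y.toFam) ∈
        (covCor σ α χ).cross μΓ :=
      (covCor σ α χ).fmul_mem (covCor σ α χ) μΓ (T := (covCor σ α χ).ρF a)
        (L := ContinuousLinearMap.mul ℂ A a) (fun _ => rfl)
        (fun i b => (map_mul i.rep.π a b).symm) ((covCov σ α χ hα hα0).UF_mul_mem μΓ hy' s)
    have h2 : fmul ((uCor G).VF (σ.q s)) c.toFam ∈ (uCor G).cross μ :=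
      (uCor G).UF_mul_mem μ hc' (σ.q s)
    rw [tensIdx_ρF]
    exact subset_closedGen (P := TensorProd σ α χ) _
      (tensF_mem_elemT (D := crossedProduct μΓ σ α χ) (C := groupCStar μ)
      ((mem_crossedProduct μΓ σ hχ hα hα0 (Fam.toB _)).2 h1) ((mem_groupCStar μ (Fam.toB _)).2 h2))

lemma dualCoaction_mul_mem (hχ : Continuous χ) (hα : Continuous fun p : Γ × A => α p.1 p.2)
    (hα0 : ∀ s, α s 0 = 0) {x : CovFam.Prod σ α χ} (hx : x ∈ crossedProduct μΓ σ α χ)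
    {t : TensorProd σ α χ} (ht : t ∈ tensorCStar μΓ μ σ α χ) :
    dualCoaction x * t ∈ tensorCStar μΓ μ σ α χ := by
  let M : Submodule ℂ (TensorProd σ α χ) :=
    { carrier := {t | dualCoaction x * t ∈ tensorCStar μΓ μ σ α χ}
      add_mem' := fun h h' => by
        rw [Set.mem_ofPred_eq, mul_add]; exact add_mem h h'
      zero_mem' := by rw [Set.mem_ofPred_eq, mul_zero]; exact zero_mem _
      smul_mem' := fun k _ h => by
        rw [Set.mem_ofPred_eq, mul_smul_comm]; exact SMulMemClass.smul_mem k h }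
  have hM : IsClosed (M : Set (TensorProd σ α χ)) :=
    (closedGen_closed _).preimage (continuous_const_mul _)
  refine closedGen_elemT_le (D := crossedProduct μΓ σ α χ) (C := groupCStar μ) (M := M) hM ?_ t ht
  rintro t ⟨y, hy, c, hc, ht⟩
  change dualCoaction x * t ∈ tensorCStar μΓ μ σ α χ
  rw [elemT_eq ht, dualCoaction_mul_eq]
  exact dualCoaction_mul_elem_mem μ μΓ hχ hα hα0 hx hy hc

lemma dualCoaction_star (x : CovFam.Prod σ α χ) :
    dualCoaction (G := G) (star x) = star (dualCoaction x) := rfl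

lemma dualCoaction_mem (hχ : Continuous χ) (hα : Continuous fun p : Γ × A => α p.1 p.2)
    (hα0 : ∀ s, α s 0 = 0) {x : CovFam.Prod σ α χ} (hx : x ∈ crossedProduct μΓ σ α χ) :
    dualCoaction x ∈ multiplierAlgebra (tensorCStar μΓ μ σ α χ) := by
  intro t ht
  refine ⟨dualCoaction_mul_mem μ μΓ hχ hα hα0 hx ht, ?_⟩
  have := star_mem (dualCoaction_mul_mem μ μΓ hχ hα hα0 (star_mem hx) (star_mem ht))
  rwa [dualCoaction_star, star_mul, star_star, star_star] at this

variable {B : Type*} [NonUnitalCStarAlgebra B] {X : Type*} [NormedAddCommGroup X]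
  [NormedSpace ℂ X] {O : BimodOps Γ A B X}

/-- Amplification of a bimodule representation by a unitary representation. -/
def BimodRep.tensor {H H' K : Type u} [NormedAddCommGroup H] [InnerProductSpace ℂ H]
    [CompleteSpace H] [NormedAddCommGroup H'] [InnerProductSpace ℂ H'] [CompleteSpace H']
    [NormedAddCommGroup K] [InnerProductSpace ℂ K] [CompleteSpace K]
    (k : BimodRep σ O H H') (V : URep G K) : BimodRep σ O (HTensor H K) (HTensor H' K) where
  left := k.left.tensor V
  right := k.right.tensor V
  πX :=
    { toFun := fun x => hampl K (k.πX x)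
      map_add' := fun x y => hmap_ext (by simp [htmul_add_left])
      map_smul' := fun c x => hmap_ext (by simp [htmul_smul_left]) }
  map_linner x y := by
    change hampl K (k.left.π (O.linner x y)) = hampl K (k.πX x) ∘L
      ContinuousLinearMap.adjoint (hampl K (k.πX y))
    rw [adjoint_hampl, hampl_comp, k.map_linner]
  map_rinner x y := by
    change hampl K (k.right.π (O.rinner x y)) = ContinuousLinearMap.adjoint (hampl K (k.πX x)) ∘L
      hampl K (k.πX y)
    rw [adjoint_hampl, hampl_comp, k.map_rinner]
  map_lact a x := by
    change hampl K (k.πX (O.lact a x)) = hampl K (k.left.π a) ∘L hampl K (k.πX x)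
    rw [hampl_comp, k.map_lact]
  map_ract x b := by
    change hampl K (k.πX (O.ract x b)) = hampl K (k.πX x) ∘L hampl K (k.right.π b)
    rw [hampl_comp, k.map_ract]
  covariant s x ξ := by
    refine DFunLike.congr_fun (?_ : hmapL (k.left.U s : H →L[ℂ] H) (V.U (σ.q s) : K →L[ℂ] K) ∘L
      hampl K (k.πX x) = hampl K (k.πX (O.γ s x)) ∘L
        hmapL (k.right.U s : H' →L[ℂ] H') (V.U (σ.q s) : K →L[ℂ] K)) ξ
    exact hmap_ext (by simp [k.covariant])

/-- Amplification of bimodule representations. -/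
def BimodFam.tensor (k : BimodFam σ O) (j : URepFam G) : BimodFam σ O :=
  ⟨HTensor k.H j.H, HTensor k.H' j.H, k.rep.tensor j.rep⟩

lemma dualCoaction_rel {T : Fam (fun k : BimodFam σ O => k.H') (fun k => k.H)}
    (hT : ∀ k j, T (k.tensor j) = hampl (H' := k.H') (H := k.H) j.H (T k))
    {x : CovFam.Prod σ O.β (MonoidHom.id Circle)} {y : CovFam.Prod σ O.α 1}
    (h : IsAd (σ := σ) (O := O) T x y) :
    AdRel (H' := fun p : CovFam σ O.β (MonoidHom.id Circle) × URepFam G => HTensor p.1.H p.2.H)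
      (H := fun p : CovFam σ O.α 1 × URepFam G => HTensor p.1.H p.2.H)
      (amplIdx (URepFam G) BimodFam.rightIdx) (amplIdx (URepFam G) BimodFam.leftIdx)
      (amplFam (H' := fun i : CovFam σ O.β (MonoidHom.id Circle) => i.H)
        (H := fun i : CovFam σ O.α 1 => i.H) (K := fun j : URepFam G => j.H)
        BimodFam.rightIdx BimodFam.leftIdx (fun k => T k)) (dualCoaction x) (dualCoaction y) := by
  intro p
  have h1 := h (p.1.tensor p.2)
  rw [hT] at h1
  exact h1

end Coaction

/-! ### The equivalence bimodule `C₀(Γ, ῑ)` -/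

section Functions

lemma continuous_of_isometric {Z E : Type*} [TopologicalSpace Z] [NormedAddCommGroup E]
    (T : Z → E → E) (h : ∀ s x y, ‖T s x - T s y‖ ≤ ‖x - y‖) (hc : ∀ x, Continuous fun s => T s x) :
    Continuous fun p : Z × E => T p.1 p.2 :=
  continuous_prod_of_continuous_lipschitzWith' _ 1
    (fun s => LipschitzWith.of_dist_le_mul fun x y => by
      simpa [dist_eq_norm] using h s x y) hc

lemma c0_apply_le {M : Type*} [TopologicalSpace M] (f : C₀(M, ℂ)) (t : M) : ‖f t‖ ≤ ‖f‖ := by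
  rw [← ZeroAtInftyContinuousMap.norm_toBCF_eq_norm]
  exact f.toBCF.norm_coe_le_norm t

lemma c0_norm_le {M : Type*} [TopologicalSpace M] {f : C₀(M, ℂ)} {C : ℝ} (hC : 0 ≤ C)
    (h : ∀ t, ‖f t‖ ≤ C) : ‖f‖ ≤ C := by
  rw [← ZeroAtInftyContinuousMap.norm_toBCF_eq_norm]
  exact (BoundedContinuousFunction.norm_le hC).2 h

lemma c0_sum_apply {M ι : Type*} [TopologicalSpace M] (T : Finset ι) (F : ι → C₀(M, ℂ)) (t : M) :
    (∑ i ∈ T, F i) t = ∑ i ∈ T, F i t := by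
  induction T using Finset.cons_induction with
  | empty => simp
  | cons a s ha ih =>
    rw [Finset.sum_cons, Finset.sum_cons, ZeroAtInftyContinuousMap.add_apply, ih]

lemma C0bar.norm_fn {G Γ : Type u} [Group G] [TopologicalSpace G] [IsTopologicalGroup G]
    [Group Γ] [TopologicalSpace Γ] [IsTopologicalGroup Γ] {σ : Twist G Γ} (f : C0bar σ) :
    ‖f.fn‖ = ‖f‖ := rfl

lemma eventually_transl_sub_lt {M : Type*} [Group M] [TopologicalSpace M] [IsTopologicalGroup M]
    (f : C₀(M, ℂ)) {ε : ℝ} (hε : 0 < ε) : ∀ᶠ g in 𝓝 (1 : M), ∀ t, ‖f (t * g) - f t‖ < ε := by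
  obtain ⟨K, hK, hKf⟩ := mem_cocompact.1 ((zero_at_infty f) (Metric.ball_mem_nhds 0 (half_pos hε)))
  have hsm : ∀ t ∉ K, ‖f t‖ < ε / 2 := fun t ht => by
    have := hKf ht
    simpa using this
  have h1 : ∀ᶠ g in 𝓝 (1 : M), ∀ t ∈ K, ‖f (t * g) - f t‖ < ε := by
    refine hK.eventually_forall_of_forall_eventually fun t _ => ?_
    have hc : Continuous fun p : M × M => ‖f (p.2 * p.1) - f p.2‖ := by
      have := map_continuous f
      fun_prop
    exact hc.tendsto (1, t) (gt_mem_nhds (by simpa using hε))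
  have h2 : ∀ᶠ g in 𝓝 (1 : M), ∀ t ∈ K, ‖f (t * g⁻¹) - f t‖ < ε := by
    have := (continuous_inv.tendsto (1 : M))
    rw [inv_one] at this
    exact this.eventually h1
  filter_upwards [h1, h2] with g hg hg' t
  by_cases ht : t ∈ K
  · exact hg t ht
  by_cases ht' : t * g ∈ K
  · have := hg' _ ht'
    rwa [mul_inv_cancel_right, norm_sub_rev] at this
  · calc _ ≤ ‖f (t * g)‖ + ‖f t‖ := norm_sub_le _ _
      _ < ε / 2 + ε / 2 := add_lt_add (hsm _ ht') (hsm _ ht)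
      _ = ε := add_halves ε

lemma norm_rt {M : Type*} [Group M] [TopologicalSpace M] [IsTopologicalGroup M] (g : M)
    (f : C₀(M, ℂ)) : ‖rt g f‖ ≤ ‖f‖ :=
  c0_norm_le (norm_nonneg _) fun _ => c0_apply_le f _

lemma continuous_rt {M : Type*} [Group M] [TopologicalSpace M] [IsTopologicalGroup M] :
    Continuous fun p : M × C₀(M, ℂ) => rt p.1 p.2 := by
  refine continuous_of_isometric _ (fun g f f' => norm_rt g (f - f')) fun f => ?_
  rw [continuous_iff_continuousAt]
  intro g
  rw [ContinuousAt, Metric.tendsto_nhds]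
  intro ε hε
  have h1 : Tendsto (fun g' => g⁻¹ * g') (𝓝 g) (𝓝 1) := by
    have : Continuous fun g' => g⁻¹ * g' := by fun_prop
    simpa using this.tendsto g
  filter_upwards [h1.eventually (eventually_transl_sub_lt f (half_pos hε))] with g' hg'
  rw [dist_eq_norm]
  refine (c0_norm_le (half_pos hε).le fun t => ?_).trans_lt (half_lt_self hε)
  have := hg' (t * g)
  rw [mul_assoc, mul_inv_cancel_left] at this
  exact this.le

end Functions

section BasicBimodule

variable {G Γ : Type u} [Group G] [TopologicalSpace G] [IsTopologicalGroup G]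
  [LocallyCompactSpace G] [T2Space G] [Group Γ] [TopologicalSpace Γ] [IsTopologicalGroup Γ]
  [LocallyCompactSpace Γ] [T2Space Γ] (σ : Twist G Γ)

lemma norm_linner₀_le (f g : C0bar σ) : ‖linner₀ σ f g‖ ≤ ‖f‖ * ‖g‖ :=
  c0_norm_le (by positivity) fun t => by
    obtain ⟨s, rfl⟩ := σ.q_surj t
    rw [linner₀_q, norm_mul, RCLike.norm_conj]
    gcongr
    · exact c0_apply_le f.fn s
    · exact c0_apply_le g.fn s

lemma norm_rinner₀_le (f g : C0bar σ) : ‖rinner₀ σ f g‖ ≤ ‖f‖ * ‖g‖ :=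
  c0_norm_le (by positivity) fun t => by
    obtain ⟨s, rfl⟩ := σ.q_surj t
    rw [rinner₀_q, norm_mul, RCLike.norm_conj]
    gcongr
    · exact c0_apply_le f.fn s
    · exact c0_apply_le g.fn s

lemma norm_actC_le (c : C₀(G, ℂ)) (f : C0bar σ) : ‖actC σ c.toBCF f‖ ≤ ‖c‖ * ‖f‖ :=
  c0_norm_le (f := (actC σ c.toBCF f).fn) (by positivity) fun s => by
    rw [actC_apply, norm_mul]
    gcongr
    · exact c0_apply_le c _
    · exact c0_apply_le f.fn s

/-- The absolute value of `f ∈ C₀(Γ, ῑ)`, as a function on `G`. -/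
def C0bar.abs {σ : Twist G Γ} (f : C0bar σ) : C₀(G, ℂ) :=
  descend σ (c0OfLe (fun s => (‖f.fn s‖ : ℂ))
    (Complex.continuous_ofReal.comp (map_continuous f.fn).norm) f.fn 1 (fun s => by simp))
    (fun s z => by
      rw [c0OfLe_apply, c0OfLe_apply, f.prop, norm_mul, RCLike.norm_conj, Circle.norm_coe, one_mul])

@[simp] lemma C0bar.abs_q {σ : Twist G Γ} (f : C0bar σ) (s : Γ) :
    f.abs (σ.q s) = (‖f.fn s‖ : ℂ) := descend_q σ _ _ s

/-- The element of `C₀(Γ, ῑ)` given by a twisted function in `C_c(Γ)`. -/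
def C0bar.ofAvg (h : C_c(Γ, ℂ)) : C0bar σ :=
  C0bar.mk ⟨(avg σ (MonoidHom.id Circle) continuous_id h).toContinuousMap, by
    have h0 := (avg σ (MonoidHom.id Circle) continuous_id h).hasCompactSupport
    exact h0.is_zero_at_infty⟩ (fun s z => avg_mul σ (MonoidHom.id Circle) continuous_id h s z)

attribute [local instance] circleBorel circleBorel_borel

set_option maxHeartbeats 1000000 in
lemma exists_apply_ne_zero (s : Γ) : ∃ f : C0bar σ, f.fn s ≠ 0 := by
  have hcl : IsCompact ((fun z => s * σ.ι z) '' {z : Circle | (z : ℂ).re ≤ 0}) := by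
    refine (IsClosed.isCompact ?_).image (by have := σ.ι_cont; fun_prop)
    exact isClosed_le (Complex.continuous_re.comp continuous_subtype_val) continuous_const
  have hdis : Disjoint {s} ((fun z => s * σ.ι z) '' {z : Circle | (z : ℂ).re ≤ 0}) := by
    rw [Set.disjoint_singleton_left]
    rintro ⟨z, hz, h⟩
    have h1 : σ.ι z = σ.ι 1 := by simpa using h
    rw [σ.ι_inj h1] at hz
    change (1 : ℂ).re ≤ 0 at hz
    norm_num at hz
  obtain ⟨h, h1, h0, hs, hr⟩ := exists_continuous_one_zero_of_isCompact isCompact_singleton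
    hcl.isClosed hdis
  let hc : C_c(Γ, ℂ) := ⟨⟨fun t => (h t : ℂ), by fun_prop⟩, hs.comp_left (g := fun r : ℝ => (r : ℂ)) Complex.ofReal_zero⟩
  refine ⟨C0bar.ofAvg σ hc, fun hz => ?_⟩
  change avg σ (MonoidHom.id Circle) continuous_id hc s = 0 at hz
  rw [avg_apply] at hz
  let F : Circle → ℝ := fun z => (z : ℂ).re * h (s * σ.ι z)
  have hFc : Continuous F := by
    have := σ.ι_cont
    exact (Complex.continuous_re.comp continuous_subtype_val).mul (by fun_prop)
  have hInt : Integrable (fun z : Circle => ((MonoidHom.id Circle z : Circle) : ℂ) * hc (s * σ.ι z))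
      circleHaar := by
    refine Continuous.integrable_of_hasCompactSupport ?_ (HasCompactSupport.of_compactSpace _)
    have := σ.ι_cont
    exact (continuous_subtype_val).mul (hc.continuous.comp (by fun_prop))
  have hre : ∫ z, F z ∂circleHaar = 0 := by
    rw [← Complex.zero_re, ← hz]
    refine Eq.trans ?_ (integral_re hInt)
    refine integral_congr_ae (.of_forall fun z => ?_)
    exact (Complex.re_mul_ofReal _ _).symm
  have hpos : 0 < ∫ z, F z ∂circleHaar := by
    refine hFc.integral_pos_of_hasCompactSupport_nonneg_nonzero
      (HasCompactSupport.of_compactSpace _) (fun z => ?_) (x := 1) ?_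
    · by_cases hz : (z : ℂ).re ≤ 0
      · have : h (s * σ.ι z) = 0 := h0 ⟨z, hz, rfl⟩
        simp [F, this]
      · exact mul_nonneg (not_le.1 hz).le (hr _).1
    · have : h s = 1 := h1 rfl
      simp [F, this]
  exact hpos.ne' hre

lemma dense_linner₀ :
    Dense (Submodule.span ℂ {a | ∃ f g, a = linner₀ σ f g} : Set C₀(G, ℂ)) := by
  rw [Metric.dense_iff]
  intro c ε hε
  obtain ⟨K, hK, hKc⟩ := mem_cocompact.1 ((zero_at_infty c) (Metric.ball_mem_nhds 0 (half_pos hε)))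
  have hsm : ∀ t ∉ K, ‖c t‖ < ε / 2 := fun t ht => by
    have := hKc ht
    simpa using this
  choose f hf using exists_apply_ne_zero σ
  let lift : G → Γ := Function.surjInv σ.q_surj
  have hl : ∀ g, σ.q (lift g) = g := Function.surjInv_eq σ.q_surj
  let d : G → C₀(G, ℂ) := fun g => linner₀ σ (f (lift g)) (f (lift g))
  have hd : ∀ g s, d g (σ.q s) = ((‖(f (lift g)).fn s‖ ^ 2 : ℝ) : ℂ) := fun g s => by
    simp only [d, linner₀_q, Complex.mul_conj, Complex.normSq_eq_norm_sq]
  have hdre : ∀ g t, d g t = ((d g t).re : ℂ) ∧ 0 ≤ (d g t).re := fun g t => by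
    obtain ⟨s, rfl⟩ := σ.q_surj t
    rw [hd, Complex.ofReal_re]
    exact ⟨rfl, by positivity⟩
  have hdd : ∀ g, 0 < (d g g).re := fun g => by
    have : d g g = d g (σ.q (lift g)) := by rw [hl]
    rw [this, hd, Complex.ofReal_re]
    have := norm_pos_iff.2 (hf (lift g))
    positivity
  have hcont : ∀ g, Continuous fun t => (d g t).re :=
    fun g => Complex.continuous_re.comp (map_continuous (d g))
  obtain ⟨T, hT⟩ := hK.elim_finite_subcover (fun g => {t | 0 < (d g t).re})
    (fun g => isOpen_lt continuous_const (hcont g)) (fun g _ => Set.mem_iUnion.2 ⟨g, hdd g⟩)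
  let D : G → ℝ := fun t => ∑ g ∈ T, (d g t).re
  have hDc : Continuous D := continuous_finsetSum _ fun g _ => hcont g
  have hD0 : ∀ t, 0 ≤ D t := fun t => Finset.sum_nonneg fun g _ => (hdre g t).2
  have hDK : ∀ t ∈ K, 0 < D t := fun t ht => by
    obtain ⟨g, hg, hgt⟩ := Set.mem_iUnion₂.1 (hT ht)
    exact Finset.sum_pos' (fun g _ => (hdre g t).2) ⟨g, hg, hgt⟩
  obtain ⟨δ, hδ, hδK⟩ : ∃ δ > 0, ∀ t ∈ K, δ ≤ D t := by
    rcases K.eq_empty_or_nonempty with rfl | hne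
    · exact ⟨1, one_pos, by simp⟩
    · obtain ⟨t, ht, hmin⟩ := hK.exists_isMinOn hne hDc.continuousOn
      exact ⟨D t, hDK t ht, fun t' ht' => hmin ht'⟩
  obtain ⟨η, hη, hηc⟩ : ∃ η > 0, ‖c‖ * η ≤ δ * (ε / 2) := by
    refine ⟨δ * (ε / 2) / (‖c‖ + 1), by positivity, ?_⟩
    rw [mul_div_assoc', div_le_iff₀ (by positivity)]
    nlinarith [norm_nonneg c, mul_pos hδ hε]
  have hpos : ∀ t, 0 < D t + η := fun t => by linarith [hD0 t]
  let e : C₀(G, ℂ) := c0OfLe (fun t => c t / ((D t + η : ℝ) : ℂ))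
    ((map_continuous c).div (by fun_prop) fun t => by exact_mod_cast (hpos t).ne') c η⁻¹
    (fun t => by
      rw [norm_div, Complex.norm_real, Real.norm_of_nonneg (hpos t).le, div_eq_inv_mul]
      gcongr
      linarith [hD0 t])
  refine ⟨∑ g ∈ T, linner₀ σ (actC σ e.toBCF (f (lift g))) (f (lift g)), ?_,
    sum_mem fun g _ => Submodule.subset_span ⟨_, _, rfl⟩⟩
  rw [Metric.mem_ball, dist_comm, dist_eq_norm]
  refine (c0_norm_le (half_pos hε).le fun t => ?_).trans_lt (half_lt_self hε)
  have hsum : (∑ g ∈ T, linner₀ σ (actC σ e.toBCF (f (lift g))) (f (lift g))) t =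
      c t / ((D t + η : ℝ) : ℂ) * (D t : ℂ) := by
    have hD : (D t : ℂ) = ∑ g ∈ T, ((d g t).re : ℂ) := Complex.ofReal_sum _ _
    rw [c0_sum_apply, hD, Finset.mul_sum]
    refine Finset.sum_congr rfl fun g _ => ?_
    rw [← (hdre g t).1]
    obtain ⟨s, rfl⟩ := σ.q_surj t
    have hds : d g (σ.q s) = (f (lift g)).fn s * conj ((f (lift g)).fn s) := linner₀_q σ _ _ s
    rw [linner₀_q, actC_apply, hds, mul_assoc]
    rfl
  rw [ZeroAtInftyContinuousMap.sub_apply, hsum]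
  have hne : ((D t + η : ℝ) : ℂ) ≠ 0 := by exact_mod_cast (hpos t).ne'
  have heq : c t - c t / ((D t + η : ℝ) : ℂ) * (D t : ℂ) = c t * (η : ℂ) / ((D t + η : ℝ) : ℂ) := by
    field_simp
    push_cast
    ring
  rw [heq, norm_div, norm_mul, Complex.norm_real, Complex.norm_real, Real.norm_of_nonneg hη.le,
    Real.norm_of_nonneg (hpos t).le, div_le_iff₀ (hpos t)]
  by_cases ht : t ∈ K
  · calc ‖c t‖ * η ≤ ‖c‖ * η := by gcongr; exact c0_apply_le c t
      _ ≤ δ * (ε / 2) := hηc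
      _ ≤ ε / 2 * (D t + η) := by
        rw [mul_comm]
        gcongr
        linarith [hδK t ht]
  · have := hsm t ht
    nlinarith [hD0 t, norm_nonneg (c t)]

lemma eqBimod₀ : EqBimod σ (bimod₀ σ) where
  α_cont := continuous_rt.comp ((σ.q_cont.comp continuous_fst).prodMk continuous_snd)
  β_cont := continuous_rt.comp ((σ.q_cont.comp continuous_fst).prodMk continuous_snd)
  γ_cont := by
    have h : Continuous fun p : Γ × C0bar σ => (rtσ σ p.1 p.2).fn :=
      continuous_rt.comp (continuous_fst.prodMk (continuous_subtype_val.comp continuous_snd))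
    exact h.subtype_mk _
  β_star s b := by ext t; rfl
  α_zero s := by ext t; rfl
  β_zero s := by ext t; rfl
  γ_zero s := map_zero (rtσ σ s)
  γ_one x := by ext t; exact congrArg x.fn (mul_one t)
  γ_mul s t x := by ext r; exact congrArg x.fn (mul_assoc r s t).symm
  γ_ι z x := by ext t; exact x.prop t z
  lact_cont a := AddMonoidHomClass.continuous_of_bound (actC σ a.toBCF) ‖a‖ (norm_actC_le σ a)
  lact_add a x y := map_add _ x y
  lact_smul a k x := map_smul _ k x
  add_lact a b x := by ext t; exact add_mul _ _ _
  smul_lact k a x := by ext t; exact mul_assoc _ _ _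
  mul_lact a b x := by ext t; exact mul_assoc _ _ _
  ract_cont x := by
    let L : C₀(G, ℂ) →ₗ[ℂ] C0bar σ :=
      { toFun := fun c => actC σ c.toBCF x
        map_add' := fun c d => by ext t; exact add_mul _ _ _
        map_smul' := fun k c => by ext t; exact mul_assoc _ _ _ }
    exact AddMonoidHomClass.continuous_of_bound L ‖x‖ fun c => by
      rw [mul_comm]; exact norm_actC_le σ c x
  ract_add x b c := by ext t; exact add_mul _ _ _
  ract_smul x k b := by ext t; exact mul_assoc _ _ _
  add_ract x y b := map_add _ x y
  smul_ract k x b := map_smul _ k x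
  ract_mul x b c := by ext t; change b _ * c _ * _ = c _ * (b _ * _); ring
  linner_cont := by
    let L : C0bar σ →ₗ⋆[ℂ] C0bar σ →ₗ[ℂ] C₀(G, ℂ) := LinearMap.mk₂'ₛₗ _ _
      (fun g f => linner₀ σ f g)
      (fun g g' f => c0_ext_q σ fun s => by simp [mul_add])
      (fun k g f => c0_ext_q σ fun s => by simp; ring)
      (fun g f f' => c0_ext_q σ fun s => by simp [add_mul])
      (fun k g f => c0_ext_q σ fun s => by simp; ring)
    let M := L.mkContinuous₂ 1 fun g f => by
      rw [one_mul, mul_comm]; exact norm_linner₀_le σ f g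
    have : Continuous fun p : C0bar σ × C0bar σ => M p.2 p.1 := by fun_prop
    exact this
  norm_rinner x := by rw [sq]; exact norm_rinner₀_le σ x x
  norm_linner x := by rw [sq]; exact norm_linner₀_le σ x x
  linner_star x y := c0_ext_q σ fun s => by
    simp [bimod₀, mul_comm]
  rinner_star x y := rinner₀_star σ x y
  linner_add x y z := c0_ext_q σ fun s => by simp [bimod₀, add_mul]
  linner_smul k x y := c0_ext_q σ fun s => by simp [bimod₀, mul_assoc]
  rinner_add x y z := rinner₀_add_right σ x y z
  rinner_smul k x y := rinner₀_smul_right σ k x y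
  linner_lact a x y := c0_ext_q σ fun s => by simp [bimod₀, mul_assoc]
  rinner_ract x y b := c0_ext_q σ fun s => by simp [bimod₀]; ring
  linner_ract x y b := c0_ext_q σ fun s => by simp [bimod₀]; ring
  rinner_lact a x y := c0_ext_q σ fun s => by simp [bimod₀]; ring
  imprim x y z := by ext s; simp [bimod₀]; ring
  linner_pos x := by
    refine ⟨x.abs, c0_ext_q σ fun s => ?_⟩
    simp [bimod₀, Complex.mul_conj, Complex.normSq_eq_norm_sq, sq]
  rinner_pos x := by
    refine ⟨x.abs, c0_ext_q σ fun s => ?_⟩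
    simp [bimod₀, Complex.conj_mul', sq]
  linner_dense := dense_linner₀ σ
  lact_dense := fun x => subset_closure (Submodule.subset_span (by
    obtain ⟨c, f', h⟩ := exists_factor σ x
    exact ⟨c, f', h⟩))
  ract_dense := fun x => subset_closure (Submodule.subset_span (by
    obtain ⟨c, f', h⟩ := exists_factor σ x
    exact ⟨f', c, h⟩))
  γ_linner s x y := c0_ext_q σ fun t => by
    simp [bimod₀, ← map_mul]
  γ_rinner s x y := c0_ext_q σ fun t => by
    simp [bimod₀, ← map_mul]
  γ_lact s a x := by ext t; simp [bimod₀]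
  γ_ract s x b := by ext t; simp [bimod₀]

end BasicBimodule

/-! ### The equivalence bimodule `𝓔_σ(B)` -/

section HilbertModule

variable {B : Type*} [NonUnitalCStarAlgebra B] {E : Type*} [NormedAddCommGroup E]
  [NormedSpace ℂ E] [CompleteSpace E] [HilbMod B E]

open HilbMod

lemma norm_rs_le (x : E) (b : B) : ‖rs x b‖ ≤ ‖x‖ * ‖b‖ := by
  refine le_of_sq_le_sq ?_ (by positivity)
  rw [← ip_norm, ip_rs, rs_ip, mul_pow, ← ip_norm]
  calc _ ≤ ‖star b‖ * ‖ip x x‖ * ‖b‖ := norm_mul₃_le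
    _ = _ := by rw [norm_star]; ring

lemma norm_theta_le (x y : E) : ‖theta x y‖ ≤ ‖x‖ * ‖y‖ :=
  ContinuousLinearMap.opNorm_le_bound _ (by positivity) fun z => by
    change ‖rs x (ip y z)‖ ≤ _
    rw [mul_assoc]
    exact (norm_rs_le _ _).trans (by gcongr; exact ip_le y z)

lemma sq_norm_le_theta (x : E) : ‖x‖ ^ 2 ≤ ‖theta x x‖ := by
  rcases eq_or_ne x 0 with rfl | hx
  · simp
  have h1 : ‖x‖ ^ 2 * ‖x‖ ^ 2 ≤ ‖x‖ ^ 2 * ‖theta x x‖ := by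
    have h : ‖ip x x‖ * ‖ip x x‖ = ‖ip x ((theta x x).1 x)‖ := by
      rw [← CStarRing.norm_star_mul_self, theta_apply, ip_rs, ip_star]
    rw [← ip_norm, h]
    calc _ ≤ ‖x‖ * ‖(theta x x).1 x‖ := ip_le _ _
      _ ≤ ‖x‖ * (‖theta x x‖ * ‖x‖) := by
        gcongr; exact (theta x x).1.le_opNorm x
      _ = _ := by rw [ip_norm]; ring
  exact le_of_mul_le_mul_left h1 (by have := norm_pos_iff.2 hx; positivity)

lemma theta_sub (x y z w : E) :
    theta (x - y) (z - w) = theta x z - theta x w - (theta y z - theta y w) := by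
  ext v
  change rs (x - y) (ip (z - w) v) = rs x (ip z v) - rs x (ip w v) - (rs y (ip z v) - rs y (ip w v))
  simp only [map_sub, _root_.sub_apply]
  abel

lemma exists_comp_apply_near (x : E) {ε : ℝ} (hε : 0 < ε) :
    ∃ k : Comp E, ‖x - k.val.1 x‖ < ε := by
  let _ : PartialOrder (Comp E) := CStarAlgebra.spectralOrder _
  have _ : StarOrderedRing (Comp E) := CStarAlgebra.spectralOrderedRing _
  have hA := CStarAlgebra.increasingApproximateUnit (Comp E)
  have h1 := hA.tendsto_mul_left (ctheta x x)
  obtain ⟨a, ha1, ha2, ha3⟩ := ((h1.eventually (Metric.ball_mem_nhds _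
    (show 0 < ε ^ 2 / 2 by positivity))).and (hA.eventually_norm.and
      hA.eventually_star_eq)).exists
  refine ⟨a, lt_of_pow_lt_pow_left₀ 2 hε.le ((sq_norm_le_theta _).trans_lt ?_)⟩
  have hs : (star a.val) = a.val := by rw [← Comp.val_star, ha3]
  have heq : theta (x - a.val.1 x) (x - a.val.1 x) =
      (theta x x - theta x x * a.val) - a.val * (theta x x - theta x x * a.val) := by
    rw [theta_sub, mul_sub, theta_mul, mul_theta, mul_theta, hs]
  have hk : ‖theta x x - theta x x * a.val‖ < ε ^ 2 / 2 := by
    rw [dist_comm, dist_eq_norm] at ha1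
    exact ha1
  have ha : ‖a.val‖ ≤ 1 := ha2
  rw [heq]
  calc _ ≤ ‖theta x x - theta x x * a.val‖ + ‖a.val‖ * ‖theta x x - theta x x * a.val‖ :=
        (norm_sub_le _ _).trans (by gcongr; exact norm_mul_le _ _)
    _ ≤ ‖theta x x - theta x x * a.val‖ + 1 * ‖theta x x - theta x x * a.val‖ := by gcongr
    _ < ε ^ 2 := by linarith

lemma exists_rs_near (x : E) {ε : ℝ} (hε : 0 < ε) : ∃ b : B, ‖x - rs x b‖ < ε := by
  let _ : PartialOrder B := CStarAlgebra.spectralOrder _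
  have _ : StarOrderedRing B := CStarAlgebra.spectralOrderedRing _
  have hA := CStarAlgebra.increasingApproximateUnit B
  have h1 := hA.tendsto_mul_left (ip x x)
  obtain ⟨a, ha1, ha2, ha3⟩ := ((h1.eventually (Metric.ball_mem_nhds _
    (show 0 < ε ^ 2 / 2 by positivity))).and (hA.eventually_norm.and
      hA.eventually_star_eq)).exists
  refine ⟨a, lt_of_pow_lt_pow_left₀ 2 hε.le ?_⟩
  have heq : ip (x - rs x a) (x - rs x a) =
      (ip x x - ip x x * a) - a * (ip x x - ip x x * a) := by
    simp only [map_sub, _root_.sub_apply, ip_rs, rs_ip, ha3, mul_sub]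
    rw [mul_assoc]
    abel
  have hk : ‖ip x x - ip x x * a‖ < ε ^ 2 / 2 := by
    rwa [dist_comm, dist_eq_norm] at ha1
  rw [← ip_norm, heq]
  calc _ ≤ ‖ip x x - ip x x * a‖ + ‖a‖ * ‖ip x x - ip x x * a‖ :=
        (norm_sub_le _ _).trans (by gcongr; exact norm_mul_le _ _)
    _ ≤ ‖ip x x - ip x x * a‖ + 1 * ‖ip x x - ip x x * a‖ := by gcongr
    _ < ε ^ 2 := by linarith

lemma eq_zero_of_star_mul_add {b c : B} (h : star b * b + star c * c = 0) : c = 0 := by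
  let _ : PartialOrder B := CStarAlgebra.spectralOrder _
  have _ : StarOrderedRing B := CStarAlgebra.spectralOrderedRing _
  refine (CStarRing.star_mul_self_eq_zero_iff c).1 (le_antisymm ?_ (star_mul_self_nonneg c))
  rw [← h]
  exact le_add_of_nonneg_left (star_mul_self_nonneg b)

lemma ctheta_pos (x : E) : ∃ c, ctheta x x = star c * c := by
  let _ : PartialOrder (Comp E) := CStarAlgebra.spectralOrder _
  have _ : StarOrderedRing (Comp E) := CStarAlgebra.spectralOrderedRing _
  set T := ctheta x x with hT
  have hTsa : IsSelfAdjoint T := Comp.ext (by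
    rw [Comp.val_star]; exact star_theta x x)
  obtain ⟨e, he⟩ := CStarAlgebra.nonneg_iff_eq_star_mul_self.1 (CFC.negPart_nonneg T)
  set S := T⁻ with hS
  have hSsa : star S = S := (CFC.negPart_nonneg T).isSelfAdjoint
  have hSTS : S * T * S = -(S * S * S) := by
    conv_lhs => rw [← CFC.posPart_sub_negPart T hTsa]
    rw [mul_sub, CFC.negPart_mul_posPart, zero_sub, neg_mul]
  have hz : ∀ z : E, (e * S).val.1 z = 0 := fun z => by
    have h1 : ip z ((S * T * S).val.1 z) =
        star (ip x (S.val.1 z)) * ip x (S.val.1 z) := by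
      have : (S * T * S).val.1 z = (star S.val).1 (rs x (ip x (S.val.1 z))) := by
        rw [← Comp.val_star, hSsa]; rfl
      rw [this, ← Adj.ip_star', ip_rs, ip_star]
    have h2 : ip z ((S * S * S).val.1 z) = ip ((e * S).val.1 z) ((e * S).val.1 z) := by
      have h3 : S * S * S = star (e * S) * (e * S) := by
        rw [star_mul, hSsa, mul_assoc, mul_assoc S, ← mul_assoc (star e), ← he]
      have : (S * S * S).val.1 z = (star (e * S).val).1 ((e * S).val.1 z) := by
        rw [← Comp.val_star, h3]; rfl
      rw [this, ← Adj.ip_star']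
    obtain ⟨c, hc⟩ := ip_pos ((e * S).val.1 z)
    have h4 : star (ip x (S.val.1 z)) * ip x (S.val.1 z) + star c * c = 0 := by
      rw [← h1, ← hc, ← h2, hSTS]
      change ip z (-((S * S * S).val.1 z)) + _ = 0
      rw [map_neg, neg_add_cancel]
    have h5 := eq_zero_of_star_mul_add h4
    have h6 : ‖(e * S).val.1 z‖ ^ 2 = 0 := by
      rw [← ip_norm, hc, h5, mul_zero, norm_zero]
    exact norm_eq_zero.1 (pow_eq_zero_iff two_ne_zero |>.1 h6)
  have heS : e * S = 0 := Comp.ext (Subtype.ext (ContinuousLinearMap.ext hz))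
  have hS3 : S * S * S = 0 := by
    have : S * S * S = S * (star e * (e * S)) := by
      rw [mul_assoc, ← mul_assoc (star e), ← he]
    rw [this, heS, mul_zero, mul_zero]
  have hS2 : S * S = 0 := by
    refine (CStarRing.star_mul_self_eq_zero_iff _).1 ?_
    rw [star_mul, hSsa, ← mul_assoc, hS3, zero_mul]
  have hS0 : S = 0 := (CStarRing.star_mul_self_eq_zero_iff S).1 (by rw [hSsa, hS2])
  exact CStarAlgebra.nonneg_iff_eq_star_mul_self.1
    ((CFC.negPart_eq_zero_iff T hTsa).1 hS0)

end HilbertModule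

section DeformedBimodule

open HilbMod

variable {G Γ : Type u} [Group G] [TopologicalSpace G] [IsTopologicalGroup G]
  [LocallyCompactSpace G] [T2Space G] [Group Γ] [TopologicalSpace Γ] [IsTopologicalGroup Γ]
  [LocallyCompactSpace Γ] [T2Space Γ] {B : Type u} [NonUnitalCStarAlgebra B]
  (W : WeakAlg G B) (σ : Twist G Γ)

lemma norm_φ_le (c : C₀(G, ℂ)) : ‖(W.φ c).fst‖ ≤ ‖c‖ := by
  rw [DoubleCentralizer.norm_fst]
  exact NonUnitalStarAlgHom.norm_apply_le W.φ c

lemma norm_tens_le (f : C0bar σ) (b : B) : ‖W.tens σ f b‖ ≤ ‖f‖ * ‖b‖ := by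
  refine (norm_tens W σ f b).trans ?_
  gcongr
  refine (Real.sqrt_le_left (norm_nonneg _)).2 ?_
  rw [sq]
  exact (norm_φ_le W _).trans (norm_rinner₀_le σ f f)

/-- `f ⊗ b` as a bounded bilinear map. -/
def tensC : C0bar σ →L[ℂ] B →L[ℂ] W.E σ :=
  (W.tensL σ).mkContinuous₂ 1 fun f b => by rw [one_mul]; exact norm_tens_le W σ f b

lemma norm_β (g : G) (b : B) : ‖W.β g b‖ ≤ ‖b‖ := NonUnitalStarAlgHom.norm_apply_le _ _

lemma norm_γ (s : Γ) (x : W.E σ) : ‖W.γ σ s x‖ ≤ ‖x‖ := by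
  refine le_of_sq_le_sq ?_ (norm_nonneg _)
  rw [← ip_norm, γ_ip, ← ip_norm]
  exact norm_β W _ _

lemma continuous_infl : Continuous fun p : Γ × B => W.infl σ p.1 p.2 :=
  continuous_of_isometric (W.infl σ) (fun s x y => by
    change ‖W.β _ x - W.β _ y‖ ≤ _
    rw [← map_sub]
    exact norm_β W _ _) fun b => (W.cont b).comp σ.q_cont

lemma continuous_γ_apply (x : W.E σ) : Continuous fun s => W.γ σ s x := by
  refine strongCont_of_dense (W.γ σ) (norm_γ W σ) _ (dense_tens W σ) ?_ x
  rintro _ ⟨f, b, rfl⟩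
  have h : ∀ s, W.γ σ s (W.tens σ f b) = tensC W σ (rtσ σ s f) (W.β (σ.q s) b) :=
    fun s => γ_tens W σ s f b
  simp only [h]
  have h1 : Continuous fun s => rtσ σ s f :=
    (eqBimod₀ σ).γ_cont.comp (continuous_id.prodMk continuous_const)
  have h2 : Continuous fun s => W.β (σ.q s) b := (W.cont b).comp σ.q_cont
  fun_prop

lemma continuous_γ : Continuous fun p : Γ × W.E σ => W.γ σ p.1 p.2 :=
  continuous_of_isometric (fun s x => W.γ σ s x) (fun s x y => by
    rw [← map_sub]
    exact norm_γ W σ _ _) (continuous_γ_apply W σ)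

/-- `θ_{x, y}` as a bounded sesquilinear map, conjugate linear in the first argument `y`. -/
def cthetaC : W.E σ →L⋆[ℂ] W.E σ →L[ℂ] W.Bσ σ :=
  (LinearMap.mk₂'ₛₗ (starRingEnd ℂ) (RingHom.id ℂ) (fun y x => (ctheta x y : W.Bσ σ))
    (fun y y' x => Comp.ext (by
      ext z; change rs x (ip (y + y') z) = rs x (ip y z) + rs x (ip y' z)
      rw [map_add, _root_.add_apply, map_add]))
    (fun k y x => Comp.ext (by
      ext z; change rs x (ip (k • y) z) = conj k • rs x (ip y z)
      rw [map_smulₛₗ, _root_.smul_apply, map_smul]))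
    (fun y x x' => (cthetaL W σ y).map_add x x')
    (fun k y x => (cthetaL W σ y).map_smul k x)).mkContinuous₂ 1 fun y x => by
      rw [one_mul, mul_comm]; exact norm_theta_le x y

/-- `β^σ_s` as a bounded map. -/
def βσL (s : Γ) : W.Bσ σ →L[ℂ] W.Bσ σ :=
  LinearMap.mkContinuous
    { toFun := W.βσ σ s
      map_add' := fun k l => Comp.ext (Subtype.ext (by
        ext z; exact map_add (W.γ σ s) _ _))
      map_smul' := fun c k => Comp.ext (Subtype.ext (by
        ext z; exact map_smul (W.γ σ s) c _)) } 1 fun k => by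
    rw [one_mul]
    refine ContinuousLinearMap.opNorm_le_bound _ (norm_nonneg _) fun z => ?_
    refine (norm_γ W σ s _).trans ((k.val.1.le_opNorm _).trans ?_)
    gcongr
    · exact le_rfl
    · exact norm_γ W σ s⁻¹ z

lemma norm_βσL (s : Γ) (k : W.Bσ σ) : ‖βσL W σ s k‖ ≤ ‖k‖ := by
  have := (βσL W σ s).le_of_opNorm_le (LinearMap.mkContinuous_norm_le _ zero_le_one _) k
  rwa [one_mul] at this

lemma βσL_apply (s : Γ) (k : W.Bσ σ) : βσL W σ s k = W.βσ σ s k := rfl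

lemma βσL_ctheta (s : Γ) (x y : W.E σ) :
    βσL W σ s (ctheta x y) = cthetaC W σ (W.γ σ s y) (W.γ σ s x) :=
  Comp.ext (adγ_theta W σ s x y)

lemma continuous_βσL (k : W.Bσ σ) : Continuous fun s => βσL W σ s k := by
  refine strongCont_of_dense (βσL W σ) (norm_βσL W σ) _ dense_ctheta ?_ k
  rintro _ ⟨x, y, rfl⟩
  simp only [βσL_ctheta]
  exact ((cthetaC W σ).continuous.comp (continuous_γ_apply W σ y)).clm_apply
    (continuous_γ_apply W σ x)

lemma continuous_βσ : Continuous fun p : Γ × W.Bσ σ => W.βσ σ p.1 p.2 := by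
  have h : Continuous fun p : Γ × W.Bσ σ => βσL W σ p.1 p.2 :=
    continuous_of_isometric (fun s k => βσL W σ s k) (fun s x y => by
      rw [← map_sub]
      exact norm_βσL W σ s (x - y)) (continuous_βσL W σ)
  simpa only [βσL_apply] using h

lemma γ_ι (z : Circle) (x : W.E σ) : W.γ σ (σ.ι z) x = conj (z : ℂ) • x := by
  have : W.γ σ (σ.ι z) = conj (z : ℂ) • ContinuousLinearMap.id ℂ (W.E σ) :=
    preE_ext W σ fun f b => by
      rw [γ_tens, σ.q_ι, map_one]
      have : rtσ σ (σ.ι z) f = conj (z : ℂ) • f := (eqBimod₀ σ).γ_ι z f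
      rw [this]
      exact (tensC W σ).map_smul₂ _ f b
  rw [this]; rfl

lemma eqBimod : EqBimod σ (W.bimod σ) where
  α_cont := continuous_βσ W σ
  β_cont := continuous_infl W σ
  γ_cont := continuous_γ W σ
  β_star s b := map_star (W.β (σ.q s)) b
  α_zero s := map_zero (βσL W σ s)
  β_zero s := map_zero (W.β (σ.q s))
  γ_zero s := map_zero (W.γ σ s)
  γ_one x := by
    change W.γ σ 1 x = x
    rw [γ_one]; rfl
  γ_mul s t x := by
    change W.γ σ (s * t) x = W.γ σ s (W.γ σ t x)
    rw [← γ_mul]; rfl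
  γ_ι := γ_ι W σ
  lact_cont a := a.val.1.continuous
  lact_add a x y := map_add a.val.1 x y
  lact_smul a k x := map_smul a.val.1 k x
  add_lact a b x := rfl
  smul_lact k a x := rfl
  mul_lact a b x := rfl
  ract_cont x := (rs x).continuous
  ract_add x b c := map_add (rs x) b c
  ract_smul x k b := map_smul (rs x) k b
  add_ract x y b := by
    change rs (x + y) b = rs x b + rs y b
    rw [map_add]; rfl
  smul_ract k x b := by
    change rs (k • x) b = k • rs x b
    rw [map_smul]; rfl
  ract_mul x b c := (rs_rs x b c).symm
  linner_cont := by
    have : Continuous fun p : W.E σ × W.E σ => cthetaC W σ p.2 p.1 := by fun_prop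
    exact this
  norm_rinner x := (ip_norm x).le
  norm_linner x := (norm_theta_le x x).trans (sq ‖x‖).ge
  linner_star x y := Comp.ext (by rw [Comp.val_star]; exact star_theta x y)
  rinner_star := ip_star
  linner_add x y z := map_add (cthetaL W σ z) x y
  linner_smul k x y := map_smul (cthetaL W σ y) k x
  rinner_add x y z := map_add (ip x) y z
  rinner_smul k x y := map_smul (ip x) k y
  linner_lact a x y := Comp.ext (mul_theta a.val x y).symm
  rinner_ract := ip_rs
  linner_ract x y b := Comp.ext (Subtype.ext (ContinuousLinearMap.ext fun z => by
    change rs (rs x b) (ip y z) = rs x (ip (rs y (star b)) z)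
    rw [rs_rs, rs_ip, star_star]))
  rinner_lact a x y := by
    change ip (a.val.1 x) y = ip x ((star a).val.1 y)
    rw [Comp.val_star, Adj.ip_star']
  imprim x y z := rfl
  linner_pos := ctheta_pos
  rinner_pos := ip_pos
  linner_dense := dense_ctheta
  lact_dense := Metric.dense_iff.2 fun x ε hε => by
    obtain ⟨k, hk⟩ := exists_comp_apply_near x hε
    refine ⟨k.val.1 x, ?_, Submodule.subset_span ⟨k, x, rfl⟩⟩
    rwa [Metric.mem_ball, dist_comm, dist_eq_norm]
  ract_dense := Metric.dense_iff.2 fun x ε hε => by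
    obtain ⟨b, hb⟩ := exists_rs_near x hε
    refine ⟨rs x b, ?_, Submodule.subset_span ⟨x, b, rfl⟩⟩
    rwa [Metric.mem_ball, dist_comm, dist_eq_norm]
  γ_linner s x y := Comp.ext (adγ_theta W σ s x y).symm
  γ_rinner s x y := γ_ip W σ s x y
  γ_lact s a x := by
    change W.γ σ s (a.val.1 x) = W.γ σ s (a.val.1 (W.γ σ s⁻¹ (W.γ σ s x)))
    have := γ_inv W σ s⁻¹ x
    rw [inv_inv] at this
    rw [this]
  γ_ract s x b := γ_rs W σ s x b

end DeformedBimodule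

/-! ### Strong limits of bounded nets -/

section StrongLimit

variable {P : Type*} {l : Filter P} [NeBot l]

lemma isClosed_exists_tendsto {E F : Type*} [NormedAddCommGroup E] [NormedSpace ℂ E]
    [NormedAddCommGroup F] [NormedSpace ℂ F] [CompleteSpace F] (T : P → E →L[ℂ] F)
    (hT : ∀ p z, ‖T p z‖ ≤ ‖z‖) : IsClosed {z | ∃ y, Tendsto (fun p => T p z) l (𝓝 y)} := by
  refine isClosed_of_closure_subset fun z hz => ?_
  refine cauchy_map_iff_exists_tendsto.1 (Metric.cauchy_iff.2 ⟨inferInstance, fun ε hε => ?_⟩)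
  obtain ⟨z', ⟨y, hy⟩, hz'⟩ := Metric.mem_closure_iff.1 hz (ε / 4) (by positivity)
  rw [dist_eq_norm] at hz'
  have hev := hy.eventually (Metric.ball_mem_nhds y (show 0 < ε / 4 by positivity))
  refine ⟨_, image_mem_map hev, ?_⟩
  rintro _ ⟨p, hp, rfl⟩ _ ⟨p', hp', rfl⟩
  have h1 : ∀ p, dist (T p z) (T p z') < ε / 4 := fun p => by
    rw [dist_eq_norm, ← map_sub]
    exact (hT p _).trans_lt hz'
  have h2 : dist (T p z') y < ε / 4 := hp
  have h3 : dist (T p' z') y < ε / 4 := hp'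
  have h4 := h1 p'
  have h5 := h1 p
  have t1 := dist_triangle4 (T p z) (T p z') (T p' z') (T p' z)
  have t2 := dist_triangle_right (T p z') (T p' z') y
  rw [dist_comm] at h4
  linarith

variable {I : Type*} {H' H K : I → Type*} [∀ i, NormedAddCommGroup (H i)]
  [∀ i, InnerProductSpace ℂ (H i)] [∀ i, CompleteSpace (H i)]
  [∀ i, NormedAddCommGroup (H' i)] [∀ i, InnerProductSpace ℂ (H' i)]
  [∀ i, CompleteSpace (H' i)] [∀ i, NormedAddCommGroup (K i)]
  [∀ i, InnerProductSpace ℂ (K i)] [∀ i, CompleteSpace (K i)]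

lemma norm_fmul_le_of_le {T : Fam H' H} (hT : ‖T‖ ≤ 1) (z : Fam K H') : ‖fmul T z‖ ≤ ‖z‖ :=
  (norm_fmul_le T z).trans (mul_le_of_le_one_left (norm_nonneg z) hT)

lemma norm_apply_le_of_le {T : Fam H' H} (hT : ‖T‖ ≤ 1) (i : I) (ξ : H' i) : ‖T i ξ‖ ≤ ‖ξ‖ :=
  ((T i).le_opNorm ξ).trans (mul_le_of_le_one_left (norm_nonneg ξ) ((fam_le T i).trans hT))

/-- A bounded net `(T_p)` for which the products `T_p z` with the elements `z` of a nondegenerate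
space converge in norm has a strong limit. -/
lemma exists_strong_limit (T : P → Fam H' H) (hT : ∀ p, ‖T p‖ ≤ 1) (M : Set (Fam K H'))
    (hM : ∀ i, Dense (Submodule.span ℂ {η | ∃ z ∈ M, ∃ ξ, η = z i ξ} : Set (H' i)))
    (hlim : ∀ z ∈ M, ∃ y, Tendsto (fun p => fmul (T p) z) l (𝓝 y)) :
    ∃ S : Fam H' H, (∀ z ∈ M, Tendsto (fun p => fmul (T p) z) l (𝓝 (fmul S z))) ∧
      ∀ i ξ, Tendsto (fun p => T p i ξ) l (𝓝 (S i ξ)) := by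
  have h1 : ∀ i ξ, ∃ η, Tendsto (fun p => T p i ξ) l (𝓝 η) := by
    intro i
    refine (hM i).induction (P := fun ξ => ∃ η, Tendsto (fun p => T p i ξ) l (𝓝 η)) ?_
      (isClosed_exists_tendsto (fun p => T p i) fun p z => norm_apply_le_of_le (hT p) i z)
    intro ξ hξ
    induction hξ using Submodule.span_induction with
    | zero => exact ⟨0, by simp⟩
    | add x y _ _ hx hy =>
      obtain ⟨a, ha⟩ := hx
      obtain ⟨b, hb⟩ := hy
      exact ⟨a + b, by simpa using ha.add hb⟩
    | smul c x _ hx =>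
      obtain ⟨a, ha⟩ := hx
      exact ⟨c • a, by simpa using ha.const_smul c⟩
    | mem x hx =>
      obtain ⟨z, hz, ξ, rfl⟩ := hx
      obtain ⟨y, hy⟩ := hlim z hz
      exact ⟨y i ξ, ((evalAt i ξ).continuous.tendsto y).comp hy⟩
  choose f hf using h1
  let S : ∀ i, H' i →L[ℂ] H i := fun i => LinearMap.mkContinuous
    { toFun := f i
      map_add' := fun x y => tendsto_nhds_unique (hf i (x + y)) (by
        simpa using (hf i x).add (hf i y))
      map_smul' := fun c x => tendsto_nhds_unique (hf i (c • x)) (by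
        simpa using (hf i x).const_smul c) } 1 fun x => by
      rw [one_mul]
      exact le_of_tendsto (hf i x).norm (.of_forall fun p => norm_apply_le_of_le (hT p) i x)
  let S' : Fam H' H := famMk S 1 fun i => LinearMap.mkContinuous_norm_le _ zero_le_one _
  refine ⟨S', fun z hz => ?_, hf⟩
  obtain ⟨y, hy⟩ := hlim z hz
  have : y = fmul S' z := fam_ext fun i ξ =>
    tendsto_nhds_unique (((evalAt i ξ).continuous.tendsto y).comp hy) (hf i (z i ξ))
  rwa [← this]

lemma fadj_eq_of_tendsto {T : P → Fam H' H} {S : Fam H' H} {S' : Fam H H'}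
    (h : ∀ i ξ, Tendsto (fun p => T p i ξ) l (𝓝 (S i ξ)))
    (h' : ∀ i ξ, Tendsto (fun p => fadj (T p) i ξ) l (𝓝 (S' i ξ))) : S' = fadj S := by
  refine fam_ext' fun i => ?_
  rw [fadj_apply, ContinuousLinearMap.eq_adjoint_iff]
  intro ξ η
  refine tendsto_nhds_unique ((h' i ξ).inner (tendsto_const_nhds (x := η))) ?_
  refine (Tendsto.inner (tendsto_const_nhds (x := ξ)) (h i η)).congr fun p => ?_
  rw [fadj_apply, ContinuousLinearMap.adjoint_inner_left]

lemma tendsto_fmul_fmul {T : P → Fam H' H} {S : Fam H' H}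
    {Q : P → Fam H H'} (hQ : ∀ p, ‖Q p‖ ≤ 1) {S' : Fam H H'} {z : Fam K H'}
    (h1 : Tendsto (fun p => fmul (T p) z) l (𝓝 (fmul S z)))
    (h2 : Tendsto (fun p => fmul (Q p) (fmul S z)) l (𝓝 (fmul S' (fmul S z)))) :
    Tendsto (fun p => fmul (Q p) (fmul (T p) z)) l (𝓝 (fmul S' (fmul S z))) := by
  have h3 : Tendsto (fun p => fmul (Q p) (fmul (T p) z - fmul S z)) l (𝓝 0) := by
    refine squeeze_zero_norm (fun p => norm_fmul_le_of_le (hQ p) _) ?_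
    simpa using (h1.sub_const (fmul S z)).norm
  have := h3.add h2
  simpa using this

end StrongLimit

/-! ### An `L²`-estimate for covariant representations of `(C₀(G), rt)` -/

section L2Estimate

variable {G Γ : Type u} [Group G] [TopologicalSpace G] [IsTopologicalGroup G]
  [LocallyCompactSpace G] [T2Space G] [Group Γ] [TopologicalSpace Γ] [IsTopologicalGroup Γ]
  [LocallyCompactSpace Γ] [T2Space Γ] [MeasurableSpace Γ] [BorelSpace Γ]
  (μ : Measure Γ) [IsHaarMeasure μ] [Regular μ] {σ : Twist G Γ} {χ : Circle →* Circle}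
  {H : Type*} [NormedAddCommGroup H] [InnerProductSpace ℂ H] [CompleteSpace H]

/-- Evaluation at a point, as a bounded functional on `C₀(G)`. -/
def c0Eval (t : G) : C₀(G, ℂ) →L[ℂ] ℂ :=
  LinearMap.mkContinuous
    { toFun := fun c => c t
      map_add' := fun _ _ => rfl
      map_smul' := fun _ _ => rfl } 1 fun c => by rw [one_mul]; exact c0_apply_le c t

/-- A representation as a bounded linear map. -/
def repL {A : Type*} [NonUnitalCStarAlgebra A] (π : A →⋆ₙₐ[ℂ] (H →L[ℂ] H)) :
    A →L[ℂ] (H →L[ℂ] H) :=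
  LinearMap.mkContinuous (repLin π) 1 fun a => by
    rw [one_mul]; exact NonUnitalStarAlgHom.norm_apply_le π a

lemma sq_integral_mul_le {Ω : Type*} [MeasurableSpace Ω] {ν : Measure Ω} {a N : Ω → ℝ}
    (ha : ∀ s, 0 ≤ a s) (h0 : Integrable a ν) (h1 : Integrable (fun s => a s * N s) ν)
    (h2 : Integrable (fun s => a s * N s ^ 2) ν) :
    (∫ s, a s * N s ∂ν) ^ 2 ≤ (∫ s, a s ∂ν) * ∫ s, a s * N s ^ 2 ∂ν := by
  have h : ∀ t : ℝ, 0 ≤ (∫ s, a s ∂ν) * (t * t) + (-2 * ∫ s, a s * N s ∂ν) * t +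
      ∫ s, a s * N s ^ 2 ∂ν := fun t => by
    have : (∫ s, a s ∂ν) * (t * t) + (-2 * ∫ s, a s * N s ∂ν) * t + ∫ s, a s * N s ^ 2 ∂ν =
        ∫ s, a s * (N s - t) ^ 2 ∂ν := by
      rw [← integral_mul_const, ← integral_const_mul, ← integral_mul_const,
        ← integral_add (h0.mul_const _) ((h1.const_mul _).mul_const _),
        ← integral_add (f := fun s => a s * (t * t) + -2 * (a s * N s) * t)
          ((h0.mul_const _).add ((h1.const_mul _).mul_const _)) h2]
      exact integral_congr_ae (.of_forall fun s => by ring)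
    rw [this]
    exact integral_nonneg fun s => mul_nonneg (ha s) (sq_nonneg _)
  have := discrim_le_zero h
  rw [discrim] at this
  nlinarith

variable (σ) in
/-- The function `s ↦ |h(s)| rt_{q(s)⁻¹}(|c|²)`. -/
def slice (h : C_c(Γ, ℂ)) (c : C₀(G, ℂ)) : C_c(Γ, C₀(G, ℂ)) :=
  ⟨⟨fun s => (‖h s‖ : ℂ) • rt (σ.q s)⁻¹ (star c * c), by
    have h1 : Continuous fun s => rt (σ.q s)⁻¹ (star c * c) :=
      continuous_rt.comp ((σ.q_cont.inv).prodMk continuous_const)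
    have h2 : Continuous fun s => (‖h s‖ : ℂ) :=
      Complex.continuous_ofReal.comp h.continuous.norm
    exact h2.smul h1⟩, h.hasCompactSupport.mono fun s hs => by
      rw [Function.mem_support] at hs ⊢
      rintro h0
      simp [h0] at hs⟩

lemma norm_integral_slice_le (h : C_c(Γ, ℂ)) (c : C₀(G, ℂ))
    (hc : Integrable (fun s => ‖c (σ.q s)‖ ^ 2) μ) {D : ℝ}
    (hD : ∀ s, ‖Corner.flip h s‖ ≤ D) :
    ‖∫ s, slice σ h c s ∂μ‖ ≤ D * ∫ s, ‖c (σ.q s)‖ ^ 2 ∂μ := by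
  have hD0 : 0 ≤ D := (norm_nonneg _).trans (hD 1)
  have hI0 : 0 ≤ ∫ s, ‖c (σ.q s)‖ ^ 2 ∂μ := integral_nonneg fun _ => by positivity
  refine c0_norm_le (by positivity) fun t => ?_
  obtain ⟨τ, rfl⟩ := σ.q_surj t
  have hq := map_continuous c
  have hqc := σ.q_cont
  let F : Γ → ℝ := fun s => ‖h s‖ * ‖c (σ.q (τ * s⁻¹))‖ ^ 2
  have hFc : Continuous F := by
    have := h.continuous
    fun_prop
  have hFs : HasCompactSupport F := h.hasCompactSupport.mono fun s hs => by
    rw [Function.mem_support] at hs ⊢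
    rintro h0
    simp [F, h0] at hs
  have h1 : (∫ s, slice σ h c s ∂μ) (σ.q τ) = ((∫ s, F s ∂μ : ℝ) : ℂ) := by
    have := (c0Eval (σ.q τ)).integral_comp_comm (Corner.integrable_cc μ (slice σ h c))
    refine this.symm.trans ?_
    rw [← integral_complex_ofReal]
    refine integral_congr_ae (.of_forall fun s => ?_)
    change (‖h s‖ : ℂ) * (conj (c (σ.q τ * (σ.q s)⁻¹)) * c (σ.q τ * (σ.q s)⁻¹)) = (F s : ℂ)
    rw [Complex.conj_mul']
    simp [F]
  rw [h1, Complex.norm_real, Real.norm_of_nonneg (integral_nonneg fun s => by positivity),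
    ← integral_inv_modular_real μ hFc hFs]
  have hτ : ∫ s, ‖c (σ.q (τ * s))‖ ^ 2 ∂μ = ∫ s, ‖c (σ.q s)‖ ^ 2 ∂μ :=
    integral_mul_left_eq_self (μ := μ) (fun s => ‖c (σ.q s)‖ ^ 2) τ
  rw [← hτ, ← integral_const_mul]
  refine integral_mono_of_nonneg (.of_forall fun s => ?_) ?_ (.of_forall fun s => ?_)
  · exact mul_nonneg (by positivity) (modular_pos s).le
  · exact (hc.comp_mul_left τ).const_mul D
  · have := hD s
    rw [Corner.flip_apply, norm_smul, Complex.norm_real,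
      Real.norm_of_nonneg (modular_pos s).le] at this
    simp only [F, inv_inv]
    calc _ = (modularCharacterFun s : ℝ) * ‖h s⁻¹‖ * ‖c (σ.q (τ * s))‖ ^ 2 := by ring
      _ ≤ _ := by gcongr

lemma sq_norm_rep_apply (π : C₀(G, ℂ) →⋆ₙₐ[ℂ] (H →L[ℂ] H)) (c : C₀(G, ℂ)) (ξ : H) :
    ((‖π c ξ‖ ^ 2 : ℝ) : ℂ) = inner ℂ ξ (π (star c * c) ξ) := by
  rw [map_mul, map_star]
  have : inner ℂ ξ ((star (π c) * π c) ξ) = inner ℂ (π c ξ) (π c ξ) :=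
    ContinuousLinearMap.adjoint_inner_right (π c) ξ (π c ξ)
  rw [this, inner_self_eq_norm_sq_to_K]
  norm_cast

lemma sq_norm_rep_integral_le (r : CovRep σ (fun s => rt (σ.q s)) χ H) (h : C_c(Γ, ℂ))
    (c : C₀(G, ℂ)) (hc : Integrable (fun s => ‖c (σ.q s)‖ ^ 2) μ) {D : ℝ}
    (hD : ∀ s, ‖Corner.flip h s‖ ≤ D) (ξ : H) :
    ‖r.π c (∫ s, h s • (r.U s : H →L[ℂ] H) ξ ∂μ)‖ ^ 2 ≤
      (∫ s, ‖h s‖ ∂μ) * (D * ∫ s, ‖c (σ.q s)‖ ^ 2 ∂μ) * ‖ξ‖ ^ 2 := by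
  have hU : Continuous fun s => (r.U s : H →L[ℂ] H) ξ := r.cont ξ
  have hN : Continuous fun s => ‖r.π c ((r.U s : H →L[ℂ] H) ξ)‖ :=
    ((r.π c).continuous.comp hU).norm
  have hcs : ∀ g : Γ → ℝ, HasCompactSupport fun s => ‖h s‖ * g s := fun g =>
    h.hasCompactSupport.norm.mul_right
  have hInt : ∀ g : Γ → ℝ, Continuous g → Integrable (fun s => ‖h s‖ * g s) μ := fun g hg =>
    (h.continuous.norm.mul hg).integrable_of_hasCompactSupport (hcs g)
  have hv : ‖r.π c (∫ s, h s • (r.U s : H →L[ℂ] H) ξ ∂μ)‖ ≤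
      ∫ s, ‖h s‖ * ‖r.π c ((r.U s : H →L[ℂ] H) ξ)‖ ∂μ := by
    rw [← (r.π c).integral_comp_comm]
    · refine (norm_integral_le_integral_norm _).trans_eq ?_
      refine integral_congr_ae (.of_forall fun s => ?_)
      beta_reduce
      rw [map_smul, norm_smul]
    · exact (h.continuous.smul hU).integrable_of_hasCompactSupport
        h.hasCompactSupport.smul_right
  have hQ : ∫ s, ‖h s‖ * ‖r.π c ((r.U s : H →L[ℂ] H) ξ)‖ ^ 2 ∂μ ≤
      (D * ∫ s, ‖c (σ.q s)‖ ^ 2 ∂μ) * ‖ξ‖ ^ 2 := by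
    have h1 : ((∫ s, ‖h s‖ * ‖r.π c ((r.U s : H →L[ℂ] H) ξ)‖ ^ 2 ∂μ : ℝ) : ℂ) =
        inner ℂ ξ (repL r.π (∫ s, slice σ h c s ∂μ) ξ) := by
      have h2 := (((innerSL ℂ ξ).comp ((ContinuousLinearMap.apply ℂ H ξ).comp
        (repL r.π)))).integral_comp_comm (Corner.integrable_cc μ (slice σ h c))
      refine Eq.trans ?_ h2
      rw [← integral_complex_ofReal]
      refine integral_congr_ae (.of_forall fun s => ?_)
      beta_reduce
      rw [Complex.ofReal_mul, sq_norm_rep_apply]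
      have h3 : (r.U s : H →L[ℂ] H) (r.π (rt (σ.q s)⁻¹ (star c * c)) ξ) =
          r.π (star c * c) ((r.U s : H →L[ℂ] H) ξ) := by
        rw [r.covariant]
        congr 2
        ext t
        simp only [rt_apply]
        rw [mul_inv_cancel_right]
      have h4 : inner ℂ ((r.U s : H →L[ℂ] H) ξ) (r.π (star c * c) ((r.U s : H →L[ℂ] H) ξ)) =
          inner ℂ ξ (r.π (rt (σ.q s)⁻¹ (star c * c)) ξ) := by
        rw [← h3]
        exact ContinuousLinearMap.inner_map_map_of_mem_unitary (r.U s).2 _ _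
      rw [h4]
      change _ = inner ℂ ξ (r.π ((‖h s‖ : ℂ) • rt (σ.q s)⁻¹ (star c * c)) ξ)
      rw [map_smul, _root_.smul_apply, inner_smul_right]
    have h5 : ‖inner ℂ ξ (repL r.π (∫ s, slice σ h c s ∂μ) ξ)‖ ≤
        (D * ∫ s, ‖c (σ.q s)‖ ^ 2 ∂μ) * ‖ξ‖ ^ 2 := by
      calc _ ≤ ‖ξ‖ * (‖repL r.π (∫ s, slice σ h c s ∂μ)‖ * ‖ξ‖) :=
            (norm_inner_le_norm _ _).trans (by gcongr; exact ContinuousLinearMap.le_opNorm _ _)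
        _ ≤ ‖ξ‖ * ((D * ∫ s, ‖c (σ.q s)‖ ^ 2 ∂μ) * ‖ξ‖) := by
            gcongr
            exact (NonUnitalStarAlgHom.norm_apply_le r.π _).trans
              (norm_integral_slice_le μ h c hc hD)
        _ = _ := by ring
    rw [← h1, Complex.norm_real] at h5
    exact (le_abs_self _).trans h5
  calc _ ≤ (∫ s, ‖h s‖ * ‖r.π c ((r.U s : H →L[ℂ] H) ξ)‖ ∂μ) ^ 2 := by gcongr
    _ ≤ (∫ s, ‖h s‖ ∂μ) * ∫ s, ‖h s‖ * ‖r.π c ((r.U s : H →L[ℂ] H) ξ)‖ ^ 2 ∂μ :=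
      sq_integral_mul_le (fun s => norm_nonneg _) (Corner.integrable_cc μ h).norm (hInt _ hN)
        (hInt _ (hN.pow 2))
    _ ≤ _ := by
      rw [mul_assoc]
      gcongr

end L2Estimate

/-! ### Approximation of Borel sections by continuous functions -/

section Approximants

open scoped Pointwise

attribute [local instance] circleBorel circleBorel_borel

variable {G Γ : Type u} [Group G] [TopologicalSpace G] [IsTopologicalGroup G]
  [Group Γ] [TopologicalSpace Γ] [IsTopologicalGroup Γ]
  [LocallyCompactSpace Γ] [T2Space Γ] [MeasurableSpace Γ] [BorelSpace Γ]
  (μ : Measure Γ) [IsHaarMeasure μ] [Regular μ] (σ : Twist G Γ)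

lemma sq_norm_L2 {Ω : Type*} [MeasurableSpace Ω] {ν : Measure Ω} (x : Lp ℂ 2 ν) :
    ‖x‖ ^ 2 = ∫ s, ‖x s‖ ^ 2 ∂ν := by
  have h : ((‖x‖ ^ 2 : ℝ) : ℂ) = ((∫ s, ‖x s‖ ^ 2 ∂ν : ℝ) : ℂ) := by
    have := inner_self_eq_norm_sq_to_K (𝕜 := ℂ) x
    rw [L2.inner_def] at this
    push_cast at this ⊢
    refine this.symm.trans ?_
    rw [← integral_complex_ofReal]
    refine integral_congr_ae (.of_forall fun s => ?_)
    change x s * conj (x s) = _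
    rw [Complex.mul_conj, Complex.normSq_eq_norm_sq]
  exact_mod_cast h

/-- The class in `L²(Γ)` of a function in `C_c(Γ)`. -/
def ccLp (h : C_c(Γ, ℂ)) : Lp ℂ 2 μ :=
  (h.continuous.memLp_of_hasCompactSupport (p := 2) (μ := μ) h.hasCompactSupport).toLp

lemma ccLp_coe (h : C_c(Γ, ℂ)) : ccLp μ h =ᵐ[μ] h := MemLp.coeFn_toLp _

lemma inner_ccLp (h : C_c(Γ, ℂ)) (ξ : Lp ℂ 2 μ) :
    inner ℂ (ccLp μ h) ξ = ∫ s, conj (h s) * ξ s ∂μ := by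
  rw [L2.inner_def]
  refine integral_congr_ae ?_
  filter_upwards [ccLp_coe μ h] with s hs
  rw [hs, RCLike.inner_apply, mul_comm]

lemma dense_ccLp : Dense (Set.range (ccLp μ : C_c(Γ, ℂ) → Lp ℂ 2 μ)) := by
  rw [Metric.dense_iff]
  intro ξ ε hε
  obtain ⟨g, hg2, hg3, hg1⟩ := exists_cc_approx μ (Lp.memLp ξ) (ε := ENNReal.ofReal (ε / 2))
    (by simpa using hε)
  refine ⟨ccLp μ ⟨⟨g, hg3⟩, hg1⟩, ?_, ⟨_, rfl⟩⟩
  rw [Metric.mem_ball, dist_comm, Lp.dist_def]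
  have : eLpNorm (⇑ξ - ⇑(ccLp μ ⟨⟨g, hg3⟩, hg1⟩)) 2 μ = eLpNorm (⇑ξ - g) 2 μ :=
    eLpNorm_congr_ae (by
      filter_upwards [ccLp_coe μ ⟨⟨g, hg3⟩, hg1⟩] with t ht
      rw [Pi.sub_apply, Pi.sub_apply, ht]; rfl)
  rw [this]
  have := ENNReal.toReal_le_of_le_ofReal (by positivity) hg2
  linarith

lemma ext_inner_ccLp {ξ η : Lp ℂ 2 μ} (h : ∀ k, inner ℂ (ccLp μ k) ξ = inner ℂ (ccLp μ k) η) :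
    ξ = η :=
  (dense_ccLp μ).eq_of_inner_right ℂ (by rintro _ ⟨k, rfl⟩; exact h k)

lemma modular_ι (z : Circle) : (modularCharacterFun (σ.ι z) : ℝ) = 1 := by
  obtain ⟨h, h1, -, -⟩ := exists_bump (haar : Measure Γ) (F := fun _ : Γ => (0 : ℂ)) continuous_const
    (Filter.univ_mem) one_pos
  have h2 := integral_mul_right_modular (haar : Measure Γ) (fun t => ‖h t‖) (σ.ι z)
  have h3 := integral_mul_left_eq_self (μ := haar) (fun t => ‖h t‖) (σ.ι z)
  simp only [σ.central] at h3
  rw [h3, h1, smul_eq_mul, mul_one] at h2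
  exact h2.symm

lemma sqrtModular_ι (z : Circle) : sqrtModular (σ.ι z) = 1 := by
  rw [sqrtModular, modular_ι σ, Real.sqrt_one, inv_one]

variable {χ : Circle →* Circle} (hχ : Continuous χ)

lemma integral_transl_ccLp (h : C_c(Γ, ℂ)) :
    ∫ z, (χ z : ℂ) • transl μ (σ.ι z) (ccLp μ h) ∂circleHaar = ccLp μ (avg σ χ hχ h) := by
  refine ext_inner_ccLp μ fun k => ?_
  have hcont : Continuous fun z => (χ z : ℂ) • transl μ (σ.ι z) (ccLp μ h) :=
    (continuous_subtype_val.comp hχ).smul ((continuous_transl μ _).comp σ.ι_cont)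
  have hInt : Integrable (fun z => (χ z : ℂ) • transl μ (σ.ι z) (ccLp μ h)) circleHaar :=
    hcont.integrable_of_hasCompactSupport (HasCompactSupport.of_compactSpace _)
  have h1 := (innerSL ℂ (ccLp μ k)).integral_comp_comm hInt
  refine h1.symm.trans ?_
  have h2 : ∀ z, innerSL ℂ (ccLp μ k) ((χ z : ℂ) • transl μ (σ.ι z) (ccLp μ h)) =
      ∫ s, conj (k s) * ((χ z : ℂ) * h (s * σ.ι z)) ∂μ := fun z => by
    rw [map_smul, innerSL_apply_apply, inner_ccLp, smul_eq_mul, ← integral_const_mul]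
    refine integral_congr_ae ?_
    filter_upwards [transl_coe μ (σ.ι z) (ccLp μ h), (qmp_mul_right μ (σ.ι z)).ae (ccLp_coe μ h)]
      with s hs hs'
    rw [hs, hs', sqrtModular_ι, Complex.ofReal_one]
    ring
  simp only [h2]
  rw [inner_ccLp]
  have hk := k.continuous
  have hh := h.continuous
  have hι := σ.ι_cont
  rw [← integral_integral_swap_of_hasCompactSupport
    (f := fun (s : Γ) (z : Circle) => conj (k s) * ((χ z : ℂ) * h (s * σ.ι z)))]
  · refine integral_congr_ae ?_
    filter_upwards [ccLp_coe μ (avg σ χ hχ h)] with s hs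
    rw [hs, avg_apply, ← integral_const_mul]
  · exact (Complex.continuous_conj.comp (hk.comp continuous_fst)).mul
      ((continuous_subtype_val.comp (hχ.comp continuous_snd)).mul (hh.comp (by fun_prop)))
  · refine HasCompactSupport.intro (k.hasCompactSupport.isCompact.prod isCompact_univ) ?_
    rintro ⟨s, z⟩ hs
    have : k s = 0 := image_eq_zero_of_notMem_tsupport (f := k) fun hz =>
      hs ⟨hz, Set.mem_univ _⟩
    simp [this]

lemma norm_ccLp_avg_sub_le (h : C_c(Γ, ℂ)) {ζ : Lp ℂ 2 μ}
    (hζ : ∀ z, transl μ (σ.ι z) ζ = conj (χ z : ℂ) • ζ) :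
    ‖ccLp μ (avg σ χ hχ h) - ζ‖ ≤ ‖ccLp μ h - ζ‖ := by
  have hcont : ∀ ξ : Lp ℂ 2 μ, Integrable (fun z => (χ z : ℂ) • transl μ (σ.ι z) ξ) circleHaar :=
    fun ξ => ((continuous_subtype_val.comp hχ).smul
      ((continuous_transl μ _).comp σ.ι_cont)).integrable_of_hasCompactSupport
        (HasCompactSupport.of_compactSpace _)
  have h1 : ζ = ∫ z, (χ z : ℂ) • transl μ (σ.ι z) ζ ∂circleHaar := by
    have : ∀ z, (χ z : ℂ) • transl μ (σ.ι z) ζ = ζ := fun z => by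
      rw [hζ, smul_smul, mul_comm, conj_mul_circle, one_smul]
    simp only [this, integral_const, probReal_univ, one_smul]
  conv_lhs => rw [← integral_transl_ccLp μ σ hχ h, h1, ← integral_sub (hcont _) (hcont _)]
  refine (norm_integral_le_integral_norm _).trans_eq ?_
  have h2 : ∀ z, ‖(χ z : ℂ) • transl μ (σ.ι z) (ccLp μ h) - (χ z : ℂ) • transl μ (σ.ι z) ζ‖ =
      ‖ccLp μ h - ζ‖ := fun z => by
    rw [← smul_sub, ← map_sub, norm_smul, Circle.norm_coe, one_mul, LinearIsometry.norm_map]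
  simp only [h2, integral_const, probReal_univ, one_smul]

lemma norm_trunc_sub_le (w : Circle) (z : ℂ) :
    ‖z / (max 1 ‖z‖ : ℝ) - w‖ ≤ ‖z - w‖ := by
  rcases le_total ‖z‖ 1 with hz | hz
  · simp [max_eq_left hz]
  rw [max_eq_right hz]
  have hr : (0 : ℝ) < ‖z‖ := by linarith
  refine le_of_sq_le_sq ?_ (norm_nonneg _)
  have e1 : ∀ v : ℂ, ‖v - w‖ ^ 2 = ‖v‖ ^ 2 + 1 - 2 * (v * conj (w : ℂ)).re := fun v => by
    rw [← Complex.normSq_eq_norm_sq, Complex.normSq_sub, Complex.normSq_eq_norm_sq,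
      Complex.normSq_eq_norm_sq, Circle.norm_coe]
    ring
  have e2 : (z / (‖z‖ : ℂ) * conj (w : ℂ)).re = (z * conj (w : ℂ)).re / ‖z‖ := by
    rw [div_mul_eq_mul_div, Complex.div_ofReal_re]
  have e3 : (z * conj (w : ℂ)).re ≤ ‖z‖ := by
    refine (Complex.re_le_norm _).trans ?_
    rw [norm_mul, RCLike.norm_conj, Circle.norm_coe, mul_one]
  rw [e1, e1, e2, norm_div, Complex.norm_real, norm_norm, div_self hr.ne']
  have e4 : (z * conj (w : ℂ)).re / ‖z‖ ≤ 1 := (div_le_one hr).2 e3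
  have e5 : (z * conj (w : ℂ)).re = (z * conj (w : ℂ)).re / ‖z‖ * ‖z‖ := by field_simp
  set a := (z * conj (w : ℂ)).re / ‖z‖
  rw [e5]
  nlinarith

/-- Truncation `f / max(1, |f|)`. -/
def C0bar.trunc {σ : Twist G Γ} (f : C0bar σ) : C0bar σ :=
  C0bar.mk (c0OfLe (fun s => f.fn s / ((max 1 ‖f.fn s‖ : ℝ) : ℂ))
    ((map_continuous f.fn).div (Complex.continuous_ofReal.comp
      (continuous_const.max (map_continuous f.fn).norm)) fun s => by
        have : (0 : ℝ) < max 1 ‖f.fn s‖ := by positivity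
        exact_mod_cast this.ne') f.fn 1 (fun s => by
      rw [norm_div, Complex.norm_real, one_mul, Real.norm_of_nonneg (by positivity)]
      exact div_le_self (norm_nonneg _) (le_max_left _ _))) (fun s z => by
    simp only [c0OfLe_apply, f.prop, norm_mul, RCLike.norm_conj, Circle.norm_coe, one_mul,
      mul_div_assoc])

lemma C0bar.trunc_apply {σ : Twist G Γ} (f : C0bar σ) (s : Γ) :
    f.trunc.fn s = f.fn s / ((max 1 ‖f.fn s‖ : ℝ) : ℂ) := rfl

lemma C0bar.norm_trunc_apply_le {σ : Twist G Γ} (f : C0bar σ) (s : Γ) : ‖f.trunc.fn s‖ ≤ 1 := by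
  rw [C0bar.trunc_apply, norm_div, Complex.norm_real, Real.norm_of_nonneg (by positivity)]
  exact div_le_one_of_le₀ (le_max_right _ _) (by positivity)

variable {ϕ : Γ → Circle}

lemma integrableOn_sq_sub (hm : Measurable fun t => (ϕ t : ℂ)) (f : C0bar σ) {K : Set Γ}
    (hK : IsCompact K) :
    IntegrableOn (fun s => ‖f.fn s - ϕ s‖ ^ 2) K μ := by
  have hmeas : Measurable fun s => ‖f.fn s - ϕ s‖ ^ 2 :=
    ((map_continuous f.fn).measurable.sub hm).norm.pow_const 2
  have : IsFiniteMeasure (μ.restrict K) := ⟨by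
    rw [Measure.restrict_apply_univ]; exact hK.measure_lt_top⟩
  refine Integrable.of_bound hmeas.aestronglyMeasurable ((‖f‖ + 1) ^ 2) (.of_forall fun s => ?_)
  rw [Real.norm_of_nonneg (by positivity)]
  gcongr
  refine (norm_sub_le _ _).trans ?_
  rw [Circle.norm_coe]
  gcongr
  exact c0_apply_le f.fn s

lemma exists_approx_section (hm : Measurable fun t => (ϕ t : ℂ))
    (hϕ : ∀ s z, ϕ (s * σ.ι z) = z⁻¹ * ϕ s) {K : Set Γ} (hK : IsCompact K) {ε : ℝ} (hε : 0 < ε) :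
    ∃ F : C0bar σ, (∀ s, ‖F.fn s‖ ≤ 1) ∧ ∫ s in K, ‖F.fn s - ϕ s‖ ^ 2 ∂μ < ε := by
  let K' : Set Γ := K * Set.range σ.ι
  have hK' : IsCompact K' := hK.mul (isCompact_range σ.ι_cont)
  have hKK' : K ⊆ K' := fun s hs => ⟨s, hs, 1, ⟨1, map_one _⟩, mul_one s⟩
  have hK'z : ∀ s z, s * σ.ι z ∈ K' ↔ s ∈ K' := fun s z => by
    constructor
    · rintro ⟨k, hk, _, ⟨w, rfl⟩, h⟩
      refine ⟨k, hk, _, ⟨w * z⁻¹, rfl⟩, ?_⟩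
      beta_reduce at h ⊢
      rw [map_mul, ← mul_assoc, h, mul_assoc, ← map_mul, mul_inv_cancel, map_one, mul_one]
    · rintro ⟨k, hk, _, ⟨w, rfl⟩, rfl⟩
      exact ⟨k, hk, _, ⟨w * z, rfl⟩, by simp [mul_assoc]⟩
  have hmem : MemLp (K'.indicator fun s => (ϕ s : ℂ)) 2 μ := by
    rw [memLp_indicator_iff_restrict hK'.measurableSet]
    have : IsFiniteMeasure (μ.restrict K') := ⟨by
      rw [Measure.restrict_apply_univ]; exact hK'.measure_lt_top⟩
    exact MemLp.of_bound hm.aestronglyMeasurable 1 (.of_forall fun s => (Circle.norm_coe _).le)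
  set ζ : Lp ℂ 2 μ := hmem.toLp with hζdef
  have hζ : ∀ z, transl μ (σ.ι z) ζ = conj ((MonoidHom.id Circle z : Circle) : ℂ) • ζ := fun z => by
    refine Lp.ext ((transl_coe μ _ _).trans (.trans ?_ (Lp.coeFn_smul _ _).symm))
    filter_upwards [hmem.coeFn_toLp, (qmp_mul_right μ (σ.ι z)).ae hmem.coeFn_toLp] with s h1 h2
    rw [Pi.smul_apply]
    rw [h1, h2, sqrtModular_ι, Complex.ofReal_one, one_mul]
    by_cases hs : s ∈ K'
    · rw [Set.indicator_of_mem hs, Set.indicator_of_mem ((hK'z s z).2 hs), hϕ, Circle.coe_mul,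
        Circle.coe_inv_eq_conj]
      rfl
    · rw [Set.indicator_of_notMem hs, Set.indicator_of_notMem (mt (hK'z s z).1 hs), smul_zero]
  obtain ⟨_, hh, h, rfl⟩ := Metric.dense_iff.1 (dense_ccLp μ) ζ (√ε) (Real.sqrt_pos.2 hε)
  rw [Metric.mem_ball, dist_eq_norm] at hh
  have h1 := norm_ccLp_avg_sub_le μ σ (χ := MonoidHom.id Circle) continuous_id h hζ
  set g := avg σ (MonoidHom.id Circle) continuous_id h with hg
  have h2 : ‖ccLp μ g - ζ‖ ^ 2 < ε := by
    have := pow_lt_pow_left₀ (h1.trans_lt hh) (norm_nonneg _) two_ne_zero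
    rwa [Real.sq_sqrt hε.le] at this
  have hae : ⇑(ccLp μ g - ζ) =ᵐ[μ] fun s => g s - K'.indicator (fun s => (ϕ s : ℂ)) s := by
    filter_upwards [Lp.coeFn_sub (ccLp μ g) ζ, ccLp_coe μ g, hmem.coeFn_toLp] with s e1 e2 e3
    rw [e1, Pi.sub_apply, e2, hζdef, e3]
  rw [sq_norm_L2] at h2
  let f : C0bar σ := C0bar.ofAvg σ h
  have hf : ∀ s, f.fn s = g s := fun s => rfl
  refine ⟨f.trunc, f.norm_trunc_apply_le, lt_of_le_of_lt ?_ h2⟩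
  have hInt : Integrable (fun s => ‖(ccLp μ g - ζ) s‖ ^ 2) μ :=
    (memLp_two_iff_integrable_sq_norm (Lp.aestronglyMeasurable _)).1 (Lp.memLp (ccLp μ g - ζ))
  calc ∫ s in K, ‖f.trunc.fn s - ϕ s‖ ^ 2 ∂μ ≤ ∫ s in K, ‖(ccLp μ g - ζ) s‖ ^ 2 ∂μ := by
        refine setIntegral_mono_on_ae (integrableOn_sq_sub μ σ hm _ hK) hInt.integrableOn
          hK.measurableSet ?_
        filter_upwards [hae] with s hs hsK
        rw [hs, Set.indicator_of_mem (hKK' hsK), ← hf, C0bar.trunc_apply]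
        gcongr
        exact norm_trunc_sub_le (ϕ s) (f.fn s)
    _ ≤ ∫ s, ‖(ccLp μ g - ζ) s‖ ^ 2 ∂μ :=
        setIntegral_le_integral hInt (.of_forall fun s => by positivity)

variable (ϕ) in
/-- A net of continuous functions converging to `ϕ` in mean square on compact sets. -/
structure Approximants (F : TopologicalSpace.Compacts Γ × ℕ → C0bar σ) : Prop where
  norm_apply_le : ∀ p s, ‖(F p).fn s‖ ≤ 1
  tendsto : ∀ K : Set Γ, IsCompact K →
    Tendsto (fun p => ∫ s in K, ‖(F p).fn s - ϕ s‖ ^ 2 ∂μ) atTop (𝓝 0)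

lemma exists_approximants (hm : Measurable fun t => (ϕ t : ℂ))
    (hϕ : ∀ s z, ϕ (s * σ.ι z) = z⁻¹ * ϕ s) : ∃ F, Approximants μ σ ϕ F := by
  choose F hF1 hF2 using fun p : TopologicalSpace.Compacts Γ × ℕ =>
    exists_approx_section μ σ hm hϕ p.1.isCompact (ε := 1 / ((p.2 : ℝ) + 1)) (by positivity)
  refine ⟨F, hF1, fun K hK => ?_⟩
  have h0 : Tendsto (fun p : TopologicalSpace.Compacts Γ × ℕ => 1 / ((p.2 : ℝ) + 1)) atTop (𝓝 0) := by
    refine tendsto_one_div_add_atTop_nhds_zero_nat.comp ?_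
    rw [← prod_atTop_atTop_eq]
    exact tendsto_snd
  refine tendsto_of_tendsto_of_tendsto_of_le_of_le' tendsto_const_nhds h0
    (.of_forall fun p => integral_nonneg fun s => by positivity) ?_
  filter_upwards [eventually_ge_atTop ((⟨K, hK⟩, 0) : TopologicalSpace.Compacts Γ × ℕ)] with p hp
  refine le_trans ?_ (hF2 p).le
  exact setIntegral_mono_set (integrableOn_sq_sub μ σ hm _ p.1.isCompact)
    (.of_forall fun s => by positivity) (LE.le.eventuallyLE (show K ⊆ p.1 from hp.1))

end Approximants

/-! ### The multiplier `S_ϕ` -/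

section Sphi

variable {G Γ : Type u} [Group G] [TopologicalSpace G] [IsTopologicalGroup G]
  [LocallyCompactSpace G] [T2Space G] [Group Γ] [TopologicalSpace Γ] [IsTopologicalGroup Γ]
  [LocallyCompactSpace Γ] [T2Space Γ] [MeasurableSpace Γ] [BorelSpace Γ]
  (μ : Measure Γ) [IsHaarMeasure μ] [Regular μ] (σ : Twist G Γ)

lemma C0bar.exists_compactSupport_near (f : C0bar σ) {ε : ℝ} (hε : 0 < ε) :
    ∃ f' : C0bar σ, (∃ K : Set Γ, IsCompact K ∧ ∀ s ∉ K, f'.fn s = 0) ∧ ‖f - f'‖ ≤ ε := by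
  have hε' : (ε : ℂ) ≠ 0 := by exact_mod_cast hε.ne'
  let t : C0bar σ := (ε : ℂ) • ((ε : ℂ)⁻¹ • f).trunc
  obtain ⟨K, hK, hKf⟩ := mem_cocompact.1 ((zero_at_infty f.fn) (Metric.ball_mem_nhds 0 hε))
  refine ⟨f - t, ⟨K, hK, fun s hs => ?_⟩, ?_⟩
  · have h1 : ‖f.fn s‖ < ε := by simpa using hKf hs
    have h2 : ‖(ε : ℂ)⁻¹ * f.fn s‖ ≤ 1 := by
      rw [norm_mul, norm_inv, Complex.norm_real, Real.norm_of_nonneg hε.le, inv_mul_le_iff₀ hε,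
        mul_one]
      exact h1.le
    change f.fn s - (ε : ℂ) * (((ε : ℂ)⁻¹ * f.fn s) /
      ((max 1 ‖(ε : ℂ)⁻¹ * f.fn s‖ : ℝ) : ℂ)) = 0
    rw [max_eq_left h2, Complex.ofReal_one, div_one, mul_inv_cancel_left₀ hε', sub_self]
  · rw [sub_sub_cancel]
    refine c0_norm_le (f := t.fn) hε.le fun s => ?_
    change ‖(ε : ℂ) * ((ε : ℂ)⁻¹ • f).trunc.fn s‖ ≤ ε
    rw [norm_mul, Complex.norm_real, Real.norm_of_nonneg hε.le]
    exact mul_le_of_le_one_right hε.le (C0bar.norm_trunc_apply_le _ s)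

section Corner

variable {Y : Type*} [NormedAddCommGroup Y] [NormedSpace ℂ Y] {I : Type*} {H' H : I → Type*}
  [∀ i, NormedAddCommGroup (H i)] [∀ i, InnerProductSpace ℂ (H i)] [∀ i, CompleteSpace (H i)]
  [∀ i, NormedAddCommGroup (H' i)] [∀ i, InnerProductSpace ℂ (H' i)]
  [∀ i, CompleteSpace (H' i)] (c : Corner Γ Y H' H)

lemma Corner.integ_tens_apply (h : C_c(Γ, ℂ)) (y : Y) (i : I) (ξ : H' i) :
    c.integ μ (Corner.tens h y) i ξ =
      c.ρ i y (∫ s, h s • ((c.V i).U s : H' i →L[ℂ] H' i) ξ ∂μ) := by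
  rw [c.integ_tens]
  rfl

lemma Corner.cross_le_of_dense {D : Set Y} (hD : Dense (Submodule.span ℂ D : Set Y))
    {M : Submodule ℂ (Fam H' H)} (hM : IsClosed (M : Set (Fam H' H)))
    (h : ∀ g, ∀ y ∈ D, c.integ μ (Corner.tens g y) ∈ M) : c.cross μ ≤ M := by
  refine c.cross_le_of_tens μ hM fun g y => ?_
  rw [c.integ_tens]
  let L : Y →L[ℂ] Fam H' H :=
    (ContinuousLinearMap.flip fmul (c.scal.integ μ g)).comp c.ρF
  change L y ∈ M
  refine hD.induction (P := fun y => L y ∈ M) (fun y hy => ?_) (hM.preimage L.continuous) y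
  induction hy using Submodule.span_induction with
  | zero => rw [map_zero]; exact zero_mem _
  | add x y _ _ hx hy => rw [map_add]; exact add_mem hx hy
  | smul k x _ hx => rw [map_smul]; exact Submodule.smul_mem _ k hx
  | mem y hy =>
    have := h g y hy
    rw [c.integ_tens] at this
    exact this

end Corner

lemma dense_c0bar_compactSupport :
    Dense (Submodule.span ℂ {f : C0bar σ | ∃ K : Set Γ, IsCompact K ∧ ∀ s ∉ K, f.fn s = 0} :
      Set (C0bar σ)) :=
  Metric.dense_iff.2 fun f ε hε => by
    obtain ⟨f', hf', h⟩ := f.exists_compactSupport_near σ (half_pos hε)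
    refine ⟨f', ?_, Submodule.subset_span hf'⟩
    rw [Metric.mem_ball, dist_comm, dist_eq_norm]
    linarith

lemma dense_c0_compactSupport :
    Dense (Submodule.span ℂ {c : C₀(G, ℂ) | ∃ K : Set Γ, IsCompact K ∧ ∀ s ∉ K, c (σ.q s) = 0} :
      Set C₀(G, ℂ)) := by
  refine dense_of_le_closure (dense_linner₀ σ) ?_
  rintro _ ⟨f, g, rfl⟩
  have hL : Continuous fun f => linner₀ σ f g :=
    (eqBimod₀ σ).linner_cont.comp (continuous_id.prodMk continuous_const)
  have := map_mem_closure hL (dense_c0bar_compactSupport σ f)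
    (t := (Submodule.span ℂ {c : C₀(G, ℂ) | ∃ K : Set Γ, IsCompact K ∧ ∀ s ∉ K, c (σ.q s) = 0}))
    fun f hf => ?_
  · exact this
  induction hf using Submodule.span_induction with
  | zero =>
    have : linner₀ σ 0 g = 0 := c0_ext_q σ fun s => by
      rw [linner₀_q]; exact zero_mul _
    rw [this]; exact zero_mem _
  | add x y _ _ hx hy =>
    have : linner₀ σ (x + y) g = linner₀ σ x g + linner₀ σ y g := (eqBimod₀ σ).linner_add x y g
    rw [this]; exact add_mem hx hy
  | smul k x _ hx =>
    have : linner₀ σ (k • x) g = k • linner₀ σ x g := (eqBimod₀ σ).linner_smul k x g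
    rw [this]; exact Submodule.smul_mem _ k hx
  | mem f hf =>
    obtain ⟨K, hK, h0⟩ := hf
    refine Submodule.subset_span ⟨K, hK, fun s hs => ?_⟩
    rw [linner₀_q, h0 s hs, zero_mul]

lemma sq_norm_πX_apply (k : BimodFam σ (bimod₀ σ)) (f : C0bar σ) (ξ : k.H') :
    ‖k.rep.πX f ξ‖ = ‖k.rep.right.π f.abs ξ‖ := by
  have h1 : star f.abs * f.abs = rinner₀ σ f f := c0_ext_q σ fun s => by
    rw [rinner₀_q, Complex.conj_mul']
    change conj (f.abs (σ.q s)) * f.abs (σ.q s) = _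
    rw [C0bar.abs_q, Complex.conj_ofReal, sq]
  have h2 : ((‖k.rep.πX f ξ‖ ^ 2 : ℝ) : ℂ) = ((‖k.rep.right.π f.abs ξ‖ ^ 2 : ℝ) : ℂ) := by
    rw [sq_norm_rep_apply, h1]
    have h3 : k.rep.right.π (rinner₀ σ f f) =
      ContinuousLinearMap.adjoint (k.rep.πX f) ∘L k.rep.πX f := k.rep.map_rinner f f
    rw [h3, ContinuousLinearMap.comp_apply, ContinuousLinearMap.adjoint_inner_right,
      inner_self_eq_norm_sq_to_K]
    norm_cast
  have h3 : ‖k.rep.πX f ξ‖ ^ 2 = ‖k.rep.right.π f.abs ξ‖ ^ 2 := by exact_mod_cast h2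
  exact (sq_eq_sq₀ (norm_nonneg _) (norm_nonneg _)).1 h3

lemma exists_sq_norm_integ_le (h : C_c(Γ, ℂ)) : ∃ C : ℝ, 0 ≤ C ∧
    (∀ c : C₀(G, ℂ), Integrable (fun s => ‖c (σ.q s)‖ ^ 2) μ →
      ‖(EqBimod.corB σ (bimod₀ σ)).integ μ (Corner.tens h c)‖ ^ 2 ≤
        C * ∫ s, ‖c (σ.q s)‖ ^ 2 ∂μ) ∧
    (∀ f : C0bar σ, Integrable (fun s => ‖f.fn s‖ ^ 2) μ →
      ‖(eqBimod₀ σ).cor.integ μ (Corner.tens h f)‖ ^ 2 ≤ C * ∫ s, ‖f.fn s‖ ^ 2 ∂μ) := by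
  obtain ⟨D, hD⟩ := (Corner.flip h).continuous.bounded_above_of_compact_support
    (Corner.flip h).hasCompactSupport
  have hD0 : 0 ≤ D := (norm_nonneg _).trans (hD 1)
  have hA : 0 ≤ ∫ s, ‖h s‖ ∂μ := integral_nonneg fun s => norm_nonneg _
  have hC : 0 ≤ (∫ s, ‖h s‖ ∂μ) * D := by positivity
  have key : ∀ (c : C₀(G, ℂ)), Integrable (fun s => ‖c (σ.q s)‖ ^ 2) μ →
      ∀ (k : BimodFam σ (bimod₀ σ)) (ξ : k.H'),
      ‖k.rep.right.π c (∫ s, h s • (k.rep.right.U s : k.H' →L[ℂ] k.H') ξ ∂μ)‖ ≤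
        √((∫ s, ‖h s‖ ∂μ) * D * ∫ s, ‖c (σ.q s)‖ ^ 2 ∂μ) * ‖ξ‖ := fun c hc k ξ => by
    have h1 := sq_norm_rep_integral_le μ (σ := σ) (χ := MonoidHom.id Circle) k.rep.right h c hc hD ξ
    refine le_of_sq_le_sq ?_ (by positivity)
    have hI : 0 ≤ ∫ s, ‖c (σ.q s)‖ ^ 2 ∂μ := integral_nonneg fun _ => by positivity
    rw [mul_pow, Real.sq_sqrt (by positivity), mul_assoc (∫ s, ‖h s‖ ∂μ) D]
    exact h1
  refine ⟨_, hC, fun c hc => ?_, fun f hf => ?_⟩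
  · have hI : 0 ≤ ∫ s, ‖c (σ.q s)‖ ^ 2 ∂μ := integral_nonneg fun _ => by positivity
    refine (Real.le_sqrt (norm_nonneg _) (by positivity)).1
      (fam_norm_le_of_apply (Real.sqrt_nonneg _) fun k ξ => ?_)
    rw [Corner.integ_tens_apply]
    exact key c hc k ξ
  · have hI : 0 ≤ ∫ s, ‖f.fn s‖ ^ 2 ∂μ := integral_nonneg fun _ => by positivity
    have he : ∀ s, ‖f.abs (σ.q s)‖ = ‖f.fn s‖ := fun s => by simp
    refine (Real.le_sqrt (norm_nonneg _) (by positivity)).1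
      (fam_norm_le_of_apply (Real.sqrt_nonneg _) fun k ξ => ?_)
    rw [Corner.integ_tens_apply]
    have h1 := key f.abs (by simpa only [he] using hf) k ξ
    rw [← sq_norm_πX_apply] at h1
    simp only [he] at h1
    exact h1

lemma exists_tendsto_of_sq_le {P E : Type*} [NormedAddCommGroup E] [CompleteSpace E] {l : Filter P}
    [NeBot l] {x : P → E} {e : P → ℝ} {C : ℝ} (h : ∀ p p', ‖x p - x p'‖ ^ 2 ≤ C * (e p + e p'))
    (he : Tendsto e l (𝓝 0)) : ∃ y, Tendsto x l (𝓝 y) := by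
  refine cauchy_map_iff_exists_tendsto.1 (Metric.cauchy_iff.2 ⟨inferInstance, fun ε hε => ?_⟩)
  have h1 : Tendsto (fun p => C * e p) l (𝓝 0) := by simpa using he.const_mul C
  have hev := h1.eventually (gt_mem_nhds (show 0 < ε ^ 2 / 2 by positivity))
  refine ⟨_, image_mem_map hev, ?_⟩
  rintro _ ⟨p, hp, rfl⟩ _ ⟨p', hp', rfl⟩
  have hp1 : C * e p < ε ^ 2 / 2 := hp
  have hp2 : C * e p' < ε ^ 2 / 2 := hp'
  rw [dist_eq_norm]
  refine lt_of_pow_lt_pow_left₀ 2 hε.le ((h p p').trans_lt ?_)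
  linarith

lemma tendsto_of_sq_le {P E : Type*} [NormedAddCommGroup E] {l : Filter P}
    {x : P → E} {y : E} {e : P → ℝ} {C : ℝ} (h : ∀ p, ‖x p - y‖ ^ 2 ≤ C * e p)
    (he : Tendsto e l (𝓝 0)) : Tendsto x l (𝓝 y) := by
  rw [tendsto_iff_norm_sub_tendsto_zero]
  have h1 : Tendsto (fun p => C * e p) l (𝓝 0) := by simpa using he.const_mul C
  have h2 : Tendsto (fun p => ‖x p - y‖ ^ 2) l (𝓝 0) :=
    squeeze_zero (fun p => by positivity) h h1
  have h3 := h2.sqrt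
  simpa [Real.sqrt_sq (norm_nonneg _)] using h3

end Sphi


section SphiExists

variable {G Γ : Type u} [Group G] [TopologicalSpace G] [IsTopologicalGroup G]
  [LocallyCompactSpace G] [T2Space G] [Group Γ] [TopologicalSpace Γ] [IsTopologicalGroup Γ]
  [LocallyCompactSpace Γ] [T2Space Γ] [MeasurableSpace Γ] [BorelSpace Γ]
  (μ : Measure Γ) [IsHaarMeasure μ] [Regular μ] (σ : Twist G Γ)

section Corner

variable {Y Y₂ : Type*} [NormedAddCommGroup Y] [NormedSpace ℂ Y] {I : Type*} {H' H H₂ : I → Type*}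
  [∀ i, NormedAddCommGroup (H i)] [∀ i, InnerProductSpace ℂ (H i)] [∀ i, CompleteSpace (H i)]
  [∀ i, NormedAddCommGroup (H' i)] [∀ i, InnerProductSpace ℂ (H' i)]
  [∀ i, CompleteSpace (H' i)] [∀ i, NormedAddCommGroup (H₂ i)]
  [∀ i, InnerProductSpace ℂ (H₂ i)] [∀ i, CompleteSpace (H₂ i)] (c : Corner Γ Y H' H)

lemma Corner.integ_tens_sub (h : C_c(Γ, ℂ)) (y y' : Y) :
    c.integ μ (Corner.tens h (y - y')) =
      c.integ μ (Corner.tens h y) - c.integ μ (Corner.tens h y') := fam_ext fun i ξ => by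
  have : (c.integ μ (Corner.tens h y) - c.integ μ (Corner.tens h y')) i ξ =
    c.integ μ (Corner.tens h y) i ξ - c.integ μ (Corner.tens h y') i ξ := rfl
  rw [this, c.integ_tens_apply μ, c.integ_tens_apply μ, c.integ_tens_apply μ, map_sub]
  rfl

lemma Corner.exists_tendsto_of_dense {P : Type*} {l : Filter P} [NeBot l] {D : Set Y}
    (hD : Dense (Submodule.span ℂ D : Set Y)) {T : P → Fam H H₂} (hT : ∀ p, ‖T p‖ ≤ 1)
    (h : ∀ g, ∀ y ∈ D, ∃ w, Tendsto (fun p => fmul (T p) (c.integ μ (Corner.tens g y))) l (𝓝 w))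
    {z : Fam H' H} (hz : z ∈ c.cross μ) : ∃ w, Tendsto (fun p => fmul (T p) z) l (𝓝 w) := by
  let M : Submodule ℂ (Fam H' H) :=
    { carrier := {z | ∃ w, Tendsto (fun p => fmul (T p) z) l (𝓝 w)}
      zero_mem' := ⟨0, by simp⟩
      add_mem' := by
        rintro a b ⟨v, hv⟩ ⟨w, hw⟩
        exact ⟨v + w, by simpa using hv.add hw⟩
      smul_mem' := by
        rintro k a ⟨v, hv⟩
        exact ⟨k • v, by simpa using hv.const_smul k⟩ }
  exact c.cross_le_of_dense μ (M := M) hD (isClosed_exists_tendsto (fun p => fmul (T p))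
    fun p z => norm_fmul_le_of_le (hT p) z) h hz

lemma Corner.dense_of_rho (i : I) (h : Dense (Submodule.span ℂ {η | ∃ y ξ, η = c.ρ i y ξ} :
    Set (H i))) :
    Dense (Submodule.span ℂ {η | ∃ z ∈ (c.cross μ : Set (Fam H' H)), ∃ ξ, η = z i ξ} :
      Set (H i)) := by
  refine dense_of_le_closure h ?_
  rintro _ ⟨y, ξ, rfl⟩
  refine c.rho_mem μ i y ξ (M := (Submodule.span ℂ {η | ∃ z ∈ (c.cross μ : Set (Fam H' H)),
    ∃ ξ, η = z i ξ}).topologicalClosure) (Submodule.isClosed_topologicalClosure _) ?_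
  intro x hx
  exact Submodule.le_topologicalClosure _ (Submodule.subset_span ⟨x, hx, ξ, rfl⟩)

end Corner

lemma EqBimod.dense_πX {A B X : Type*} [NonUnitalCStarAlgebra A] [NonUnitalCStarAlgebra B]
    [NormedAddCommGroup X] [NormedSpace ℂ X] {σ : Twist G Γ} {O : BimodOps Γ A B X}
    (hO : EqBimod σ O) (k : BimodFam σ O) :
    Dense (Submodule.span ℂ {η | ∃ x ξ, η = k.rep.πX x ξ} : Set k.H) := by
  refine dense_of_le_closure k.rep.left.nondeg ?_
  rintro _ ⟨a, ξ, rfl⟩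
  let M : Submodule ℂ k.H := (Submodule.span ℂ {η | ∃ x ξ, η = k.rep.πX x ξ}).topologicalClosure
  have hc : Continuous fun a => k.rep.left.π a ξ :=
    (ContinuousLinearMap.apply ℂ k.H ξ).continuous.comp (repL k.rep.left.π).continuous
  change k.rep.left.π a ξ ∈ M
  refine hO.linner_dense.induction (P := fun a => k.rep.left.π a ξ ∈ M) ?_
    ((Submodule.isClosed_topologicalClosure _).preimage hc) a
  intro a ha
  induction ha using Submodule.span_induction with
  | zero => rw [map_zero]; exact zero_mem _
  | add x y _ _ hx hy => rw [map_add]; exact add_mem hx hy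
  | smul k x _ hx => rw [map_smul]; exact Submodule.smul_mem _ _ hx
  | mem a ha =>
    obtain ⟨x, y, rfl⟩ := ha
    rw [k.rep.map_linner]
    exact Submodule.le_topologicalClosure _ (Submodule.subset_span ⟨x, _, rfl⟩)

variable {ϕ : Γ → Circle}

lemma integral_sq_le_of_approx (hm : Measurable fun t => (ϕ t : ℂ)) {u : Γ → ℂ} (hu : Continuous u)
    {K : Set Γ} (hK : IsCompact K) (h0 : ∀ s ∉ K, u s = 0) {C : ℝ} {f g : C0bar σ}
    (h : ∀ s, ‖u s‖ ^ 2 ≤ C * (‖f.fn s - ϕ s‖ ^ 2 + ‖g.fn s - ϕ s‖ ^ 2)) :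
    Integrable (fun s => ‖u s‖ ^ 2) μ ∧ ∫ s, ‖u s‖ ^ 2 ∂μ ≤
      C * (∫ s in K, ‖f.fn s - ϕ s‖ ^ 2 ∂μ + ∫ s in K, ‖g.fn s - ϕ s‖ ^ 2 ∂μ) := by
  have hi : Integrable (fun s => ‖u s‖ ^ 2) μ :=
    (hu.norm.pow 2).integrable_of_hasCompactSupport (HasCompactSupport.intro hK fun s hs => by
      simp [h0 s hs])
  refine ⟨hi, ?_⟩
  have hf := integrableOn_sq_sub μ σ hm f hK
  have hg := integrableOn_sq_sub μ σ hm g hK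
  rw [← integral_add hf hg, ← integral_const_mul,
    ← setIntegral_eq_integral_of_forall_compl_eq_zero (s := K) fun s hs => by simp [h0 s hs]]
  exact setIntegral_mono hi.integrableOn ((hf.add hg).const_mul C) h

lemma norm_sq_sub_le (a b w : ℂ) : ‖a - b‖ ^ 2 ≤ 2 * (‖a - w‖ ^ 2 + ‖b - w‖ ^ 2) := by
  have h : ‖a - b‖ ≤ ‖a - w‖ + ‖b - w‖ := by
    rw [norm_sub_rev b w]; exact norm_sub_le_norm_sub_add_norm_sub a w b
  have h2 : ‖a - b‖ ^ 2 ≤ (‖a - w‖ + ‖b - w‖) ^ 2 := by gcongr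
  nlinarith [sq_nonneg (‖a - w‖ - ‖b - w‖)]

lemma norm_conj_mul_self_sub_one_le {a : ℂ} (ha : ‖a‖ ≤ 1) (w : Circle) :
    ‖conj a * a - 1‖ ^ 2 ≤ 2 * (‖a - w‖ ^ 2 + ‖a - w‖ ^ 2) := by
  have hw : ‖(w : ℂ)‖ = 1 := Circle.norm_coe w
  have h1 : conj (w : ℂ) * w = 1 := conj_mul_circle w
  have h2 : conj a * a - 1 = conj a * (a - w) + conj (a - w) * w := by
    rw [map_sub]; linear_combination h1
  have h3 : ‖conj a * a - 1‖ ≤ 2 * ‖a - w‖ := by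
    rw [h2]
    refine (norm_add_le _ _).trans ?_
    rw [norm_mul, norm_mul, RCLike.norm_conj, RCLike.norm_conj, hw]
    nlinarith [norm_nonneg (a - w)]
  calc ‖conj a * a - 1‖ ^ 2 ≤ (2 * ‖a - w‖) ^ 2 := by gcongr
    _ = _ := by ring

lemma ρF_mul_integ (f : C0bar σ) (h : C_c(Γ, ℂ)) (y : C₀(G, ℂ)) :
    fmul ((eqBimod₀ σ).cor.ρF f) ((EqBimod.corB σ (bimod₀ σ)).integ μ (Corner.tens h y)) =
      (eqBimod₀ σ).cor.integ μ (Corner.tens h (actC σ y.toBCF f)) := fam_ext fun k ξ => by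
  rw [fmul_apply, ContinuousLinearMap.comp_apply, Corner.integ_tens_apply, Corner.integ_tens_apply]
  exact (DFunLike.congr_fun (k.rep.map_ract f y) _).symm

lemma adj_ρF_mul_integ (f g : C0bar σ) (h : C_c(Γ, ℂ)) :
    fmul (fadj ((eqBimod₀ σ).cor.ρF f)) ((eqBimod₀ σ).cor.integ μ (Corner.tens h g)) =
      (EqBimod.corB σ (bimod₀ σ)).integ μ (Corner.tens h (rinner₀ σ f g)) := fam_ext fun k ξ => by
  rw [fmul_apply, ContinuousLinearMap.comp_apply, Corner.integ_tens_apply, Corner.integ_tens_apply]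
  exact (DFunLike.congr_fun (k.rep.map_rinner f g) _).symm

section Limits

variable {F : TopologicalSpace.Compacts Γ × ℕ → C0bar σ}

lemma Approximants.norm_le (hF : Approximants μ σ ϕ F) (p) : ‖F p‖ ≤ 1 :=
  c0_norm_le (f := (F p).fn) zero_le_one (hF.norm_apply_le p)

lemma Approximants.tendsto_add (hF : Approximants μ σ ϕ F) {K : Set Γ} (hK : IsCompact K) :
    Tendsto (fun p => ∫ s in K, ‖(F p).fn s - ϕ s‖ ^ 2 ∂μ + ∫ s in K, ‖(F p).fn s - ϕ s‖ ^ 2 ∂μ)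
      atTop (𝓝 0) := by
  simpa using (hF.tendsto K hK).add (hF.tendsto K hK)

lemma exists_tendsto_integ_act (hm : Measurable fun t => (ϕ t : ℂ))
    (hF : Approximants μ σ ϕ F) (h : C_c(Γ, ℂ)) {y : C₀(G, ℂ)} {K : Set Γ} (hK : IsCompact K)
    (h0 : ∀ s ∉ K, y (σ.q s) = 0) :
    ∃ w, Tendsto (fun p => (eqBimod₀ σ).cor.integ μ (Corner.tens h (actC σ y.toBCF (F p)))) atTop
      (𝓝 w) := by
  obtain ⟨C, hC, -, hC2⟩ := exists_sq_norm_integ_le μ σ h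
  refine exists_tendsto_of_sq_le (C := C * (2 * ‖y‖ ^ 2)) (fun p p' => ?_) (hF.tendsto K hK)
  rw [← Corner.integ_tens_sub]
  have hu : ∀ s, (actC σ y.toBCF (F p) - actC σ y.toBCF (F p')).fn s =
      y (σ.q s) * ((F p).fn s - (F p').fn s) := fun s => by
    rw [mul_sub]; rfl
  have h1 := integral_sq_le_of_approx μ σ hm (f := F p) (g := F p') (C := 2 * ‖y‖ ^ 2)
    (map_continuous (actC σ y.toBCF (F p) - actC σ y.toBCF (F p')).fn) hK
    (fun s hs => by rw [hu, h0 s hs, zero_mul]) (fun s => by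
      rw [hu, norm_mul, mul_pow, mul_comm 2, mul_assoc]
      have := c0_apply_le y (σ.q s)
      gcongr
      exact norm_sq_sub_le _ _ _)
  refine (hC2 _ h1.1).trans ?_
  rw [mul_assoc C]
  exact mul_le_mul_of_nonneg_left h1.2 hC

lemma exists_tendsto_integ_inner (hm : Measurable fun t => (ϕ t : ℂ))
    (hF : Approximants μ σ ϕ F) (h : C_c(Γ, ℂ)) {g : C0bar σ} {K : Set Γ} (hK : IsCompact K)
    (h0 : ∀ s ∉ K, g.fn s = 0) :
    ∃ w, Tendsto (fun p => (EqBimod.corB σ (bimod₀ σ)).integ μ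
      (Corner.tens h (rinner₀ σ (F p) g))) atTop (𝓝 w) := by
  obtain ⟨C, hC, hC1, -⟩ := exists_sq_norm_integ_le μ σ h
  refine exists_tendsto_of_sq_le (C := C * (2 * ‖g‖ ^ 2)) (fun p p' => ?_) (hF.tendsto K hK)
  rw [← Corner.integ_tens_sub]
  have hu : ∀ s, (rinner₀ σ (F p) g - rinner₀ σ (F p') g) (σ.q s) =
      g.fn s * conj ((F p).fn s - (F p').fn s) := fun s => by
    rw [ZeroAtInftyContinuousMap.sub_apply, rinner₀_q, rinner₀_q, map_sub]; ring
  have h1 := integral_sq_le_of_approx μ σ hm (f := F p) (g := F p') (C := 2 * ‖g‖ ^ 2)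
    ((map_continuous (rinner₀ σ (F p) g - rinner₀ σ (F p') g)).comp σ.q_cont) hK
    (fun s hs => by rw [Function.comp_apply, hu, h0 s hs, zero_mul]) (fun s => by
      rw [Function.comp_apply, hu, norm_mul, mul_pow, mul_comm 2, mul_assoc, RCLike.norm_conj]
      have := c0_apply_le g.fn s
      rw [← C0bar.norm_fn]
      gcongr
      exact norm_sq_sub_le _ _ _)
  refine (hC1 _ h1.1).trans ?_
  rw [mul_assoc C]
  exact mul_le_mul_of_nonneg_left h1.2 hC

lemma tendsto_integ_inner_act (hm : Measurable fun t => (ϕ t : ℂ))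
    (hF : Approximants μ σ ϕ F) (h : C_c(Γ, ℂ)) {y : C₀(G, ℂ)} {K : Set Γ} (hK : IsCompact K)
    (h0 : ∀ s ∉ K, y (σ.q s) = 0) :
    Tendsto (fun p => (EqBimod.corB σ (bimod₀ σ)).integ μ (Corner.tens h
      (rinner₀ σ (F p) (actC σ y.toBCF (F p))))) atTop
      (𝓝 ((EqBimod.corB σ (bimod₀ σ)).integ μ (Corner.tens h y))) := by
  obtain ⟨C, hC, hC1, -⟩ := exists_sq_norm_integ_le μ σ h
  refine tendsto_of_sq_le (C := C * (2 * ‖y‖ ^ 2)) (fun p => ?_) (hF.tendsto_add μ σ hK)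
  rw [← Corner.integ_tens_sub]
  have hu : ∀ s, (rinner₀ σ (F p) (actC σ y.toBCF (F p)) - y) (σ.q s) =
      y (σ.q s) * (conj ((F p).fn s) * (F p).fn s - 1) := fun s => by
    rw [ZeroAtInftyContinuousMap.sub_apply, rinner₀_q, actC_apply]
    change conj ((F p).fn s) * (y (σ.q s) * (F p).fn s) - y (σ.q s) = _
    ring
  have h1 := integral_sq_le_of_approx μ σ hm (f := F p) (g := F p) (C := 2 * ‖y‖ ^ 2)
    ((map_continuous (rinner₀ σ (F p) (actC σ y.toBCF (F p)) - y)).comp σ.q_cont) hK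
    (fun s hs => by rw [Function.comp_apply, hu, h0 s hs, zero_mul]) (fun s => by
      rw [Function.comp_apply, hu, norm_mul, mul_pow, mul_comm 2, mul_assoc]
      have := c0_apply_le y (σ.q s)
      gcongr
      exact norm_conj_mul_self_sub_one_le (hF.norm_apply_le p s) _)
  refine (hC1 _ h1.1).trans ?_
  rw [mul_assoc C]
  exact mul_le_mul_of_nonneg_left h1.2 hC

lemma tendsto_integ_act_inner (hm : Measurable fun t => (ϕ t : ℂ))
    (hF : Approximants μ σ ϕ F) (h : C_c(Γ, ℂ)) {g : C0bar σ} {K : Set Γ} (hK : IsCompact K)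
    (h0 : ∀ s ∉ K, g.fn s = 0) :
    Tendsto (fun p => (eqBimod₀ σ).cor.integ μ (Corner.tens h
      (actC σ (rinner₀ σ (F p) g).toBCF (F p)))) atTop
      (𝓝 ((eqBimod₀ σ).cor.integ μ (Corner.tens h g))) := by
  obtain ⟨C, hC, -, hC2⟩ := exists_sq_norm_integ_le μ σ h
  refine tendsto_of_sq_le (C := C * (2 * ‖g‖ ^ 2)) (fun p => ?_) (hF.tendsto_add μ σ hK)
  rw [← Corner.integ_tens_sub]
  have hu : ∀ s, (actC σ (rinner₀ σ (F p) g).toBCF (F p) - g).fn s =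
      g.fn s * (conj ((F p).fn s) * (F p).fn s - 1) := fun s => by
    change rinner₀ σ (F p) g (σ.q s) * (F p).fn s - g.fn s = _
    rw [rinner₀_q]
    ring
  have h1 := integral_sq_le_of_approx μ σ hm (f := F p) (g := F p) (C := 2 * ‖g‖ ^ 2)
    (map_continuous (actC σ (rinner₀ σ (F p) g).toBCF (F p) - g).fn) hK
    (fun s hs => by rw [hu, h0 s hs, zero_mul]) (fun s => by
      rw [hu, norm_mul, mul_pow, mul_comm 2, mul_assoc]
      have := c0_apply_le g.fn s
      rw [← C0bar.norm_fn]
      gcongr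
      exact norm_conj_mul_self_sub_one_le (hF.norm_apply_le p s) _)
  refine (hC2 _ h1.1).trans ?_
  rw [mul_assoc C]
  exact mul_le_mul_of_nonneg_left h1.2 hC

end Limits

end SphiExists


section SphiLimit

variable {G Γ : Type u} [Group G] [TopologicalSpace G] [IsTopologicalGroup G]
  [LocallyCompactSpace G] [T2Space G] [Group Γ] [TopologicalSpace Γ] [IsTopologicalGroup Γ]
  [LocallyCompactSpace Γ] [T2Space Γ] [MeasurableSpace Γ] [BorelSpace Γ]
  (μ : Measure Γ) [IsHaarMeasure μ] [Regular μ] (σ : Twist G Γ) {ϕ : Γ → Circle}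
  {F : TopologicalSpace.Compacts Γ × ℕ → C0bar σ}

lemma Approximants.norm_ρF_le (hF : Approximants μ σ ϕ F) (p) :
    ‖(eqBimod₀ σ).cor.ρF (F p)‖ ≤ 1 :=
  fam_norm_le zero_le_one fun k =>
    ((eqBimod₀ σ).norm_πX k.rep (F p)).trans (hF.norm_le μ σ p)

lemma Approximants.norm_adj_ρF_le (hF : Approximants μ σ ϕ F) (p) :
    ‖fadj ((eqBimod₀ σ).cor.ρF (F p))‖ ≤ 1 :=
  fam_norm_le zero_le_one fun k => by
    have h1 : ‖fadj ((eqBimod₀ σ).cor.ρF (F p)) k‖ = ‖k.rep.πX (F p)‖ := by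
      rw [fadj_apply]
      exact LinearIsometryEquiv.norm_map _ _
    rw [h1]
    exact ((eqBimod₀ σ).norm_πX k.rep (F p)).trans (hF.norm_le μ σ p)

lemma ρF_mul_mem (f : C0bar σ) {b : Fam (fun k : BimodFam σ (bimod₀ σ) => k.H') (fun k => k.H')}
    (hb : b ∈ (EqBimod.corB σ (bimod₀ σ)).cross μ) :
    fmul ((eqBimod₀ σ).cor.ρF f) b ∈ (eqBimod₀ σ).cor.cross μ := by
  refine (EqBimod.corB σ (bimod₀ σ)).cross_le_of_tens μ
    (M := ((eqBimod₀ σ).cor.cross μ).comap (fmul ((eqBimod₀ σ).cor.ρF f)).toLinearMap)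
    (((eqBimod₀ σ).cor.isClosed_cross μ).preimage (fmul ((eqBimod₀ σ).cor.ρF f)).continuous)
    (fun h y => ?_) hb
  change fmul ((eqBimod₀ σ).cor.ρF f) _ ∈ (eqBimod₀ σ).cor.cross μ
  rw [ρF_mul_integ]
  exact (eqBimod₀ σ).cor.integ_mem μ _

lemma adj_ρF_mul_mem (f : C0bar σ)
    {x : Fam (fun k : BimodFam σ (bimod₀ σ) => k.H') (fun k => k.H)}
    (hx : x ∈ (eqBimod₀ σ).cor.cross μ) :
    fmul (fadj ((eqBimod₀ σ).cor.ρF f)) x ∈ (EqBimod.corB σ (bimod₀ σ)).cross μ := by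
  refine (eqBimod₀ σ).cor.cross_le_of_tens μ
    (M := ((EqBimod.corB σ (bimod₀ σ)).cross μ).comap
      (fmul (fadj ((eqBimod₀ σ).cor.ρF f))).toLinearMap)
    (((EqBimod.corB σ (bimod₀ σ)).isClosed_cross μ).preimage
      (fmul (fadj ((eqBimod₀ σ).cor.ρF f))).continuous)
    (fun h y => ?_) hx
  change fmul (fadj ((eqBimod₀ σ).cor.ρF f)) _ ∈ (EqBimod.corB σ (bimod₀ σ)).cross μ
  rw [adj_ρF_mul_integ]
  exact (EqBimod.corB σ (bimod₀ σ)).integ_mem μ _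

/-- A family acting as the identity on a nondegenerate corner is the identity. -/
lemma Corner.apply_eq_of_fmul_eq {Y : Type*} [NormedAddCommGroup Y] [NormedSpace ℂ Y] {I : Type*}
    {H' H : I → Type*} [∀ i, NormedAddCommGroup (H i)] [∀ i, InnerProductSpace ℂ (H i)]
    [∀ i, CompleteSpace (H i)] [∀ i, NormedAddCommGroup (H' i)]
    [∀ i, InnerProductSpace ℂ (H' i)] [∀ i, CompleteSpace (H' i)] (c : Corner Γ Y H' H)
    {D : Set Y} (hD : Dense (Submodule.span ℂ D : Set Y)) {T : Fam H H}
    (h : ∀ g, ∀ y ∈ D, fmul T (c.integ μ (Corner.tens g y)) = c.integ μ (Corner.tens g y))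
    (i : I) (hi : Dense (Submodule.span ℂ {η | ∃ y ξ, η = c.ρ i y ξ} : Set (H i))) :
    T i = ContinuousLinearMap.id ℂ (H i) := by
  have h1 : ∀ z ∈ c.cross μ, fmul T z = z := by
    let M : Submodule ℂ (Fam H' H) := LinearMap.eqLocus (fmul T).toLinearMap LinearMap.id
    exact fun z hz => c.cross_le_of_dense μ (M := M) hD
      (isClosed_eq (fmul T).continuous continuous_id) h hz
  refine ContinuousLinearMap.ext_on (c.dense_of_rho μ i hi) ?_
  rintro _ ⟨z, hz, ξ, rfl⟩
  exact DFunLike.congr_fun (congrFun (congrArg Subtype.val (h1 z hz)) i) ξ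

lemma dense_corB_apply (k : BimodFam σ (bimod₀ σ)) :
    Dense (Submodule.span ℂ {η : k.H' | ∃ z ∈ ((EqBimod.corB σ (bimod₀ σ)).cross μ :
      Set (Fam (fun k : BimodFam σ (bimod₀ σ) => k.H') (fun k => k.H'))), ∃ ξ, η = z k ξ} :
      Set k.H') :=
  (EqBimod.corB σ (bimod₀ σ)).dense_of_rho μ k k.rep.right.nondeg

lemma dense_cor_apply (k : BimodFam σ (bimod₀ σ)) :
    Dense (Submodule.span ℂ {η : k.H | ∃ z ∈ ((eqBimod₀ σ).cor.cross μ :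
      Set (Fam (fun k : BimodFam σ (bimod₀ σ) => k.H') (fun k => k.H))), ∃ ξ, η = z k ξ} :
      Set k.H) :=
  (eqBimod₀ σ).cor.dense_of_rho μ k ((eqBimod₀ σ).dense_πX k)

lemma Approximants.exists_tendsto_mul (hm : Measurable fun t => (ϕ t : ℂ))
    (hF : Approximants μ σ ϕ F)
    {z : Fam (fun k : BimodFam σ (bimod₀ σ) => k.H') (fun k => k.H')}
    (hz : z ∈ (EqBimod.corB σ (bimod₀ σ)).cross μ) :
    ∃ w, Tendsto (fun p => fmul ((eqBimod₀ σ).cor.ρF (F p)) z) atTop (𝓝 w) :=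
  (EqBimod.corB σ (bimod₀ σ)).exists_tendsto_of_dense μ
    (dense_c0_compactSupport σ) (hF.norm_ρF_le μ σ) (fun h y hy => by
      obtain ⟨K, hK, h0⟩ := hy
      simp only [ρF_mul_integ]
      exact exists_tendsto_integ_act μ σ hm hF h hK h0) hz

lemma Approximants.exists_tendsto_adj_mul (hm : Measurable fun t => (ϕ t : ℂ))
    (hF : Approximants μ σ ϕ F)
    {z : Fam (fun k : BimodFam σ (bimod₀ σ) => k.H') (fun k => k.H)}
    (hz : z ∈ (eqBimod₀ σ).cor.cross μ) :
    ∃ w, Tendsto (fun p => fmul (fadj ((eqBimod₀ σ).cor.ρF (F p))) z) atTop (𝓝 w) :=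
  (eqBimod₀ σ).cor.exists_tendsto_of_dense μ
    (dense_c0bar_compactSupport σ) (hF.norm_adj_ρF_le μ σ) (fun h y hy => by
      obtain ⟨K, hK, h0⟩ := hy
      simp only [adj_ρF_mul_integ]
      exact exists_tendsto_integ_inner μ σ hm hF h hK h0) hz

lemma Approximants.exists_limit_mul (hm : Measurable fun t => (ϕ t : ℂ))
    (hF : Approximants μ σ ϕ F) :
    ∃ S : Fam (fun k : BimodFam σ (bimod₀ σ) => k.H') (fun k => k.H),
      (∀ z ∈ ((EqBimod.corB σ (bimod₀ σ)).cross μ :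
          Set (Fam (fun k : BimodFam σ (bimod₀ σ) => k.H') (fun k => k.H'))),
        Tendsto (fun p => fmul ((eqBimod₀ σ).cor.ρF (F p)) z) atTop (𝓝 (fmul S z))) ∧
      ∀ k ξ, Tendsto (fun p => (eqBimod₀ σ).cor.ρF (F p) k ξ) atTop (𝓝 (S k ξ)) :=
  exists_strong_limit (K := fun k : BimodFam σ (bimod₀ σ) => k.H')
    (H' := fun k : BimodFam σ (bimod₀ σ) => k.H') (H := fun k : BimodFam σ (bimod₀ σ) => k.H)
    (fun p => (eqBimod₀ σ).cor.ρF (F p)) (hF.norm_ρF_le μ σ)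
    ((EqBimod.corB σ (bimod₀ σ)).cross μ :
      Set (Fam (fun k : BimodFam σ (bimod₀ σ) => k.H') (fun k => k.H'))) (dense_corB_apply μ σ)
    (fun _ hz => hF.exists_tendsto_mul μ σ hm hz)

lemma Approximants.exists_limit_adj_mul (hm : Measurable fun t => (ϕ t : ℂ))
    (hF : Approximants μ σ ϕ F) :
    ∃ S : Fam (fun k : BimodFam σ (bimod₀ σ) => k.H) (fun k => k.H'),
      (∀ z ∈ ((eqBimod₀ σ).cor.cross μ :
          Set (Fam (fun k : BimodFam σ (bimod₀ σ) => k.H') (fun k => k.H))),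
        Tendsto (fun p => fmul (fadj ((eqBimod₀ σ).cor.ρF (F p))) z) atTop (𝓝 (fmul S z))) ∧
      ∀ k ξ, Tendsto (fun p => fadj ((eqBimod₀ σ).cor.ρF (F p)) k ξ) atTop (𝓝 (S k ξ)) :=
  exists_strong_limit (K := fun k : BimodFam σ (bimod₀ σ) => k.H')
    (H' := fun k : BimodFam σ (bimod₀ σ) => k.H) (H := fun k : BimodFam σ (bimod₀ σ) => k.H')
    (fun p => fadj ((eqBimod₀ σ).cor.ρF (F p))) (hF.norm_adj_ρF_le μ σ)
    ((eqBimod₀ σ).cor.cross μ :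
      Set (Fam (fun k : BimodFam σ (bimod₀ σ) => k.H') (fun k => k.H))) (dense_cor_apply μ σ)
    (fun _ hz => hF.exists_tendsto_adj_mul μ σ hm hz)

lemma Approximants.exists_limit (hm : Measurable fun t => (ϕ t : ℂ))
    (hF : Approximants μ σ ϕ F) :
    ∃ S : Fam (fun k : BimodFam σ (bimod₀ σ) => k.H') (fun k => k.H),
      (∀ z ∈ ((EqBimod.corB σ (bimod₀ σ)).cross μ :
          Set (Fam (fun k : BimodFam σ (bimod₀ σ) => k.H') (fun k => k.H'))),
        Tendsto (fun p => fmul ((eqBimod₀ σ).cor.ρF (F p)) z) atTop (𝓝 (fmul S z))) ∧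
      (∀ z ∈ ((eqBimod₀ σ).cor.cross μ :
          Set (Fam (fun k : BimodFam σ (bimod₀ σ) => k.H') (fun k => k.H))),
        Tendsto (fun p => fmul (fadj ((eqBimod₀ σ).cor.ρF (F p))) z) atTop
          (𝓝 (fmul (fadj S) z))) ∧
      ∀ k ξ, Tendsto (fun p => (eqBimod₀ σ).cor.ρF (F p) k ξ) atTop (𝓝 (S k ξ)) := by
  obtain ⟨S, hS1, hS2⟩ := hF.exists_limit_mul μ σ hm
  obtain ⟨S', hS1', hS2'⟩ := hF.exists_limit_adj_mul μ σ hm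
  have hSS : S' = fadj S :=
    fadj_eq_of_tendsto (H' := fun k : BimodFam σ (bimod₀ σ) => k.H')
      (H := fun k : BimodFam σ (bimod₀ σ) => k.H)
      (T := fun p => (eqBimod₀ σ).cor.ρF (F p)) hS2 hS2'
  rw [hSS] at hS1'
  exact ⟨S, hS1, hS1', hS2⟩

/-- The strong limit of the multiplication operators by approximants of `ϕ` is a unitary
multiplier. -/
theorem Approximants.exists_good (hm : Measurable fun t => (ϕ t : ℂ))
    (hF : Approximants μ σ ϕ F) :
    ∃ S, EqBimod.Good μ (eqBimod₀ σ) S ∧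
      ∀ k ξ, Tendsto (fun p => k.rep.πX (F p) ξ) atTop (𝓝 (S k ξ)) := by
  obtain ⟨S, hS1, hS1', hS2⟩ := hF.exists_limit μ σ hm
  have hmem : ∀ b ∈ (EqBimod.corB σ (bimod₀ σ)).cross μ, fmul S b ∈ (eqBimod₀ σ).cor.cross μ :=
    fun b hb => ((eqBimod₀ σ).cor.isClosed_cross μ).mem_of_tendsto (hS1 b hb)
      (.of_forall fun p => ρF_mul_mem μ σ _ hb)
  have hmem' : ∀ x ∈ (eqBimod₀ σ).cor.cross μ,
      fmul (fadj S) x ∈ (EqBimod.corB σ (bimod₀ σ)).cross μ :=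
    fun x hx => ((EqBimod.corB σ (bimod₀ σ)).isClosed_cross μ).mem_of_tendsto (hS1' x hx)
      (.of_forall fun p => adj_ρF_mul_mem μ σ _ hx)
  have h1 : ∀ g, ∀ y ∈ {c : C₀(G, ℂ) | ∃ K : Set Γ, IsCompact K ∧ ∀ s ∉ K, c (σ.q s) = 0},
      fmul (fmul (fadj S) S) ((EqBimod.corB σ (bimod₀ σ)).integ μ (Corner.tens g y)) =
        (EqBimod.corB σ (bimod₀ σ)).integ μ (Corner.tens g y) := by
    rintro h y ⟨K, hK, h0⟩
    have hb := (EqBimod.corB σ (bimod₀ σ)).integ_mem μ (Corner.tens h y)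
    have h1 := tendsto_fmul_fmul (hF.norm_adj_ρF_le μ σ) (hS1 _ hb) (hS1' _ (hmem _ hb))
    simp only [ρF_mul_integ, adj_ρF_mul_integ] at h1
    rw [fmul_assoc]
    exact tendsto_nhds_unique h1 (tendsto_integ_inner_act μ σ hm hF h hK h0)
  have h2 : ∀ g, ∀ y ∈ {f : C0bar σ | ∃ K : Set Γ, IsCompact K ∧ ∀ s ∉ K, f.fn s = 0},
      fmul (fmul S (fadj S)) ((eqBimod₀ σ).cor.integ μ (Corner.tens g y)) =
        (eqBimod₀ σ).cor.integ μ (Corner.tens g y) := by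
    rintro h y ⟨K, hK, h0⟩
    have hb := (eqBimod₀ σ).cor.integ_mem μ (Corner.tens h y)
    have h1 := tendsto_fmul_fmul (hF.norm_ρF_le μ σ) (hS1' _ hb) (hS1 _ (hmem' _ hb))
    simp only [ρF_mul_integ, adj_ρF_mul_integ] at h1
    rw [fmul_assoc]
    exact tendsto_nhds_unique h1 (tendsto_integ_act_inner μ σ hm hF h hK h0)
  exact ⟨S, ⟨fun k => ⟨(EqBimod.corB σ (bimod₀ σ)).apply_eq_of_fmul_eq μ
      (T := fmul (fadj S) S) (dense_c0_compactSupport σ) h1 k k.rep.right.nondeg,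
    (eqBimod₀ σ).cor.apply_eq_of_fmul_eq μ (T := fmul S (fadj S))
      (dense_c0bar_compactSupport σ) h2 k ((eqBimod₀ σ).dense_πX k)⟩, hmem, hmem'⟩, hS2⟩

lemma inner_ccLp_op_sub (hm : Measurable fun t => (ϕ t : ℂ))
    (hϕ : ∀ s z, ϕ (s * σ.ι z) = z⁻¹ * ϕ s) (f : C0bar σ) (h : C_c(Γ, ℂ)) {D : ℝ}
    (hD : ∀ s, ‖h s‖ ≤ D) (ξ : Lchi μ σ (MonoidHom.id Circle)) :
    ‖(inner ℂ (ccLp μ h) (Lchi.fn μ ((TwFn.ofC0bar f).op μ ξ)) : ℂ) -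
      inner ℂ (ccLp μ h) (Lchi.fn μ (Lphi μ ϕ hm hϕ ξ))‖ ≤
      D * √(∫ s in tsupport h, ‖f.fn s - ϕ s‖ ^ 2 ∂μ) * ‖ξ‖ := by
  have hD0 : 0 ≤ D := (norm_nonneg _).trans (hD 1)
  have hw : MemLp (fun s => conj (f.fn s - ϕ s) * h s) 2 μ := by
    have h1 := memLp_mul μ (h := fun s => conj (f.fn s - ϕ s))
      (Complex.continuous_conj.measurable.comp
        ((map_continuous f.fn).measurable.sub hm)) ⟨‖f‖ + 1, fun s => by
        rw [RCLike.norm_conj]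
        refine (norm_sub_le _ _).trans ?_
        rw [Circle.norm_coe]
        gcongr
        exact c0_apply_le f.fn s⟩ (ccLp μ h)
    refine h1.ae_eq ?_
    filter_upwards [ccLp_coe μ h] with s hs
    rw [hs]
  have h1 : (inner ℂ (ccLp μ h) (Lchi.fn μ ((TwFn.ofC0bar f).op μ ξ)) : ℂ) -
      inner ℂ (ccLp μ h) (Lchi.fn μ (Lphi μ ϕ hm hϕ ξ)) = inner ℂ hw.toLp (Lchi.fn μ ξ) := by
    rw [← inner_sub_right, inner_ccLp, L2.inner_def]
    refine integral_congr_ae ?_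
    filter_upwards [Lp.coeFn_sub (Lchi.fn μ ((TwFn.ofC0bar f).op μ ξ))
      (Lchi.fn μ (Lphi μ ϕ hm hϕ ξ)), (TwFn.ofC0bar f).op_coe μ ξ,
      (TwFn.ofBorel ϕ hm hϕ).op_coe μ ξ, hw.coeFn_toLp] with s e1 e2 e3 e4
    rw [e1, Pi.sub_apply, e2, e4, RCLike.inner_apply]
    change _ * (_ - Lchi.fn μ ((TwFn.ofBorel ϕ hm hϕ).op μ ξ) s) = _
    rw [e3]
    change conj (h s) * (f.fn s * Lchi.fn μ ξ s - ϕ s * Lchi.fn μ ξ s) = _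
    simp only [map_mul, Complex.conj_conj]
    ring
  have h2 : ‖hw.toLp‖ ≤ D * √(∫ s in tsupport h, ‖f.fn s - ϕ s‖ ^ 2 ∂μ) := by
    refine le_of_sq_le_sq ?_ (by positivity)
    have hK : IsCompact (tsupport h) := h.hasCompactSupport
    have hae : ∀ᵐ s ∂μ, ‖(hw.toLp : Lp ℂ 2 μ) s‖ ^ 2 = ‖conj (f.fn s - ϕ s) * h s‖ ^ 2 := by
      filter_upwards [hw.coeFn_toLp] with s hs
      rw [hs]
    rw [sq_norm_L2, mul_pow, Real.sq_sqrt (integral_nonneg fun _ => by positivity),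
      ← integral_const_mul, integral_congr_ae hae,
      ← setIntegral_eq_integral_of_forall_compl_eq_zero (s := tsupport h) fun s hs => by
        simp [image_eq_zero_of_notMem_tsupport (f := h) hs]]
    refine setIntegral_mono ?_ ((integrableOn_sq_sub μ σ hm f hK).const_mul _) fun s => ?_
    · exact ((memLp_two_iff_integrable_sq_norm hw.1).1 hw).integrableOn
    · beta_reduce
      rw [norm_mul, RCLike.norm_conj, mul_pow, mul_comm]
      gcongr
      exact hD s
  rw [h1]
  refine (norm_inner_le_norm _ _).trans ?_
  rw [LinearIsometry.norm_map]
  gcongr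

lemma Approximants.limit_regIdx (hm : Measurable fun t => (ϕ t : ℂ))
    (hϕ : ∀ s z, ϕ (s * σ.ι z) = z⁻¹ * ϕ s) (hF : Approximants μ σ ϕ F)
    {S : Fam (fun k : BimodFam σ (bimod₀ σ) => k.H') (fun k => k.H)}
    (hS : ∀ k ξ, Tendsto (fun p => k.rep.πX (F p) ξ) atTop (𝓝 (S k ξ))) :
    S (regIdx μ σ) = Lphi μ ϕ hm hϕ := by
  refine ContinuousLinearMap.ext fun (ξ : Lchi μ σ (MonoidHom.id Circle)) =>
    Lchi.ext μ (ext_inner_ccLp μ fun h => ?_)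
  obtain ⟨D, hD⟩ := h.continuous.bounded_above_of_compact_support h.hasCompactSupport
  have h1 : Tendsto (fun p => (inner ℂ (ccLp μ h)
      (Lchi.fn μ ((TwFn.ofC0bar (F p)).op μ ξ)) : ℂ)) atTop
      (𝓝 (inner ℂ (ccLp μ h) (Lchi.fn μ (S (regIdx μ σ) ξ)))) :=
    tendsto_const_nhds.inner (((Lchi.fn μ).continuous.tendsto _).comp (hS (regIdx μ σ) ξ))
  refine tendsto_nhds_unique h1 ?_
  rw [tendsto_iff_norm_sub_tendsto_zero]
  refine squeeze_zero (fun _ => norm_nonneg _)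
    (fun p => inner_ccLp_op_sub μ σ hm hϕ (F p) h hD ξ) ?_
  have h2 := ((hF.tendsto _ h.hasCompactSupport).sqrt.const_mul D).mul_const ‖ξ‖
  simpa using h2

end SphiLimit


/-! ### Faithfulness of the regular representation of `C₀(G) ⋊ G` -/

section Faithful

open scoped Pointwise

variable {G Γ : Type u} [Group G] [TopologicalSpace G] [IsTopologicalGroup G]
  [LocallyCompactSpace G] [T2Space G] [Group Γ] [TopologicalSpace Γ] [IsTopologicalGroup Γ]
  [LocallyCompactSpace Γ] [T2Space Γ] [MeasurableSpace Γ] [BorelSpace Γ]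
  (μ : Measure Γ) [IsHaarMeasure μ] [Regular μ] (σ : Twist G Γ)

lemma continuous_c0_eval : Continuous fun p : C₀(G, ℂ) × G => p.1 p.2 := by
  have h : Continuous fun p : C₀(G, ℂ) × G => rt p.2 p.1 :=
    continuous_rt.comp (continuous_snd.prodMk continuous_fst)
  have h2 := (c0Eval (1 : G)).continuous.comp h
  refine h2.congr fun p => ?_
  change rt p.2 p.1 1 = _
  rw [rt_apply, one_mul]

/-- The regular representation of `C₀(G) ⋊ G` as an index. -/
def regCov : CovFam σ (fun s => rt (σ.q s)) 1 := ⟨Lchi μ σ 1, regRep μ 1⟩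

lemma continuous_fam_apply {I : Type*} {H' H : I → Type*}
    [∀ i, NormedAddCommGroup (H i)] [∀ i, InnerProductSpace ℂ (H i)] [∀ i, CompleteSpace (H i)]
    [∀ i, NormedAddCommGroup (H' i)] [∀ i, InnerProductSpace ℂ (H' i)]
    [∀ i, CompleteSpace (H' i)] (i : I) : Continuous fun a : Fam H' H => a i :=
  (LipschitzWith.of_dist_le_mul (K := 1) fun a b => by
    rw [NNReal.coe_one, one_mul, dist_eq_norm, dist_eq_norm]
    exact fam_le (a - b) i).continuous

/-- The class in `L²(Γ)^𝕋` of a `𝕋`-invariant function in `C_c(Γ)`. -/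
def invLp (u : C_c(Γ, ℂ)) (hu : ∀ y z, u (y * σ.ι z) = u y) : Lchi μ σ 1 :=
  ⟨ccLp μ u, fun z => by
    rw [MonoidHom.one_apply, Circle.coe_one, one_smul]
    refine Lp.ext ((transl_coe μ _ _).trans ?_)
    filter_upwards [ccLp_coe μ u, (qmp_mul_right μ (σ.ι z)).ae (ccLp_coe μ u)] with s h1 h2
    rw [h1, h2, sqrtModular_ι, Complex.ofReal_one, one_mul, hu]⟩

lemma fn_invLp (u : C_c(Γ, ℂ)) (hu : ∀ y z, u (y * σ.ι z) = u y) :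
    Lchi.fn μ (invLp μ σ u hu) = ccLp μ u := rfl

lemma norm_fn_apply_invLp_le (T : Lchi μ σ 1 →L[ℂ] Lchi μ σ 1) (u : C_c(Γ, ℂ))
    (hu : ∀ y z, u (y * σ.ι z) = u y) :
    ‖Lchi.fn μ (T (invLp μ σ u hu))‖ ≤ ‖T‖ * ‖ccLp μ u‖ := by
  rw [LinearIsometry.norm_map]
  exact T.le_opNorm _

lemma fn_reg_apply (c : C₀(G, ℂ)) (t : Γ) (u : C_c(Γ, ℂ)) (hu : ∀ y z, u (y * σ.ι z) = u y) :
    Lchi.fn μ ((TwFn.ofC0 σ 1 c).op μ (rhoIso μ t (invLp μ σ u hu))) =ᵐ[μ]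
      fun v => c (σ.q v) * ((sqrtModular t : ℂ) * u (v * t)) := by
  filter_upwards [(TwFn.ofC0 σ 1 c).op_coe μ (rhoIso μ t (invLp μ σ u hu)),
    rhoIso_coe μ t (invLp μ σ u hu), (qmp_mul_right μ t).ae (ccLp_coe μ u)] with v h1 h2 h3
  rw [h1, h2, fn_invLp, h3]
  rfl

lemma fn_reg_integ (f : C_c(Γ, C₀(G, ℂ))) (u : C_c(Γ, ℂ)) (hu : ∀ y z, u (y * σ.ι z) = u y)
    (Φ : C_c(Γ, ℂ)) (hΦ : ∀ v, Φ v = ∫ t, f t (σ.q v) * ((sqrtModular t : ℂ) * u (v * t)) ∂μ) :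
    Lchi.fn μ ((covCor σ (fun s => rt (σ.q s)) 1).integ μ f (regCov μ σ)
      (invLp μ σ u hu)) = ccLp μ Φ := by
  refine ext_inner_ccLp μ fun k => ?_
  have hInt := (covCor σ (fun s => rt (σ.q s)) 1).integrable_integrand μ (regCov μ σ) f
    (invLp μ σ u hu)
  have h1 := ((innerSL ℂ (ccLp μ k)).comp
    (Lchi.fn μ (σ := σ) (χ := 1)).toContinuousLinearMap).integral_comp_comm hInt
  refine h1.symm.trans ?_
  have h2 : ∀ t, (innerSL ℂ (ccLp μ k)).comp (Lchi.fn μ (σ := σ) (χ := 1)).toContinuousLinearMap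
      ((TwFn.ofC0 σ 1 (f t)).op μ (rhoIso μ t (invLp μ σ u hu))) =
      ∫ v, conj (k v) * (f t (σ.q v) * ((sqrtModular t : ℂ) * u (v * t))) ∂μ := fun t => by
    change inner ℂ (ccLp μ k) (Lchi.fn μ _) = _
    rw [inner_ccLp]
    refine integral_congr_ae ?_
    filter_upwards [fn_reg_apply μ σ (f t) t u hu] with v hv
    rw [hv]
  refine (integral_congr_ae (.of_forall h2)).trans ?_
  rw [inner_ccLp, integral_integral_swap_of_hasCompactSupport
    (f := fun t v => conj (k v) * (f t (σ.q v) * ((sqrtModular t : ℂ) * u (v * t))))]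
  · refine integral_congr_ae ?_
    filter_upwards [ccLp_coe μ Φ] with v hv
    rw [hv, hΦ, integral_const_mul]
  · have e1 : Continuous fun p : Γ × Γ => f p.1 (σ.q p.2) :=
      continuous_c0_eval.comp ((f.continuous.comp continuous_fst).prodMk
        (σ.q_cont.comp continuous_snd))
    exact (Complex.continuous_conj.comp (k.continuous.comp continuous_snd)).mul
      (e1.mul ((Complex.continuous_ofReal.comp (continuous_sqrtModular.comp continuous_fst)).mul
        (u.continuous.comp (continuous_snd.mul continuous_fst))))
  · refine HasCompactSupport.intro (f.hasCompactSupport.isCompact.prod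
      k.hasCompactSupport.isCompact) ?_
    rintro ⟨t, v⟩ hs
    rw [Set.mem_prod, not_and_or] at hs
    rcases hs with hs | hs
    · have : f t = 0 := image_eq_zero_of_notMem_tsupport (f := f) hs
      simp [Function.uncurry, this]
    · have : k v = 0 := image_eq_zero_of_notMem_tsupport (f := k) hs
      simp [Function.uncurry, this]

section Rep

variable {χ : Circle →* Circle} {H : Type u} [NormedAddCommGroup H] [InnerProductSpace ℂ H]
  [CompleteSpace H]

lemma sq_norm_rep_transl (r : CovRep σ (fun s => rt (σ.q s)) χ H) (c : C₀(G, ℂ)) (s : Γ) (ξ : H) :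
    ((‖r.π c ((r.U s : H →L[ℂ] H) ξ)‖ ^ 2 : ℝ) : ℂ) =
      inner ℂ ξ (r.π (rt (σ.q s)⁻¹ (star c * c)) ξ) := by
  rw [sq_norm_rep_apply]
  have h3 : (r.U s : H →L[ℂ] H) (r.π (rt (σ.q s)⁻¹ (star c * c)) ξ) =
      r.π (star c * c) ((r.U s : H →L[ℂ] H) ξ) := by
    rw [r.covariant]
    congr 2
    ext t
    simp only [rt_apply]
    rw [mul_inv_cancel_right]
  rw [← h3]
  exact ContinuousLinearMap.inner_map_map_of_mem_unitary (r.U s).2 _ _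

lemma sq_norm_integ_apply_le (r : CovRep σ (fun s => rt (σ.q s)) χ H) (g : C_c(Γ, C₀(G, ℂ)))
    {K : Set Γ} (hK : IsCompact K) (hg : ∀ s ∉ K, g s = 0) {N : ℝ} (hN0 : 0 ≤ N)
    (hN : ∀ x, ∫ s, ‖g s (σ.q (x * s⁻¹))‖ ^ 2 ∂μ ≤ N) (ξ : H) :
    ‖∫ s, r.π (g s) ((r.U s : H →L[ℂ] H) ξ) ∂μ‖ ^ 2 ≤ μ.real K * N * ‖ξ‖ ^ 2 := by
  have hc : Continuous fun s => r.π (g s) ((r.U s : H →L[ℂ] H) ξ) :=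
    ((repL r.π).continuous.comp g.continuous).clm_apply (r.cont ξ)
  have h0 : ∀ s ∉ K, r.π (g s) ((r.U s : H →L[ℂ] H) ξ) = 0 := fun s hs => by
    rw [hg s hs, map_zero]; rfl
  have hfin : IsFiniteMeasure (μ.restrict K) := ⟨by
    rw [Measure.restrict_apply_univ]; exact hK.measure_lt_top⟩
  have hcs : HasCompactSupport fun s => r.π (g s) ((r.U s : H →L[ℂ] H) ξ) :=
    HasCompactSupport.intro hK h0
  have hi1 : Integrable (fun s => ‖r.π (g s) ((r.U s : H →L[ℂ] H) ξ)‖) μ :=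
    hc.norm.integrable_of_hasCompactSupport hcs.norm
  have hi2 : Integrable (fun s => ‖r.π (g s) ((r.U s : H →L[ℂ] H) ξ)‖ ^ 2) μ :=
    (hc.norm.pow 2).integrable_of_hasCompactSupport (HasCompactSupport.intro hK fun s hs => by
      change ‖r.π (g s) ((r.U s : H →L[ℂ] H) ξ)‖ ^ 2 = 0
      rw [h0 s hs]; simp)
  let P : C_c(Γ, C₀(G, ℂ)) := ⟨⟨fun s => rt (σ.q s)⁻¹ (star (g s) * g s),
    continuous_rt.comp (σ.q_cont.inv.prodMk (g.continuous.star.mul g.continuous))⟩,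
    HasCompactSupport.intro hK fun s hs => by
      ext t
      simp [hg s hs, rt_apply]⟩
  have hP : ‖∫ s, P s ∂μ‖ ≤ N := by
    refine c0_norm_le hN0 fun t => ?_
    obtain ⟨x, rfl⟩ := σ.q_surj t
    have h1 := (c0Eval (σ.q x)).integral_comp_comm (Corner.integrable_cc μ P)
    change ‖c0Eval (σ.q x) (∫ s, P s ∂μ)‖ ≤ N
    rw [← h1]
    refine (norm_integral_le_integral_norm _).trans (le_trans (le_of_eq ?_) (hN x))
    refine integral_congr_ae (.of_forall fun s => ?_)
    change ‖rt (σ.q s)⁻¹ (star (g s) * g s) (σ.q x)‖ = _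
    rw [rt_apply, ← map_inv, ← map_mul]
    change ‖conj (g s (σ.q (x * s⁻¹))) * g s (σ.q (x * s⁻¹))‖ = _
    rw [norm_mul, RCLike.norm_conj, ← sq]
  have hQ : ∫ s, ‖r.π (g s) ((r.U s : H →L[ℂ] H) ξ)‖ ^ 2 ∂μ ≤ N * ‖ξ‖ ^ 2 := by
    have h2 := (((innerSL ℂ ξ).comp ((ContinuousLinearMap.apply ℂ H ξ).comp
        (repL r.π)))).integral_comp_comm (Corner.integrable_cc μ P)
    have h1 : ((∫ s, ‖r.π (g s) ((r.U s : H →L[ℂ] H) ξ)‖ ^ 2 ∂μ : ℝ) : ℂ) =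
        inner ℂ ξ (repL r.π (∫ s, P s ∂μ) ξ) := by
      refine Eq.trans ?_ h2
      rw [← integral_complex_ofReal]
      refine integral_congr_ae (.of_forall fun s => ?_)
      exact sq_norm_rep_transl σ r (g s) s ξ
    have h5 : ‖inner ℂ ξ (repL r.π (∫ s, P s ∂μ) ξ)‖ ≤ N * ‖ξ‖ ^ 2 := by
      calc _ ≤ ‖ξ‖ * (‖repL r.π (∫ s, P s ∂μ)‖ * ‖ξ‖) :=
            (norm_inner_le_norm _ _).trans (by gcongr; exact ContinuousLinearMap.le_opNorm _ _)
        _ ≤ ‖ξ‖ * (N * ‖ξ‖) := by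
            gcongr
            exact (NonUnitalStarAlgHom.norm_apply_le r.π _).trans hP
        _ = _ := by ring
    rw [← h1, Complex.norm_real] at h5
    exact (le_abs_self _).trans h5
  have hCS := sq_integral_mul_le (ν := μ.restrict K) (a := fun _ => 1)
    (N := fun s => ‖r.π (g s) ((r.U s : H →L[ℂ] H) ξ)‖) (fun _ => zero_le_one)
    (integrable_const 1) (by simpa using hi1.restrict) (by simpa using hi2.restrict)
  simp only [one_mul, integral_const, smul_eq_mul, mul_one, measureReal_restrict_apply_univ] at hCS
  rw [setIntegral_eq_integral_of_forall_compl_eq_zero (fun s hs => by rw [h0 s hs, norm_zero]),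
    setIntegral_eq_integral_of_forall_compl_eq_zero (fun s hs => by rw [h0 s hs]; simp)] at hCS
  calc _ ≤ (∫ s, ‖r.π (g s) ((r.U s : H →L[ℂ] H) ξ)‖ ∂μ) ^ 2 := by
        gcongr; exact norm_integral_le_integral_norm _
    _ ≤ _ := hCS
    _ ≤ _ := by
      rw [mul_assoc]
      gcongr

end Rep

section Conv

variable (f : C_c(Γ, C₀(G, ℂ))) (c : C₀(G, ℂ)) (h : C_c(Γ, ℂ))

/-- The kernel of the product of the integrated form of `f` and `π(c) U(h)`. -/
def convKer (s : Γ) : C₀(G, ℂ) := ∫ t, h (t⁻¹ * s) • (f t * rt (σ.q t) c) ∂μ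

lemma continuous_convIntegrand :
    Continuous fun p : Γ × Γ => h (p.2⁻¹ * p.1) • (f p.2 * rt (σ.q p.2) c) := by
  have h1 : Continuous fun p : Γ × Γ => rt (σ.q p.2) c :=
    continuous_rt.comp ((σ.q_cont.comp continuous_snd).prodMk continuous_const)
  exact (h.continuous.comp (continuous_snd.inv.mul continuous_fst)).smul
    ((f.continuous.comp continuous_snd).mul h1)

lemma integrable_convIntegrand (s : Γ) :
    Integrable (fun t => h (t⁻¹ * s) • (f t * rt (σ.q t) c)) μ :=
  ((continuous_convIntegrand σ f c h).comp
    (continuous_const.prodMk continuous_id : Continuous fun t : Γ => (s, t))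
    ).integrable_of_hasCompactSupport (HasCompactSupport.intro f.hasCompactSupport.isCompact
      fun t ht => by
        have : f t = 0 := image_eq_zero_of_notMem_tsupport (f := f) ht
        simp [this])

lemma continuous_convKer : Continuous (convKer μ σ f c h) := by
  rw [← continuousOn_univ]
  refine continuousOn_integral_of_compact_support f.hasCompactSupport.isCompact
    (f := fun s t => h (t⁻¹ * s) • (f t * rt (σ.q t) c))
    (continuous_convIntegrand σ f c h).continuousOn fun s t _ ht => ?_
  have : f t = 0 := image_eq_zero_of_notMem_tsupport (f := f) ht
  simp [this]

lemma convKer_apply (s v : Γ) : convKer μ σ f c h s (σ.q v) =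
    ∫ t, h (t⁻¹ * s) * (f t (σ.q v) * c (σ.q (v * t))) ∂μ := by
  have h1 := (c0Eval (σ.q v)).integral_comp_comm (integrable_convIntegrand μ σ f c h s)
  refine h1.symm.trans (integral_congr_ae (.of_forall fun t => ?_))
  change h (t⁻¹ * s) * (f t (σ.q v) * rt (σ.q t) c (σ.q v)) = _
  rw [rt_apply, ← map_mul]

variable {Kf Kc : Set Γ} {f} {c}

lemma convKer_apply_eq_zero_of_notMem (hf : ∀ t, ∀ v ∉ Kf, f t (σ.q v) = 0) (s : Γ) {v : Γ}
    (hv : v ∉ Kf) : convKer μ σ f c h s (σ.q v) = 0 := by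
  rw [convKer_apply]
  simp [hf _ v hv]

lemma convKer_eq_zero (hf : ∀ t, ∀ v ∉ Kf, f t (σ.q v) = 0) (hc : ∀ v ∉ Kc, c (σ.q v) = 0) {s : Γ}
    (hs : s ∉ Kf⁻¹ * Kc * tsupport h) : convKer μ σ f c h s = 0 := c0_ext_q σ fun v => by
  by_cases hv : v ∈ Kf
  · rw [convKer_apply]
    refine (integral_congr_ae (g := fun _ => (0 : ℂ)) (.of_forall fun t => ?_)).trans (by simp)
    beta_reduce
    by_cases hvt : v * t ∈ Kc
    · have : h (t⁻¹ * s) = 0 := image_eq_zero_of_notMem_tsupport (f := h) fun ht =>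
        hs ⟨v⁻¹ * (v * t), ⟨v⁻¹, by simpa using hv, v * t, hvt, rfl⟩, t⁻¹ * s, ht, by simp⟩
      rw [this, zero_mul]
    · rw [hc _ hvt]; simp
  · exact convKer_apply_eq_zero_of_notMem μ σ h hf s hv

lemma integ_apply_rep_integral {χ : Circle →* Circle} {H : Type u} [NormedAddCommGroup H]
    [InnerProductSpace ℂ H] [CompleteSpace H] (r : CovRep σ (fun s => rt (σ.q s)) χ H) (ξ : H) :
    ∫ t, r.π (f t) ((r.U t : H →L[ℂ] H)
      (r.π c (∫ s, h s • (r.U s : H →L[ℂ] H) ξ ∂μ))) ∂μ =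
      ∫ s, r.π (convKer μ σ f c h s) ((r.U s : H →L[ℂ] H) ξ) ∂μ := by
  have hU := r.cont ξ
  have hInt : Integrable (fun s => h s • (r.U s : H →L[ℂ] H) ξ) μ :=
    (h.continuous.smul hU).integrable_of_hasCompactSupport h.hasCompactSupport.smul_right
  have h1 : ∀ t, r.π (f t) ((r.U t : H →L[ℂ] H)
      (r.π c (∫ s, h s • (r.U s : H →L[ℂ] H) ξ ∂μ))) =
      ∫ s, r.π (h (t⁻¹ * s) • (f t * rt (σ.q t) c)) ((r.U s : H →L[ℂ] H) ξ) ∂μ := fun t => by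
    rw [r.covariant, ← ContinuousLinearMap.integral_comp_comm _ hInt,
      ← ContinuousLinearMap.integral_comp_comm _ (ContinuousLinearMap.integrable_comp _ hInt),
      ← ContinuousLinearMap.integral_comp_comm _ (ContinuousLinearMap.integrable_comp _
        (ContinuousLinearMap.integrable_comp _ hInt)),
      ← integral_mul_left_eq_self (fun s => r.π (h (t⁻¹ * s) • (f t * rt (σ.q t) c))
        ((r.U s : H →L[ℂ] H) ξ)) t]
    refine integral_congr_ae (.of_forall fun s => ?_)
    beta_reduce
    rw [inv_mul_cancel_left, map_smul, map_smul, map_smul, map_smul, _root_.map_mul,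
      _root_.map_mul]
    rfl
  simp only [h1]
  rw [integral_integral_swap_of_hasCompactSupport
    (f := fun t s => r.π (h (t⁻¹ * s) • (f t * rt (σ.q t) c)) ((r.U s : H →L[ℂ] H) ξ))]
  · refine integral_congr_ae (.of_forall fun s => ?_)
    exact ((ContinuousLinearMap.apply ℂ H ((r.U s : H →L[ℂ] H) ξ)).comp
      (repL r.π)).integral_comp_comm (integrable_convIntegrand μ σ f c h s)
  · exact ((repL r.π).continuous.comp ((continuous_convIntegrand σ f c h).comp
      continuous_swap)).clm_apply (hU.comp continuous_snd)
  · refine HasCompactSupport.intro (f.hasCompactSupport.isCompact.prod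
      (f.hasCompactSupport.isCompact.mul h.hasCompactSupport.isCompact)) ?_
    rintro ⟨t, s⟩ hs
    change r.π (h (t⁻¹ * s) • (f t * rt (σ.q t) c)) ((r.U s : H →L[ℂ] H) ξ) = 0
    by_cases ht : t ∈ tsupport f
    · have : h (t⁻¹ * s) = 0 := image_eq_zero_of_notMem_tsupport (f := h) fun hts =>
        hs ⟨ht, t, ht, t⁻¹ * s, hts, by simp⟩
      rw [this, zero_smul, map_zero]; rfl
    · have : f t = 0 := image_eq_zero_of_notMem_tsupport (f := f) ht
      rw [this, zero_mul, smul_zero, map_zero]; rfl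

lemma sqrtModular_sq (s : Γ) : sqrtModular s ^ 2 = (modularCharacterFun s : ℝ)⁻¹ := by
  rw [sqrtModular, inv_pow, Real.sq_sqrt (modular_pos s).le]

lemma sq_norm_ccLp (u : C_c(Γ, ℂ)) : ‖ccLp μ u‖ ^ 2 = ∫ s, ‖u s‖ ^ 2 ∂μ := by
  rw [sq_norm_L2]
  refine integral_congr_ae ?_
  filter_upwards [ccLp_coe μ u] with s hs
  rw [hs]

lemma integral_sq_convKer_le (hKf : IsCompact Kf) (hKc : IsCompact Kc)
    (hf : ∀ t, ∀ v ∉ Kf, f t (σ.q v) = 0) (hc : ∀ v ∉ Kc, c (σ.q v) = 0)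
    (hh : ∀ s z, h (s * σ.ι z) = h s) {D : ℝ} (hD : ∀ s, ‖h s * sqrtModular s‖ ≤ D) (x : Γ) :
    ∫ s, ‖convKer μ σ f c h s (σ.q (x * s⁻¹))‖ ^ 2 ∂μ ≤
      ‖(covCor σ (fun s => rt (σ.q s)) 1).integ μ f (regCov μ σ)‖ ^ 2 *
        (D ^ 2 * ∫ s, ‖c (σ.q s)‖ ^ 2 ∂μ) := by
  have hδ := continuous_sqrtModular (Γ := Γ)
  have hK : IsCompact (Kf⁻¹ * Kc * tsupport h) :=
    (hKf.inv.mul hKc).mul h.hasCompactSupport.isCompact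
  have hgc := continuous_convKer μ σ f c h
  let u : C_c(Γ, ℂ) := ⟨⟨fun y => c (σ.q y) * (h (y⁻¹ * x) * sqrtModular (y⁻¹ * x)),
    ((map_continuous c).comp σ.q_cont).mul ((h.continuous.comp (by fun_prop)).mul
      (Complex.continuous_ofReal.comp (hδ.comp (by fun_prop))))⟩,
    HasCompactSupport.intro hKc fun y hy => by simp [hc y hy]⟩
  have hu : ∀ y z, u (y * σ.ι z) = u y := fun y z => by
    change c (σ.q (y * σ.ι z)) * (h ((y * σ.ι z)⁻¹ * x) * sqrtModular ((y * σ.ι z)⁻¹ * x)) =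
      c (σ.q y) * (h (y⁻¹ * x) * sqrtModular (y⁻¹ * x))
    have e : (y * σ.ι z)⁻¹ * x = y⁻¹ * x * σ.ι z⁻¹ := by
      rw [mul_inv_rev, ← map_inv, mul_assoc, σ.central]
    rw [e, hh, sqrtModular_mul, sqrtModular_ι, mul_one, map_mul, σ.q_ι, mul_one]
  let Φ : C_c(Γ, ℂ) := ⟨⟨fun v => sqrtModular (v⁻¹ * x) * convKer μ σ f c h (v⁻¹ * x) (σ.q v),
    (Complex.continuous_ofReal.comp (hδ.comp (by fun_prop))).mul
      (continuous_c0_eval.comp ((hgc.comp (by fun_prop)).prodMk σ.q_cont))⟩,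
    HasCompactSupport.intro hKf fun v hv => by
      simp [convKer_apply_eq_zero_of_notMem μ σ h hf _ hv]⟩
  have hΦ : ∀ v, Φ v = ∫ t, f t (σ.q v) * ((sqrtModular t : ℂ) * u (v * t)) ∂μ := fun v => by
    change sqrtModular (v⁻¹ * x) * convKer μ σ f c h (v⁻¹ * x) (σ.q v) = _
    rw [convKer_apply, ← integral_const_mul]
    refine integral_congr_ae (.of_forall fun t => ?_)
    change _ = f t (σ.q v) * ((sqrtModular t : ℂ) *
      (c (σ.q (v * t)) * (h ((v * t)⁻¹ * x) * sqrtModular ((v * t)⁻¹ * x))))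
    have e1 : (v * t)⁻¹ * x = t⁻¹ * (v⁻¹ * x) := by group
    have e2 : sqrtModular (v⁻¹ * x) = sqrtModular t * sqrtModular ((v * t)⁻¹ * x) := by
      rw [e1, ← sqrtModular_mul, mul_inv_cancel_left]
    beta_reduce
    rw [e2, e1]
    push_cast
    ring
  have h1 := fn_reg_integ μ σ f u hu Φ hΦ
  have h2 : ‖ccLp μ Φ‖ ≤
      ‖(covCor σ (fun s => rt (σ.q s)) 1).integ μ f (regCov μ σ)‖ * ‖ccLp μ u‖ := by
    rw [← h1]
    exact norm_fn_apply_invLp_le μ σ _ u hu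
  have h3 : ‖ccLp μ u‖ ^ 2 ≤ D ^ 2 * ∫ s, ‖c (σ.q s)‖ ^ 2 ∂μ := by
    rw [sq_norm_ccLp, ← integral_const_mul]
    have hq : Integrable (fun s => ‖c (σ.q s)‖ ^ 2) μ :=
      (((map_continuous c).comp σ.q_cont).norm.pow 2).integrable_of_hasCompactSupport
        (HasCompactSupport.intro hKc fun s hs => by
          change ‖c (σ.q s)‖ ^ 2 = 0
          simp [hc s hs])
    have hui : Integrable (fun s => ‖u s‖ ^ 2) μ :=
      (u.continuous.norm.pow 2).integrable_of_hasCompactSupport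
        (HasCompactSupport.intro hKc fun s hs => by
          change ‖c (σ.q s) * (h (s⁻¹ * x) * sqrtModular (s⁻¹ * x))‖ ^ 2 = 0
          simp [hc s hs])
    refine integral_mono hui (hq.const_mul _) fun s => ?_
    change ‖c (σ.q s) * (h (s⁻¹ * x) * sqrtModular (s⁻¹ * x))‖ ^ 2 ≤ _
    rw [norm_mul, mul_pow, mul_comm]
    gcongr
    exact hD _
  have h4 : ∫ s, ‖convKer μ σ f c h s (σ.q (x * s⁻¹))‖ ^ 2 ∂μ = ‖ccLp μ Φ‖ ^ 2 := by
    let F : Γ → ℝ := fun s => ‖convKer μ σ f c h s (σ.q (x * s⁻¹))‖ ^ 2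
    have hF : Continuous F := by
      have e : Continuous fun s => σ.q (x * s⁻¹) := σ.q_cont.comp (by fun_prop)
      exact (continuous_c0_eval.comp (hgc.prodMk e)).norm.pow 2
    have hFK : HasCompactSupport F := HasCompactSupport.intro hK fun s hs => by
      simp [F, convKer_eq_zero μ σ h hf hc hs]
    have e1 := integral_inv_modular_real μ (f := fun v => F (v * x)) (hF.comp (by fun_prop))
      (hFK.comp_homeomorph (Homeomorph.mulRight x))
    rw [integral_mul_right_modular, smul_eq_mul] at e1
    have e2 : ∀ v, ‖Φ v‖ ^ 2 = (modularCharacterFun x : ℝ)⁻¹ *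
        (F (v⁻¹ * x) * (modularCharacterFun v : ℝ)) := fun v => by
      change ‖(sqrtModular (v⁻¹ * x) : ℂ) * convKer μ σ f c h (v⁻¹ * x) (σ.q v)‖ ^ 2 =
        _ * (‖convKer μ σ f c h (v⁻¹ * x) (σ.q (x * (v⁻¹ * x)⁻¹))‖ ^ 2 * _)
      have : x * (v⁻¹ * x)⁻¹ = v := by group
      rw [this, norm_mul, mul_pow, Complex.norm_real, Real.norm_of_nonneg (sqrtModular_pos _).le,
        sqrtModular_sq, modularCharacterFun_map_mul, NNReal.coe_mul, modular_inv, mul_inv, inv_inv]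
      ring
    rw [sq_norm_ccLp]
    simp only [e2]
    rw [integral_const_mul, e1, inv_mul_cancel_left₀ (modular_pos x).ne']
  rw [h4]
  calc _ ≤ (‖(covCor σ (fun s => rt (σ.q s)) 1).integ μ f (regCov μ σ)‖ *
        ‖ccLp μ u‖) ^ 2 := by gcongr
    _ ≤ _ := by
      rw [mul_pow]
      gcongr

end Conv

lemma avg_one_mul (hχ : Continuous (1 : Circle →* Circle)) (h : C_c(Γ, ℂ)) (s : Γ) (z : Circle) :
    avg σ 1 hχ h (s * σ.ι z) = avg σ 1 hχ h s := by
  rw [avg_mul]; simp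

/-- Multiplication by a fixed function. -/
def mulCc (d : C₀(G, ℂ)) (f : C_c(Γ, C₀(G, ℂ))) : C_c(Γ, C₀(G, ℂ)) :=
  ⟨⟨fun t => d * f t, continuous_const.mul f.continuous⟩,
    f.hasCompactSupport.mono fun t ht h => ht (by simp [h])⟩

lemma integ_mulCc (d : C₀(G, ℂ)) (f : C_c(Γ, C₀(G, ℂ)))
    (i : CovFam σ (fun s => rt (σ.q s)) 1) (ξ : i.H) :
    (covCor σ (fun s => rt (σ.q s)) 1).integ μ (mulCc d f) i ξ =
      i.rep.π d ((covCor σ (fun s => rt (σ.q s)) 1).integ μ f i ξ) := by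
  have h := (i.rep.π d).integral_comp_comm
    ((covCor σ (fun s => rt (σ.q s)) 1).integrable_integrand μ i f ξ)
  refine Eq.trans ?_ h
  refine integral_congr_ae (.of_forall fun t => ?_)
  change i.rep.π (d * f t) _ = i.rep.π d (i.rep.π (f t) _)
  rw [map_mul]
  rfl

lemma exists_sq_norm_mul_le {d c : C₀(G, ℂ)} {Kd Kc : Set Γ} (hKd : IsCompact Kd)
    (hKc : IsCompact Kc) (hd : ∀ v ∉ Kd, d (σ.q v) = 0) (hc : ∀ v ∉ Kc, c (σ.q v) = 0)
    {h : C_c(Γ, ℂ)} (hh : ∀ s z, h (s * σ.ι z) = h s) :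
    ∃ C : ℝ, ∀ a ∈ (covCor σ (fun s => rt (σ.q s)) 1).cross μ,
      ∀ (i : CovFam σ (fun s => rt (σ.q s)) 1) (ξ : i.H),
      ‖i.rep.π d (a i (i.rep.π c (∫ s, h s • (i.rep.U s : i.H →L[ℂ] i.H) ξ ∂μ)))‖ ^ 2 ≤
        C * ‖a (regCov μ σ)‖ ^ 2 * ‖ξ‖ ^ 2 := by
  obtain ⟨D, hD⟩ := ((h.continuous.mul (Complex.continuous_ofReal.comp
    (continuous_sqrtModular (Γ := Γ)))).bounded_above_of_compact_support
      h.hasCompactSupport.mul_right)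
  have hK : IsCompact (Kd⁻¹ * Kc * tsupport h) :=
    (hKd.inv.mul hKc).mul h.hasCompactSupport.isCompact
  refine ⟨μ.real (Kd⁻¹ * Kc * tsupport h) * (‖d‖ ^ 2 * (D ^ 2 * ∫ s, ‖c (σ.q s)‖ ^ 2 ∂μ)),
    fun a ha i ξ => ?_⟩
  have hI : 0 ≤ ∫ s, ‖c (σ.q s)‖ ^ 2 ∂μ := integral_nonneg fun _ => by positivity
  set v := i.rep.π c (∫ s, h s • (i.rep.U s : i.H →L[ℂ] i.H) ξ ∂μ) with hv
  refine closure_minimal (s := ((LinearMap.range ((covCor σ (fun s => rt (σ.q s)) 1).integ μ) :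
    Submodule ℂ _) : Set (Fam (fun i : CovFam σ (fun s => rt (σ.q s)) 1 => i.H) (fun i => i.H))))
    (t := {a | ‖i.rep.π d (a i v)‖ ^ 2 ≤
      μ.real (Kd⁻¹ * Kc * tsupport h) * (‖d‖ ^ 2 * (D ^ 2 * ∫ s, ‖c (σ.q s)‖ ^ 2 ∂μ)) *
        ‖a (regCov μ σ)‖ ^ 2 * ‖ξ‖ ^ 2}) ?_ ?_ ha
  · rintro _ ⟨f, rfl⟩
    change ‖i.rep.π d ((covCor σ (fun s => rt (σ.q s)) 1).integ μ f i v)‖ ^ 2 ≤ _ * _ ^ 2 * _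
    rw [← integ_mulCc]
    have hf : ∀ t, ∀ v ∉ Kd, mulCc d f t (σ.q v) = 0 := fun t v hv => by
      change d (σ.q v) * f t (σ.q v) = 0
      rw [hd v hv, zero_mul]
    let g : C_c(Γ, C₀(G, ℂ)) := ⟨⟨convKer μ σ (mulCc d f) c h, continuous_convKer μ σ _ c h⟩,
      HasCompactSupport.intro hK fun s hs => convKer_eq_zero μ σ h hf hc hs⟩
    have e1 : (covCor σ (fun s => rt (σ.q s)) 1).integ μ (mulCc d f) i v =
        ∫ s, i.rep.π (g s) ((i.rep.U s : i.H →L[ℂ] i.H) ξ) ∂μ :=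
      integ_apply_rep_integral μ σ h i.rep ξ
    have e2 : ‖(covCor σ (fun s => rt (σ.q s)) 1).integ μ (mulCc d f) (regCov μ σ)‖ ≤
        ‖d‖ * ‖(covCor σ (fun s => rt (σ.q s)) 1).integ μ f (regCov μ σ)‖ := by
      refine ContinuousLinearMap.opNorm_le_bound _ (by positivity) fun ζ => ?_
      rw [integ_mulCc, mul_assoc]
      refine (ContinuousLinearMap.le_opNorm _ _).trans ?_
      gcongr
      · exact NonUnitalStarAlgHom.norm_apply_le _ d
      · exact ContinuousLinearMap.le_opNorm _ _
    have e3 := sq_norm_integ_apply_le μ σ i.rep g hK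
      (fun s hs => convKer_eq_zero μ σ h hf hc hs) (by positivity)
      (integral_sq_convKer_le μ σ h hKd hKc hf hc hh hD) ξ
    rw [e1]
    refine e3.trans ?_
    have e4 := pow_le_pow_left₀ (norm_nonneg _) e2 2
    rw [mul_pow] at e4
    calc _ ≤ μ.real (Kd⁻¹ * Kc * tsupport h) * (‖d‖ ^ 2 *
          ‖(covCor σ (fun s => rt (σ.q s)) 1).integ μ f (regCov μ σ)‖ ^ 2 *
          (D ^ 2 * ∫ s, ‖c (σ.q s)‖ ^ 2 ∂μ)) * ‖ξ‖ ^ 2 := by gcongr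
      _ = _ := by ring
  · refine isClosed_le ?_ ?_
    · exact ((i.rep.π d).continuous.comp ((continuous_fam_apply i).clm_apply continuous_const)).norm.pow 2
    · exact (continuous_const.mul ((continuous_fam_apply _).norm.pow 2)).mul continuous_const

/-- The regular representation of `C₀(G) ⋊ G` is faithful. -/
theorem eq_zero_of_reg_eq_zero
    {a : Fam (fun i : CovFam σ (fun s => rt (σ.q s)) 1 => i.H) (fun i => i.H)}
    (ha : a ∈ (covCor σ (fun s => rt (σ.q s)) 1).cross μ) (h0 : a (regCov μ σ) = 0) :
    a = 0 := by
  refine fam_ext' fun i => ?_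
  have h1 : ∀ d ∈ {c : C₀(G, ℂ) | ∃ K : Set Γ, IsCompact K ∧ ∀ s ∉ K, c (σ.q s) = 0},
      ∀ x ∈ (covCor σ (fun s => rt (σ.q s)) 1).cross μ, ∀ ξ, i.rep.π d (a i (x i ξ)) = 0 := by
    rintro d ⟨Kd, hKd, hd⟩ x hx ξ
    let T : Fam (fun i : CovFam σ (fun s => rt (σ.q s)) 1 => i.H) (fun i => i.H) →L[ℂ] i.H :=
      (i.rep.π d ∘L a i).comp (evalAt i ξ)
    refine (covCor σ (fun s => rt (σ.q s)) 1).cross_le_of_dense μ (dense_c0_compactSupport σ)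
      (M := LinearMap.ker T.toLinearMap) (T.isClosed_ker) (fun h c hc => ?_) hx
    obtain ⟨Kc, hKc, hc⟩ := hc
    rw [← (covCor σ (fun s => rt (σ.q s)) 1).integ_tens_avg σ 1 μ continuous_const
      (fun i => i.rep.twist)]
    obtain ⟨C, hC⟩ := exists_sq_norm_mul_le μ σ hKd hKc hd hc
      (h := avg σ 1 continuous_const h)
      (avg_one_mul σ _ h)
    have h2 := hC a ha i ξ
    rw [h0, norm_zero, zero_pow two_ne_zero, mul_zero, zero_mul] at h2
    have h3 := norm_eq_zero.1 (pow_eq_zero_iff two_ne_zero |>.1 (le_antisymm h2 (by positivity)))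
    refine Eq.trans ?_ h3
    change i.rep.π d (a i ((covCor σ (fun s => rt (σ.q s)) 1).integ μ _ i ξ)) = _
    rw [Corner.integ_tens_apply]
    rfl
  have h2 : ∀ d x, x ∈ (covCor σ (fun s => rt (σ.q s)) 1).cross μ →
      ∀ ξ, i.rep.π d (a i (x i ξ)) = 0 := fun d x hx ξ => by
    let T : C₀(G, ℂ) →L[ℂ] i.H := (ContinuousLinearMap.apply ℂ i.H (a i (x i ξ))).comp
      (repL i.rep.π)
    have := (dense_c0_compactSupport σ).induction (P := fun d => T d = 0) (fun d hd => ?_)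
      (isClosed_eq T.continuous continuous_const) d
    · exact this
    · exact (Submodule.span_le (p := LinearMap.ker T.toLinearMap)).2
        (fun d hd => h1 d hd x hx ξ) hd
  refine ContinuousLinearMap.ext_on ((covCor σ (fun s => rt (σ.q s)) 1).dense_of_rho μ i
    i.rep.nondeg) ?_
  rintro _ ⟨x, hx, ξ, rfl⟩
  refine i.rep.nondeg.eq_zero_of_inner_right ℂ fun v hv => ?_
  induction hv using Submodule.span_induction with
  | zero => exact inner_zero_left _
  | add v w _ _ hv hw => rw [inner_add_left, hv, hw, add_zero]
  | smul k v _ hv => rw [inner_smul_left, hv, mul_zero]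
  | mem v hv =>
    obtain ⟨d, η, rfl⟩ := hv
    rw [← ContinuousLinearMap.adjoint_inner_right, ← ContinuousLinearMap.star_eq_adjoint,
      ← map_star]
    have h3 := h2 (star d) x hx ξ
    rw [h3, inner_zero_right]

lemma ActsNondeg.eq_of_ap {I : Type*} {H : I → Type*} [∀ i, NormedAddCommGroup (H i)]
    [∀ i, InnerProductSpace ℂ (H i)] [∀ i, CompleteSpace (H i)]
    {D : NonUnitalStarSubalgebra ℂ (BFam H)} (hD : ActsNondeg D) (i : I) {v w : H i}
    (h : ∀ d ∈ D, d.ap i v = d.ap i w) : v = w := by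
  refine (hD i).eq_of_inner_right ℂ fun u hu => ?_
  induction hu using Submodule.span_induction with
  | zero => rw [inner_zero_left, inner_zero_left]
  | add v w _ _ hv hw => rw [inner_add_left, inner_add_left, hv, hw]
  | smul k v _ hv => rw [inner_smul_left, inner_smul_left, hv]
  | mem u hu =>
    obtain ⟨d, hd, η, rfl⟩ := hu
    have h1 := h (star d) (star_mem hd)
    rw [BFam.star_ap, ContinuousLinearMap.star_eq_adjoint] at h1
    rw [← ContinuousLinearMap.adjoint_inner_right, h1, ContinuousLinearMap.adjoint_inner_right]

/-- Multipliers of `C₀(Γ, ῑ) ⋊ G` are determined by the regular representation. -/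
theorem bimodMultiplier_ext {S S' : BimodFam.Prod σ (bimod₀ σ)}
    (hS : IsBimodMultiplier μ σ (bimod₀ σ) S) (hS' : IsBimodMultiplier μ σ (bimod₀ σ) S')
    (h : S (regIdx μ σ) = S' (regIdx μ σ)) : S = S' := by
  have hO := eqBimod₀ σ
  have key : ∀ a ∈ crossedProduct μ σ (bimod₀ σ).α 1, ∀ k : BimodFam σ (bimod₀ σ),
      (BFam.ap a k.leftIdx : k.H →L[ℂ] k.H) ∘L S k =
        (BFam.ap a k.leftIdx : k.H →L[ℂ] k.H) ∘L S' k := by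
    intro a ha
    obtain ⟨x, hx, hxa⟩ := hS.2 a ha
    obtain ⟨x', hx', hxa'⟩ := hS'.2 a ha
    rw [hO.mem_bimodCrossedProduct μ] at hx hx'
    let y : Fam (fun k : BimodFam σ (bimod₀ σ) => k.H') (fun k => k.H) := x - x'
    have hy : y ∈ hO.cor.cross μ := Submodule.sub_mem _ hx hx'
    have hyk : ∀ k, y k = x k - x' k := fun k => rfl
    have hz := hO.mul_adj_mem μ hy hy
    obtain ⟨z, hz1, hz2⟩ := Corner.exists_of_mem_comap (covCor σ (bimod₀ σ).α 1) μ
      (r := BimodFam.leftIdx) hO.exists_leftIdx hz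
    have hzk : ∀ k : BimodFam σ (bimod₀ σ),
        z k.leftIdx = y k ∘L ContinuousLinearMap.adjoint (y k) := fun k =>
      congrFun (congrArg Subtype.val hz2) k
    have hy0 : y (regIdx μ σ) = 0 := by
      have e : x (regIdx μ σ) = x' (regIdx μ σ) := (hxa _).trans (by rw [h]; exact (hxa' _).symm)
      exact (hyk _).trans (sub_eq_zero.2 e)
    have hz0 : z = 0 := eq_zero_of_reg_eq_zero μ σ hz1 (by
      refine (hzk (regIdx μ σ)).trans ?_
      rw [hy0]
      exact ContinuousLinearMap.zero_comp _)
    intro k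
    have h1 : y k ∘L ContinuousLinearMap.adjoint (y k) = 0 := by
      rw [← hzk, hz0]; rfl
    have h2 : ‖y k‖ = 0 := by
      have h3 := ContinuousLinearMap.norm_adjoint_comp_self (ContinuousLinearMap.adjoint (y k))
      rw [ContinuousLinearMap.adjoint_adjoint, h1, norm_zero] at h3
      have h4 := mul_self_eq_zero.1 h3.symm
      rwa [LinearIsometryEquiv.norm_map] at h4
    exact (hxa k).symm.trans ((sub_eq_zero.1 ((hyk k).symm.trans (norm_eq_zero.1 h2))).trans
      (hxa' k))
  have hnd := actsNondeg_crossedProduct μ (σ := σ) (χ := 1) continuous_const hO.α_cont hO.α_zero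
  refine Subtype.ext (funext fun k => ContinuousLinearMap.ext fun ξ => ?_)
  exact hnd.eq_of_ap k.leftIdx fun d hd => DFunLike.congr_fun (key d hd k) ξ

end Faithful

/-! ### Multipliers from a smaller corner -/

section Act

variable {Γ : Type*} [Group Γ] [TopologicalSpace Γ] [IsTopologicalGroup Γ]
  [MeasurableSpace Γ] [BorelSpace Γ] [LocallyCompactSpace Γ] {Y₀ Y Z : Type*}
  [NormedAddCommGroup Y₀] [NormedSpace ℂ Y₀] [NormedAddCommGroup Y] [NormedSpace ℂ Y]
  [NormedAddCommGroup Z] [NormedSpace ℂ Z] {I : Type*} {K H' H : I → Type*}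
  [∀ i, NormedAddCommGroup (H i)] [∀ i, InnerProductSpace ℂ (H i)] [∀ i, CompleteSpace (H i)]
  [∀ i, NormedAddCommGroup (H' i)] [∀ i, InnerProductSpace ℂ (H' i)] [∀ i, CompleteSpace (H' i)]
  [∀ i, NormedAddCommGroup (K i)] [∀ i, InnerProductSpace ℂ (K i)] [∀ i, CompleteSpace (K i)]
  {c₀ : Corner Γ Y₀ H' H} {c : CovCorner Γ Y K H'} {d : Corner Γ Z K H} {t : Y₀ → Y → Z}
  (μ : Measure Γ) [IsHaarMeasure μ]

/-- The corner `c₀` acts on `c` with values in `d`, by `ρ₀(f) ρ_c(b) = ρ_d(t(f, b))`. -/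
structure Corner.Acts (c₀ : Corner Γ Y₀ H' H) (c : CovCorner Γ Y K H') (d : Corner Γ Z K H)
    (t : Y₀ → Y → Z) : Prop where
  hU : ∀ i, c.U i = c₀.V i
  hV : ∀ i, d.V i = c.V i
  act : ∀ i f b ξ, c₀.ρ i f (c.ρ i b ξ) = d.ρ i (t f b) ξ

namespace Corner.Acts

lemma UF_eq (h : c₀.Acts c d t) (s : Γ) : c.UF s = c₀.VF s :=
  fam_ext' fun i => by rw [CovCorner.UF_apply, Corner.VF_apply, h.hU]

lemma rho_integ (h : c₀.Acts c d t) (f : Y₀) (g : C_c(Γ, ℂ)) (b : Y) :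
    fmul (c₀.ρF f) (c.integ μ (Corner.tens g b)) = d.integ μ (Corner.tens g (t f b)) := by
  refine fam_ext fun i ξ => ?_
  rw [d.integ_tens, c.integ_tens]
  have : d.scal.integ μ g i ξ = c.scal.integ μ g i ξ := by
    rw [Corner.integ_apply, Corner.integ_apply]
    change ∫ s, (g s • (1 : K i →L[ℂ] K i)) (((d.V i).U s : K i →L[ℂ] K i) ξ) ∂μ =
      ∫ s, (g s • (1 : K i →L[ℂ] K i)) (((c.V i).U s : K i →L[ℂ] K i) ξ) ∂μ
    rw [h.hV]
  change c₀.ρ i f (c.ρ i b (c.scal.integ μ g i ξ)) = d.ρ i (t f b) (d.scal.integ μ g i ξ)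
  rw [this, h.act]

variable [T2Space Γ]

lemma rho_mem (h : c₀.Acts c d t) (f : Y₀) {z : Fam K H'} (hz : z ∈ c.cross μ) :
    fmul (c₀.ρF f) z ∈ d.cross μ := by
  let T : Fam K H' →L[ℂ] Fam K H := fmul (c₀.ρF f)
  have : c.cross μ ≤ (d.cross μ).comap (T : Fam K H' →ₗ[ℂ] Fam K H) :=
    c.cross_le_of_tens μ ((d.isClosed_cross μ).preimage T.continuous) fun g b => by
      change fmul (c₀.ρF f) (c.integ μ (Corner.tens g b)) ∈ d.cross μ
      rw [h.rho_integ μ]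
      exact d.integ_mem μ _
  exact this hz

lemma mem (h : c₀.Acts c d t) {x : Fam H' H} (hx : x ∈ c₀.cross μ) {z : Fam K H'}
    (hz : z ∈ c.cross μ) : fmul x z ∈ d.cross μ := by
  have hc : Continuous fun s => fmul (c₀.VF s) z := by
    simpa only [h.UF_eq] using c.continuous_UF_mul μ hz
  refine c₀.fcomp_mem μ id (d.isClosed_cross μ) hc (fun y s => ?_) hx
  exact h.rho_mem μ y (by rw [← h.UF_eq]; exact c.UF_mul_mem μ hz s)

lemma cross_le [Regular μ] (h : c₀.Acts c d t)
    (hD : Dense (Submodule.span ℂ {z | ∃ f b, z = t f b} : Set Z)) {M : Submodule ℂ (Fam K H)}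
    (hM : IsClosed (M : Set (Fam K H)))
    (hm : ∀ g, ∀ z ∈ c.cross μ, fmul (c₀.integ μ g) z ∈ M) : d.cross μ ≤ M := by
  refine d.cross_le_of_dense μ hD hM ?_
  rintro g _ ⟨f, b, rfl⟩
  rw [← h.rho_integ μ]
  set z := c.integ μ (Corner.tens g b) with hz
  have hzm : z ∈ c.cross μ := c.integ_mem μ _
  have hc : Continuous fun s => fmul (c₀.VF s) z := by
    simpa only [h.UF_eq] using c.continuous_UF_mul μ hzm
  rw [← SetLike.mem_coe, ← hM.closure_eq, Metric.mem_closure_iff]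
  intro ε hε
  obtain ⟨e, -, he⟩ := c₀.exists_scal_approx μ id hc Filter.univ_mem
    (ε := ε / (2 * (‖c₀.ρF f‖ + 1))) (by positivity)
  refine ⟨fmul (c₀.integ μ (Corner.tens e f)) z, hm _ _ hzm, ?_⟩
  rw [c₀.integ_tens, fmul_assoc, dist_comm, dist_eq_norm, ← map_sub]
  refine (norm_fmul_le _ _).trans_lt ?_
  have hε' : (‖c₀.ρF f‖ + 1) * (ε / (2 * (‖c₀.ρF f‖ + 1))) = ε / 2 := by field_simp
  have h1 : ‖fmul (c₀.scal.integ μ e) z - z‖ ≤ ε / (2 * (‖c₀.ρF f‖ + 1)) := he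
  nlinarith [norm_nonneg (c₀.ρF f), norm_nonneg (fmul (c₀.scal.integ μ e) z - z)]

lemma fmul_mem [Regular μ] {L : I → Type*} [∀ i, NormedAddCommGroup (L i)]
    [∀ i, InnerProductSpace ℂ (L i)] [∀ i, CompleteSpace (L i)] (h : c₀.Acts c d t)
    (hD : Dense (Submodule.span ℂ {z | ∃ f b, z = t f b} : Set Z)) (T : Fam H L)
    {N : Submodule ℂ (Fam K L)} (hN : IsClosed (N : Set (Fam K L)))
    (hm : ∀ g, ∀ z ∈ c.cross μ, fmul T (fmul (c₀.integ μ g) z) ∈ N) {x : Fam K H}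
    (hx : x ∈ d.cross μ) : fmul T x ∈ N := by
  let T' : Fam K H →L[ℂ] Fam K L := fmul T
  have : d.cross μ ≤ N.comap (T' : Fam K H →ₗ[ℂ] Fam K L) :=
    h.cross_le μ hD (hN.preimage T'.continuous) fun g z hz => hm g z hz
  exact this hx

end Corner.Acts

end Act

/-! ### The multiplier `R_ϕ` -/

section Descent

variable {G Γ : Type u} [Group G] [TopologicalSpace G] [IsTopologicalGroup G]
  [LocallyCompactSpace G] [T2Space G]
  [Group Γ] [TopologicalSpace Γ] [IsTopologicalGroup Γ] [LocallyCompactSpace Γ] [T2Space Γ]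
  {B : Type u} [NonUnitalCStarAlgebra B] (W : WeakAlg G B) (σ : Twist G Γ)

/-- The index of the pulled back bimodule representation. -/
abbrev pullIdx (k : BimodFam σ (W.bimod σ)) : BimodFam σ (bimod₀ σ) := ⟨k.H, k.H', k.rep.pull⟩

/-- The corner `C₀(Γ, ῑ)` in the representations of `𝓔_σ(B)`. -/
def pullCor : Corner Γ (C0bar σ) (fun k : BimodFam σ (W.bimod σ) => k.H') (fun k => k.H) where
  ρ k := k.rep.pull.πX
  V k := k.rep.right.toURep
  le k := (eqBimod₀ σ).norm_πX k.rep.pull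

/-- The corner `C₀(G)` in the representations of `B`. -/
def pullCorB : Corner Γ C₀(G, ℂ) (fun k : BimodFam σ (W.bimod σ) => k.H') (fun k => k.H') where
  ρ k := repLin k.rep.pull.right.π
  V k := k.rep.right.toURep
  le k := NonUnitalStarAlgHom.norm_apply_le k.rep.pull.right.π

/-- The right corner of `𝓔_σ(B)`, with its left unitaries. -/
def corBCov : CovCorner Γ B (fun k : BimodFam σ (W.bimod σ) => k.H') (fun k => k.H') where
  toCorner := EqBimod.corB σ (W.bimod σ)
  U k := k.rep.right.toURep
  γ := W.infl σ
  γ_zero := (eqBimod W σ).β_zero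
  γ_cont := (eqBimod W σ).β_cont
  cov k := k.rep.right.covariant

lemma acts_pullCor :
    (pullCor W σ).Acts (corBCov W σ) (eqBimod W σ).cor.toCorner (W.tens σ) where
  hU _ := rfl
  hV _ := rfl
  act k f b ξ := k.rep.opX_apply f b ξ

lemma acts_pullCorB :
    (pullCorB W σ).Acts (corBCov W σ) (EqBimod.corB σ (W.bimod σ))
      (fun c b => (W.c0Action σ).m c b) where
  hU _ := rfl
  hV _ := rfl
  act k c b ξ := (W.c0Action σ).op_apply k.rep.r' c b ξ

variable [MeasurableSpace Γ] [BorelSpace Γ] (μ : Measure Γ) [IsHaarMeasure μ] [Regular μ]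

lemma freindex_mem_pullCor {x : Fam (fun k : BimodFam σ (bimod₀ σ) => k.H') (fun k => k.H)}
    (hx : x ∈ (eqBimod₀ σ).cor.cross μ) :
    (freindex (H' := fun k : BimodFam σ (bimod₀ σ) => k.H') (H := fun k => k.H) (pullIdx W σ) x :
      Fam (fun k : BimodFam σ (W.bimod σ) => k.H') (fun k => k.H)) ∈ (pullCor W σ).cross μ :=
  Corner.freindex_mem (eqBimod₀ σ).cor.toCorner μ (pullIdx W σ) hx

lemma freindex_mem_pullCorB {x : Fam (fun k : BimodFam σ (bimod₀ σ) => k.H') (fun k => k.H')}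
    (hx : x ∈ (EqBimod.corB σ (bimod₀ σ)).cross μ) :
    (freindex (H' := fun k : BimodFam σ (bimod₀ σ) => k.H') (H := fun k => k.H') (pullIdx W σ) x :
      Fam (fun k : BimodFam σ (W.bimod σ) => k.H') (fun k => k.H')) ∈ (pullCorB W σ).cross μ :=
  Corner.freindex_mem (EqBimod.corB σ (bimod₀ σ)) μ (pullIdx W σ) hx

/-- `psiDescent` as a bounded family. -/
def psiFam (S : Fam (fun k : BimodFam σ (bimod₀ σ) => k.H') (fun k => k.H)) :
    Fam (fun k : BimodFam σ (W.bimod σ) => k.H') (fun k => k.H) := psiDescent W σ S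


lemma pullCorB_integ (g : C_c(Γ, C₀(G, ℂ))) (k : BimodFam σ (W.bimod σ)) :
    (pullCorB W σ).integ μ g k = (EqBimod.corB σ (bimod₀ σ)).integ μ g (pullIdx W σ k) :=
  rfl

lemma pullCor_integ (g : C_c(Γ, C0bar σ)) (k : BimodFam σ (W.bimod σ)) :
    (pullCor W σ).integ μ g k = (eqBimod₀ σ).cor.integ μ g (pullIdx W σ k) := rfl

lemma psiFam_apply (S : Fam (fun k : BimodFam σ (bimod₀ σ) => k.H') (fun k => k.H))
    (k : BimodFam σ (W.bimod σ)) : psiFam W σ S k = S (pullIdx W σ k) := rfl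


lemma psi_mul_integ (S : Fam (fun k : BimodFam σ (bimod₀ σ) => k.H') (fun k => k.H))
    (g : C_c(Γ, C₀(G, ℂ))) : fmul (psiFam W σ S) ((pullCorB W σ).integ μ g) =
      (freindex (H' := fun k : BimodFam σ (bimod₀ σ) => k.H') (H := fun k => k.H)
        (pullIdx W σ) (fmul S ((EqBimod.corB σ (bimod₀ σ)).integ μ g)) :
      Fam (fun k : BimodFam σ (W.bimod σ) => k.H') (fun k => k.H)) := by
  refine fam_ext' fun k => ?_
  rw [fmul_apply, pullCorB_integ, psiFam_apply]
  exact (fmul_apply S ((EqBimod.corB σ (bimod₀ σ)).integ μ g) (pullIdx W σ k)).symm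

lemma good_psi_mul {S : Fam (fun k : BimodFam σ (bimod₀ σ) => k.H') (fun k => k.H)}
    (hS : EqBimod.Good μ (eqBimod₀ σ) S) (g : C_c(Γ, C₀(G, ℂ)))
    {z : Fam (fun k : BimodFam σ (W.bimod σ) => k.H') (fun k => k.H')}
    (hz : z ∈ (corBCov W σ).cross μ) :
    fmul (psiFam W σ S) (fmul ((pullCorB W σ).integ μ g) z) ∈ (eqBimod W σ).cor.cross μ := by
  rw [← fmul_assoc, psi_mul_integ]
  refine (acts_pullCor W σ).mem μ ?_ hz
  refine freindex_mem_pullCor W σ μ ?_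
  exact hS.mul_mem _ ((EqBimod.corB σ (bimod₀ σ)).integ_mem μ g)

lemma psi_adj_integ (S : Fam (fun k : BimodFam σ (bimod₀ σ) => k.H') (fun k => k.H))
    (g : C_c(Γ, C0bar σ)) : fmul (fadj (psiFam W σ S)) ((pullCor W σ).integ μ g) =
      (freindex (H' := fun k : BimodFam σ (bimod₀ σ) => k.H') (H := fun k => k.H')
        (pullIdx W σ) (fmul (fadj S) ((eqBimod₀ σ).cor.integ μ g)) :
      Fam (fun k : BimodFam σ (W.bimod σ) => k.H') (fun k => k.H')) := by
  refine fam_ext' fun k => ?_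
  rw [fmul_apply, pullCor_integ, fadj_apply, psiFam_apply]
  exact (fmul_apply (fadj S) ((eqBimod₀ σ).cor.integ μ g) (pullIdx W σ k)).symm

lemma good_psi_adj {S : Fam (fun k : BimodFam σ (bimod₀ σ) => k.H') (fun k => k.H)}
    (hS : EqBimod.Good μ (eqBimod₀ σ) S) (g : C_c(Γ, C0bar σ))
    {z : Fam (fun k : BimodFam σ (W.bimod σ) => k.H') (fun k => k.H')}
    (hz : z ∈ (corBCov W σ).cross μ) :
    fmul (fadj (psiFam W σ S)) (fmul ((pullCor W σ).integ μ g) z) ∈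
      (EqBimod.corB σ (W.bimod σ)).cross μ := by
  rw [← fmul_assoc, psi_adj_integ]
  refine (acts_pullCorB W σ).mem μ ?_ hz
  refine freindex_mem_pullCorB W σ μ ?_
  exact hS.adj_mem _ ((eqBimod₀ σ).cor.integ_mem μ g)

lemma psi_mul_mem {S : Fam (fun k : BimodFam σ (bimod₀ σ) => k.H') (fun k => k.H)}
    (hS : EqBimod.Good μ (eqBimod₀ σ) S)
    {b : Fam (fun k : BimodFam σ (W.bimod σ) => k.H') (fun k => k.H')}
    (hb : b ∈ (EqBimod.corB σ (W.bimod σ)).cross μ) :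
    fmul (psiFam W σ S) b ∈ (eqBimod W σ).cor.cross μ :=
  (acts_pullCorB W σ).fmul_mem μ (W.c0Action σ).nondeg (psiFam W σ S)
    ((eqBimod W σ).cor.isClosed_cross μ) (fun g _ hz => good_psi_mul W σ μ hS g hz) hb

lemma psi_adj_mem {S : Fam (fun k : BimodFam σ (bimod₀ σ) => k.H') (fun k => k.H)}
    (hS : EqBimod.Good μ (eqBimod₀ σ) S)
    {x : Fam (fun k : BimodFam σ (W.bimod σ) => k.H') (fun k => k.H)}
    (hx : x ∈ (eqBimod W σ).cor.cross μ) :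
    fmul (fadj (psiFam W σ S)) x ∈ (EqBimod.corB σ (W.bimod σ)).cross μ :=
  (acts_pullCor W σ).fmul_mem μ (dense_tens W σ) (fadj (psiFam W σ S))
    ((EqBimod.corB σ (W.bimod σ)).isClosed_cross μ)
    (fun g _ hz => good_psi_adj W σ μ hS g hz) hx

lemma isUnitaryFam_psi {S : Fam (fun k : BimodFam σ (bimod₀ σ) => k.H') (fun k => k.H)}
    (hS : IsUnitaryFam (σ := σ) (O := bimod₀ σ) S) :
    IsUnitaryFam (σ := σ) (O := W.bimod σ) (psiFam W σ S) :=
  fun k => hS (pullIdx W σ k)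

lemma good_psi {S : Fam (fun k : BimodFam σ (bimod₀ σ) => k.H') (fun k => k.H)}
    (hS : EqBimod.Good μ (eqBimod₀ σ) S) : EqBimod.Good μ (eqBimod W σ) (psiFam W σ S) :=
  ⟨isUnitaryFam_psi W σ hS.unit, fun _ hb => psi_mul_mem W σ μ hS hb,
    fun _ hx => psi_adj_mem W σ μ hS hx⟩

end Descent

section Tensor

variable {G Γ : Type u} [Group G] [TopologicalSpace G] [IsTopologicalGroup G]
  [LocallyCompactSpace G] [T2Space G]
  [Group Γ] [TopologicalSpace Γ] [IsTopologicalGroup Γ] [LocallyCompactSpace Γ] [T2Space Γ]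
  {B : Type u} [NonUnitalCStarAlgebra B] {W : WeakAlg G B} {σ : Twist G Γ}

lemma BimodRep.opX_tensor {H H' K : Type u} [NormedAddCommGroup H] [InnerProductSpace ℂ H]
    [CompleteSpace H] [NormedAddCommGroup H'] [InnerProductSpace ℂ H'] [CompleteSpace H']
    [NormedAddCommGroup K] [InnerProductSpace ℂ K] [CompleteSpace K]
    (r : BimodRep σ (W.bimod σ) H H') (V : URep G K) (f : C0bar σ) :
    (r.tensor V).opX f = hampl K (r.opX f) := by
  refine (r.tensor V).r'.ext_clm fun b ξ => ?_
  rw [BimodRep.opX_apply]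
  change hampl K (r.πX (W.tens σ f b)) ξ = (hampl K (r.opX f) ∘L hampl K (r.r'.π b)) ξ
  rw [hampl_comp]
  congr 2
  ext η
  exact (r.opX_apply f b η).symm

lemma eq_hampl_of_tendsto {H H' K : Type u} [NormedAddCommGroup H] [InnerProductSpace ℂ H]
    [CompleteSpace H] [NormedAddCommGroup H'] [InnerProductSpace ℂ H'] [CompleteSpace H']
    [NormedAddCommGroup K] [InnerProductSpace ℂ K] [CompleteSpace K] {ι : Type*} {l : Filter ι}
    [l.NeBot] {T : ι → H' →L[ℂ] H} {Q : H' →L[ℂ] H} {P : HTensor H' K →L[ℂ] HTensor H K}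
    (h1 : ∀ ζ, Tendsto (fun p => hampl K (T p) ζ) l (𝓝 (P ζ)))
    (h2 : ∀ ξ, Tendsto (fun p => T p ξ) l (𝓝 (Q ξ))) : P = hampl K Q := by
  refine hmap_ext fun ξ η => ?_
  have hc : Continuous fun x : H => (htmul x η : HTensor H K) :=
    continuous_htmul.comp (continuous_id.prodMk continuous_const)
  have h3 : Tendsto (fun p => (htmul (T p ξ) η : HTensor H K)) l (𝓝 (htmul (Q ξ) η)) :=
    (hc.tendsto (Q ξ)).comp (h2 ξ)
  rw [hampl_htmul]
  refine tendsto_nhds_unique (h1 _) (h3.congr fun p => ?_)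
  rw [hampl_htmul]

variable {ι : Type*} {l : Filter ι} {F : ι → C0bar σ}
  {S : Fam (fun k : BimodFam σ (bimod₀ σ) => k.H') (fun k => k.H)}

lemma tendsto_psiFam (hS : ∀ k ξ, Tendsto (fun p => k.rep.πX (F p) ξ) l (𝓝 (S k ξ)))
    (k : BimodFam σ (W.bimod σ)) (ξ : k.H') :
    Tendsto (fun p => k.rep.opX (F p) ξ) l (𝓝 (psiFam W σ S k ξ)) :=
  hS (pullIdx W σ k) ξ

lemma tendsto_psiFam_tensor (hS : ∀ k ξ, Tendsto (fun p => k.rep.πX (F p) ξ) l (𝓝 (S k ξ)))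
    (k : BimodFam σ (W.bimod σ)) (j : URepFam G) (ζ : HTensor k.H' j.H) :
    Tendsto (fun p => hampl j.H (k.rep.opX (F p)) ζ) l
      (𝓝 ((psiFam W σ S (k.tensor j) : HTensor k.H' j.H →L[ℂ] HTensor k.H j.H) ζ)) :=
  (tendsto_psiFam hS (k.tensor j) ζ).congr fun p =>
    DFunLike.congr_fun (k.rep.opX_tensor j.rep (F p)) ζ

lemma psiFam_tensor [l.NeBot]
    (hS : ∀ k ξ, Tendsto (fun p => k.rep.πX (F p) ξ) l (𝓝 (S k ξ)))
    (k : BimodFam σ (W.bimod σ)) (j : URepFam G) :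
    psiFam W σ S (k.tensor j) = hampl (H' := k.H') (H := k.H) j.H (psiFam W σ S k) :=
  eq_hampl_of_tendsto (H := k.H) (H' := k.H') (K := j.H) (tendsto_psiFam_tensor hS k j)
    (tendsto_psiFam hS k)

end Tensor

section PhiDescent

variable {G Γ : Type u} [Group G] [TopologicalSpace G] [IsTopologicalGroup G]
  [Group Γ] [TopologicalSpace Γ] [IsTopologicalGroup Γ] [LocallyCompactSpace Γ] [T2Space Γ]
  [MeasurableSpace Γ] [BorelSpace Γ] (μ : Measure Γ) [IsHaarMeasure μ] [Regular μ]
  {A : Type*} [NonUnitalCStarAlgebra A] {σ : Twist G Γ} {α : Γ → A → A} {χ : Circle →* Circle}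

/-- The corner `C₀(G)` in the covariant representations of `A`. -/
def C0Action.cor (Φ : C0Action σ α) (χ : Circle →* Circle) :
    Corner Γ C₀(G, ℂ) (fun i : CovFam σ α χ => i.H) (fun i => i.H) where
  ρ i := repLin (Φ.pull i.rep).π
  V i := i.rep.toURep
  le i := NonUnitalStarAlgHom.norm_apply_le (Φ.pull i.rep).π

lemma C0Action.acts (Φ : C0Action σ α) (hα : Continuous fun p : Γ × A => α p.1 p.2)
    (hα0 : ∀ s, α s 0 = 0) :
    (Φ.cor χ).Acts (covCov σ α χ hα hα0) (covCor σ α χ) (fun c a => Φ.m c a) where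
  hU _ := rfl
  hV _ := rfl
  act i c a ξ := Φ.op_apply i.rep c a ξ

lemma C0Action.descent_cor (Φ : C0Action σ α)
    {x : CovFam.Prod σ (fun s => rt (σ.q s)) χ}
    (hx : x.toFam ∈ (covCor σ (fun s => rt (σ.q s)) χ).cross μ) :
    (Φ.descent χ x).toFam ∈ (Φ.cor χ).cross μ :=
  Corner.freindex_mem (covCor σ (fun s => rt (σ.q s)) χ) μ
    (fun i : CovFam σ α χ => (⟨i.H, Φ.pull i.rep⟩ : CovFam σ (fun s => rt (σ.q s)) χ)) hx

lemma C0Action.descent_mul_mem (Φ : C0Action σ α) (hχ : Continuous χ)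
    (hα : Continuous fun p : Γ × A => α p.1 p.2) (hα0 : ∀ s, α s 0 = 0)
    {x : CovFam.Prod σ (fun s => rt (σ.q s)) χ}
    (hx : x.toFam ∈ (covCor σ (fun s => rt (σ.q s)) χ).cross μ) {d : CovFam.Prod σ α χ}
    (hd : d ∈ crossedProduct μ σ α χ) : Φ.descent χ x * d ∈ crossedProduct μ σ α χ := by
  rw [mem_crossedProduct μ σ hχ hα hα0] at hd ⊢
  exact (Φ.acts hα hα0).mem μ (Φ.descent_cor μ hx) hd

lemma C0Action.descent_star (Φ : C0Action σ α) (x : CovFam.Prod σ (fun s => rt (σ.q s)) χ) :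
    Φ.descent χ (star x) = star (Φ.descent χ x) := rfl

lemma C0Action.descent_mem (Φ : C0Action σ α) (hχ : Continuous χ)
    (hα : Continuous fun p : Γ × A => α p.1 p.2) (hα0 : ∀ s, α s 0 = 0)
    (hrt : Continuous fun p : Γ × C₀(G, ℂ) => rt (σ.q p.1) p.2)
    (hrt0 : ∀ s, rt (σ.q s) (0 : C₀(G, ℂ)) = 0)
    {x : CovFam.Prod σ (fun s => rt (σ.q s)) χ}
    (hx : x ∈ crossedProduct μ σ (fun s => rt (σ.q s)) χ) :
    Φ.descent χ x ∈ multiplierAlgebra (crossedProduct μ σ α χ) := by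
  intro d hd
  refine ⟨Φ.descent_mul_mem μ hχ hα hα0 ((mem_crossedProduct μ σ hχ hrt hrt0 x).1 hx) hd, ?_⟩
  have := star_mem (Φ.descent_mul_mem μ hχ hα hα0
    ((mem_crossedProduct μ σ hχ hrt hrt0 _).1 (star_mem hx)) (star_mem hd))
  rwa [C0Action.descent_star, star_mul, star_star, star_star] at this

end PhiDescent

section Isos

variable {G Γ : Type u} [Group G] [TopologicalSpace G] [IsTopologicalGroup G]
  [LocallyCompactSpace G] [T2Space G] [MeasurableSpace G] [BorelSpace G]
  [Group Γ] [TopologicalSpace Γ] [IsTopologicalGroup Γ] [LocallyCompactSpace Γ] [T2Space Γ]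
  [MeasurableSpace Γ] [BorelSpace Γ] {μ : Measure G} [IsHaarMeasure μ] [Regular μ]
  {μΓ : Measure Γ} [IsHaarMeasure μΓ] [Regular μΓ]
  {σ : Twist G Γ}

section Gen

variable {A B X : Type u} [NonUnitalCStarAlgebra A] [NonUnitalCStarAlgebra B]
  [NormedAddCommGroup X] [NormedSpace ℂ X] {O : BimodOps Γ A B X} {hO : EqBimod σ O}
  {T : Fam (fun k : BimodFam σ O => k.H') (fun k => k.H)}

/-- `s = (T ⊗ 1) t (T ⊗ 1)⋆`. -/
def AmplAd (T : Fam (fun k : BimodFam σ O => k.H') (fun k => k.H))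
    (t : TensorProd σ O.β (MonoidHom.id Circle)) (s : TensorProd σ O.α 1) : Prop :=
  AdRel (H' := fun p : CovFam σ O.β (MonoidHom.id Circle) × URepFam G => HTensor p.1.H p.2.H)
    (H := fun p : CovFam σ O.α 1 × URepFam G => HTensor p.1.H p.2.H)
    (amplIdx (URepFam G) BimodFam.rightIdx) (amplIdx (URepFam G) BimodFam.leftIdx)
    (amplFam (H' := fun i : CovFam σ O.β (MonoidHom.id Circle) => i.H)
      (H := fun i : CovFam σ O.α 1 => i.H) (K := fun j : URepFam G => j.H)
      BimodFam.rightIdx BimodFam.leftIdx (fun k => T k)) t s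

lemma EqBimod.rightIdx_surjective (hO : EqBimod σ O) :
    Function.Surjective (BimodFam.rightIdx (σ := σ) (O := O)) := hO.exists_rightIdx

lemma EqBimod.leftIdx_surjective (hO : EqBimod σ O) :
    Function.Surjective (BimodFam.leftIdx (σ := σ) (O := O)) := hO.exists_leftIdx

lemma EqBimod.isAd_unique (hO : EqBimod σ O) {x : CovFam.Prod σ O.β (MonoidHom.id Circle)}
    {y y' : CovFam.Prod σ O.α 1} (h : IsAd (σ := σ) (O := O) T x y)
    (h' : IsAd (σ := σ) (O := O) T x y') : y = y' :=
  AdRel.unique_right hO.leftIdx_surjective (isAd_iff.1 h) (isAd_iff.1 h')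

lemma EqBimod.amplAd_unique (hO : EqBimod σ O) {t : TensorProd σ O.β (MonoidHom.id Circle)}
    {s s' : TensorProd σ O.α 1} (h : AmplAd T t s) (h' : AmplAd T t s') : s = s' :=
  AdRel.unique_right (amplIdx_surjective hO.leftIdx_surjective) h h'

lemma amplAd_elem {x : CovFam.Prod σ O.β (MonoidHom.id Circle)} {y : CovFam.Prod σ O.α 1}
    (h : IsAd (σ := σ) (O := O) T x y) (c : URepFam.Prod G) :
    AmplAd T (tensF x.toFam c.toFam).toB (tensF y.toFam c.toFam).toB :=
  AdRel.ampl (J := URepFam G) (EqBimod.isAd_iff.1 h) c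

lemma EqBimod.isElemTensor_amplAd (hO : EqBimod σ O)
    {x : CovFam.Prod σ O.β (MonoidHom.id Circle)} {y : CovFam.Prod σ O.α 1}
    (h : IsAd (σ := σ) (O := O) T x y) {c : URepFam.Prod G}
    {t : TensorProd σ O.β (MonoidHom.id Circle)} {s : TensorProd σ O.α 1}
    (ht : IsElemTensor x c t) (hs : AmplAd T t s) : IsElemTensor y c s := by
  have h1 : t = (tensF x.toFam c.toFam).toB := elemT_eq ht
  have h2 : s = (tensF y.toFam c.toFam).toB := hO.amplAd_unique hs (h1 ▸ amplAd_elem h c)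
  rw [h2]
  exact fun p => rfl

lemma EqBimod.amplAd_dualCoaction (hO : EqBimod σ O)
    (hamp : ∀ k (j : URepFam G), T (k.tensor j) = hampl (H' := k.H') (H := k.H) j.H (T k))
    {x : CovFam.Prod σ O.β (MonoidHom.id Circle)} {y : CovFam.Prod σ O.α 1}
    (h : IsAd (σ := σ) (O := O) T x y) {s : TensorProd σ O.α 1}
    (hs : AmplAd T (dualCoaction x) s) : s = dualCoaction y :=
  hO.amplAd_unique hs (dualCoaction_rel hamp h)

namespace EqBimod.Good

lemma exists_isos (hT : EqBimod.Good μΓ hO T) :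
    ∃ (e : crossedProduct μΓ σ O.β (MonoidHom.id Circle) ≃⋆ₐ[ℂ] crossedProduct μΓ σ O.α 1)
      (f : multiplierAlgebra (crossedProduct μΓ σ O.β (MonoidHom.id Circle)) ≃⋆ₐ[ℂ]
        multiplierAlgebra (crossedProduct μΓ σ O.α 1)),
      (∀ x, IsAd (σ := σ) (O := O) T x.1 (e x).1) ∧ ∀ m, IsAd (σ := σ) (O := O) T m.1 (f m).1 :=
  AdRel.exists_isos hT.adUnit hO.rightIdx_surjective hO.leftIdx_surjective
    (fun _ hx => hT.exists_left hx) (fun _ hy => hT.exists_right hy)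
    (actsNondeg_crossedProduct μΓ continuous_id hO.β_cont hO.β_zero)
    (actsNondeg_crossedProduct μΓ continuous_const hO.α_cont hO.α_zero)

variable (μ) in
lemma exists_tensor_iso (hT : EqBimod.Good μΓ hO T) :
    ∃ f : multiplierAlgebra (tensorCStar μΓ μ σ O.β (MonoidHom.id Circle)) ≃⋆ₐ[ℂ]
        multiplierAlgebra (tensorCStar μΓ μ σ O.α 1),
      ∀ m, AmplAd T m.1 (f m).1 :=
  TwistDeform.exists_tensor_iso (C := groupCStar μ) hT.adUnit hO.rightIdx_surjective
    hO.leftIdx_surjective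
    (fun _ hx => hT.exists_left hx) (fun _ hy => hT.exists_right hy)
    (actsNondeg_crossedProduct μΓ continuous_id hO.β_cont hO.β_zero)
    (actsNondeg_crossedProduct μΓ continuous_const hO.α_cont hO.α_zero) (actsNondeg_groupCStar μ)

end EqBimod.Good

lemma EqBimod.mult_extends (hO : EqBimod σ O)
    {e : crossedProduct μΓ σ O.β (MonoidHom.id Circle) ≃⋆ₐ[ℂ] crossedProduct μΓ σ O.α 1}
    {f : multiplierAlgebra (crossedProduct μΓ σ O.β (MonoidHom.id Circle)) ≃⋆ₐ[ℂ]
      multiplierAlgebra (crossedProduct μΓ σ O.α 1)}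
    (he : ∀ x, IsAd (σ := σ) (O := O) T x.1 (e x).1)
    (hf : ∀ m, IsAd (σ := σ) (O := O) T m.1 (f m).1) (x) (m) (hm : m.1 = x.1) :
    (f m).1 = (e x).1 :=
  hO.isAd_unique (hf m) (hm ▸ he x)

lemma EqBimod.tensor_dualCoaction (hO : EqBimod σ O)
    (hamp : ∀ k (j : URepFam G), T (k.tensor j) = hampl (H' := k.H') (H := k.H) j.H (T k))
    {g : multiplierAlgebra (tensorCStar μΓ μ σ O.β (MonoidHom.id Circle)) ≃⋆ₐ[ℂ]
      multiplierAlgebra (tensorCStar μΓ μ σ O.α 1)} (hg : ∀ m, AmplAd T m.1 (g m).1)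
    {x : CovFam.Prod σ O.β (MonoidHom.id Circle)} {y : CovFam.Prod σ O.α 1}
    (hx : x ∈ crossedProduct μΓ σ O.β (MonoidHom.id Circle))
    (hxy : IsAd (σ := σ) (O := O) T x y) :
    ∃ h : dualCoaction x ∈ multiplierAlgebra (tensorCStar μΓ μ σ O.β (MonoidHom.id Circle)),
        (g ⟨dualCoaction x, h⟩).1 = dualCoaction y :=
  ⟨dualCoaction_mem μ μΓ continuous_id hO.β_cont hO.β_zero hx,
    hO.amplAd_dualCoaction hamp hxy (hg _)⟩

end Gen

end Isos

section Sphi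

variable {G Γ B : Type u}
  [Group G] [TopologicalSpace G] [IsTopologicalGroup G] [LocallyCompactSpace G] [T2Space G]
  [MeasurableSpace G] [BorelSpace G]
  [Group Γ] [TopologicalSpace Γ] [IsTopologicalGroup Γ] [LocallyCompactSpace Γ] [T2Space Γ]
  [MeasurableSpace Γ] [BorelSpace Γ]
  {μ : Measure G} [IsHaarMeasure μ] [Regular μ] {μΓ : Measure Γ} [IsHaarMeasure μΓ] [Regular μΓ]
  {σ : Twist G Γ} [NonUnitalCStarAlgebra B] {W : WeakAlg G B}
  {ϕ : Γ → Circle} {hm : Measurable fun t => (ϕ t : ℂ)}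
  {hϕ : ∀ s z, ϕ (s * σ.ι z) = z⁻¹ * ϕ s}

variable (hm hϕ) in
lemma exists_isSphi : ∃ S, IsSphi μΓ σ ϕ hm hϕ S ∧ EqBimod.Good μΓ (eqBimod₀ σ) S ∧
    ∃ F : TopologicalSpace.Compacts Γ × ℕ → C0bar σ,
      ∀ k ξ, Tendsto (fun p => k.rep.πX (F p) ξ) atTop (𝓝 (S k ξ)) := by
  obtain ⟨F, hF⟩ := exists_approximants μΓ σ hm hϕ
  obtain ⟨S, hS, hS'⟩ := hF.exists_good μΓ σ hm
  exact ⟨S, ⟨hS.isBimodMultiplier, hF.limit_regIdx μΓ σ hm hϕ hS'⟩, hS, F, hS'⟩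

lemma IsSphi.unique {S S' : BimodFam.Prod σ (bimod₀ σ)} (hS : IsSphi μΓ σ ϕ hm hϕ S)
    (hS' : IsSphi μΓ σ ϕ hm hϕ S') : S = S' :=
  bimodMultiplier_ext μΓ σ hS.1 hS'.1 (hS.2.trans hS'.2.symm)

lemma IsSphi.good {S : BimodFam.Prod σ (bimod₀ σ)} (hS : IsSphi μΓ σ ϕ hm hϕ S) :
    EqBimod.Good μΓ (eqBimod₀ σ) S := by
  obtain ⟨S', h1, h2, -⟩ := exists_isSphi (μΓ := μΓ) hm hϕ
  rw [hS.unique h1]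
  exact h2

lemma IsSphi.psi_tensor {S : BimodFam.Prod σ (bimod₀ σ)} (hS : IsSphi μΓ σ ϕ hm hϕ S)
    (k : BimodFam σ (W.bimod σ)) (j : URepFam G) :
    psiFam W σ S (k.tensor j) = hampl (H' := k.H') (H := k.H) j.H (psiFam W σ S k) := by
  obtain ⟨S', h1, -, F, h3⟩ := exists_isSphi (μΓ := μΓ) hm hϕ
  rw [hS.unique h1]
  exact psiFam_tensor h3 k j

lemma isAd_descent {S : BimodFam.Prod σ (bimod₀ σ)}
    {x : CovFam.Prod σ (fun s => rt (σ.q s)) (MonoidHom.id Circle)}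
    {y : CovFam.Prod σ (fun s => rt (σ.q s)) 1} (h : IsAd S x y) :
    IsAd (psiDescent W σ S) (W.phiDescent σ x) (W.phiσDescent σ y) :=
  fun k => h (pullIdx W σ k)

lemma phiDescent_mem {x : CovFam.Prod σ (fun s => rt (σ.q s)) (MonoidHom.id Circle)}
    (hx : x ∈ c0Cross μΓ σ (MonoidHom.id Circle)) :
    W.phiDescent σ x ∈ multiplierAlgebra (W.twCross μΓ σ) :=
  (W.c0Action σ).descent_mem μΓ continuous_id (eqBimod W σ).β_cont (eqBimod W σ).β_zero
    (eqBimod₀ σ).β_cont (eqBimod₀ σ).β_zero hx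

lemma mult_phiDescent {S : BimodFam.Prod σ (bimod₀ σ)}
    {f : multiplierAlgebra (W.twCross μΓ σ) ≃⋆ₐ[ℂ] multiplierAlgebra (W.defCross μΓ σ)}
    (hf : ∀ m, IsAd (psiDescent W σ S) m.1 (f m).1)
    {x : CovFam.Prod σ (fun s => rt (σ.q s)) (MonoidHom.id Circle)}
    {y : CovFam.Prod σ (fun s => rt (σ.q s)) 1}
    (hx : x ∈ c0Cross μΓ σ (MonoidHom.id Circle)) (hxy : IsAd S x y) :
    ∃ h : W.phiDescent σ x ∈ multiplierAlgebra (W.twCross μΓ σ),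
      (f ⟨W.phiDescent σ x, h⟩).1 = W.phiσDescent σ y :=
  ⟨phiDescent_mem hx, (eqBimod W σ).isAd_unique (hf ⟨W.phiDescent σ x, phiDescent_mem hx⟩)
    (isAd_descent hxy)⟩

lemma exists_AdS {S : BimodFam.Prod σ (bimod₀ σ)} (hS : EqBimod.Good μΓ (eqBimod₀ σ) S) :
    ∃ e : c0Cross μΓ σ (MonoidHom.id Circle) ≃⋆ₐ[ℂ] c0Cross μΓ σ 1,
      ∀ x, IsAd S x.1 (e x).1 :=
  hS.exists_isos.imp fun _ h => h.elim fun _ h' => h'.1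

lemma exists_AdR {S : BimodFam.Prod σ (bimod₀ σ)} (hS : EqBimod.Good μΓ (eqBimod₀ σ) S) :
    ∃ (e : W.twCross μΓ σ ≃⋆ₐ[ℂ] W.defCross μΓ σ)
      (f : multiplierAlgebra (W.twCross μΓ σ) ≃⋆ₐ[ℂ] multiplierAlgebra (W.defCross μΓ σ)),
      (∀ x, IsAd (psiDescent W σ S) x.1 (e x).1) ∧ ∀ m, IsAd (psiDescent W σ S) m.1 (f m).1 :=
  (good_psi W σ μΓ hS).exists_isos

variable (μ) in
lemma exists_AdRT {S : BimodFam.Prod σ (bimod₀ σ)} (hS : EqBimod.Good μΓ (eqBimod₀ σ) S) :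
    ∃ g : multiplierAlgebra (W.twTensor μΓ μ σ) ≃⋆ₐ[ℂ] multiplierAlgebra (W.defTensor μΓ μ σ),
      ∀ m, AmplAd (O := W.bimod σ) (psiFam W σ S) m.1 (g m).1 :=
  (good_psi W σ μΓ hS).exists_tensor_iso μ

end Sphi

end TwistDeform

end

open MeasureTheory MeasureTheory.Measure TwistDeform in
theorem mainTheorem2 {G Γ B : Type u}
    [Group G] [TopologicalSpace G] [IsTopologicalGroup G] [LocallyCompactSpace G] [T2Space G]
    [MeasurableSpace G] [BorelSpace G]
    [Group Γ] [TopologicalSpace Γ] [IsTopologicalGroup Γ] [LocallyCompactSpace Γ] [T2Space Γ]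
    [MeasurableSpace Γ] [BorelSpace Γ]
    (μ : Measure G) [IsHaarMeasure μ] [Regular μ] (μΓ : Measure Γ) [IsHaarMeasure μΓ] [Regular μΓ]
    (σ : Twist G Γ) [NonUnitalCStarAlgebra B] (W : WeakAlg G B)
    (ϕ : Γ → Circle) (hm : Measurable fun t => (ϕ t : ℂ))
    (hϕ : ∀ s z, ϕ (s * σ.ι z) = z⁻¹ * ϕ s) :
    (∃! S, IsSphi μΓ σ ϕ hm hϕ S) ∧
    ∀ S, IsSphi μΓ σ ϕ hm hϕ S →
      IsUnitaryFam S ∧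
      IsBimodMultiplier μΓ σ (W.bimod σ) (psiDescent W σ S) ∧
      IsUnitaryFam (psiDescent W σ S) ∧
      ∃ (AdS : c0Cross μΓ σ (MonoidHom.id Circle) ≃⋆ₐ[ℂ] c0Cross μΓ σ 1)
        (AdR : W.twCross μΓ σ ≃⋆ₐ[ℂ] W.defCross μΓ σ)
        (AdRM : multiplierAlgebra (W.twCross μΓ σ) ≃⋆ₐ[ℂ] multiplierAlgebra (W.defCross μΓ σ))
        (AdRT : multiplierAlgebra (W.twTensor μΓ μ σ) ≃⋆ₐ[ℂ]
          multiplierAlgebra (W.defTensor μΓ μ σ)),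
        (∀ x, IsAd S x.1 (AdS x).1) ∧
        (∀ x, IsAd (psiDescent W σ S) x.1 (AdR x).1) ∧
        (∀ m, IsAd (psiDescent W σ S) m.1 (AdRM m).1) ∧
        (∀ x m, m.1 = x.1 → (AdRM m).1 = (AdR x).1) ∧
        (∀ x, ∃ h : W.phiDescent σ x.1 ∈ multiplierAlgebra (W.twCross μΓ σ),
          (AdRM ⟨W.phiDescent σ x.1, h⟩).1 = W.phiσDescent σ (AdS x).1) ∧
        (∀ x, ∀ c ∈ groupCStar μ, ∀ t, IsElemTensor x.1 c t.1 →
          IsElemTensor (AdR x).1 c (AdRT t).1) ∧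
        (∀ x, ∃ h : dualCoaction x.1 ∈ multiplierAlgebra (W.twTensor μΓ μ σ),
          (AdRT ⟨dualCoaction x.1, h⟩).1 = dualCoaction (AdR x).1) := by
  refine ⟨?_, fun S hS => ?_⟩
  · obtain ⟨S, hS, -⟩ := exists_isSphi (μΓ := μΓ) hm hϕ
    exact ⟨S, hS, fun S' hS' => hS'.unique hS⟩
  have hg := hS.good
  have hR := good_psi W σ μΓ hg
  refine ⟨hg.unit, hR.isBimodMultiplier, hR.unit, ?_⟩
  refine (exists_AdS hg).elim fun AdS hAdS => ?_
  refine (exists_AdR (W := W) hg).elim fun AdR h => h.elim fun AdRM h => ?_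
  refine (exists_AdRT (W := W) μ hg).elim fun AdRT hT => ?_
  exact ⟨AdS, AdR, AdRM, AdRT, hAdS, h.1, h.2, (eqBimod W σ).mult_extends h.1 h.2,
    fun x => mult_phiDescent h.2 x.2 (hAdS x),
    fun x c _ t ht => (eqBimod W σ).isElemTensor_amplAd (h.1 x) ht (hT t),
    fun x => (eqBimod W σ).tensor_dualCoaction hS.psi_tensor hT x.2 (h.1 x)⟩
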